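/- **Conventions.** A metric graph $\Gamma$ is the metric realization of a finite connected graph with positive edge lengths; it is assumed not to be a single point. $T_x(\Gamma)$ is the finite set of outgoing unit tangent directions at $x$. $\mathrm{Rat}(\Gamma)$ is the set of continuous piecewise affine functions $\Gamma\to\mathbb R$ with integral slopes; $\mathrm{div}(f)=\sum_x \mathrm{ord}_x(f)\,x$ with $\mathrm{ord}_x(f)=-\sum_{\nu\in T_x(\Gamma)}\mathrm{slope}_\nu(f)$; for a divisor $D$, $\mathrm{Rat}(D)=\{f\in\mathrm{Rat}(\Gamma): D+\mathrm{div}(f)\ge 0\}$. *Rank functions.* A rank function on $\{0,\dots,r\}^{\delta}$ is a function $\rho$ with values in $\{-1,0,\dots,r\}$ which is non-increasing, satisfies $\rho(a)+\rho(b)\le\rho(a\vee b)+\rho(a\wedge b)$, and $\rho(t e_i)=r-t$ for all $i$ and $0\le t\le r$. A jump of $\rho$ is a point $a$ with $\rho(a)\ge 0$ and $\rho(a+e_i)=\rho(a)-1$ whenever $a+e_i$ lies in the hypercube. The standard rank function is $\rho(a)=r-\sum a_i$ if $\sum a_i\le r$, and $-1$ otherwise. *Slope structures.* An $r$-slope structure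 $\mathfrak S$ on $\Gamma$ consists of integers $s_0^\nu<\dots<s_r^\nu$ for each tangent direction $\nu$ and a rank function $\rho_x$ on $\{0,\dots,r\}^{T_x(\Gamma)}$ for each point $x$, coming from a simple graph model of $\Gamma$: along each edge $\{u,v\}$ of the model the slopes are constant in either direction, with $s_i^{uv}+s_{r-i}^{vu}=0$, and $\rho_x$ is standard at all $x$ in the interior of edges. $\mathrm{Rat}(D,\mathfrak S)$ is the set of $f\in\mathrm{Rat}(D)$ such that at each $x$ the vector $\delta_x(f)$ of outgoing slopes equals $(s^\nu_{a_\nu})_{\nu\in T_x(\Gamma)}$ for some jump $a$ of $\rho_x$; we write $\rho_x(\delta_x(f))=\rho_x(a)$ whenever $\delta_x(f)=(s^\nu_{a_\nu})_\nu$. *Linear series.* A set $M$ of functions satisfies the rank condition for $(D,\mathfrak S)$ if for every effective divisor $E$ of degree $r$ there is $f\in M$ with $\rho_x(\delta_x(f))\ge E(x)$ for all $x$ and $D+\mathrm{div}(f)-E\ge0$. $(D,\mathfrak S)$ is a crude linear series if $\mathrm{Rat}(D,\mathfrak S)$ satisfies it. A $\mathfrak g^r_d$ associated to a crude linear series $(D,\mathfrak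 S)$ with $\deg D=d$ is a subset $M\subseteq\mathrm{Rat}(D,\mathfrak S)$, stable under $\min$ and under adding real constants, closed in $(\mathrm{Rat}(D),\|\cdot\|_\infty)$, and satisfying the rank condition. It is refined if its tropical rank is $r$, i.e. $r$ is the least integer such that for all $f_0,\dots,f_{r+1}\in M$ there are $c_0,\dots,c_{r+1}\in\mathbb R$ for which $\min_i(f_i(x)+c_i)$ is attained at least twice at every $x\in\Gamma$. It is effective if $0\in M$. *Reduced divisors.* For $v\in\Gamma$ let $f_v(x)=\inf_{g\in M}(g(x)-g(v))$. One has $f_v\in M$; the $v$-reduced divisor (with respect to $M$) is $D_v=D+\mathrm{div}(f_v)$, and $\mathrm{Red}:\Gamma\to|M|=\{D+\mathrm{div}(f):f\in M\}\subset\mathrm{Sym}^d(\Gamma)$ sends $v$ to $D_v$. $D$ is $x_0$-reduced if $D_{x_0}=D$. *Morphisms.* A finite morphism of metric graphs is a continuous map which, for suitable models, maps each edge onto an edge by a dilation with positive integral factor. It is harmonic if it is surjective and, for each point $p$, the sum of the expansion factors over the directions at $p$ lying over a given direction $\nu'$ at $\varphi(p)$ is a number $d_p(\varphi)$ independent of $\nu'$;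 its degree is $\sum_{p\in\varphi^{-1}(q)}d_p(\varphi)$, for any $q$. A tropical modification $\widetilde\Gamma\to\Gamma$ is obtained by finitely many times attaching a segment of finite length along one endpoint (and contracting these segments). For a metric tree $T$ and $t\in T$ let $N_t=\mathrm{Rat}((t))$ on $T$. For a map $\varphi$, $\varphi^*(N)=\{g\circ\varphi: g\in N\}$. **Theorem.** Let $\Gamma$ be a metric graph and $x_0\in\Gamma$. (1) Let $M$ be an effective refined $\mathfrak g^1_d$ associated to a crude linear series $(D,\mathfrak S)$ on $\Gamma$, $\deg D=d$, such that $D$ is $x_0$-reduced with respect to $M$. Then: - the image of $\mathrm{Red}:\Gamma\to|M|\subset\mathrm{Sym}^d(\Gamma)$, with the subspace topology, carries the structure of a metric tree $T$ for which $\mathrm{Red}:\Gamma\to T$ is a finite morphism and $M=\mathrm{Red}^*(N)$, where $N=N_{\mathrm{Red}(x_0)}$; moreover $N$ is a refined $\mathfrak g^1_1$ on $T$, associated to the divisor $(\mathrm{Red}(x_0))$ with a suitable slope structure, and it is the unique $\mathfrak g^1_1$ on $T$ up to linear equivalence (any $\mathfrak g^1_1$ $N'$ on $T$ associated to some $(D',\mathfrak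 S')$ is of the form $N'=N+h$ with $h\in\mathrm{Rat}(T)$ and $D'+\mathrm{div}(h)=(\mathrm{Red}(x_0))$); - there are a tropical modification $\alpha:\widetilde\Gamma\to\Gamma$ and a finite harmonic morphism $\varphi:\widetilde\Gamma\to T$ of degree $d$ such that $\varphi|_{\Gamma}=\mathrm{Red}$. (2) Conversely, let $\psi:\Gamma\to T'$ be any finite harmonic morphism to a metric tree $T'$. Then $\psi$ has a well-defined degree $d$, and $\psi^*(N_{\psi(x_0)})$ is an effective refined $\mathfrak g^1_d$ on $\Gamma$, associated to some crude linear series $(D,\mathfrak S)$ with $\deg D=d$. -/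

import Mathlib

open Set Topology

noncomputable section

/-! ## Metric graphs -/

/-- A (connected, compact) metric graph, given by a finite simple graph model together with
positive edge lengths. Every connected metric graph which is not a single point has such a
model. -/
structure MetricGraph where
  V : Type
  [finV : Finite V]
  [nontrivialV : Nontrivial V]
  G : SimpleGraph V
  connected : G.Connected
  len : Sym2 V → ℝ
  len_pos : ∀ e ∈ G.edgeSet, 0 < len e

namespace MetricGraph

/-- An oriented edge of the model. -/
abbrev Dart (Γ : MetricGraph) : Type := Γ.G.Dart

/-- The length of an oriented edge. -/
def edgeLen (Γ : MetricGraph) (d : Γ.Dart) : ℝ := Γ.len d.edge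

theorem edgeLen_pos (Γ : MetricGraph) (d : Γ.Dart) : 0 < Γ.edgeLen d :=
  Γ.len_pos d.edge d.edge_mem

open Classical in
/-- Barycentric coordinates of the point at distance `t` from the tail of the oriented
edge `d`. -/
def bary (Γ : MetricGraph) (d : Γ.Dart) (t : ℝ) : Γ.V → ℝ :=
  (1 - t / Γ.edgeLen d) • Pi.single d.fst 1 + (t / Γ.edgeLen d) • Pi.single d.snd 1

/-- The points of the metric graph: the geometric realization of the model in barycentric
coordinates. It carries the subspace topology of `V → ℝ`, which is the topology of the path
metric; the metric itself is recorded by the arc length parametrizations `Γ.param d`. -/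
def Point (Γ : MetricGraph) : Type :=
  {x : Γ.V → ℝ // ∃ d : Γ.Dart, ∃ t ∈ Icc (0 : ℝ) (Γ.edgeLen d), x = Γ.bary d t}

instance (Γ : MetricGraph) : TopologicalSpace Γ.Point :=
  inferInstanceAs (TopologicalSpace {x : Γ.V → ℝ //
    ∃ d : Γ.Dart, ∃ t ∈ Icc (0 : ℝ) (Γ.edgeLen d), x = Γ.bary d t})

/-- Arc length parametrization of an oriented edge: the point at distance `t` from the tail
of `d`. (Values of `t` outside `[0, ℓ]` are projected to `[0, ℓ]`.) -/
def param (Γ : MetricGraph) (d : Γ.Dart) (t : ℝ) : Γ.Point :=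
  ⟨Γ.bary d (projIcc 0 (Γ.edgeLen d) (Γ.edgeLen_pos d).le t),
    d, _, (projIcc 0 (Γ.edgeLen d) (Γ.edgeLen_pos d).le t).2, rfl⟩

/-- A metric tree. -/
def IsTree (Γ : MetricGraph) : Prop := Γ.G.IsTree

/-- A unit tangent direction of `Γ`: it is based at the point at distance `pos < ℓ` from the
tail of the oriented edge `dart`, and points along `dart`. -/
structure Dir (Γ : MetricGraph) where
  dart : Γ.Dart
  pos : ℝ
  pos_mem : pos ∈ Ico (0 : ℝ) (Γ.edgeLen dart)

/-- The point at distance `h` (for small `h ≥ 0`) from the base point of `ν` in direction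
`ν`. -/
def Dir.move {Γ : MetricGraph} (ν : Γ.Dir) (h : ℝ) : Γ.Point := Γ.param ν.dart (ν.pos + h)

/-- The base point of a tangent direction. -/
def Dir.base {Γ : MetricGraph} (ν : Γ.Dir) : Γ.Point := Γ.param ν.dart ν.pos

/-- `T_x(Γ)`: the (finite) set of outgoing tangent directions at `x`. -/
abbrev Tangent (Γ : MetricGraph) (x : Γ.Point) : Type := {ν : Γ.Dir // ν.base = x}

/-! ## Rational functions and divisors -/

/-- `Rat(Γ)`: the (continuous) piecewise affine functions with integral slopes. Each edge is
cut at finitely many points into closed segments on which `f` is affine with integral slope. -/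
def Rat (Γ : MetricGraph) : Set (Γ.Point → ℝ) :=
  {f | ∀ d : Γ.Dart, ∃ A : Finset ℝ, ∀ a b : ℝ, 0 ≤ a → a < b → b ≤ Γ.edgeLen d →
    (∀ c ∈ A, c ∉ Ioo a b) →
      ∃ k : ℤ, ∀ t ∈ Icc a b, f (Γ.param d t) = f (Γ.param d a) + k * (t - a)}

/-- `f` is affine of slope `s` on a small segment in direction `ν`. -/
def HasSlope {Γ : MetricGraph} (f : Γ.Point → ℝ) (ν : Γ.Dir) (s : ℤ) : Prop :=
  ∃ ε > (0 : ℝ), ∀ h ∈ Ico 0 ε, f (ν.move h) = f ν.base + s * h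

open Classical in
/-- The outgoing slope of a rational function along a tangent direction. -/
def slope {Γ : MetricGraph} (f : Γ.Point → ℝ) (ν : Γ.Dir) : ℤ :=
  if h : ∃ s : ℤ, HasSlope f ν s then h.choose else 0

theorem HasSlope.slope_eq {Γ : MetricGraph} {f : Γ.Point → ℝ} {ν : Γ.Dir} {s : ℤ}
    (hs : HasSlope f ν s) : slope f ν = s := by
  have hex : ∃ s : ℤ, HasSlope f ν s := ⟨s, hs⟩
  have h1 : HasSlope f ν (slope f ν) := by
    unfold slope
    rw [dif_pos hex]
    exact hex.choose_spec
  obtain ⟨ε, hε, h⟩ := hs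
  obtain ⟨ε', hε', h'⟩ := h1
  have hm : 0 < min ε ε' / 2 := by positivity
  have hlt : min ε ε' / 2 < min ε ε' := by linarith [lt_min hε hε']
  have e1 := h (min ε ε' / 2) ⟨hm.le, hlt.trans_le (min_le_left _ _)⟩
  have e2 := h' (min ε ε' / 2) ⟨hm.le, hlt.trans_le (min_le_right _ _)⟩
  have e3 : ((slope f ν : ℤ) : ℝ) = (s : ℝ) :=
    mul_right_cancel₀ hm.ne' (by linarith)
  exact_mod_cast e3

/-- `ord_x(f) = - ∑_{ν ∈ T_x(Γ)} slope_ν(f)`, the coefficient of `x` in `div(f)`. -/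
def ord {Γ : MetricGraph} (f : Γ.Point → ℝ) (x : Γ.Point) : ℤ :=
  - ∑ᶠ ν : Γ.Tangent x, slope f ν.1

/-- Divisors on `Γ`. -/
abbrev Divisor (Γ : MetricGraph) : Type := Γ.Point →₀ ℤ

/-- The degree of a divisor. -/
def degree {Γ : MetricGraph} (D : Γ.Divisor) : ℤ := D.sum fun _ n => n

/-- `Rat(D)`: the rational functions `f` with `D + div(f) ≥ 0`. -/
def ratDiv {Γ : MetricGraph} (D : Γ.Divisor) : Set (Γ.Point → ℝ) :=
  {f | f ∈ Γ.Rat ∧ ∀ x, 0 ≤ D x + ord f x}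

/-! ## Rank functions on hypercubes -/

/-- Rank functions on the hypercube `{0, …, r}^ι`. -/
structure IsRankFunction {ι : Type} (r : ℕ) (ρ : (ι → Fin (r + 1)) → ℤ) : Prop where
  supermodular : ∀ a b, ρ a + ρ b ≤ ρ (a ⊔ b) + ρ (a ⊓ b)
  mem_range : ∀ a, -1 ≤ ρ a ∧ ρ a ≤ r
  antitone : Antitone ρ
  axis : ∀ (i : ι) (t : Fin (r + 1)) (a : ι → Fin (r + 1)),
    a i = t → (∀ j, j ≠ i → a j = 0) → ρ a = (r : ℤ) - (t : ℕ)

open Classical in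
/-- Jumps of a rank function. -/
def IsJump {ι : Type} {r : ℕ} (ρ : (ι → Fin (r + 1)) → ℤ) (a : ι → Fin (r + 1)) : Prop :=
  0 ≤ ρ a ∧ ∀ (i : ι) (b : Fin (r + 1)), (b : ℕ) = (a i : ℕ) + 1 →
    ρ (Function.update a i b) = ρ a - 1

/-- The standard rank function. -/
def stdRank {ι : Type} (r : ℕ) (a : ι → Fin (r + 1)) : ℤ :=
  if ∑ᶠ i, (a i : ℕ) ≤ r then (r : ℤ) - ((∑ᶠ i, (a i : ℕ) : ℕ) : ℤ) else -1

/-! ## Slope structures -/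

/-- An `r`-slope structure on `Γ`, as a collection of allowed slopes
`s₀^ν < ⋯ < s_r^ν` for all tangent directions `ν` and of rank functions `ρ_x` on the hypercubes
`{0, …, r}^{T_x(Γ)}` for all points `x`, which comes from a graph model of `Γ` with vertex set
a finite set `A`: in the interior of the edges of that model `ρ_x` is standard, and on each of
these edges the slopes are constant in either direction, with `s_i^{uv} + s_{r-i}^{vu} = 0`. -/
structure SlopeStructure (Γ : MetricGraph) (r : ℕ) where
  s : Γ.Dir → Fin (r + 1) → ℤ
  strictMono : ∀ ν, StrictMono (s ν)
  ρ : ∀ x : Γ.Point, (Γ.Tangent x → Fin (r + 1)) → ℤ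
  isRank : ∀ x, IsRankFunction r (ρ x)
  model : ∃ A : Set Γ.Point, A.Finite ∧ (∀ d : Γ.Dart, Γ.param d 0 ∈ A) ∧
    (∀ x, x ∉ A → ρ x = stdRank r) ∧
    ∀ (d : Γ.Dart) (a b : ℝ), 0 ≤ a → b ≤ Γ.edgeLen d →
      (∀ t ∈ Ioo a b, Γ.param d t ∉ A) →
      ∀ ν ν' : Γ.Dir, ν.dart = d → ν.pos ∈ Ico a b →
        ν'.dart = d.symm → Γ.edgeLen d - ν'.pos ∈ Ioc a b →
        ∀ i : Fin (r + 1), s ν i + s ν' i.rev = 0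

/-- `s_a = δ_x(f)`: the vector of outgoing slopes of `f` at `x` is the one with index `a` in the
hypercube. -/
def SlopeStructure.IsIndexAt {Γ : MetricGraph} {r : ℕ} (S : SlopeStructure Γ r)
    (f : Γ.Point → ℝ) (x : Γ.Point) (a : Γ.Tangent x → Fin (r + 1)) : Prop :=
  ∀ ν : Γ.Tangent x, slope f ν.1 = S.s ν.1 (a ν)

/-- `Rat(D, 𝔖)`: the functions in `Rat(D)` such that at each point `x` the vector of outgoing
slopes is `s_a` for a jump `a` of `ρ_x`. -/
def ratSlope {Γ : MetricGraph} {r : ℕ} (D : Γ.Divisor) (S : SlopeStructure Γ r) :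
    Set (Γ.Point → ℝ) :=
  {f | f ∈ ratDiv D ∧ ∀ x, ∃ a, S.IsIndexAt f x a ∧ IsJump (S.ρ x) a}

/-! ## Linear series -/

/-- The rank condition on a set `M` of rational functions: for each effective divisor `E` of
degree `r` there is `f ∈ M` with `ρ_x(δ_x(f)) ≥ E(x)` for all `x`, and `D + div(f) - E ≥ 0`. -/
def RankCondition {Γ : MetricGraph} {r : ℕ} (D : Γ.Divisor) (S : SlopeStructure Γ r)
    (M : Set (Γ.Point → ℝ)) : Prop :=
  ∀ E : Γ.Divisor, (∀ x, 0 ≤ E x) → degree E = r → ∃ f ∈ M,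
    (∀ x, ∃ a, S.IsIndexAt f x a ∧ E x ≤ S.ρ x a) ∧ ∀ x, 0 ≤ D x + ord f x - E x

/-- `(D, 𝔖)` is a crude linear series. -/
def IsCrudeLinearSeries {Γ : MetricGraph} {r : ℕ} (D : Γ.Divisor)
    (S : SlopeStructure Γ r) : Prop :=
  RankCondition D S (ratSlope D S)

/-- `M` is a linear series (a `𝔤^r_d`, where `d` is the degree of `D`) associated to the crude
linear series `(D, 𝔖)`. The field `closed` says that `M` is closed in `Rat(D)` with respect to
the norm `‖·‖_∞`. -/
structure IsLinearSeries {Γ : MetricGraph} {r : ℕ} (D : Γ.Divisor) (S : SlopeStructure Γ r)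
    (M : Set (Γ.Point → ℝ)) : Prop where
  crude : IsCrudeLinearSeries D S
  subset : M ⊆ ratSlope D S
  min_mem : ∀ f ∈ M, ∀ g ∈ M, (fun x => min (f x) (g x)) ∈ M
  add_const_mem : ∀ f ∈ M, ∀ c : ℝ, (fun x => f x + c) ∈ M
  closed : ∀ f ∈ ratDiv D, (∀ ε > (0 : ℝ), ∃ g ∈ M, ∀ x, |f x - g x| ≤ ε) → f ∈ M
  rank : RankCondition D S M

/-- Any `r + 2` functions in `M` are tropically dependent. -/
def TropicallyDependent {X : Type} (M : Set (X → ℝ)) (r : ℕ) : Prop :=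
  ∀ f : Fin (r + 2) → X → ℝ, (∀ i, f i ∈ M) → ∃ c : Fin (r + 2) → ℝ, ∀ x, ∃ i j, i ≠ j ∧
    ∀ k, f i x + c i ≤ f k x + c k ∧ f j x + c j ≤ f k x + c k

/-- The tropical rank of `M` is `r`. -/
def HasTropicalRank {X : Type} (M : Set (X → ℝ)) (r : ℕ) : Prop :=
  IsLeast {n : ℕ | TropicallyDependent M n} r

/-- Refined linear series. -/
def IsRefinedLinearSeries {Γ : MetricGraph} {r : ℕ} (D : Γ.Divisor) (S : SlopeStructure Γ r)
    (M : Set (Γ.Point → ℝ)) : Prop :=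
  IsLinearSeries D S M ∧ HasTropicalRank M r

/-! ## Reduced divisors -/

/-- The function `f_v^M(x) = inf_{g ∈ M} (g(x) - g(v))`; the `v`-reduced divisor linearly
equivalent to `D` with respect to `M` is `D + div(f_v^M)`. -/
def redFun {Γ : MetricGraph} (M : Set (Γ.Point → ℝ)) (v x : Γ.Point) : ℝ :=
  sInf {y | ∃ g ∈ M, y = g x - g v}

/-- `D` is `v`-reduced with respect to `M`, i.e. `D + div(f_v^M) = D`. -/
def IsReduced {Γ : MetricGraph} (D : Γ.Divisor) (M : Set (Γ.Point → ℝ)) (v : Γ.Point) : Prop :=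
  ∀ x, D x + ord (redFun M v) x = D x

end MetricGraph

/-- The symmetric product `Sym^d(X)` has the quotient topology of `X^d`. -/
instance symProductTopology (X : Type) [TopologicalSpace X] (d : ℕ) :
    TopologicalSpace (Sym X d) :=
  TopologicalSpace.coinduced
    (fun p : Fin d → X => (⟨Finset.univ.val.map p, by simp⟩ : Sym X d)) inferInstance

namespace MetricGraph

open Classical in
/-- `R : Γ → Sym^d(Γ)` is the map `Red : Γ → |M| ⊆ Sym^d(Γ)` sending `v` to the `v`-reduced
divisor `D + div(f_v^M)`, where `f_v^M ∈ M`. -/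
def IsRedMap {Γ : MetricGraph} {d : ℕ} (D : Γ.Divisor) (M : Set (Γ.Point → ℝ))
    (R : Γ.Point → Sym Γ.Point d) : Prop :=
  ∀ v, redFun M v ∈ M ∧
    ∀ x, ((Multiset.count x (R v : Multiset Γ.Point) : ℕ) : ℤ) = D x + ord (redFun M v) x

/-! ## Morphisms -/

/-- The path `γ : [0, ℓ] → Γ` is piecewise a dilation with factors in `K`: after cutting
`[0, ℓ]` at finitely many points, each closed piece is mapped into an edge by an affine map of
slope `k ∈ K` with respect to arc length (the edge being suitably oriented). -/
def IsPiecewiseDilation {Γ : MetricGraph} (γ : ℝ → Γ.Point) (l : ℝ) (K : Set ℕ) : Prop :=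
  ∃ A : Finset ℝ, ∀ a b : ℝ, 0 ≤ a → a < b → b ≤ l → (∀ c ∈ A, c ∉ Ioo a b) →
    ∃ k ∈ K, ∃ (d : Γ.Dart) (c : ℝ), ∀ t ∈ Icc a b,
      c + (k : ℝ) * (t - a) ∈ Icc 0 (Γ.edgeLen d) ∧ γ t = Γ.param d (c + (k : ℝ) * (t - a))

/-- Finite morphisms of metric graphs: continuous maps which are, on each edge, piecewise
dilations by positive integral factors. (For suitable models of the source and the target, each
edge is then mapped onto an edge, by a dilation with positive integral factor.) -/
def IsFiniteMorphism {Γ Γ' : MetricGraph} (φ : Γ.Point → Γ'.Point) : Prop :=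
  Continuous φ ∧ ∀ d : Γ.Dart,
    IsPiecewiseDilation (fun t => φ (Γ.param d t)) (Γ.edgeLen d) {k | 1 ≤ k}

/-- `φ` maps the direction `ν` to the direction `ν'` with expansion factor `k`. -/
def MapsDir {Γ Γ' : MetricGraph} (φ : Γ.Point → Γ'.Point) (ν : Γ.Dir) (ν' : Γ'.Dir) (k : ℕ) :
    Prop :=
  1 ≤ k ∧ ∃ ε > (0 : ℝ), ∀ h ∈ Ico 0 ε, φ (ν.move h) = ν'.move ((k : ℝ) * h)

open Classical in
/-- The expansion factor of `φ` along `ν` if `φ` maps `ν` to the direction `ν'`, and `0` if it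
does not. -/
def expansion {Γ Γ' : MetricGraph} (φ : Γ.Point → Γ'.Point) (ν : Γ.Dir) (ν' : Γ'.Dir) : ℕ :=
  if h : ∃ k : ℕ, MapsDir φ ν ν' k then h.choose else 0

/-- The sum of the expansion factors of `φ` over the directions at `p` that are mapped
to `ν'`. -/
def localDegree {Γ Γ' : MetricGraph} (φ : Γ.Point → Γ'.Point) (p : Γ.Point) (ν' : Γ'.Dir) : ℕ :=
  ∑ᶠ ν : Γ.Tangent p, expansion φ ν.1 ν'

/-- Finite harmonic morphisms. -/
structure IsFiniteHarmonic {Γ Γ' : MetricGraph} (φ : Γ.Point → Γ'.Point) : Prop where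
  finite : IsFiniteMorphism φ
  surjective : Function.Surjective φ
  harmonic : ∀ (p : Γ.Point) (ν₁ ν₂ : Γ'.Dir), ν₁.base = φ p → ν₂.base = φ p →
    localDegree φ p ν₁ = localDegree φ p ν₂

/-- The harmonic morphism `φ` has degree `d`: the local degrees of `φ` at the points of each
fibre add up to `d`. -/
def HasDegree {Γ Γ' : MetricGraph} (φ : Γ.Point → Γ'.Point) (d : ℕ) : Prop :=
  ∀ ν' : Γ'.Dir, ∑ᶠ p : {p : Γ.Point // φ p = ν'.base}, localDegree φ p.1 ν' = d

/-- The pullback of a set of functions. -/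
def pullback {X Y : Type} (φ : X → Y) (N : Set (Y → ℝ)) : Set (X → ℝ) :=
  (fun g => g ∘ φ) '' N

/-! ## Tropical modifications -/

/-- `j` identifies `Γ` with a closed subgraph of `Γ'`, preserving lengths. -/
def IsSubgraphEmbedding {Γ Γ' : MetricGraph} (j : Γ.Point → Γ'.Point) : Prop :=
  Function.Injective j ∧ Continuous j ∧ ∀ d : Γ.Dart,
    IsPiecewiseDilation (fun t => j (Γ.param d t)) (Γ.edgeLen d) {1}

/-- `α : Γ' → Γ` is an elementary tropical modification, where `j` is the inclusion of `Γ`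
in `Γ'`: the metric graph `Γ'` is obtained from `Γ` by attaching a segment `[0, ℓ]`, glued along
`0` to a point `p` of `Γ`, and `α` contracts this segment to `p`. -/
def IsElementaryModification {Γ Γ' : MetricGraph} (j : Γ.Point → Γ'.Point)
    (α : Γ'.Point → Γ.Point) : Prop :=
  IsSubgraphEmbedding j ∧ (∀ x, α (j x) = x) ∧
  ∃ (p : Γ.Point) (l : ℝ) (γ : ℝ → Γ'.Point), 0 < l ∧ IsPiecewiseDilation γ l {1} ∧
    InjOn γ (Icc 0 l) ∧ γ 0 = j p ∧ (∀ t ∈ Ioc 0 l, γ t ∉ range j) ∧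
    (∀ y, y ∈ range j ∨ ∃ t ∈ Icc 0 l, γ t = y) ∧ ∀ t ∈ Icc 0 l, α (γ t) = p

/-- `α : Γ' → Γ` is a tropical modification, with inclusion `i : Γ → Γ'`: a finite sequence of
elementary tropical modifications, up to isometry. -/
inductive IsTropicalModification (Γ : MetricGraph) :
    (Γ' : MetricGraph) → (Γ.Point → Γ'.Point) → (Γ'.Point → Γ.Point) → Prop
  | isometry (Γ' : MetricGraph) (i : Γ.Point → Γ'.Point) (α : Γ'.Point → Γ.Point)
      (hi : IsSubgraphEmbedding i) (hα : ∀ x, α (i x) = x) (hα' : ∀ y, i (α y) = y) :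
      IsTropicalModification Γ Γ' i α
  | attach (Γ' Γ'' : MetricGraph) (i : Γ.Point → Γ'.Point) (α : Γ'.Point → Γ.Point)
      (j : Γ'.Point → Γ''.Point) (β : Γ''.Point → Γ'.Point)
      (hi : IsTropicalModification Γ Γ' i α) (hj : IsElementaryModification j β) :
      IsTropicalModification Γ Γ'' (j ∘ i) (α ∘ β)

/-! ## The `𝔤^1_1` on a tree -/

/-- The semimodule `N = Rat((t))` on a metric tree `T`, for a point `t` of `T`. -/
def treeSeries {T : MetricGraph} (t : T.Point) : Set (T.Point → ℝ) :=
  ratDiv (Finsupp.single t 1)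

/-- `N` is a refined `𝔤^1_1` on `T` associated to the divisor `(t)`, and it is the unique `𝔤^1_1`
on `T` up to linear equivalence. -/
def IsUniqueG11 {T : MetricGraph} (t : T.Point) (N : Set (T.Point → ℝ)) : Prop :=
  (∃ S : SlopeStructure T 1, IsRefinedLinearSeries (Finsupp.single t 1) S N) ∧
  ∀ (D' : T.Divisor) (S' : SlopeStructure T 1) (N' : Set (T.Point → ℝ)),
    degree D' = 1 → IsLinearSeries D' S' N' →
    ∃ h ∈ T.Rat, (∀ x, D' x + ord h x = Finsupp.single t (1 : ℤ) x) ∧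
      ∀ f, f ∈ N' ↔ f - h ∈ N

end MetricGraph

end

noncomputable section
namespace MetricGraph

/-! ## Points and parametrizations -/

/-! Everything rests on Green's identity for rational functions, obtained by summation by parts on a
model, and on the minimum principle derived from it.

On a metric tree any two points are linearly equivalent, so `Rat((t))` consists of the functions
with divisor (x) - (t), written `IsDiv f x t`. Green's identity becomes a reciprocity law,
`IsDiv.green`, from which the rest follows. The slope of such a function along a direction only
depends on whether the direction points towards x and towards t. Normalized at t, the function is
the Gromov product of x with its argument, so it satisfies the ultrametric inequality; this says
that three functions of `Rat((t))` are tropically dependent.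

For the converse part, a harmonic morphism multiplies orders by local degrees. Pulling back (x) -
(t) therefore gives effective divisors of constant degree. The slope structure on Γ lets the rank
function at p be the one attached to the partition of the directions at p by their images
(`fiberRank`).

For the direct part, the consequence of tropical rank one that is used is `IsPencil.dichotomy`: for
g, p, q in M, the sets where p - g and q - g are minimal are equal or cover Γ. Two consequences give
M the shape of a tree. Functions vanishing at x₀ with the same maximum, attained at a common point,
are equal. By connectedness and compactness, every function of M is a reduced function up to a
constant (`IsPencil.exists_eq_pot`). Let the height of v be the value at v of its reduced function
normalized to vanish at x₀. Truncating these functions produces the points below v, one for each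
smaller height up to equivalence under M; so the classes of points form a rooted tree, and the
normalized reduced function of v takes at x the height of the meet of v and x.

To see that this quotient is a metric graph, Γ is refined so that the two allowed slopes are
constant along each edge. Functions of M are then concave with two slopes on each edge ("tents"),
which also proves that reduced functions belong to M. Since 0 is in M, each edge has an upward
orientation whose lower slope is 0, and the height grows along it with the upper slope. Cutting at
finitely many full level sets of the height makes the quotient map simplicial (`IsLeveled`). The
quotient is connected and each of its edges is determined by its upper end, so it is a tree by
counting. The cut function of a tree edge pulls back to the difference of two normalized reduced
functions (`IsFine.cutFun_map`), which identifies M with the pullback of the tree series.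

Two points have the same reduced divisor exactly when M does not separate them. Green's identity
makes the reduced divisor depend continuously on the point, so the compact quotient embeds in the
symmetric product.

Finally, put δ(v) = D(v) minus the sum of the lower slopes at v. Effectivity of a reduced divisor
bounds by δ(v) the sum of the factors over each tree direction. A deficit m is repaired by attaching
a leaf that maps to the tree edge with factor m. This creates new deficits only farther out in the
tree, so a weighted count decreases and the process ends in a harmonic morphism; its degree is d by
an Euler characteristic computation. -/

instance finite_V (Γ : MetricGraph) : Finite Γ.V := Γ.finV

instance nontrivial_V (Γ : MetricGraph) : Nontrivial Γ.V := Γ.nontrivialV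

instance finite_dart (Γ : MetricGraph) : Finite Γ.Dart :=
  Finite.of_injective (fun d : Γ.Dart => d.toProd) (fun _ _ h => SimpleGraph.Dart.ext _ _ h)

theorem edgeLen_symm (Γ : MetricGraph) (d : Γ.Dart) : Γ.edgeLen d.symm = Γ.edgeLen d := by
  unfold edgeLen; rw [SimpleGraph.Dart.edge_symm]

theorem exists_dart_fst (Γ : MetricGraph) (v : Γ.V) : ∃ d : Γ.Dart, d.fst = v := by
  obtain ⟨w, hw⟩ := Γ.connected.preconnected.exists_adj_of_nontrivial v
  exact ⟨⟨(v, w), hw⟩, rfl⟩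

open Classical in
theorem bary_zero (Γ : MetricGraph) (d : Γ.Dart) : Γ.bary d 0 = Pi.single d.fst 1 := by
  simp [bary]

open Classical in
theorem bary_len (Γ : MetricGraph) (d : Γ.Dart) :
    Γ.bary d (Γ.edgeLen d) = Pi.single d.snd 1 := by
  simp [bary, (Γ.edgeLen_pos d).ne']

theorem bary_symm (Γ : MetricGraph) (d : Γ.Dart) (t : ℝ) :
    Γ.bary d.symm (Γ.edgeLen d - t) = Γ.bary d t := by
  have h := (Γ.edgeLen_pos d).ne'
  unfold bary
  rw [edgeLen_symm, add_comm]
  congr 2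
  · field_simp
  · field_simp
    ring

open Classical in
/-- The point of `Γ` given by a vertex of the model. -/
def vert (Γ : MetricGraph) (v : Γ.V) : Γ.Point :=
  ⟨Pi.single v 1, (Γ.exists_dart_fst v).choose, 0,
    ⟨le_rfl, (Γ.edgeLen_pos _).le⟩, by
      rw [bary_zero, (Γ.exists_dart_fst v).choose_spec]⟩

theorem vert_injective (Γ : MetricGraph) : Function.Injective Γ.vert := by
  classical
  intro v w h
  have h1 : (Γ.vert v).1 v = (Γ.vert w).1 v := by rw [h]
  by_contra hne
  simp [vert, hne] at h1

theorem param_val (Γ : MetricGraph) (d : Γ.Dart) {t : ℝ} (ht : t ∈ Icc 0 (Γ.edgeLen d)) :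
    (Γ.param d t).1 = Γ.bary d t := by
  simp only [param]
  rw [projIcc_of_mem _ ht]

theorem param_zero (Γ : MetricGraph) (d : Γ.Dart) : Γ.param d 0 = Γ.vert d.fst := by
  apply Subtype.ext
  rw [param_val _ _ ⟨le_rfl, (Γ.edgeLen_pos d).le⟩, bary_zero]
  rfl

theorem param_len (Γ : MetricGraph) (d : Γ.Dart) :
    Γ.param d (Γ.edgeLen d) = Γ.vert d.snd := by
  apply Subtype.ext
  rw [param_val _ _ ⟨(Γ.edgeLen_pos d).le, le_rfl⟩, bary_len]
  rfl

theorem param_symm (Γ : MetricGraph) (d : Γ.Dart) {t : ℝ} (ht : t ∈ Icc 0 (Γ.edgeLen d)) :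
    Γ.param d.symm (Γ.edgeLen d - t) = Γ.param d t := by
  apply Subtype.ext
  rw [param_val _ _ ht, param_val, bary_symm]
  rw [edgeLen_symm]
  exact ⟨by linarith [ht.2], by linarith [ht.1]⟩

theorem exists_param (Γ : MetricGraph) (x : Γ.Point) :
    ∃ d : Γ.Dart, ∃ t ∈ Icc (0 : ℝ) (Γ.edgeLen d), Γ.param d t = x := by
  obtain ⟨x, d, t, ht, rfl⟩ := x
  exact ⟨d, t, ht, Subtype.ext (param_val _ _ ht)⟩

/-- Every point is the base point of a direction. -/
theorem exists_param_Ico (Γ : MetricGraph) (x : Γ.Point) :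
    ∃ d : Γ.Dart, ∃ t ∈ Ico (0 : ℝ) (Γ.edgeLen d), Γ.param d t = x := by
  obtain ⟨d, t, ht, rfl⟩ := Γ.exists_param x
  rcases ht.2.lt_or_eq with h | h
  · exact ⟨d, t, ⟨ht.1, h⟩, rfl⟩
  · refine ⟨d.symm, 0, ⟨le_rfl, Γ.edgeLen_pos _⟩, ?_⟩
    rw [← param_symm _ _ ht, h, sub_self]

theorem bary_fst (Γ : MetricGraph) (d : Γ.Dart) (t : ℝ) :
    Γ.bary d t d.fst = 1 - t / Γ.edgeLen d := by
  classical
  simp [bary, d.adj.ne]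

theorem bary_snd (Γ : MetricGraph) (d : Γ.Dart) (t : ℝ) :
    Γ.bary d t d.snd = t / Γ.edgeLen d := by
  classical
  simp [bary, d.adj.ne']

theorem bary_ne (Γ : MetricGraph) (d : Γ.Dart) (t : ℝ) {v : Γ.V} (h : v ≠ d.fst)
    (h' : v ≠ d.snd) : Γ.bary d t v = 0 := by
  classical
  simp [bary, h, h']

theorem param_ne_vert (Γ : MetricGraph) (d : Γ.Dart) {t : ℝ} (ht : t ∈ Ioo 0 (Γ.edgeLen d))
    (v : Γ.V) : Γ.param d t ≠ Γ.vert v := by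
  classical
  intro h
  have h0 := Γ.edgeLen_pos d
  have e : ∀ w, Γ.bary d t w = (Pi.single v 1 : Γ.V → ℝ) w := by
    intro w
    rw [← param_val _ _ (Ioo_subset_Icc_self ht), h]; rfl
  have h1 := e d.fst
  have h2 := e d.snd
  have p1 : 0 < t / Γ.edgeLen d := div_pos ht.1 h0
  have p2 : t / Γ.edgeLen d < 1 := (div_lt_one h0).2 ht.2
  rw [bary_fst, Pi.single_apply] at h1
  rw [bary_snd, Pi.single_apply] at h2
  split_ifs at h1 h2 <;> linarith

/-- Two interior parametrizations of the same point use the same edge. -/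
theorem param_eq_interior (Γ : MetricGraph) {d d' : Γ.Dart} {t t' : ℝ}
    (ht : t ∈ Ioo 0 (Γ.edgeLen d)) (ht' : t' ∈ Icc 0 (Γ.edgeLen d'))
    (h : Γ.param d t = Γ.param d' t') :
    (d' = d ∧ t' = t) ∨ (d' = d.symm ∧ t' = Γ.edgeLen d - t) := by
  have h0 := Γ.edgeLen_pos d
  have e : ∀ w, Γ.bary d t w = Γ.bary d' t' w := by
    intro w
    rw [← param_val _ _ (Ioo_subset_Icc_self ht), h, param_val _ _ ht']
  have p1 : 0 < t / Γ.edgeLen d := div_pos ht.1 h0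
  have p2 : t / Γ.edgeLen d < 1 := (div_lt_one h0).2 ht.2
  have h1 : d.fst = d'.fst ∨ d.fst = d'.snd := by
    by_contra! hc
    have := e d.fst
    rw [bary_fst, bary_ne _ _ _ hc.1 hc.2] at this
    linarith
  have h2 : d.snd = d'.fst ∨ d.snd = d'.snd := by
    by_contra! hc
    have := e d.snd
    rw [bary_snd, bary_ne _ _ _ hc.1 hc.2] at this
    linarith
  have hne := d.adj.ne
  have key : ∀ d'' : Γ.Dart, ∀ t'', d''.fst = d.fst → d''.snd = d.snd →
      (∀ w, Γ.bary d t w = Γ.bary d'' t'' w) → d'' = d ∧ t'' = t := by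
    intro d'' t'' a b c
    have hd : d'' = d := SimpleGraph.Dart.ext _ _ (Prod.ext a b)
    refine ⟨hd, ?_⟩
    subst hd
    have := c d''.snd
    rw [bary_snd, bary_snd] at this
    field_simp at this
    exact this.symm
  rcases h1 with h1 | h1 <;> rcases h2 with h2 | h2
  · exact absurd (h1.trans h2.symm) hne
  · exact Or.inl (key d' t' h1.symm h2.symm e)
  · right
    have := key d'.symm (Γ.edgeLen d' - t') h1.symm h2.symm (fun w => by
      rw [bary_symm]; exact e w)
    obtain ⟨a, b⟩ := this
    have hd : d' = d.symm := by rw [← a, SimpleGraph.Dart.symm_symm]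
    refine ⟨hd, ?_⟩
    rw [hd, edgeLen_symm] at b
    linarith
  · exact absurd (h1.trans h2.symm) hne

theorem param_injOn (Γ : MetricGraph) (d : Γ.Dart) :
    InjOn (Γ.param d) (Icc 0 (Γ.edgeLen d)) := by
  intro t ht t' ht' h
  have h0 := Γ.edgeLen_pos d
  have e : Γ.bary d t d.snd = Γ.bary d t' d.snd := by
    rw [← param_val _ _ ht, ← param_val _ _ ht', h]
  rw [bary_snd, bary_snd] at e
  field_simp at e
  exact e

theorem mem_Icc_cases {t l : ℝ} (ht : t ∈ Icc 0 l) : t = 0 ∨ t = l ∨ t ∈ Ioo 0 l := by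
  rcases ht.1.eq_or_lt with h | h
  · exact Or.inl h.symm
  · rcases ht.2.eq_or_lt with h' | h'
    · exact Or.inr (Or.inl h')
    · exact Or.inr (Or.inr ⟨h, h'⟩)

/-- Functions on `Γ` are given by compatible functions on the vertices and edges. -/
theorem glue (Γ : MetricGraph) {Y : Type*} (fV : Γ.V → Y) (γ : Γ.Dart → ℝ → Y)
    (h0 : ∀ d, γ d 0 = fV d.fst)
    (hs : ∀ d, ∀ t ∈ Icc 0 (Γ.edgeLen d), γ d.symm (Γ.edgeLen d - t) = γ d t) :
    ∃ F : Γ.Point → Y, ∀ d, ∀ t ∈ Icc 0 (Γ.edgeLen d), F (Γ.param d t) = γ d t := by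
  choose D T hT hD using Γ.exists_param
  have h1 : ∀ d, γ d (Γ.edgeLen d) = fV d.snd := by
    intro d
    have := hs d (Γ.edgeLen d) ⟨(Γ.edgeLen_pos d).le, le_rfl⟩
    rw [sub_self, h0] at this
    exact this.symm
  refine ⟨fun x => γ (D x) (T x), fun d t ht => ?_⟩
  have hx := hD (Γ.param d t)
  have hT' := hT (Γ.param d t)
  change γ (D (Γ.param d t)) (T (Γ.param d t)) = γ d t
  generalize D (Γ.param d t) = d' at hx hT' ⊢
  generalize T (Γ.param d t) = t' at hx hT' ⊢
  have hv : ∀ (v : Γ.V) (d : Γ.Dart) (t : ℝ), t ∈ Icc 0 (Γ.edgeLen d) →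
      Γ.param d t = Γ.vert v → γ d t = fV v := by
    intro v d t ht h
    rcases mem_Icc_cases ht with rfl | rfl | h'
    · rw [param_zero] at h
      rw [h0, Γ.vert_injective h]
    · rw [param_len] at h
      rw [h1, Γ.vert_injective h]
    · exact absurd h (Γ.param_ne_vert d h' v)
  rcases mem_Icc_cases ht with h | h | h
  · have e : Γ.param d t = Γ.vert d.fst := by rw [h, param_zero]
    rw [hv _ d t ht e, hv _ d' t' hT' (hx.trans e)]
  · have e : Γ.param d t = Γ.vert d.snd := by rw [h, param_len]
    rw [hv _ d t ht e, hv _ d' t' hT' (hx.trans e)]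
  · rcases Γ.param_eq_interior h hT' hx.symm with ⟨rfl, rfl⟩ | ⟨rfl, rfl⟩
    · rfl
    · exact hs d t ht

/-! ## Topology -/

instance t2_point (Γ : MetricGraph) : T2Space Γ.Point :=
  inferInstanceAs (T2Space {x : Γ.V → ℝ //
    ∃ d : Γ.Dart, ∃ t ∈ Icc (0 : ℝ) (Γ.edgeLen d), x = Γ.bary d t})

theorem continuous_param (Γ : MetricGraph) (d : Γ.Dart) : Continuous (Γ.param d) := by
  classical
  refine Continuous.subtype_mk (f := fun t : ℝ =>
    Γ.bary d (projIcc 0 (Γ.edgeLen d) (Γ.edgeLen_pos d).le t)) ?_ _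
  unfold bary
  have : Continuous fun t : ℝ =>
      ((projIcc 0 (Γ.edgeLen d) (Γ.edgeLen_pos d).le t : Icc 0 (Γ.edgeLen d)) : ℝ) :=
    continuous_subtype_val.comp continuous_projIcc
  fun_prop

instance compact_point (Γ : MetricGraph) : CompactSpace Γ.Point := by
  have : (univ : Set Γ.Point) = ⋃ d : Γ.Dart, Γ.param d '' Icc 0 (Γ.edgeLen d) := by
    ext x
    obtain ⟨d, t, ht, rfl⟩ := Γ.exists_param x
    simp only [mem_univ, mem_iUnion, true_iff]
    exact ⟨d, mem_image_of_mem _ ht⟩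
  refine ⟨?_⟩
  rw [this]
  exact isCompact_iUnion fun d => isCompact_Icc.image (Γ.continuous_param d)

/-- The edges map from a compact disjoint union onto a Hausdorff space, so `Γ` carries the quotient
topology of its edges. -/
theorem continuous_iff_param {Γ : MetricGraph} {Y : Type*} [TopologicalSpace Y]
    {f : Γ.Point → Y} : Continuous f ↔ ∀ d, ContinuousOn (f ∘ Γ.param d) (Icc 0 (Γ.edgeLen d)) := by
  refine ⟨fun h d => (h.comp (Γ.continuous_param d)).continuousOn, fun h => ?_⟩
  let q : (Σ d : Γ.Dart, Icc 0 (Γ.edgeLen d)) → Γ.Point := fun p => Γ.param p.1 p.2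
  have hq : Continuous q := continuous_sigma fun d =>
    (Γ.continuous_param d).comp continuous_subtype_val
  have hs : Function.Surjective q := fun x => by
    obtain ⟨d, t, ht, rfl⟩ := Γ.exists_param x
    exact ⟨⟨d, t, ht⟩, rfl⟩
  rw [(hq.isClosedMap.isQuotientMap hq hs).continuous_iff]
  exact continuous_sigma fun d => (continuousOn_iff_continuous_domRestrict.1 (h d))

theorem vert_reachable_induction (Γ : MetricGraph) {P : Γ.V → Prop} {v₀ : Γ.V} (h0 : P v₀)
    (hs : ∀ d : Γ.Dart, P d.fst → P d.snd) (v : Γ.V) : P v := by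
  obtain ⟨w⟩ := Γ.connected.preconnected v₀ v
  induction w with
  | nil => exact h0
  | cons h _ ih => exact ih (hs ⟨(_, _), h⟩ h0)

instance connected_point (Γ : MetricGraph) : ConnectedSpace Γ.Point := by
  obtain ⟨v₀⟩ : Nonempty Γ.V := inferInstance
  have hd : ∀ d : Γ.Dart, range (Γ.param d) ⊆ connectedComponent (Γ.vert d.fst) := fun d =>
    (isPreconnected_range (Γ.continuous_param d)).subset_connectedComponent
      ⟨0, Γ.param_zero d⟩
  have hv : ∀ v, Γ.vert v ∈ connectedComponent (Γ.vert v₀) := fun v => by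
    refine Γ.vert_reachable_induction (P := fun v => Γ.vert v ∈ connectedComponent (Γ.vert v₀))
      mem_connectedComponent (fun d h => ?_) v
    rw [← connectedComponent_eq_iff_mem.2 h]
    exact hd d ⟨Γ.edgeLen d, Γ.param_len d⟩
  have : Nonempty Γ.Point := ⟨Γ.vert v₀⟩
  refine connectedSpace_iff_connectedComponent.2 ⟨Γ.vert v₀, ?_⟩
  rw [eq_univ_iff_forall]
  intro x
  obtain ⟨d, t, ht, rfl⟩ := Γ.exists_param x
  rw [← connectedComponent_eq_iff_mem.2 (hv d.fst)]
  exact hd d ⟨t, rfl⟩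

/-! ## Directions -/

theorem Dir.base_eq {Γ : MetricGraph} (ν : Γ.Dir) : ν.base = ν.move 0 := by
  simp [Dir.base, Dir.move]

theorem Dir.pos_mem_Icc {Γ : MetricGraph} (ν : Γ.Dir) : ν.pos ∈ Icc 0 (Γ.edgeLen ν.dart) :=
  Ico_subset_Icc_self ν.pos_mem

theorem Dir.ext' {Γ : MetricGraph} {ν ν' : Γ.Dir} (h : ν.dart = ν'.dart) (h' : ν.pos = ν'.pos) :
    ν = ν' := by
  cases ν; cases ν'; cases h; cases h'; rfl

/-- The direction pointing along `d` at its tail. -/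
def dartDir (Γ : MetricGraph) (d : Γ.Dart) : Γ.Dir := ⟨d, 0, le_rfl, Γ.edgeLen_pos d⟩

@[simp] theorem dartDir_dart (Γ : MetricGraph) (d : Γ.Dart) : (Γ.dartDir d).dart = d := rfl

@[simp] theorem dartDir_pos (Γ : MetricGraph) (d : Γ.Dart) : (Γ.dartDir d).pos = 0 := rfl

theorem dartDir_base (Γ : MetricGraph) (d : Γ.Dart) : (Γ.dartDir d).base = Γ.vert d.fst :=
  Γ.param_zero d

theorem Dir.base_interior {Γ : MetricGraph} {ν : Γ.Dir} {d : Γ.Dart} {t : ℝ}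
    (ht : t ∈ Ioo 0 (Γ.edgeLen d)) (h : ν.base = Γ.param d t) :
    (ν.dart = d ∧ ν.pos = t) ∨ (ν.dart = d.symm ∧ ν.pos = Γ.edgeLen d - t) :=
  Γ.param_eq_interior ht ν.pos_mem_Icc h.symm

theorem Dir.base_vert {Γ : MetricGraph} {ν : Γ.Dir} {v : Γ.V} (h : ν.base = Γ.vert v) :
    ν = Γ.dartDir ν.dart ∧ ν.dart.fst = v := by
  rcases ν.pos_mem.1.eq_or_lt with h0 | h0
  · refine ⟨Dir.ext' rfl h0.symm, Γ.vert_injective ?_⟩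
    rw [← h, ← param_zero, Dir.base, ← h0]
  · exact absurd h (Γ.param_ne_vert ν.dart ⟨h0, ν.pos_mem.2⟩ v)

instance finite_tangent (Γ : MetricGraph) (x : Γ.Point) : Finite (Γ.Tangent x) := by
  refine Finite.of_injective (fun ν : Γ.Tangent x => ν.1.dart) fun ν ν' h => ?_
  obtain ⟨ν, hν⟩ := ν
  obtain ⟨ν', hν'⟩ := ν'
  simp only at h
  refine Subtype.ext (Dir.ext' h ?_)
  have : Γ.param ν.dart ν.pos = Γ.param ν.dart ν'.pos := by
    have : ν.base = ν'.base := hν.trans hν'.symm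
    rw [Dir.base, Dir.base, ← h] at this
    exact this
  exact Γ.param_injOn _ ν.pos_mem_Icc (by rw [h]; exact ν'.pos_mem_Icc) this

instance nonempty_tangent (Γ : MetricGraph) (x : Γ.Point) : Nonempty (Γ.Tangent x) := by
  obtain ⟨d, t, ht, rfl⟩ := Γ.exists_param_Ico x
  exact ⟨⟨⟨d, t, ht⟩, rfl⟩⟩

theorem finsum_tangent_vert {Γ : MetricGraph} {M : Type*} [AddCommMonoid M] (v : Γ.V)
    (h : Γ.Dir → M) :
    ∑ᶠ ν : Γ.Tangent (Γ.vert v), h ν.1 = ∑ᶠ d : {d : Γ.Dart // d.fst = v}, h (Γ.dartDir d) := by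
  refine finsum_eq_of_bijective (fun ν => ⟨ν.1.dart, (Dir.base_vert ν.2).2⟩) ⟨?_, ?_⟩ ?_
  · intro ν ν' e
    have e' : ν.1.dart = ν'.1.dart := congrArg Subtype.val e
    apply Subtype.ext
    rw [(Dir.base_vert ν.2).1, (Dir.base_vert ν'.2).1, e']
  · rintro ⟨d, rfl⟩
    exact ⟨⟨Γ.dartDir d, Γ.dartDir_base d⟩, rfl⟩
  · intro ν
    rw [← (Dir.base_vert ν.2).1]

theorem dart_symm_ne {Γ : MetricGraph} (d : Γ.Dart) : d.symm ≠ d :=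
  SimpleGraph.Dart.symm_ne d

theorem finsum_tangent_interior {Γ : MetricGraph} {M : Type*} [AddCommMonoid M] {d : Γ.Dart}
    {t : ℝ} (ht : t ∈ Ico 0 (Γ.edgeLen d)) (ht' : Γ.edgeLen d - t ∈ Ico 0 (Γ.edgeLen d.symm))
    (h : Γ.Dir → M) :
    ∑ᶠ ν : Γ.Tangent (Γ.param d t), h ν.1 = h ⟨d, t, ht⟩ + h ⟨d.symm, Γ.edgeLen d - t, ht'⟩ := by
  classical
  have hi : t ∈ Ioo 0 (Γ.edgeLen d) := ⟨by
    have := ht'.2; rw [edgeLen_symm] at this; linarith, ht.2⟩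
  let a : Γ.Tangent (Γ.param d t) := ⟨⟨d, t, ht⟩, rfl⟩
  let b : Γ.Tangent (Γ.param d t) := ⟨⟨d.symm, Γ.edgeLen d - t, ht'⟩,
    Γ.param_symm d (Ico_subset_Icc_self ht)⟩
  have hab : a ≠ b := fun e => dart_symm_ne d (congrArg (fun ν => ν.1.dart) e).symm
  have : Function.support (fun ν : Γ.Tangent (Γ.param d t) => h ν.1) ⊆
      (({a, b} : Finset _) : Set (Γ.Tangent (Γ.param d t))) := by
    intro ν _
    simp only [Finset.coe_insert, Finset.coe_singleton, mem_insert_iff, mem_singleton_iff]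
    rcases Dir.base_interior hi ν.2 with ⟨e, e'⟩ | ⟨e, e'⟩
    · exact Or.inl (Subtype.ext (Dir.ext' e e'))
    · exact Or.inr (Subtype.ext (Dir.ext' e e'))
  rw [finsum_eq_sum_of_support_subset _ this, Finset.sum_pair hab]

end MetricGraph
end

noncomputable section
namespace MetricGraph

/-! ## Cutting intervals -/

/-- Compactness: finitely many of the neighbourhoods formed by the two one-sided germs cover `[0,
l]`, and cutting at their centres and end points leaves gaps each inside one half of one of them.
This turns germwise statements into the piecewise ones used to define `Rat` and
`IsPiecewiseDilation`. -/
theorem exists_cut (P : ℝ → ℝ → Prop) {l : ℝ}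
    (mono : ∀ a b a' b', P a b → a ≤ a' → a' < b' → b' ≤ b → P a' b')
    (right : ∀ t ∈ Ico 0 l, ∃ ε > 0, P t (t + ε))
    (left : ∀ t ∈ Ioc 0 l, ∃ ε > 0, P (t - ε) t) :
    ∃ A : Finset ℝ, ∀ a b, 0 ≤ a → a < b → b ≤ l → (∀ c ∈ A, c ∉ Ioo a b) → P a b := by
  classical
  have h : ∀ t, ∃ ε > 0, (t ∈ Ico 0 l → P t (t + ε)) ∧ (t ∈ Ioc 0 l → P (t - ε) t) := by
    intro t
    have hr : ∃ ε > 0, t ∈ Ico 0 l → P t (t + ε) := by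
      by_cases ht : t ∈ Ico 0 l
      · obtain ⟨ε, h0, h1⟩ := right t ht
        exact ⟨ε, h0, fun _ => h1⟩
      · exact ⟨1, one_pos, fun h => absurd h ht⟩
    have hl : ∃ ε > 0, t ∈ Ioc 0 l → P (t - ε) t := by
      by_cases ht : t ∈ Ioc 0 l
      · obtain ⟨ε, h0, h1⟩ := left t ht
        exact ⟨ε, h0, fun _ => h1⟩
      · exact ⟨1, one_pos, fun h => absurd h ht⟩
    obtain ⟨ε, h0, h1⟩ := hr
    obtain ⟨ε', h0', h1'⟩ := hl
    have hm := lt_min h0 h0'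
    refine ⟨min ε ε', hm, fun h => ?_, fun h => ?_⟩
    · exact mono _ _ _ _ (h1 h) le_rfl (by linarith) (by linarith [min_le_left ε ε'])
    · exact mono _ _ _ _ (h1' h) (by linarith [min_le_right ε ε']) (by linarith) le_rfl
  choose ε hε hr hl using h
  obtain ⟨s, _, hs⟩ := (isCompact_Icc (a := (0 : ℝ)) (b := l)).elim_nhds_subcover
    (fun t => Ioo (t - ε t) (t + ε t)) (fun t _ => Ioo_mem_nhds (by linarith [hε t])
      (by linarith [hε t]))
  refine ⟨s ∪ s.image (fun t => t - ε t) ∪ s.image (fun t => t + ε t),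
    fun a b ha hab hb hA => ?_⟩
  -- The midpoint selects a covering interval. Its centre and ends are cut points, so the whole gap
  -- lies in one of its halves.
  have hm : (a + b) / 2 ∈ Icc 0 l := ⟨by linarith, by linarith⟩
  obtain ⟨t, ht, htm⟩ := mem_iUnion₂.1 (hs hm)
  have h1 := hA t (by simp [ht])
  have h2 := hA (t - ε t) (by simp only [Finset.mem_union, Finset.mem_image]; exact Or.inl (Or.inr ⟨t, ht, rfl⟩))
  have h3 := hA (t + ε t) (by simp only [Finset.mem_union, Finset.mem_image]; exact Or.inr ⟨t, ht, rfl⟩)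
  simp only [mem_Ioo, not_and, not_lt] at h1 h2 h3 htm
  have := hε t
  rcases lt_or_ge a t with hat | hat
  · have hbt := h1 hat
    have h4 : t - ε t ≤ a := by
      by_contra! hc
      linarith [h2 hc]
    rcases le_or_gt t l with htl | htl
    · exact mono _ _ _ _ (hl t ⟨by linarith, htl⟩) h4 hab hbt
    · by_contra
      obtain ⟨t', ht', htm'⟩ := mem_iUnion₂.1 (hs hm)
      linarith [(‹∀ x ∈ s, x ∈ Icc 0 l› t ht).2]
  · have h4 : b ≤ t + ε t := by
      apply h3; linarith
    have : 0 ≤ t := (‹∀ x ∈ s, x ∈ Icc 0 l› t ht).1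
    exact mono _ _ _ _ (hr t ⟨this, by linarith⟩) hat hab h4

theorem exists_gap_right (A : Finset ℝ) {p l : ℝ} (h : p < l) :
    ∃ b, p < b ∧ b ≤ l ∧ ∀ c ∈ A, c ∉ Ioo p b := by
  classical
  have hne : (insert l (A.filter (p < ·))).Nonempty := ⟨l, by simp⟩
  refine ⟨(insert l (A.filter (p < ·))).min' hne, ?_, ?_, ?_⟩
  · have := Finset.min'_mem _ hne
    rw [Finset.mem_insert, Finset.mem_filter] at this
    rcases this with h' | h'
    · rw [h']; exact h
    · exact h'.2
  · exact Finset.min'_le _ _ (by simp)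
  · intro c hc hcm
    have := Finset.min'_le (insert l (A.filter (p < ·))) c (by simp [hc, hcm.1])
    exact absurd hcm.2 (not_lt.2 this)

theorem continuousOn_of_germs {Y : Type*} [TopologicalSpace Y] {g : ℝ → Y} {l : ℝ}
    (right : ∀ t ∈ Ico 0 l, ∃ ε > 0, ContinuousWithinAt g (Icc t (t + ε)) t)
    (left : ∀ t ∈ Ioc 0 l, ∃ ε > 0, ContinuousWithinAt g (Icc (t - ε) t) t) :
    ContinuousOn g (Icc 0 l) := by
  intro t ht
  have hr : ∃ ε > 0, ContinuousWithinAt g (Icc t (t + ε) ∩ Icc 0 l) t := by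
    rcases ht.2.eq_or_lt with h | h
    · refine ⟨1, one_pos, ?_⟩
      have : Icc t (t + 1) ∩ Icc 0 l ⊆ {t} := fun x hx => by
        simp only [mem_singleton_iff]; linarith [hx.1.1, hx.2.2]
      exact (continuousWithinAt_singleton).mono this
    · obtain ⟨ε, h0, h1⟩ := right t ⟨ht.1, h⟩
      exact ⟨ε, h0, h1.mono inter_subset_left⟩
  have hl : ∃ ε > 0, ContinuousWithinAt g (Icc (t - ε) t ∩ Icc 0 l) t := by
    rcases ht.1.eq_or_lt with h | h
    · refine ⟨1, one_pos, ?_⟩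
      have : Icc (t - 1) t ∩ Icc 0 l ⊆ {t} := fun x hx => by
        simp only [mem_singleton_iff]; linarith [hx.1.2, hx.2.1]
      exact (continuousWithinAt_singleton).mono this
    · obtain ⟨ε, h0, h1⟩ := left t ⟨h, ht.2⟩
      exact ⟨ε, h0, h1.mono inter_subset_left⟩
  obtain ⟨ε, h0, h1⟩ := hr
  obtain ⟨ε', h0', h1'⟩ := hl
  refine (h1.union h1').mono_of_mem_nhdsWithin ?_
  have : Ioo (t - ε') (t + ε) ∩ Icc 0 l ⊆ Icc t (t + ε) ∩ Icc 0 l ∪ Icc (t - ε') t ∩ Icc 0 l := by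
    rintro x ⟨hx, hx'⟩
    rcases le_total x t with h | h
    · exact Or.inr ⟨⟨hx.1.le, h⟩, hx'⟩
    · exact Or.inl ⟨⟨h, hx.2.le⟩, hx'⟩
  refine Filter.mem_of_superset ?_ this
  rw [inter_comm]
  exact Filter.inter_mem self_mem_nhdsWithin (mem_nhdsWithin_of_mem_nhds
    (Ioo_mem_nhds (by linarith) (by linarith)))

/-! ## Directions along edges -/

/-- The direction pointing backwards along `d` at distance `t` from its tail. -/
def backDir (Γ : MetricGraph) (d : Γ.Dart) (t : ℝ) (ht : t ∈ Ioc 0 (Γ.edgeLen d)) : Γ.Dir :=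
  ⟨d.symm, Γ.edgeLen d - t, by
    rw [edgeLen_symm]; exact ⟨by linarith [ht.2], by linarith [ht.1]⟩⟩

theorem backDir_move (Γ : MetricGraph) (d : Γ.Dart) (t : ℝ) (ht : t ∈ Ioc 0 (Γ.edgeLen d))
    {h : ℝ} (hh : h ∈ Icc 0 t) : (Γ.backDir d t ht).move h = Γ.param d (t - h) := by
  rw [← param_symm Γ d (t := t - h) ⟨by linarith [hh.2], by linarith [hh.1, ht.2]⟩]
  simp only [Dir.move, backDir]
  congr 1; ring

theorem backDir_base (Γ : MetricGraph) (d : Γ.Dart) (t : ℝ) (ht : t ∈ Ioc 0 (Γ.edgeLen d)) :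
    (Γ.backDir d t ht).base = Γ.param d t := by
  rw [Dir.base_eq, backDir_move _ _ _ _ ⟨le_rfl, ht.1.le⟩, sub_zero]

/-! ## Slopes -/

theorem rat_hasSlope {Γ : MetricGraph} {f : Γ.Point → ℝ} (hf : f ∈ Γ.Rat) (ν : Γ.Dir) :
    ∃ s, HasSlope f ν s := by
  obtain ⟨A, hA⟩ := hf ν.dart
  obtain ⟨b, hb, hb', hc⟩ := exists_gap_right A ν.pos_mem.2
  obtain ⟨k, hk⟩ := hA ν.pos b ν.pos_mem.1 hb hb' hc
  refine ⟨k, b - ν.pos, by linarith, fun h hh => ?_⟩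
  rw [Dir.move, hk _ ⟨by linarith [hh.1], by linarith [hh.2]⟩, Dir.base]
  ring

theorem HasSlope.slope {Γ : MetricGraph} {f : Γ.Point → ℝ} (hf : f ∈ Γ.Rat) (ν : Γ.Dir) :
    HasSlope f ν (slope f ν) := by
  obtain ⟨s, hs⟩ := rat_hasSlope hf ν
  rwa [hs.slope_eq]

/-- Affine germs on both sides of every point are assembled into finitely many pieces by
`exists_cut`; membership in `Rat` is thus a local condition. -/
theorem mem_rat_iff {Γ : MetricGraph} {f : Γ.Point → ℝ} :
    f ∈ Γ.Rat ↔ ∀ ν, ∃ s, HasSlope f ν s := by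
  refine ⟨rat_hasSlope, fun H d => ?_⟩
  refine exists_cut (fun a b => ∃ k : ℤ, ∀ t ∈ Icc a b,
    f (Γ.param d t) = f (Γ.param d a) + k * (t - a)) ?_ ?_ ?_
  · rintro a b a' b' ⟨k, hk⟩ h1 h2 h3
    refine ⟨k, fun t ht => ?_⟩
    rw [hk t ⟨h1.trans ht.1, ht.2.trans h3⟩, hk a' ⟨h1, by linarith⟩]
    ring
  · intro t ht
    obtain ⟨s, ε, h0, hs⟩ := H ⟨d, t, ht⟩
    refine ⟨ε / 2, by linarith, s, fun u hu => ?_⟩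
    have := hs (u - t) ⟨by linarith [hu.1], by linarith [hu.2]⟩
    simp only [Dir.move, Dir.base] at this
    rw [← this]
    congr 2; ring
  · intro t ht
    obtain ⟨s, ε, h0, hs⟩ := H (Γ.backDir d t ht)
    have hm : 0 < min (ε / 2) t := lt_min (by linarith) ht.1
    have m1 := min_le_left (ε / 2) t
    have m2 := min_le_right (ε / 2) t
    have key : ∀ h ∈ Icc 0 (min (ε / 2) t),
        f (Γ.param d (t - h)) = f (Γ.param d t) + s * h := fun h hh => by
      rw [← backDir_move Γ d t ht ⟨hh.1, hh.2.trans m2⟩,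
        hs h ⟨hh.1, by linarith [hh.2]⟩, backDir_base]
    refine ⟨_, hm, -s, fun u hu => ?_⟩
    have k1 := key (t - u) ⟨by linarith [hu.2], by linarith [hu.1]⟩
    have k2 := key _ ⟨hm.le, le_rfl⟩
    rw [sub_sub_cancel] at k1
    rw [k1, k2]
    push_cast; ring

theorem HasSlope.add {Γ : MetricGraph} {f g : Γ.Point → ℝ} {ν : Γ.Dir} {s s' : ℤ}
    (h : HasSlope f ν s) (h' : HasSlope g ν s') : HasSlope (f + g) ν (s + s') := by
  obtain ⟨ε, h0, h1⟩ := h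
  obtain ⟨ε', h0', h1'⟩ := h'
  refine ⟨min ε ε', lt_min h0 h0', fun x hx => ?_⟩
  simp only [Pi.add_apply]
  rw [h1 x ⟨hx.1, hx.2.trans_le (min_le_left _ _)⟩, h1' x ⟨hx.1, hx.2.trans_le (min_le_right _ _)⟩]
  push_cast; ring

theorem HasSlope.neg {Γ : MetricGraph} {f : Γ.Point → ℝ} {ν : Γ.Dir} {s : ℤ}
    (h : HasSlope f ν s) : HasSlope (-f) ν (-s) := by
  obtain ⟨ε, h0, h1⟩ := h
  refine ⟨ε, h0, fun x hx => ?_⟩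
  simp only [Pi.neg_apply]
  rw [h1 x hx]
  push_cast; ring

theorem HasSlope.const {Γ : MetricGraph} (c : ℝ) (ν : Γ.Dir) :
    HasSlope (fun _ : Γ.Point => c) ν 0 := ⟨1, one_pos, fun x _ => by simp⟩

theorem HasSlope.congr_near {Γ : MetricGraph} {f g : Γ.Point → ℝ} {ν : Γ.Dir} {s : ℤ}
    (h : HasSlope f ν s) {ε : ℝ} (h0 : 0 < ε) (he : ∀ x ∈ Ico 0 ε, g (ν.move x) = f (ν.move x)) :
    HasSlope g ν s := by
  obtain ⟨ε', h0', h1⟩ := h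
  refine ⟨min ε ε', lt_min h0 h0', fun x hx => ?_⟩
  rw [he x ⟨hx.1, hx.2.trans_le (min_le_left _ _)⟩, h1 x ⟨hx.1, hx.2.trans_le (min_le_right _ _)⟩,
    Dir.base_eq, he 0 ⟨le_rfl, h0⟩]

theorem HasSlope.min_lt {Γ : MetricGraph} {f g : Γ.Point → ℝ} {ν : Γ.Dir} {s s' : ℤ}
    (h : HasSlope f ν s) (h' : HasSlope g ν s') (hlt : f ν.base < g ν.base) :
    HasSlope (fun x => min (f x) (g x)) ν s := by
  obtain ⟨ε, h0, h1⟩ := h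
  obtain ⟨ε', h0', h1'⟩ := h'
  -- `K` exceeds the rate at which `f` can catch up with `g`, so `f` stays below for distances up to
  -- the gap at the base divided by `K`.
  set K : ℝ := |(s : ℝ)| + |(s' : ℝ)| + 1 with hK
  have hK0 : 0 < K := by positivity
  set δ : ℝ := (g ν.base - f ν.base) / K with hδ
  have hδ0 : 0 < δ := div_pos (by linarith) hK0
  refine HasSlope.congr_near (f := f) ⟨ε, h0, h1⟩ (ε := min δ (min ε ε'))
    (lt_min hδ0 (lt_min h0 h0')) fun x hx => min_eq_left ?_
  have hx1 : x < δ := hx.2.trans_le (min_le_left _ _)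
  have hx2 : x < ε := hx.2.trans_le ((min_le_right _ _).trans (min_le_left _ _))
  have hx3 : x < ε' := hx.2.trans_le ((min_le_right _ _).trans (min_le_right _ _))
  rw [h1 x ⟨hx.1, hx2⟩, h1' x ⟨hx.1, hx3⟩]
  have e : δ * K = g ν.base - f ν.base := by rw [hδ]; field_simp
  have a1 : (s : ℝ) * x ≤ |(s : ℝ)| * x := mul_le_mul_of_nonneg_right (le_abs_self _) hx.1
  have a2 : -|(s' : ℝ)| * x ≤ (s' : ℝ) * x := mul_le_mul_of_nonneg_right (neg_abs_le _) hx.1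
  have a3 : x * K ≤ δ * K := mul_le_mul_of_nonneg_right hx1.le hK0.le
  have a4 : x * K = |(s : ℝ)| * x + |(s' : ℝ)| * x + x := by rw [hK]; ring
  linarith [hx.1]

theorem HasSlope.min_eq {Γ : MetricGraph} {f g : Γ.Point → ℝ} {ν : Γ.Dir} {s s' : ℤ}
    (h : HasSlope f ν s) (h' : HasSlope g ν s') (heq : f ν.base = g ν.base) :
    HasSlope (fun x => min (f x) (g x)) ν (min s s') := by
  obtain ⟨ε, h0, h1⟩ := h
  obtain ⟨ε', h0', h1'⟩ := h'
  refine ⟨min ε ε', lt_min h0 h0', fun x hx => ?_⟩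
  change min (f (ν.move x)) (g (ν.move x)) = min (f ν.base) (g ν.base) + _
  rw [h1 x ⟨hx.1, hx.2.trans_le (min_le_left _ _)⟩, h1' x ⟨hx.1, hx.2.trans_le (min_le_right _ _)⟩,
    ← heq, min_self, min_add_add_left]
  push_cast
  rw [min_mul_of_nonneg _ _ hx.1]

theorem HasSlope.min_exists {Γ : MetricGraph} {f g : Γ.Point → ℝ} {ν : Γ.Dir} {s s' : ℤ}
    (h : HasSlope f ν s) (h' : HasSlope g ν s') :
    ∃ s'', HasSlope (fun x => min (f x) (g x)) ν s'' := by
  rcases lt_trichotomy (f ν.base) (g ν.base) with hl | hl | hl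
  · exact ⟨_, h.min_lt h' hl⟩
  · exact ⟨_, h.min_eq h' hl⟩
  · refine ⟨s', ?_⟩
    have := h'.min_lt h hl
    simpa only [min_comm] using this

theorem add_mem_rat {Γ : MetricGraph} {f g : Γ.Point → ℝ} (hf : f ∈ Γ.Rat) (hg : g ∈ Γ.Rat) :
    f + g ∈ Γ.Rat :=
  mem_rat_iff.2 fun ν => ⟨_, (HasSlope.slope hf ν).add (HasSlope.slope hg ν)⟩

theorem neg_mem_rat {Γ : MetricGraph} {f : Γ.Point → ℝ} (hf : f ∈ Γ.Rat) : -f ∈ Γ.Rat :=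
  mem_rat_iff.2 fun ν => ⟨_, (HasSlope.slope hf ν).neg⟩

theorem sub_mem_rat {Γ : MetricGraph} {f g : Γ.Point → ℝ} (hf : f ∈ Γ.Rat) (hg : g ∈ Γ.Rat) :
    f - g ∈ Γ.Rat := by
  rw [sub_eq_add_neg]; exact add_mem_rat hf (neg_mem_rat hg)

theorem const_mem_rat {Γ : MetricGraph} (c : ℝ) : (fun _ : Γ.Point => c) ∈ Γ.Rat :=
  mem_rat_iff.2 fun ν => ⟨_, HasSlope.const c ν⟩

theorem min_mem_rat {Γ : MetricGraph} {f g : Γ.Point → ℝ} (hf : f ∈ Γ.Rat) (hg : g ∈ Γ.Rat) :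
    (fun x => min (f x) (g x)) ∈ Γ.Rat :=
  mem_rat_iff.2 fun ν => (HasSlope.slope hf ν).min_exists (HasSlope.slope hg ν)

theorem slope_add {Γ : MetricGraph} {f g : Γ.Point → ℝ} (hf : f ∈ Γ.Rat) (hg : g ∈ Γ.Rat)
    (ν : Γ.Dir) : slope (f + g) ν = slope f ν + slope g ν :=
  ((HasSlope.slope hf ν).add (HasSlope.slope hg ν)).slope_eq

theorem slope_neg {Γ : MetricGraph} {f : Γ.Point → ℝ} (hf : f ∈ Γ.Rat)
    (ν : Γ.Dir) : slope (-f) ν = - slope f ν :=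
  ((HasSlope.slope hf ν).neg).slope_eq

theorem slope_const {Γ : MetricGraph} (c : ℝ) (ν : Γ.Dir) :
    slope (fun _ : Γ.Point => c) ν = 0 := (HasSlope.const c ν).slope_eq

theorem ord_add {Γ : MetricGraph} {f g : Γ.Point → ℝ} (hf : f ∈ Γ.Rat) (hg : g ∈ Γ.Rat)
    (x : Γ.Point) : ord (f + g) x = ord f x + ord g x := by
  have h := finsum_add_distrib (f := fun ν : Γ.Tangent x => slope f ν.1)
    (g := fun ν : Γ.Tangent x => slope g ν.1) (Set.toFinite _) (Set.toFinite _)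
  unfold ord
  rw [← neg_add, ← h, finsum_congr fun ν : Γ.Tangent x => slope_add hf hg ν.1]

theorem ord_neg {Γ : MetricGraph} {f : Γ.Point → ℝ} (hf : f ∈ Γ.Rat)
    (x : Γ.Point) : ord (-f) x = - ord f x := by
  unfold ord
  rw [finsum_congr fun ν : Γ.Tangent x => slope_neg hf ν.1, finsum_neg_distrib]

theorem ord_sub {Γ : MetricGraph} {f g : Γ.Point → ℝ} (hf : f ∈ Γ.Rat) (hg : g ∈ Γ.Rat)
    (x : Γ.Point) : ord (f - g) x = ord f x - ord g x := by
  rw [sub_eq_add_neg, ord_add hf (neg_mem_rat hg), ord_neg hg, sub_eq_add_neg]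

theorem ord_const {Γ : MetricGraph} (c : ℝ) (x : Γ.Point) :
    ord (fun _ : Γ.Point => c) x = 0 := by
  unfold ord
  simp [slope_const]

theorem add_const_mem_rat {Γ : MetricGraph} {f : Γ.Point → ℝ} (hf : f ∈ Γ.Rat) (c : ℝ) :
    (fun x => f x + c) ∈ Γ.Rat := add_mem_rat hf (const_mem_rat c)

theorem ord_add_const {Γ : MetricGraph} {f : Γ.Point → ℝ} (hf : f ∈ Γ.Rat) (c : ℝ)
    (x : Γ.Point) : ord (fun x => f x + c) x = ord f x := by
  have := ord_add hf (const_mem_rat c) x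
  rw [ord_const, add_zero] at this
  exact this

theorem finsum_le_finsum' {α : Type*} [Finite α] {f g : α → ℤ} (h : ∀ a, f a ≤ g a) :
    ∑ᶠ a, f a ≤ ∑ᶠ a, g a := by
  have := Fintype.ofFinite α
  rw [finsum_eq_sum_of_fintype, finsum_eq_sum_of_fintype]
  exact Finset.sum_le_sum fun a _ => h a

/-- Where the functions agree, slopes of the minimum are minima of slopes; elsewhere the minimum is
locally one of the two. This is what makes `Rat(D)` stable under minima. -/
theorem ord_min_ge {Γ : MetricGraph} {f g : Γ.Point → ℝ} (hf : f ∈ Γ.Rat) (hg : g ∈ Γ.Rat)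
    (x : Γ.Point) : ord f x ≤ ord (fun x => min (f x) (g x)) x ∨
      ord g x ≤ ord (fun x => min (f x) (g x)) x := by
  unfold ord
  rcases lt_trichotomy (f x) (g x) with hl | hl | hl
  · left
    refine neg_le_neg (finsum_le_finsum' fun ν => ?_)
    rw [((HasSlope.slope hf ν.1).min_lt (HasSlope.slope hg ν.1) (by rwa [ν.2])).slope_eq]
  · left
    refine neg_le_neg (finsum_le_finsum' fun ν => ?_)
    rw [((HasSlope.slope hf ν.1).min_eq (HasSlope.slope hg ν.1) (by rwa [ν.2])).slope_eq]
    exact min_le_left _ _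
  · right
    refine neg_le_neg (finsum_le_finsum' fun ν => ?_)
    have := (HasSlope.slope hg ν.1).min_lt (HasSlope.slope hf ν.1) (by rwa [ν.2])
    simp only [min_comm] at this ⊢
    rw [this.slope_eq]

theorem min_mem_ratDiv {Γ : MetricGraph} {D : Γ.Divisor} {f g : Γ.Point → ℝ}
    (hf : f ∈ ratDiv D) (hg : g ∈ ratDiv D) : (fun x => min (f x) (g x)) ∈ ratDiv D := by
  refine ⟨min_mem_rat hf.1 hg.1, fun x => ?_⟩
  have h1 := hf.2 x
  have h2 := hg.2 x
  rcases ord_min_ge hf.1 hg.1 x with h | h <;> linarith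

theorem add_const_mem_ratDiv {Γ : MetricGraph} {D : Γ.Divisor} {f : Γ.Point → ℝ}
    (hf : f ∈ ratDiv D) (c : ℝ) : (fun x => f x + c) ∈ ratDiv D := by
  refine ⟨add_const_mem_rat hf.1 c, fun x => ?_⟩
  rw [ord_add_const hf.1]
  exact hf.2 x

theorem continuous_of_rat {Γ : MetricGraph} {f : Γ.Point → ℝ} (hf : f ∈ Γ.Rat) :
    Continuous f := by
  refine continuous_iff_param.2 fun d => continuousOn_of_germs ?_ ?_
  · intro t ht
    obtain ⟨s, ε, h0, hs⟩ := rat_hasSlope hf ⟨d, t, ht⟩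
    refine ⟨ε / 2, by linarith, ?_⟩
    refine ContinuousWithinAt.congr (f := fun u => f (Γ.param d t) + s * (u - t))
      (by fun_prop) (fun u hu => ?_) (by simp)
    have := hs (u - t) ⟨by linarith [hu.1], by linarith [hu.2]⟩
    simp only [Dir.move, Dir.base, add_sub_cancel] at this
    exact this
  · intro t ht
    obtain ⟨s, ε, h0, hs⟩ := rat_hasSlope hf (Γ.backDir d t ht)
    refine ⟨min (ε / 2) t, lt_min (by linarith) ht.1, ?_⟩
    have m1 := min_le_left (ε / 2) t
    have m2 := min_le_right (ε / 2) t
    refine ContinuousWithinAt.congr (f := fun u => f (Γ.param d t) + s * (t - u))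
      (by fun_prop) (fun u hu => ?_) (by simp)
    have := hs (t - u) ⟨by linarith [hu.2], by linarith [hu.1]⟩
    rw [backDir_base, backDir_move _ _ _ _ ⟨by linarith [hu.2], by linarith [hu.1]⟩] at this
    simp only [sub_sub_cancel] at this
    exact this

end MetricGraph
end

noncomputable section
namespace MetricGraph

/-! ## Maps that are dilations along directions -/

theorem Dir.exists_room {Γ : MetricGraph} (ν : Γ.Dir) (k : ℕ) :
    ∃ δ > (0 : ℝ), ∀ h ∈ Icc 0 δ, ν.pos + k * h ∈ Ico ν.pos (Γ.edgeLen ν.dart) := by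
  have h1 : 0 < Γ.edgeLen ν.dart - ν.pos := by linarith [ν.pos_mem.2]
  refine ⟨(Γ.edgeLen ν.dart - ν.pos) / (2 * (k + 1)), by positivity, fun h hh => ?_⟩
  have hk : (0 : ℝ) ≤ k := Nat.cast_nonneg k
  have h2 : h * (2 * (k + 1)) ≤ Γ.edgeLen ν.dart - ν.pos := by
    rw [← le_div_iff₀ (by positivity)]; exact hh.2
  have h3 : 0 ≤ k * h := mul_nonneg hk hh.1
  constructor
  · linarith
  · nlinarith [hh.1]

/-- A point slightly beyond the base is interior to an edge, where edge and position are unique up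
to reversal. A germ of a dilation hence determines direction and factor, which makes `expansion`
meaningful. -/
theorem Dir.move_germ_unique {Γ : MetricGraph} {ν₁ ν₂ : Γ.Dir} {k₁ k₂ : ℕ} (h₁ : 1 ≤ k₁)
    (h₂ : 1 ≤ k₂) {ε : ℝ} (h0 : 0 < ε)
    (h : ∀ x ∈ Ico 0 ε, ν₁.move (k₁ * x) = ν₂.move (k₂ * x)) : ν₁ = ν₂ ∧ k₁ = k₂ := by
  obtain ⟨δ₁, p₁, r₁⟩ := ν₁.exists_room k₁
  obtain ⟨δ₂, p₂, r₂⟩ := ν₂.exists_room k₂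
  have c₁ : (1 : ℝ) ≤ k₁ := by exact_mod_cast h₁
  have c₂ : (1 : ℝ) ≤ k₂ := by exact_mod_cast h₂
  set δ := min (ε / 2) (min δ₁ δ₂)
  have hδ : 0 < δ := lt_min (by linarith) (lt_min p₁ p₂)
  have m0 : δ ≤ ε / 2 := min_le_left _ _
  have m1 : δ ≤ δ₁ := (min_le_right _ _).trans (min_le_left _ _)
  have m2 : δ ≤ δ₂ := (min_le_right _ _).trans (min_le_right _ _)
  have key : ∀ x ∈ Ioc 0 δ,
      (ν₂.dart = ν₁.dart ∧ ν₂.pos + k₂ * x = ν₁.pos + k₁ * x) ∨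
      (ν₂.dart = ν₁.dart.symm ∧ ν₂.pos + k₂ * x = Γ.edgeLen ν₁.dart - (ν₁.pos + k₁ * x)) := by
    intro x hx
    have q1 := r₁ x ⟨hx.1.le, hx.2.trans m1⟩
    have q2 := r₂ x ⟨hx.1.le, hx.2.trans m2⟩
    refine Γ.param_eq_interior ⟨?_, q1.2⟩ ⟨ν₂.pos_mem.1.trans q2.1, q2.2.le⟩
      (h x ⟨hx.1.le, by linarith [hx.2]⟩)
    have := ν₁.pos_mem.1
    nlinarith [hx.1]
  have hne := dart_symm_ne ν₁.dart
  -- A single parameter value could be matched by the reversed edge; two values exclude it, since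
  -- the positions would move in opposite directions.
  rcases key δ ⟨hδ, le_rfl⟩ with ⟨a, b⟩ | ⟨a, b⟩ <;>
    rcases key (δ / 2) ⟨by linarith, by linarith⟩ with ⟨a', b'⟩ | ⟨a', b'⟩
  · have e : (k₂ : ℝ) = k₁ := by
      have : ((k₂ : ℝ) - k₁) * δ = 0 := by linarith
      rcases mul_eq_zero.1 this with h | h <;> linarith
    exact ⟨Dir.ext' a.symm (by rw [e] at b; linarith), by exact_mod_cast e.symm⟩
  · exact absurd (a'.symm.trans a) hne
  · exact absurd (a.symm.trans a') hne
  · nlinarith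

theorem MapsDir.base {Γ Γ' : MetricGraph} {φ : Γ.Point → Γ'.Point} {ν : Γ.Dir} {ν' : Γ'.Dir}
    {k : ℕ} (h : MapsDir φ ν ν' k) : φ ν.base = ν'.base := by
  obtain ⟨_, ε, h0, h⟩ := h
  have := h 0 ⟨le_rfl, h0⟩
  rwa [mul_zero, ← Dir.base_eq, ← Dir.base_eq] at this

theorem MapsDir.unique {Γ Γ' : MetricGraph} {φ : Γ.Point → Γ'.Point} {ν : Γ.Dir}
    {ν₁ ν₂ : Γ'.Dir} {k₁ k₂ : ℕ} (h : MapsDir φ ν ν₁ k₁) (h' : MapsDir φ ν ν₂ k₂) :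
    ν₁ = ν₂ ∧ k₁ = k₂ := by
  obtain ⟨a, ε, h0, h⟩ := h
  obtain ⟨a', ε', h0', h'⟩ := h'
  exact Dir.move_germ_unique a a' (lt_min h0 h0') fun x hx => by
    rw [← h x ⟨hx.1, hx.2.trans_le (min_le_left _ _)⟩,
      ← h' x ⟨hx.1, hx.2.trans_le (min_le_right _ _)⟩]

theorem MapsDir.comp {Γ Γ' Γ'' : MetricGraph} {φ : Γ.Point → Γ'.Point} {ψ : Γ'.Point → Γ''.Point}
    {ν : Γ.Dir} {ν' : Γ'.Dir} {ν'' : Γ''.Dir} {k k' : ℕ} (h : MapsDir φ ν ν' k)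
    (h' : MapsDir ψ ν' ν'' k') : MapsDir (ψ ∘ φ) ν ν'' (k' * k) := by
  obtain ⟨a, ε, h0, h⟩ := h
  obtain ⟨a', ε', h0', h'⟩ := h'
  have hk : (0 : ℝ) < k := by exact_mod_cast a
  refine ⟨Nat.mul_pos a' a, min ε (ε' / k), lt_min h0 (by positivity), fun x hx => ?_⟩
  rw [Function.comp, h x ⟨hx.1, hx.2.trans_le (min_le_left _ _)⟩, h' _ ⟨by have := hx.1; positivity, ?_⟩]
  · push_cast; rw [mul_assoc]
  · have := hx.2.trans_le (min_le_right _ _)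
    rw [lt_div_iff₀ hk] at this
    linarith

theorem HasSlope.comp {Γ Γ' : MetricGraph} {φ : Γ.Point → Γ'.Point}
    {ν : Γ.Dir} {ν' : Γ'.Dir} {k : ℕ} {f : Γ'.Point → ℝ} {s : ℤ} (hf : HasSlope f ν' s)
    (h : MapsDir φ ν ν' k) : HasSlope (f ∘ φ) ν (k * s) := by
  have hb := h.base
  obtain ⟨a, ε, h0, h⟩ := h
  obtain ⟨ε', h0', h'⟩ := hf
  have hk : (0 : ℝ) < k := by exact_mod_cast a
  refine ⟨min ε (ε' / k), lt_min h0 (by positivity), fun x hx => ?_⟩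
  rw [Function.comp, h x ⟨hx.1, hx.2.trans_le (min_le_left _ _)⟩, h' _ ⟨by have := hx.1; positivity, ?_⟩,
    Function.comp, hb]
  · push_cast; ring
  · have := hx.2.trans_le (min_le_right _ _)
    rw [lt_div_iff₀ hk] at this
    linarith

/-- `φ` is, near each point in each direction, a dilation by a positive integral factor
in `K`. -/
def Dirwise {Γ Γ' : MetricGraph} (φ : Γ.Point → Γ'.Point) (K : Set ℕ) : Prop :=
  ∀ ν, ∃ ν', ∃ k ∈ K, MapsDir φ ν ν' k

theorem Dirwise.comp {Γ Γ' Γ'' : MetricGraph} {φ : Γ.Point → Γ'.Point}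
    {ψ : Γ'.Point → Γ''.Point} {K K' K'' : Set ℕ} (h : Dirwise φ K) (h' : Dirwise ψ K')
    (hK : ∀ k ∈ K, ∀ k' ∈ K', k' * k ∈ K'') : Dirwise (ψ ∘ φ) K'' := fun ν => by
  obtain ⟨ν', k, hk, h1⟩ := h ν
  obtain ⟨ν'', k', hk', h2⟩ := h' ν'
  exact ⟨ν'', _, hK k hk k' hk', h1.comp h2⟩

theorem Dirwise.mono {Γ Γ' : MetricGraph} {φ : Γ.Point → Γ'.Point} {K K' : Set ℕ}
    (h : Dirwise φ K) (hK : ∀ k ∈ K, 1 ≤ k → k ∈ K') : Dirwise φ K' := fun ν => by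
  obtain ⟨ν', k, hk, h1⟩ := h ν
  exact ⟨ν', k, hK k hk h1.1, h1⟩

theorem Dirwise.continuous {Γ Γ' : MetricGraph} {φ : Γ.Point → Γ'.Point} {K : Set ℕ}
    (h : Dirwise φ K) : Continuous φ := by
  refine continuous_iff_param.2 fun d => continuousOn_of_germs ?_ ?_
  · intro t ht
    obtain ⟨ν', k, _, _, ε, h0, hs⟩ := h ⟨d, t, ht⟩
    refine ⟨ε / 2, by linarith, ?_⟩
    refine ContinuousWithinAt.congr (f := fun u => Γ'.param ν'.dart (ν'.pos + k * (u - t)))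
      (((Γ'.continuous_param _).comp (by fun_prop)).continuousWithinAt) (fun u hu => ?_) ?_
    · have := hs (u - t) ⟨by linarith [hu.1], by linarith [hu.2]⟩
      simp only [Dir.move, add_sub_cancel] at this
      exact this
    · have := hs 0 ⟨le_rfl, h0⟩
      simpa [Dir.move] using this
  · intro t ht
    obtain ⟨ν', k, _, _, ε, h0, hs⟩ := h (Γ.backDir d t ht)
    refine ⟨min (ε / 2) t, lt_min (by linarith) ht.1, ?_⟩
    have m1 := min_le_left (ε / 2) t
    have m2 := min_le_right (ε / 2) t
    refine ContinuousWithinAt.congr (f := fun u => Γ'.param ν'.dart (ν'.pos + k * (t - u)))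
      (((Γ'.continuous_param _).comp (by fun_prop)).continuousWithinAt) (fun u hu => ?_) ?_
    · have := hs (t - u) ⟨by linarith [hu.2], by linarith [hu.1]⟩
      rw [backDir_move _ _ _ _ ⟨by linarith [hu.2], by linarith [hu.1]⟩] at this
      simp only [sub_sub_cancel] at this
      exact this
    · have := hs 0 ⟨le_rfl, h0⟩
      rw [backDir_move _ _ _ _ ⟨le_rfl, ht.1.le⟩] at this
      simpa [Dir.move] using this

theorem Dirwise.piecewiseDilation {Γ Γ' : MetricGraph} {φ : Γ.Point → Γ'.Point} {K : Set ℕ}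
    (h : Dirwise φ K) (d : Γ.Dart) :
    IsPiecewiseDilation (fun t => φ (Γ.param d t)) (Γ.edgeLen d) K := by
  refine exists_cut (fun a b => ∃ k ∈ K, ∃ (d' : Γ'.Dart) (c : ℝ), ∀ t ∈ Icc a b,
      c + (k : ℝ) * (t - a) ∈ Icc 0 (Γ'.edgeLen d') ∧
        φ (Γ.param d t) = Γ'.param d' (c + (k : ℝ) * (t - a))) ?_ ?_ ?_
  · rintro a b a' b' ⟨k, hk, d', c, H⟩ h1 h2 h3
    refine ⟨k, hk, d', c + k * (a' - a), fun t ht => ?_⟩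
    have := H t ⟨h1.trans ht.1, ht.2.trans h3⟩
    have e : c + k * (a' - a) + k * (t - a') = c + k * (t - a) := by ring
    rw [e]
    exact this
  · intro t ht
    obtain ⟨ν', k, hk, _, ε, h0, hs⟩ := h ⟨d, t, ht⟩
    obtain ⟨δ, hδ, r⟩ := ν'.exists_room k
    have hm : 0 < min (ε / 2) δ := lt_min (by linarith) hδ
    have m1 := min_le_left (ε / 2) δ
    have m2 := min_le_right (ε / 2) δ
    refine ⟨_, hm, k, hk, ν'.dart, ν'.pos, fun u hu => ⟨?_, ?_⟩⟩
    · have := r (u - t) ⟨by linarith [hu.1], by linarith [hu.2]⟩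
      exact ⟨ν'.pos_mem.1.trans this.1, this.2.le⟩
    · have := hs (u - t) ⟨by linarith [hu.1], by linarith [hu.2]⟩
      simp only [Dir.move, add_sub_cancel] at this
      exact this
  · intro t ht
    obtain ⟨ν', k, hk, _, ε, h0, hs⟩ := h (Γ.backDir d t ht)
    obtain ⟨δ, hδ, r⟩ := ν'.exists_room k
    set η := min (min (ε / 2) t) δ
    have hm : 0 < η := lt_min (lt_min (by linarith) ht.1) hδ
    have m1 : η ≤ ε / 2 := (min_le_left _ _).trans (min_le_left _ _)
    have m2 : η ≤ t := (min_le_left _ _).trans (min_le_right _ _)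
    have m3 : η ≤ δ := min_le_right _ _
    refine ⟨η, hm, k, hk, ν'.dart.symm, Γ'.edgeLen ν'.dart - (ν'.pos + k * η), fun u hu => ?_⟩
    have q := r (t - u) ⟨by linarith [hu.2], by linarith [hu.1]⟩
    have q0 := ν'.pos_mem.1
    have e : Γ'.edgeLen ν'.dart - (ν'.pos + k * η) + k * (u - (t - η)) =
      Γ'.edgeLen ν'.dart - (ν'.pos + k * (t - u)) := by ring
    rw [e, edgeLen_symm]
    refine ⟨⟨by linarith [q.2], by linarith [q.1]⟩, ?_⟩
    rw [param_symm _ _ ⟨q0.trans q.1, q.2.le⟩]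
    have := hs (t - u) ⟨by linarith [hu.2], by linarith [hu.1]⟩
    rw [backDir_move _ _ _ _ ⟨by linarith [hu.2], by linarith [hu.1]⟩] at this
    simp only [sub_sub_cancel] at this
    exact this

/-- Together with `IsFiniteMorphism.dirwise`, this replaces finite morphisms by maps that are
dilations along every direction, a condition that composes easily and is checked locally. -/
theorem Dirwise.isFiniteMorphism {Γ Γ' : MetricGraph} {φ : Γ.Point → Γ'.Point} {K : Set ℕ}
    (h : Dirwise φ K) : IsFiniteMorphism φ :=
  ⟨h.continuous, fun d => (h.mono (K' := {k | 1 ≤ k}) fun _ _ hk => hk).piecewiseDilation d⟩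

theorem IsFiniteMorphism.dirwise {Γ Γ' : MetricGraph} {φ : Γ.Point → Γ'.Point}
    (h : IsFiniteMorphism φ) : Dirwise φ {k | 1 ≤ k} := fun ν => by
  obtain ⟨A, hA⟩ := h.2 ν.dart
  obtain ⟨b, hb, hb', hc⟩ := exists_gap_right A ν.pos_mem.2
  obtain ⟨k, hk, d', c, H⟩ := hA ν.pos b ν.pos_mem.1 hb hb' hc
  have hk' : (1 : ℝ) ≤ k := by exact_mod_cast hk
  have h1 := (H ν.pos ⟨le_rfl, hb.le⟩).1
  have h2 := (H b ⟨hb.le, le_rfl⟩).1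
  rw [sub_self, mul_zero, add_zero] at h1
  refine ⟨⟨d', c, h1.1, by nlinarith [h2.2]⟩, k, hk, hk, b - ν.pos, by linarith,
    fun x hx => ?_⟩
  have := (H (ν.pos + x) ⟨by linarith [hx.1], by linarith [hx.2]⟩).2
  simp only [add_sub_cancel_left] at this
  exact this

theorem Dirwise.comp_mem_rat {Γ Γ' : MetricGraph} {φ : Γ.Point → Γ'.Point} {K : Set ℕ}
    (h : Dirwise φ K) {f : Γ'.Point → ℝ} (hf : f ∈ Γ'.Rat) : f ∘ φ ∈ Γ.Rat :=
  mem_rat_iff.2 fun ν => by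
    obtain ⟨ν', k, _, hk⟩ := h ν
    exact ⟨_, (HasSlope.slope hf ν').comp hk⟩

theorem expansion_eq {Γ Γ' : MetricGraph} {φ : Γ.Point → Γ'.Point} {ν : Γ.Dir}
    {ν' : Γ'.Dir} {k : ℕ} (h : MapsDir φ ν ν' k) : expansion φ ν ν' = k := by
  have hex : ∃ k, MapsDir φ ν ν' k := ⟨k, h⟩
  unfold expansion
  rw [dif_pos hex]
  exact (hex.choose_spec.unique h).2

theorem expansion_ne {Γ Γ' : MetricGraph} {φ : Γ.Point → Γ'.Point} {ν : Γ.Dir}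
    {ν' ν'' : Γ'.Dir} {k : ℕ} (h : MapsDir φ ν ν' k) (hne : ν'' ≠ ν') : expansion φ ν ν'' = 0 := by
  unfold expansion
  rw [dif_neg]
  rintro ⟨k', h'⟩
  exact hne (h'.unique h).1

theorem expansion_pos_iff {Γ Γ' : MetricGraph} {φ : Γ.Point → Γ'.Point} {ν : Γ.Dir}
    {ν' : Γ'.Dir} : expansion φ ν ν' ≠ 0 ↔ MapsDir φ ν ν' (expansion φ ν ν') := by
  refine ⟨fun h => ?_, fun h => Nat.one_le_iff_ne_zero.1 h.1⟩
  have hex : ∃ k, MapsDir φ ν ν' k := by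
    by_contra hc
    exact h (by unfold expansion; rw [dif_neg hc])
  obtain ⟨k, hk⟩ := hex
  rwa [expansion_eq hk]

/-- The order of vanishing of a pullback in terms of local degrees. -/
theorem Dirwise.ord_comp {Γ Γ' : MetricGraph} {φ : Γ.Point → Γ'.Point} {K : Set ℕ}
    (h : Dirwise φ K) {f : Γ'.Point → ℝ} (hf : f ∈ Γ'.Rat) (p : Γ.Point) {m : ℕ}
    (hm : ∀ ν' : Γ'.Dir, ν'.base = φ p → localDegree φ p ν' = m) :
    ord (f ∘ φ) p = m * ord f (φ p) := by
  have := Fintype.ofFinite (Γ.Tangent p)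
  have := Fintype.ofFinite (Γ'.Tangent (φ p))
  unfold ord
  rw [mul_neg, finsum_eq_sum_of_fintype, finsum_eq_sum_of_fintype, Finset.mul_sum]
  congr 1
  have e : ∀ ν' : Γ'.Tangent (φ p), (m : ℤ) * slope f ν'.1 =
      ∑ ν : Γ.Tangent p, (expansion φ ν.1 ν'.1 : ℤ) * slope f ν'.1 := by
    intro ν'
    rw [← hm ν'.1 ν'.2, localDegree, finsum_eq_sum_of_fintype, Nat.cast_sum, Finset.sum_mul]
  rw [Finset.sum_congr rfl fun ν' _ => e ν', Finset.sum_comm]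
  refine Finset.sum_congr rfl fun ν _ => ?_
  obtain ⟨ν', k, _, hk⟩ := h ν.1
  have hb : ν'.base = φ p := by rw [← hk.base, ν.2]
  rw [((HasSlope.slope hf ν').comp hk).slope_eq,
    Finset.sum_eq_single (⟨ν', hb⟩ : Γ'.Tangent (φ p)), expansion_eq hk]
  · intro ν'' _ hne
    rw [expansion_ne hk (fun e => hne (Subtype.ext e)), Nat.cast_zero, zero_mul]
  · exact fun h => absurd (Finset.mem_univ _) h

/-! ## Isometries -/

/-- Isometries of metric graphs. -/
structure IsIso {Γ Γ' : MetricGraph} (i : Γ.Point → Γ'.Point) : Prop where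
  bij : Function.Bijective i
  dirwise : Dirwise i {1}
  cover : ∀ ν', ∃ ν, MapsDir i ν ν' 1

theorem Dirwise.maps_one {Γ Γ' : MetricGraph} {i : Γ.Point → Γ'.Point} (h : Dirwise i {1})
    (ν : Γ.Dir) : ∃ ν', MapsDir i ν ν' 1 := by
  obtain ⟨ν', k, hk, h'⟩ := h ν
  rw [mem_singleton_iff.1 hk] at h'
  exact ⟨ν', h'⟩

theorem MapsDir.injective {Γ Γ' : MetricGraph} {i : Γ.Point → Γ'.Point}
    (hi : Function.Injective i) {ν₁ ν₂ : Γ.Dir} {ν' : Γ'.Dir} (h₁ : MapsDir i ν₁ ν' 1)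
    (h₂ : MapsDir i ν₂ ν' 1) : ν₁ = ν₂ := by
  obtain ⟨_, ε, h0, h⟩ := h₁
  obtain ⟨_, ε', h0', h'⟩ := h₂
  refine (Dir.move_germ_unique le_rfl le_rfl (lt_min h0 h0') fun x hx => hi ?_).1
  rw [Nat.cast_one, one_mul, h x ⟨hx.1, hx.2.trans_le (min_le_left _ _)⟩,
    h' x ⟨hx.1, hx.2.trans_le (min_le_right _ _)⟩]

theorem MapsDir.inverse {Γ Γ' : MetricGraph} {i : Γ.Point → Γ'.Point} {j : Γ'.Point → Γ.Point}
    (hj : ∀ x, j (i x) = x) {ν : Γ.Dir} {ν' : Γ'.Dir} (h : MapsDir i ν ν' 1) :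
    MapsDir j ν' ν 1 := by
  obtain ⟨_, ε, h0, h⟩ := h
  refine ⟨le_rfl, ε, h0, fun x hx => ?_⟩
  have := h x hx
  rw [Nat.cast_one, one_mul] at this ⊢
  rw [← this, hj]

theorem IsIso.inverse {Γ Γ' : MetricGraph} {i : Γ.Point → Γ'.Point} (h : IsIso i)
    {j : Γ'.Point → Γ.Point} (hj : ∀ x, j (i x) = x) (hj' : ∀ y, i (j y) = y) : IsIso j where
  bij := ⟨fun y y' e => by rw [← hj' y, e, hj'], fun x => ⟨i x, hj x⟩⟩
  dirwise ν := by
    obtain ⟨ν', h'⟩ := h.cover ν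
    exact ⟨ν', 1, rfl, h'.inverse hj⟩
  cover ν := by
    obtain ⟨ν', h'⟩ := h.dirwise.maps_one ν
    exact ⟨ν', h'.inverse hj⟩

theorem IsIso.comp {Γ Γ' Γ'' : MetricGraph} {i : Γ.Point → Γ'.Point} {j : Γ'.Point → Γ''.Point}
    (h : IsIso i) (h' : IsIso j) : IsIso (j ∘ i) where
  bij := h'.bij.comp h.bij
  dirwise := h.dirwise.comp h'.dirwise (by simp)
  cover ν := by
    obtain ⟨ν', h1⟩ := h'.cover ν
    obtain ⟨ν'', h2⟩ := h.cover ν'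
    exact ⟨ν'', h2.comp h1⟩

theorem IsIso.isSubgraphEmbedding {Γ Γ' : MetricGraph} {i : Γ.Point → Γ'.Point} (h : IsIso i) :
    IsSubgraphEmbedding i :=
  ⟨h.bij.1, h.dirwise.continuous, fun d => h.dirwise.piecewiseDilation d⟩

theorem IsIso.localDegree {Γ Γ' : MetricGraph} {i : Γ.Point → Γ'.Point} (h : IsIso i)
    (p : Γ.Point) (ν' : Γ'.Dir) (hν : ν'.base = i p) : localDegree i p ν' = 1 := by
  obtain ⟨ν, hm⟩ := h.cover ν'
  have hb : ν.base = p := h.bij.1 (by rw [hm.base, hν])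
  unfold MetricGraph.localDegree
  rw [finsum_eq_single _ (⟨ν, hb⟩ : Γ.Tangent p), expansion_eq hm]
  intro ν₁ hne
  obtain ⟨ν₁', h1⟩ := h.dirwise.maps_one ν₁.1
  refine expansion_ne h1 fun e => hne (Subtype.ext ?_)
  subst e
  exact h1.injective h.bij.1 hm

theorem IsIso.ord_comp {Γ Γ' : MetricGraph} {i : Γ.Point → Γ'.Point} (h : IsIso i)
    {f : Γ'.Point → ℝ} (hf : f ∈ Γ'.Rat) (p : Γ.Point) : ord (f ∘ i) p = ord f (i p) := by
  rw [h.dirwise.ord_comp hf p (m := 1) fun ν' hν => h.localDegree p ν' hν, Nat.cast_one, one_mul]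

theorem IsIso.comp_mem_rat_iff {Γ Γ' : MetricGraph} {i : Γ.Point → Γ'.Point} (h : IsIso i)
    {f : Γ'.Point → ℝ} : f ∘ i ∈ Γ.Rat ↔ f ∈ Γ'.Rat := by
  refine ⟨fun hf => ?_, h.dirwise.comp_mem_rat⟩
  obtain ⟨j, hj, hj'⟩ := Function.bijective_iff_has_inverse.1 h.bij
  have := (h.inverse hj hj').dirwise.comp_mem_rat hf
  have e : (f ∘ i) ∘ j = f := by
    ext x; simp [hj' x]
  rwa [e] at this

end MetricGraph
end

noncomputable section
namespace MetricGraph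

/-! ## Subdivisions -/

/-- The points `u` and `v` are consecutive points of `A` on the oriented edge `d`. -/
structure Consec (Γ : MetricGraph) (A : Set Γ.Point) (u v : Γ.Point) (d : Γ.Dart)
    (a b : ℝ) : Prop where
  nonneg : 0 ≤ a
  lt : a < b
  le_len : b ≤ Γ.edgeLen d
  left : Γ.param d a = u
  right : Γ.param d b = v
  free : ∀ t ∈ Ioo a b, Γ.param d t ∉ A

namespace Consec

variable {Γ : MetricGraph} {A : Set Γ.Point} {u v : Γ.Point} {d : Γ.Dart} {a b : ℝ}

theorem symm (h : Consec Γ A u v d a b) :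
    Consec Γ A v u d.symm (Γ.edgeLen d - b) (Γ.edgeLen d - a) where
  nonneg := by linarith [h.le_len]
  lt := by linarith [h.lt]
  le_len := by rw [edgeLen_symm]; linarith [h.nonneg]
  left := by rw [param_symm _ _ ⟨by linarith [h.nonneg, h.lt], h.le_len⟩, h.right]
  right := by rw [param_symm _ _ ⟨h.nonneg, by linarith [h.le_len, h.lt]⟩, h.left]
  free t ht := by
    have := h.free (Γ.edgeLen d - t) ⟨by linarith [ht.2], by linarith [ht.1]⟩
    rwa [← param_symm _ _ ⟨by linarith [ht.2, h.nonneg], by linarith [ht.1, h.le_len]⟩,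
      sub_sub_cancel] at this

/-- For `0 < a` the point `u` is interior to `d`, so the other edge is `d` or its reversal; the
reversal would put `v` on the wrong side of `u`. -/
theorem unique_left {d' : Γ.Dart} {a' b' : ℝ} (h : Consec Γ A u v d a b)
    (h' : Consec Γ A u v d' a' b') (ha : 0 < a) : d' = d ∧ a' = a ∧ b' = b := by
  have hI : a ∈ Ioo 0 (Γ.edgeLen d) := ⟨ha, by linarith [h.lt, h.le_len]⟩
  have hI' : a' ∈ Icc 0 (Γ.edgeLen d') := ⟨h'.nonneg, by linarith [h'.lt, h'.le_len]⟩
  have hb : b ∈ Icc 0 (Γ.edgeLen d) := ⟨by linarith [h.lt], h.le_len⟩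
  have hb' : b' ∈ Icc 0 (Γ.edgeLen d') := ⟨by linarith [h'.lt, h'.nonneg], h'.le_len⟩
  rcases Γ.param_eq_interior hI hI' (h.left.trans h'.left.symm) with ⟨rfl, e⟩ | ⟨rfl, e⟩
  · exact ⟨rfl, e, Γ.param_injOn _ hb' hb (h'.right.trans h.right.symm)⟩
  · exfalso
    rw [edgeLen_symm] at hb'
    have e1 : Γ.param d (Γ.edgeLen d - b') = Γ.param d b := by
      rw [h.right, ← h'.right, ← param_symm _ d ⟨by linarith [hb'.2], by linarith [hb'.1]⟩,
        sub_sub_cancel]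
    have := Γ.param_injOn d ⟨by linarith [hb'.2], by linarith [hb'.1]⟩ hb e1
    linarith [h.lt, h'.lt]

/-- Needed because the length of an edge of the subdivision is read off from an arbitrary witness.
When the witness is a whole edge of the model, it is unique because the model is a simple graph. -/
theorem unique {d' : Γ.Dart} {a' b' : ℝ} (h : Consec Γ A u v d a b)
    (h' : Consec Γ A u v d' a' b') : d' = d ∧ a' = a ∧ b' = b := by
  rcases h.nonneg.eq_or_lt with ha | ha
  swap
  · exact h.unique_left h' ha
  rcases h.le_len.eq_or_lt with hb | hb
  swap
  · obtain ⟨e1, e2, e3⟩ := h.symm.unique_left h'.symm (by linarith)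
    have e : d' = d := by rw [← SimpleGraph.Dart.symm_symm d', e1, SimpleGraph.Dart.symm_symm]
    subst e
    exact ⟨rfl, by linarith, by linarith⟩
  have hu := h.left
  have hv := h.right
  rw [← ha, param_zero] at hu
  rw [hb, param_len] at hv
  have ha' : a' = 0 := by
    rcases mem_Icc_cases (⟨h'.nonneg, by linarith [h'.lt, h'.le_len]⟩ :
      a' ∈ Icc 0 (Γ.edgeLen d')) with e | e | e
    · exact e
    · linarith [h'.lt, h'.le_len]
    · exact absurd (h'.left.trans hu.symm) (Γ.param_ne_vert _ e _)
  have hb' : b' = Γ.edgeLen d' := by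
    rcases mem_Icc_cases (⟨by linarith [h'.lt], h'.le_len⟩ :
      b' ∈ Icc 0 (Γ.edgeLen d')) with e | e | e
    · linarith [h'.lt]
    · exact e
    · exact absurd (h'.right.trans hv.symm) (Γ.param_ne_vert _ e _)
  have hu' := h'.left
  have hv' := h'.right
  rw [ha', param_zero] at hu'
  rw [hb', param_len] at hv'
  have e : d' = d := SimpleGraph.Dart.ext _ _ (Prod.ext (Γ.vert_injective (hu'.trans hu.symm))
    (Γ.vert_injective (hv'.trans hv.symm)))
  subst e
  exact ⟨rfl, by linarith, by linarith⟩

theorem ne (h : Consec Γ A u v d a b) : u ≠ v := by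
  intro e
  have := Γ.param_injOn d ⟨h.nonneg, by linarith [h.lt, h.le_len]⟩
    ⟨by linarith [h.lt, h.nonneg], h.le_len⟩ (h.left.trans (e.trans h.right.symm))
  linarith [h.lt]

end Consec

theorem finite_param_preimage (Γ : MetricGraph) {A : Set Γ.Point} (hA : A.Finite) (d : Γ.Dart) :
    {t ∈ Icc 0 (Γ.edgeLen d) | Γ.param d t ∈ A}.Finite :=
  Set.Finite.of_finite_image (hA.subset (by rintro _ ⟨t, ht, rfl⟩; exact ht.2))
    ((Γ.param_injOn d).mono fun _ h => h.1)

/-- Each `p` lies between two consecutive points of `A`. -/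
theorem exists_consec (Γ : MetricGraph) {A : Set Γ.Point} (hA : A.Finite)
    (hV : ∀ v, Γ.vert v ∈ A) (d : Γ.Dart) {p : ℝ} (hp : p ∈ Ico 0 (Γ.edgeLen d)) :
    ∃ a b, a ≤ p ∧ p < b ∧ Γ.param d a ∈ A ∧ Γ.param d b ∈ A ∧
      Consec Γ A (Γ.param d a) (Γ.param d b) d a b := by
  have hS := Γ.finite_param_preimage hA d
  have hl := Γ.edgeLen_pos d
  have h0 : (0 : ℝ) ∈ {t ∈ Icc 0 (Γ.edgeLen d) | Γ.param d t ∈ A} ∩ Iic p :=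
    ⟨⟨⟨le_rfl, hl.le⟩, by rw [param_zero]; exact hV _⟩, hp.1⟩
  have h1 : Γ.edgeLen d ∈ {t ∈ Icc 0 (Γ.edgeLen d) | Γ.param d t ∈ A} ∩ Ioi p :=
    ⟨⟨⟨hl.le, le_rfl⟩, by rw [param_len]; exact hV _⟩, hp.2⟩
  obtain ⟨a, ha, ha'⟩ := Set.exists_max_image _ id (hS.inter_of_left (Iic p)) ⟨_, h0⟩
  obtain ⟨b, hb, hb'⟩ := Set.exists_min_image _ id (hS.inter_of_left (Ioi p)) ⟨_, h1⟩
  simp only [id] at ha' hb'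
  have a2 : a ≤ p := ha.2
  have b2 : p < b := hb.2
  refine ⟨a, b, a2, b2, ha.1.2, hb.1.2, ⟨ha.1.1.1, a2.trans_lt b2, hb.1.1.2, rfl, rfl, ?_⟩⟩
  intro t ht htA
  have hI : t ∈ Icc 0 (Γ.edgeLen d) := ⟨ha.1.1.1.trans ht.1.le, ht.2.le.trans hb.1.1.2⟩
  rcases le_or_gt t p with h | h
  · exact absurd ht.1 (not_lt.2 (ha' t ⟨⟨hI, htA⟩, h⟩))
  · exact absurd ht.2 (not_lt.2 (hb' t ⟨⟨hI, htA⟩, h⟩))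

/-- The simple graph on `A` in which consecutive points are adjacent. -/
def subGraph (Γ : MetricGraph) (A : Set Γ.Point) : SimpleGraph A where
  Adj u v := ∃ d a b, Consec Γ A u.1 v.1 d a b
  symm := ⟨fun _ _ ⟨_, _, _, h⟩ => ⟨_, _, _, h.symm⟩⟩
  loopless := ⟨fun _ ⟨_, _, _, h⟩ => h.ne rfl⟩

/-- Induction on the number of points of `A` strictly between the two parameters. -/
theorem subGraph_reachable (Γ : MetricGraph) {A : Set Γ.Point} (hA : A.Finite) (d : Γ.Dart)
    (n : ℕ) : ∀ a b : ℝ, 0 ≤ a → a < b → b ≤ Γ.edgeLen d → ∀ (ha : Γ.param d a ∈ A)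
      (hb : Γ.param d b ∈ A), ({t ∈ Icc 0 (Γ.edgeLen d) | Γ.param d t ∈ A} ∩ Ioo a b).ncard ≤ n →
      (Γ.subGraph A).Reachable ⟨_, ha⟩ ⟨_, hb⟩ := by
  have hS := Γ.finite_param_preimage hA d
  induction n with
  | zero =>
    intro a b h0 hab hl ha hb hn
    have he := (Set.ncard_eq_zero (hS.inter_of_left _)).1 (Nat.le_zero.1 hn)
    refine SimpleGraph.Adj.reachable ⟨d, a, b, h0, hab, hl, rfl, rfl, fun t ht htA => ?_⟩
    have : t ∈ ({t ∈ Icc 0 (Γ.edgeLen d) | Γ.param d t ∈ A} ∩ Ioo a b) :=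
      ⟨⟨⟨h0.trans ht.1.le, ht.2.le.trans hl⟩, htA⟩, ht⟩
    rw [he] at this
    exact this
  | succ n ih =>
    intro a b h0 hab hl ha hb hn
    by_cases he : ({t ∈ Icc 0 (Γ.edgeLen d) | Γ.param d t ∈ A} ∩ Ioo a b) = ∅
    · exact SimpleGraph.Adj.reachable ⟨d, a, b, h0, hab, hl, rfl, rfl, fun t ht htA => by
        have : t ∈ ({t ∈ Icc 0 (Γ.edgeLen d) | Γ.param d t ∈ A} ∩ Ioo a b) :=
          ⟨⟨⟨h0.trans ht.1.le, ht.2.le.trans hl⟩, htA⟩, ht⟩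
        rw [he] at this
        exact this⟩
    · obtain ⟨t, ht⟩ := nonempty_iff_ne_empty.2 he
      have key : ∀ a' b', a ≤ a' → b' ≤ b → t ∉ Ioo a' b' →
          ({t ∈ Icc 0 (Γ.edgeLen d) | Γ.param d t ∈ A} ∩ Ioo a' b').ncard ≤ n := by
        intro a' b' h1 h2 h3
        have : ({t ∈ Icc 0 (Γ.edgeLen d) | Γ.param d t ∈ A} ∩ Ioo a' b').ncard <
            ({t ∈ Icc 0 (Γ.edgeLen d) | Γ.param d t ∈ A} ∩ Ioo a b).ncard := by
          refine Set.ncard_lt_ncard ⟨inter_subset_inter_right _ (Ioo_subset_Ioo h1 h2), ?_⟩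
            (hS.inter_of_left _)
          exact fun hc => h3 (hc ht).2
        omega
      exact (ih a t h0 ht.2.1 ht.1.1.2 ha ht.1.2 (key _ _ le_rfl ht.2.2.le (by simp))).trans
        (ih t b ht.1.1.1 ht.2.2 hl ht.1.2 hb (key _ _ ht.2.1.le le_rfl (by simp)))

theorem subGraph_connected (Γ : MetricGraph) {A : Set Γ.Point} (hA : A.Finite)
    (hV : ∀ v, Γ.vert v ∈ A) : (Γ.subGraph A).Connected := by
  obtain ⟨v₀⟩ : Nonempty Γ.V := inferInstance
  have hd : ∀ (d : Γ.Dart) (t : ℝ) (ht : t ∈ Icc 0 (Γ.edgeLen d)) (hu : Γ.param d t ∈ A),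
      (Γ.subGraph A).Reachable ⟨_, hV d.fst⟩ ⟨_, hu⟩ := by
    intro d t ht hu
    rcases ht.1.eq_or_lt with h | h
    · subst h
      have : (⟨_, hV d.fst⟩ : A) = ⟨_, hu⟩ := Subtype.ext (Γ.param_zero d).symm
      rw [this]
    · have h0 : Γ.param d 0 ∈ A := by rw [param_zero]; exact hV _
      have := Γ.subGraph_reachable hA d _ 0 t le_rfl h ht.2 h0 hu le_rfl
      have e : (⟨_, hV d.fst⟩ : A) = ⟨_, h0⟩ := Subtype.ext (Γ.param_zero d).symm
      rw [e]
      exact this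
  have hv : ∀ v, (Γ.subGraph A).Reachable ⟨_, hV v₀⟩ ⟨_, hV v⟩ := by
    refine Γ.vert_reachable_induction (P := fun v =>
      (Γ.subGraph A).Reachable ⟨_, hV v₀⟩ ⟨_, hV v⟩) (SimpleGraph.Reachable.refl _) ?_
    intro d h
    have h1 : Γ.param d (Γ.edgeLen d) ∈ A := by rw [param_len]; exact hV _
    have e : (⟨_, hV d.snd⟩ : A) = ⟨_, h1⟩ := Subtype.ext (Γ.param_len d).symm
    rw [e]
    exact h.trans (hd d _ ⟨(Γ.edgeLen_pos d).le, le_rfl⟩ h1)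
  have hall : ∀ u : A, (Γ.subGraph A).Reachable ⟨_, hV v₀⟩ u := by
    rintro ⟨u, hu⟩
    obtain ⟨d, t, ht, rfl⟩ := Γ.exists_param u
    exact (hv d.fst).trans (hd d t ht hu)
  have : Nonempty A := ⟨⟨_, hV v₀⟩⟩
  exact ⟨fun u v => (hall u).symm.trans (hall v)⟩

open Classical in
/-- The length of an edge of the subdivision. -/
def subLen (Γ : MetricGraph) (A : Set Γ.Point) (e : Sym2 A) : ℝ :=
  if h : ∃ r : ℝ, ∃ (u v : A) (d : Γ.Dart) (a b : ℝ), e = s(u, v) ∧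
    Consec Γ A u.1 v.1 d a b ∧ r = b - a then h.choose else 1

theorem subLen_eq {Γ : MetricGraph} {A : Set Γ.Point} {u v : A} {d : Γ.Dart} {a b : ℝ}
    (h : Consec Γ A u.1 v.1 d a b) : Γ.subLen A s(u, v) = b - a := by
  have hex : ∃ r : ℝ, ∃ (u' v' : A) (d : Γ.Dart) (a b : ℝ), s(u, v) = s(u', v') ∧
    Consec Γ A u'.1 v'.1 d a b ∧ r = b - a := ⟨_, u, v, d, a, b, rfl, h, rfl⟩
  unfold subLen
  rw [dif_pos hex]
  obtain ⟨u', v', d', a', b', e, h', hr⟩ := hex.choose_spec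
  rw [hr]
  rcases Sym2.eq_iff.1 e with ⟨rfl, rfl⟩ | ⟨rfl, rfl⟩
  · obtain ⟨_, rfl, rfl⟩ := h.unique h'
    rfl
  · obtain ⟨_, e1, e2⟩ := h.symm.unique h'
    linarith

/-- The subdivision of `Γ` with vertex set `A`. -/
def sub (Γ : MetricGraph) (A : Set Γ.Point) (hA : A.Finite) (hV : ∀ v, Γ.vert v ∈ A) :
    MetricGraph where
  V := A
  finV := hA
  nontrivialV := by
    obtain ⟨v, w, h⟩ := exists_pair_ne Γ.V
    exact ⟨⟨_, hV v⟩, ⟨_, hV w⟩, fun e => h (Γ.vert_injective (congrArg Subtype.val e))⟩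
  G := Γ.subGraph A
  connected := Γ.subGraph_connected hA hV
  len := Γ.subLen A
  len_pos e he := by
    induction e with
    | h u v =>
      obtain ⟨d, a, b, h⟩ := he
      rw [subLen_eq h]
      linarith [h.lt]

/-- Each edge of the new model is carried by the isometry `i` onto the part of an old edge starting
at `a`, with no point of `A` in its interior. All changes of model go through this statement. -/
theorem exists_sub (Γ : MetricGraph) (A : Set Γ.Point) (hA : A.Finite)
    (hV : ∀ v, Γ.vert v ∈ A) : ∃ (Γ₁ : MetricGraph) (i : Γ₁.Point → Γ.Point), IsIso i ∧
      (range fun v => i (Γ₁.vert v)) = A ∧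
      ∀ D : Γ₁.Dart, ∃ (d : Γ.Dart) (a : ℝ), 0 ≤ a ∧ a + Γ₁.edgeLen D ≤ Γ.edgeLen d ∧
        (∀ t ∈ Icc 0 (Γ₁.edgeLen D), i (Γ₁.param D t) = Γ.param d (a + t)) ∧
        ∀ t ∈ Ioo 0 (Γ₁.edgeLen D), i (Γ₁.param D t) ∉ A := by
  set Γ₁ := Γ.sub A hA hV with hΓ₁
  have hadj : ∀ D : Γ₁.Dart, ∃ d a b, Consec Γ A (D.fst : A).1 (D.snd : A).1 d a b := fun D => D.adj
  choose δ a b hc using hadj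
  have hlen : ∀ D, Γ₁.edgeLen D = b D - a D := fun D => subLen_eq (hc D)
  have hsymm : ∀ D, δ D.symm = (δ D).symm ∧ a D.symm = Γ.edgeLen (δ D) - b D ∧
      b D.symm = Γ.edgeLen (δ D) - a D := fun D => (hc D).symm.unique (hc D.symm)
  obtain ⟨i, hi⟩ := Γ₁.glue (fun u : A => u.1) (fun D t => Γ.param (δ D) (a D + t))
    (fun D => by rw [add_zero, (hc D).left]) (fun D t ht => by
      obtain ⟨e1, e2, e3⟩ := hsymm D
      rw [hlen] at ht ⊢
      rw [e1, e2, ← param_symm Γ (δ D) (t := a D + t) ⟨by linarith [(hc D).nonneg, ht.1],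
        by linarith [(hc D).le_len, ht.2]⟩]
      congr 1; ring)
  have hvert : ∀ u : A, i (Γ₁.vert u) = u.1 := by
    intro u
    obtain ⟨D, rfl⟩ := Γ₁.exists_dart_fst u
    rw [← param_zero, hi D 0 ⟨le_rfl, (Γ₁.edgeLen_pos D).le⟩, add_zero, (hc D).left]
  have hfree : ∀ D, ∀ t ∈ Ioo 0 (Γ₁.edgeLen D), i (Γ₁.param D t) ∉ A := by
    intro D t ht
    rw [hi D t (Ioo_subset_Icc_self ht)]
    rw [hlen] at ht
    exact (hc D).free _ ⟨by linarith [ht.1], by linarith [ht.2]⟩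
  have hcov : ∀ (d : Γ.Dart) (p : ℝ), p ∈ Ico 0 (Γ.edgeLen d) → ∃ D : Γ₁.Dart, δ D = d ∧
      a D ≤ p ∧ p < b D := by
    intro d p hp
    obtain ⟨a', b', h1, h2, ha, hb, h⟩ := Γ.exists_consec hA hV d hp
    let D : Γ₁.Dart := ⟨((⟨_, ha⟩ : A), (⟨_, hb⟩ : A)), ⟨d, a', b', h⟩⟩
    obtain ⟨e1, e2, e3⟩ := h.unique (hc D)
    exact ⟨D, e1, by rw [e2]; exact h1, by rw [e3]; exact h2⟩
  have hone : ∀ D D' : Γ₁.Dart, ∀ t ∈ Ioo 0 (Γ₁.edgeLen D), ∀ t' ∈ Icc 0 (Γ₁.edgeLen D'),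
      δ D' = δ D → a D' + t' = a D + t → Γ₁.param D t = Γ₁.param D' t' := by
    intro D D' t ht t' ht' e e'
    have hA1 : ∀ D : Γ₁.Dart, Γ.param (δ D) (a D) ∈ A := fun D => by
      rw [(hc D).left]; exact Subtype.mem _
    have hA2 : ∀ D : Γ₁.Dart, Γ.param (δ D) (b D) ∈ A := fun D => by
      rw [(hc D).right]; exact Subtype.mem _
    rw [hlen] at ht ht'
    -- Both new edges are gaps of `A` on the same old edge. Neither contains an end point of the
    -- other in its interior, so gaps that meet at an interior point of one of them coincide.
    have k1 : ¬ (a D' < a D ∧ a D < b D') := fun h => (hc D').free _ h (by rw [e]; exact hA1 D)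
    have k2 : ¬ (a D' < b D ∧ b D < b D') := fun h => (hc D').free _ h (by rw [e]; exact hA2 D)
    have k3 : ¬ (a D < a D' ∧ a D' < b D) := fun h => (hc D).free _ h (by rw [← e]; exact hA1 D')
    have k4 : ¬ (a D < b D' ∧ b D' < b D) := fun h => (hc D).free _ h (by rw [← e]; exact hA2 D')
    simp only [not_and, not_lt] at k1 k2 k3 k4
    obtain ⟨t1, t2⟩ := ht
    obtain ⟨t1', t2'⟩ := ht'
    have ea : a D' = a D := by
      apply le_antisymm
      · by_contra! h
        linarith [k3 h]
      · by_contra! h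
        linarith [k1 h]
    have eb : b D' = b D := by
      apply le_antisymm
      · by_contra! h
        linarith [k2 (by linarith)]
      · by_contra! h
        linarith [k4 (by linarith)]
    have eD : D' = D := by
      refine SimpleGraph.Dart.ext _ _ (Prod.ext (Subtype.ext ?_) (Subtype.ext ?_))
      · have h1 := (hc D').left
        have h2 := (hc D).left
        rw [e, ea] at h1
        exact h1.symm.trans h2
      · have h1 := (hc D').right
        have h2 := (hc D).right
        rw [e, eb] at h1
        exact h1.symm.trans h2
    rw [eD]
    congr 1
    linarith
  have hinj1 : ∀ D D' : Γ₁.Dart, ∀ t ∈ Ioo 0 (Γ₁.edgeLen D), ∀ t' ∈ Icc 0 (Γ₁.edgeLen D'),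
      i (Γ₁.param D t) = i (Γ₁.param D' t') → Γ₁.param D t = Γ₁.param D' t' := by
    intro D D' t ht t' ht' h
    have l1 := hlen D
    have l2 := hlen D'
    have c1 := hc D
    have c2 := hc D'
    rw [hi D t (Ioo_subset_Icc_self ht), hi D' t' ht'] at h
    rcases Γ.param_eq_interior (d := δ D) (d' := δ D') (t := a D + t) (t' := a D' + t')
      ⟨by linarith [ht.1, c1.nonneg], by linarith [ht.2, c1.le_len]⟩
      ⟨by linarith [ht'.1, c2.nonneg], by linarith [ht'.2, c2.le_len]⟩ h with ⟨e, e'⟩ | ⟨e, e'⟩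
    · exact hone D D' t ht t' ht' e e'
    · obtain ⟨e1, e2, e3⟩ := hsymm D'
      have ll : Γ.edgeLen (δ D') = Γ.edgeLen (δ D) := by rw [e, edgeLen_symm]
      rw [← param_symm Γ₁ D' ht']
      refine hone D D'.symm t ht _ ⟨by linarith [ht'.2], by
        rw [edgeLen_symm]; linarith [ht'.1]⟩ (by rw [e1, e, SimpleGraph.Dart.symm_symm]) ?_
      rw [e2]
      linarith
  have hinj : Function.Injective i := by
    intro x x' h
    obtain ⟨D, t, ht, rfl⟩ := Γ₁.exists_param x
    obtain ⟨D', t', ht', rfl⟩ := Γ₁.exists_param x'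
    by_cases h1 : t ∈ Ioo 0 (Γ₁.edgeLen D)
    · exact hinj1 _ _ _ h1 _ ht' h
    by_cases h2 : t' ∈ Ioo 0 (Γ₁.edgeLen D')
    · exact (hinj1 _ _ _ h2 _ ht h.symm).symm
    have hv : ∀ (D : Γ₁.Dart) (t : ℝ), t ∈ Icc 0 (Γ₁.edgeLen D) → t ∉ Ioo 0 (Γ₁.edgeLen D) →
        ∃ u : Γ₁.V, Γ₁.param D t = Γ₁.vert u := by
      intro D t ht h
      rcases mem_Icc_cases ht with e | e | e
      · exact ⟨_, by rw [e, param_zero]⟩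
      · exact ⟨_, by rw [e, param_len]⟩
      · exact absurd e h
    obtain ⟨u, hu⟩ := hv D t ht h1
    obtain ⟨u', hu'⟩ := hv D' t' ht' h2
    rw [hu, hu'] at h ⊢
    rw [hvert u, hvert u'] at h
    rw [show u = u' from Subtype.ext h]
  refine ⟨Γ₁, i, ⟨⟨hinj, ?_⟩, ?_, ?_⟩, ?_, fun D => ⟨δ D, a D, (hc D).nonneg, ?_, hi D, hfree D⟩⟩
  · intro x
    obtain ⟨d, p, hp, rfl⟩ := Γ.exists_param_Ico x
    obtain ⟨D, rfl, h1, h2⟩ := hcov d p hp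
    refine ⟨Γ₁.param D (p - a D), ?_⟩
    rw [hi D _ ⟨by linarith, by rw [hlen]; linarith⟩]
    congr 1; ring
  · intro ν
    have l1 := hlen ν.dart
    refine ⟨⟨δ ν.dart, a ν.dart + ν.pos, by linarith [(hc ν.dart).nonneg, ν.pos_mem.1],
      by linarith [(hc ν.dart).le_len, ν.pos_mem.2]⟩, 1, rfl, le_rfl,
      Γ₁.edgeLen ν.dart - ν.pos, by linarith [ν.pos_mem.2], fun h hh => ?_⟩
    change i (Γ₁.param ν.dart (ν.pos + h)) =
      Γ.param (δ ν.dart) (a ν.dart + ν.pos + (1 : ℕ) * h)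
    rw [hi _ _ ⟨by linarith [ν.pos_mem.1, hh.1], by linarith [hh.2]⟩,
      Nat.cast_one, one_mul, add_assoc]
  · intro ν'
    obtain ⟨D, e, h1, h2⟩ := hcov ν'.dart ν'.pos ν'.pos_mem
    have l1 := hlen D
    refine ⟨⟨D, ν'.pos - a D, by linarith, by linarith⟩, le_rfl, b D - ν'.pos, by linarith,
      fun h hh => ?_⟩
    rw [Dir.move, hi _ _ ⟨by linarith [hh.1], by linarith [hh.2]⟩, Dir.move, e, Nat.cast_one,
      one_mul]
    congr 1
    ring
  · ext x
    constructor
    · rintro ⟨u, rfl⟩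
      change i (Γ₁.vert u) ∈ A
      rw [hvert u]
      exact (show A from u).2
    · intro hx
      exact ⟨(⟨x, hx⟩ : A), hvert _⟩
  · rw [hlen]
    linarith [(hc D).le_len]

end MetricGraph
end

noncomputable section
namespace MetricGraph

/-! ## Edgewise affine functions and Green's identity -/

theorem finsum_comp_injective {α β M : Type*} [AddCommMonoid M] {g : α → β}
    (hg : Function.Injective g) {h : β → M} (hs : ∀ x, h x ≠ 0 → x ∈ range g) :
    ∑ᶠ x, h x = ∑ᶠ a, h (g a) := by
  rw [← finsum_mem_range hg, ← finsum_mem_univ]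
  exact (finsum_mem_inter_support_eq' h _ _ fun x hx => by simp [hs x hx])

/-- The function `F` is affine with integral slope on each edge. -/
def EdgeAffine {Γ : MetricGraph} (F : Γ.Point → ℝ) : Prop :=
  ∀ d : Γ.Dart, ∃ k : ℤ, ∀ t ∈ Icc 0 (Γ.edgeLen d), F (Γ.param d t) = F (Γ.vert d.fst) + k * t

/-- The slope of `F` along `d`, if `F` is edgewise affine. -/
def edgeSlope {Γ : MetricGraph} (F : Γ.Point → ℝ) (d : Γ.Dart) : ℝ :=
  (F (Γ.vert d.snd) - F (Γ.vert d.fst)) / Γ.edgeLen d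

theorem edgeSlope_symm {Γ : MetricGraph} (F : Γ.Point → ℝ) (d : Γ.Dart) :
    edgeSlope F d.symm = - edgeSlope F d := by
  change (F (Γ.vert d.fst) - F (Γ.vert d.snd)) / Γ.edgeLen d.symm = _
  rw [edgeLen_symm, edgeSlope, ← neg_div, neg_sub]

theorem EdgeAffine.exists_slope {Γ : MetricGraph} {F : Γ.Point → ℝ} (hF : EdgeAffine F)
    (d : Γ.Dart) : ∃ k : ℤ, (k : ℝ) = edgeSlope F d ∧
      (∀ t ∈ Icc 0 (Γ.edgeLen d), F (Γ.param d t) = F (Γ.vert d.fst) + k * t) ∧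
      ∀ ν : Γ.Dir, ν.dart = d → HasSlope F ν k := by
  obtain ⟨k, hk⟩ := hF d
  refine ⟨k, ?_, hk, ?_⟩
  · have := hk _ ⟨(Γ.edgeLen_pos d).le, le_rfl⟩
    rw [param_len] at this
    rw [edgeSlope, this]
    have := (Γ.edgeLen_pos d).ne'
    field_simp
    ring
  · rintro ν rfl
    refine ⟨Γ.edgeLen ν.dart - ν.pos, by linarith [ν.pos_mem.2], fun h hh => ?_⟩
    rw [Dir.move, Dir.base, hk _ ν.pos_mem_Icc, hk _ ⟨by linarith [ν.pos_mem.1, hh.1],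
      by linarith [hh.2]⟩]
    ring

theorem EdgeAffine.mem_rat {Γ : MetricGraph} {F : Γ.Point → ℝ} (hF : EdgeAffine F) :
    F ∈ Γ.Rat := mem_rat_iff.2 fun ν => by
  obtain ⟨k, _, _, h⟩ := hF.exists_slope ν.dart
  exact ⟨k, h ν rfl⟩

theorem EdgeAffine.slope_eq {Γ : MetricGraph} {F : Γ.Point → ℝ} (hF : EdgeAffine F)
    (ν : Γ.Dir) : (slope F ν : ℝ) = edgeSlope F ν.dart := by
  obtain ⟨k, h1, _, h⟩ := hF.exists_slope ν.dart
  rw [(h ν rfl).slope_eq, h1]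

theorem point_cases (Γ : MetricGraph) (x : Γ.Point) : (∃ v, x = Γ.vert v) ∨
    ∃ d : Γ.Dart, ∃ t ∈ Ioo 0 (Γ.edgeLen d), x = Γ.param d t := by
  obtain ⟨d, t, ht, rfl⟩ := Γ.exists_param x
  rcases mem_Icc_cases ht with rfl | rfl | h
  · exact Or.inl ⟨_, Γ.param_zero d⟩
  · exact Or.inl ⟨_, Γ.param_len d⟩
  · exact Or.inr ⟨d, t, h, rfl⟩

theorem ord_interior {Γ : MetricGraph} {F : Γ.Point → ℝ} {d : Γ.Dart} {t : ℝ}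
    (ht : t ∈ Ioo 0 (Γ.edgeLen d)) : ord F (Γ.param d t) =
      -(slope F ⟨d, t, ⟨ht.1.le, ht.2⟩⟩ + slope F (Γ.backDir d t ⟨ht.1, ht.2.le⟩)) := by
  unfold ord
  rw [finsum_tangent_interior (h := fun ν => slope F ν) ⟨ht.1.le, ht.2⟩
    (Γ.backDir d t ⟨ht.1, ht.2.le⟩).pos_mem]
  rfl

theorem EdgeAffine.ord_eq_zero {Γ : MetricGraph} {F : Γ.Point → ℝ} (hF : EdgeAffine F)
    {x : Γ.Point} (hx : x ∉ range Γ.vert) : ord F x = 0 := by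
  rcases Γ.point_cases x with ⟨v, rfl⟩ | ⟨d, t, ht, rfl⟩
  · exact absurd (mem_range_self v) hx
  · have h : (ord F (Γ.param d t) : ℝ) = 0 := by
      rw [ord_interior ht, Int.cast_neg, Int.cast_add, hF.slope_eq, hF.slope_eq]
      simp only [backDir, edgeSlope_symm]
      ring
    exact_mod_cast h

/-- Summation by parts: `ord G` lives on the vertices, and each edge is counted with its two
orientations, whence the factor one half. The right side is symmetric in the vertex values of `F`
and `G`, which is Green's identity. -/
theorem EdgeAffine.finsum_mul_ord {Γ : MetricGraph} {G : Γ.Point → ℝ} (hG : EdgeAffine G)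
    (F : Γ.Point → ℝ) : ∑ᶠ x, F x * (ord G x : ℝ) =
      2⁻¹ * ∑ᶠ d : Γ.Dart, (F (Γ.vert d.snd) - F (Γ.vert d.fst)) * edgeSlope G d := by
  classical
  have := Fintype.ofFinite Γ.V
  have := Fintype.ofFinite Γ.Dart
  rw [finsum_comp_injective Γ.vert_injective (fun x hx => by
    by_contra hc
    exact hx (by rw [hG.ord_eq_zero hc]; simp)), finsum_eq_sum_of_fintype,
    finsum_eq_sum_of_fintype]
  have h1 : ∀ v, F (Γ.vert v) * (ord G (Γ.vert v) : ℝ) =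
      ∑ d : {d : Γ.Dart // d.fst = v}, -(F (Γ.vert d.1.fst) * edgeSlope G d.1) := by
    intro v
    unfold ord
    rw [finsum_tangent_vert v (fun ν => MetricGraph.slope G ν), finsum_eq_sum_of_fintype, Int.cast_neg,
      Int.cast_sum, Finset.sum_neg_distrib, mul_neg, Finset.mul_sum]
    congr 1
    refine Finset.sum_congr rfl fun d _ => ?_
    rw [hG.slope_eq, d.2]
    rfl
  rw [Finset.sum_congr rfl fun v _ => h1 v]
  have h2 : ∑ v, ∑ d : {d : Γ.Dart // d.fst = v}, -(F (Γ.vert d.1.fst) * edgeSlope G d.1) =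
      ∑ d : Γ.Dart, -(F (Γ.vert d.fst) * edgeSlope G d) := by
    rw [← Fintype.sum_equiv (Equiv.sigmaFiberEquiv fun d : Γ.Dart => d.fst)
      (fun p => -(F (Γ.vert p.2.1.fst) * edgeSlope G p.2.1)) _ (fun p => rfl), Fintype.sum_sigma]
  rw [h2]
  have h3 : ∑ d : Γ.Dart, F (Γ.vert d.fst) * edgeSlope G d =
      ∑ d : Γ.Dart, -(F (Γ.vert d.snd) * edgeSlope G d) := by
    rw [← Equiv.sum_comp (Equiv.mk (SimpleGraph.Dart.symm (G := Γ.G)) SimpleGraph.Dart.symm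
      SimpleGraph.Dart.symm_symm SimpleGraph.Dart.symm_symm)]
    refine Finset.sum_congr rfl fun d _ => ?_
    simp only [Equiv.coe_fn_mk, edgeSlope_symm]
    rw [mul_neg]
    rfl
  simp only [sub_mul, Finset.sum_sub_distrib]
  rw [Finset.sum_neg_distrib] at h3 ⊢
  linarith

/-- The model is cut at the breakpoints of both functions and at the points of `B`. -/
theorem exists_model {Γ : MetricGraph} {f g : Γ.Point → ℝ} (hf : f ∈ Γ.Rat) (hg : g ∈ Γ.Rat)
    {B : Set Γ.Point} (hB : B.Finite) : ∃ (Γ₁ : MetricGraph) (i : Γ₁.Point → Γ.Point), IsIso i ∧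
      (∀ x ∈ B, ∃ v, i (Γ₁.vert v) = x) ∧ EdgeAffine (f ∘ i) ∧ EdgeAffine (g ∘ i) := by
  choose A hA using hf
  choose A' hA' using hg
  have hfin : (range Γ.vert ∪ B ∪ ⋃ d, (Γ.param d '' (A d : Set ℝ) ∪
      Γ.param d '' (A' d : Set ℝ))).Finite := by
    refine ((Set.finite_range _).union hB).union (Set.finite_iUnion fun d => ?_)
    exact ((A d).finite_toSet.image _).union ((A' d).finite_toSet.image _)
  obtain ⟨Γ₁, i, hi, hr, hd⟩ := Γ.exists_sub _ hfin (fun v => Or.inl (Or.inl ⟨v, rfl⟩))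
  refine ⟨Γ₁, i, hi, fun x hx => ?_, fun D => ?_, fun D => ?_⟩
  · have : x ∈ range fun v => i (Γ₁.vert v) := by rw [hr]; exact Or.inl (Or.inr hx)
    exact this
  · obtain ⟨d, a, h0, h1, h2, h3⟩ := hd D
    have hl := Γ₁.edgeLen_pos D
    obtain ⟨k, hk⟩ := hA d a (a + Γ₁.edgeLen D) h0 (by linarith) h1 fun c hc hcm => by
      refine h3 (c - a) ⟨by linarith [hcm.1], by linarith [hcm.2]⟩ (Or.inr (mem_iUnion.2 ⟨d, Or.inl ?_⟩))
      rw [h2 _ ⟨by linarith [hcm.1], by linarith [hcm.2]⟩, add_sub_cancel]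
      exact ⟨c, hc, rfl⟩
    refine ⟨k, fun t ht => ?_⟩
    rw [← param_zero, Function.comp, Function.comp, h2 t ht, h2 0 ⟨le_rfl, hl.le⟩,
      hk _ ⟨by linarith [ht.1], by linarith [ht.2]⟩, add_zero, add_sub_cancel_left]
  · obtain ⟨d, a, h0, h1, h2, h3⟩ := hd D
    have hl := Γ₁.edgeLen_pos D
    obtain ⟨k, hk⟩ := hA' d a (a + Γ₁.edgeLen D) h0 (by linarith) h1 fun c hc hcm => by
      refine h3 (c - a) ⟨by linarith [hcm.1], by linarith [hcm.2]⟩ (Or.inr (mem_iUnion.2 ⟨d, Or.inr ?_⟩))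
      rw [h2 _ ⟨by linarith [hcm.1], by linarith [hcm.2]⟩, add_sub_cancel]
      exact ⟨c, hc, rfl⟩
    refine ⟨k, fun t ht => ?_⟩
    rw [← param_zero, Function.comp, Function.comp, h2 t ht, h2 0 ⟨le_rfl, hl.le⟩,
      hk _ ⟨by linarith [ht.1], by linarith [ht.2]⟩, add_zero, add_sub_cancel_left]

theorem ord_support_finite {Γ : MetricGraph} {f : Γ.Point → ℝ} (hf : f ∈ Γ.Rat) :
    {x | ord f x ≠ 0}.Finite := by
  obtain ⟨Γ₁, i, hi, _, h, _⟩ := exists_model hf hf Set.finite_empty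
  refine (Set.finite_range fun v => i (Γ₁.vert v)).subset fun x hx => ?_
  obtain ⟨y, rfl⟩ := hi.bij.2 x
  by_contra hc
  refine hx ?_
  rw [← hi.ord_comp hf, h.ord_eq_zero]
  rintro ⟨v, rfl⟩
  exact hc ⟨v, rfl⟩

theorem IsIso.finsum_mul_ord {Γ Γ₁ : MetricGraph} {i : Γ₁.Point → Γ.Point} (hi : IsIso i)
    {g : Γ.Point → ℝ} (hg : g ∈ Γ.Rat) (F : Γ.Point → ℝ) :
    ∑ᶠ x, F x * (ord g x : ℝ) = ∑ᶠ y, (F ∘ i) y * (ord (g ∘ i) y : ℝ) := by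
  refine (finsum_eq_of_bijective i hi.bij fun y => ?_).symm
  rw [hi.ord_comp hg]
  rfl

/-- Green's identity. -/
theorem green {Γ : MetricGraph} {f g : Γ.Point → ℝ} (hf : f ∈ Γ.Rat) (hg : g ∈ Γ.Rat) :
    ∑ᶠ x, f x * (ord g x : ℝ) = ∑ᶠ x, g x * (ord f x : ℝ) := by
  obtain ⟨Γ₁, i, hi, _, h1, h2⟩ := exists_model hf hg Set.finite_empty
  rw [hi.finsum_mul_ord hg, hi.finsum_mul_ord hf, h1.finsum_mul_ord, h2.finsum_mul_ord]
  congr 1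
  refine finsum_congr fun d => ?_
  unfold edgeSlope
  ring

/-- Green's identity against the constant `1`. -/
theorem finsum_ord {Γ : MetricGraph} {f : Γ.Point → ℝ} (hf : f ∈ Γ.Rat) :
    ∑ᶠ x, ord f x = 0 := by
  have h := green (const_mem_rat (Γ := Γ) 1) hf
  have h2 : ∑ᶠ x, f x * (ord (fun _ : Γ.Point => (1 : ℝ)) x : ℝ) = 0 := by
    simp [ord_const]
  rw [h2] at h
  simp only [one_mul] at h
  have := (Int.castAddHom ℝ).map_finsum (f := fun x => ord f x) (ord_support_finite hf)
  simp only [Int.coe_castAddHom] at this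
  rw [h] at this
  exact_mod_cast this

theorem finsum_nonneg_of {α : Type*} {f : α → ℝ} (h : ∀ a, 0 ≤ f a) : 0 ≤ ∑ᶠ a, f a :=
  finsum_nonneg h

theorem EdgeAffine.eq_const {Γ : MetricGraph} {F : Γ.Point → ℝ} (hF : EdgeAffine F)
    (h : ∀ d : Γ.Dart, F (Γ.vert d.fst) = F (Γ.vert d.snd)) (x y : Γ.Point) : F x = F y := by
  obtain ⟨v₀⟩ : Nonempty Γ.V := inferInstance
  have hv : ∀ v, F (Γ.vert v) = F (Γ.vert v₀) :=
    Γ.vert_reachable_induction (P := fun v => F (Γ.vert v) = F (Γ.vert v₀)) (v₀ := v₀) rfl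
      fun d hd => by rw [← h d, hd]
  have : ∀ x, F x = F (Γ.vert v₀) := by
    intro x
    obtain ⟨d, t, ht, rfl⟩ := Γ.exists_param x
    obtain ⟨k, hk, hk', _⟩ := hF.exists_slope d
    rw [hk' t ht, hk, edgeSlope, h d, sub_self, zero_div, zero_mul, add_zero, hv]
  rw [this x, this y]

/-- A rational function which is superharmonic away from `m` has its minimum at `m`. -/
theorem min_principle {Γ : MetricGraph} {f : Γ.Point → ℝ} (hf : f ∈ Γ.Rat) {m : Γ.Point}
    (h : ∀ x, x ≠ m → 0 ≤ ord f x) (x : Γ.Point) : f m ≤ f x := by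
  -- The pairing of `u` with `div f` is at most `0`, as `u` vanishes at `m` and is nonpositive where
  -- `ord f` is nonnegative. Summation by parts writes the pairing as a sum whose terms, times the
  -- edge lengths, dominate the squares of the increments of `u`; hence `u` is constant.
  set u : Γ.Point → ℝ := fun x => min (f x + -f m) 0 with hu
  have hur : u ∈ Γ.Rat := min_mem_rat (add_const_mem_rat hf _) (const_mem_rat 0)
  obtain ⟨Γ₁, i, hi, _, h1, h2⟩ := exists_model hf hur Set.finite_empty
  have hle : ∑ᶠ x, u x * (ord f x : ℝ) ≤ 0 := by
    have : 0 ≤ ∑ᶠ x, -(u x * (ord f x : ℝ)) := by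
      refine finsum_nonneg_of fun x => ?_
      by_cases hx : x = m
      · rw [hx]; simp [hu]
      · have a1 : (0 : ℝ) ≤ ord f x := by exact_mod_cast h x hx
        have a2 : u x ≤ 0 := min_le_right _ _
        nlinarith
    rw [finsum_neg_distrib] at this
    linarith
  rw [hi.finsum_mul_ord hf, h1.finsum_mul_ord] at hle
  have := Fintype.ofFinite Γ₁.Dart
  rw [finsum_eq_sum_of_fintype] at hle
  have hterm : ∀ d : Γ₁.Dart, ((u ∘ i) (Γ₁.vert d.snd) - (u ∘ i) (Γ₁.vert d.fst)) ^ 2 ≤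
      (((u ∘ i) (Γ₁.vert d.snd) - (u ∘ i) (Γ₁.vert d.fst)) * edgeSlope (f ∘ i) d) *
        Γ₁.edgeLen d := by
    intro d
    have hl := (Γ₁.edgeLen_pos d).ne'
    rw [mul_assoc, edgeSlope, div_mul_cancel₀ _ hl, sq]
    simp only [Function.comp, hu]
    generalize f (i (Γ₁.vert d.snd)) = p
    generalize f (i (Γ₁.vert d.fst)) = q
    generalize f m = c
    rcases le_total (p + -c) 0 with h1 | h1 <;> rcases le_total (q + -c) 0 with h2 | h2 <;>
      simp only [min_eq_left h1, min_eq_right h1, min_eq_left h2, min_eq_right h2] <;> nlinarith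
  have hnn : ∀ d : Γ₁.Dart, 0 ≤
      ((u ∘ i) (Γ₁.vert d.snd) - (u ∘ i) (Γ₁.vert d.fst)) * edgeSlope (f ∘ i) d := fun d =>
    nonneg_of_mul_nonneg_left ((sq_nonneg _).trans (hterm d)) (Γ₁.edgeLen_pos d)
  have hz := (Finset.sum_eq_zero_iff_of_nonneg fun d _ => hnn d).1
    (le_antisymm (by linarith) (Finset.sum_nonneg fun d _ => hnn d))
  have hc : ∀ d : Γ₁.Dart, (u ∘ i) (Γ₁.vert d.fst) = (u ∘ i) (Γ₁.vert d.snd) := by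
    intro d
    have := hterm d
    rw [hz d (Finset.mem_univ d), zero_mul] at this
    have := pow_eq_zero_iff (two_ne_zero) |>.1 (le_antisymm this (sq_nonneg _))
    linarith
  obtain ⟨y, rfl⟩ := hi.bij.2 x
  obtain ⟨z, hz'⟩ := hi.bij.2 m
  have e := h2.eq_const hc y z
  simp only [Function.comp, hz'] at e
  have e0 : u m = 0 := by simp [hu]
  rw [e0] at e
  have : u (i y) ≤ f (i y) + -f m := min_le_left _ _
  linarith

theorem eq_of_ord_eq_zero {Γ : MetricGraph} {f : Γ.Point → ℝ} (hf : f ∈ Γ.Rat)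
    (h : ∀ x, ord f x = 0) (x y : Γ.Point) : f x = f y :=
  le_antisymm (min_principle hf (fun z _ => (h z).ge) y) (min_principle hf (fun z _ => (h z).ge) x)

theorem eq_add_of_ord_eq {Γ : MetricGraph} {f g : Γ.Point → ℝ} (hf : f ∈ Γ.Rat) (hg : g ∈ Γ.Rat)
    (h : ∀ x, ord f x = ord g x) (z : Γ.Point) : f = fun x => g x + (f z - g z) := by
  ext x
  have := eq_of_ord_eq_zero (sub_mem_rat hf hg) (fun x => by rw [ord_sub hf hg, h, sub_self]) x z
  simp only [Pi.sub_apply] at this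
  linarith

/-- `div(f) = (x) - (y)`. -/
def IsDiv {Γ : MetricGraph} (f : Γ.Point → ℝ) (x y : Γ.Point) : Prop :=
  f ∈ Γ.Rat ∧ ∀ z, ord f z = Finsupp.single x (1 : ℤ) z - Finsupp.single y (1 : ℤ) z

theorem finsum_mul_single {X : Type*} (F : X → ℝ) (x : X) :
    ∑ᶠ z, F z * ((Finsupp.single x (1 : ℤ) z : ℤ) : ℝ) = F x := by
  classical
  rw [finsum_eq_single _ x]
  · simp
  · intro z hz
    rw [Finsupp.single_eq_of_ne hz]; simp

theorem IsDiv.pairing {Γ : MetricGraph} {f : Γ.Point → ℝ} {x y : Γ.Point} (h : IsDiv f x y)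
    (F : Γ.Point → ℝ) : ∑ᶠ z, F z * (ord f z : ℝ) = F x - F y := by
  have e : ∀ z, F z * (ord f z : ℝ) = F z * ((Finsupp.single x (1 : ℤ) z : ℤ) : ℝ) -
      F z * ((Finsupp.single y (1 : ℤ) z : ℤ) : ℝ) := fun z => by
    rw [h.2 z]; push_cast; ring
  rw [finsum_congr e, finsum_sub_distrib, finsum_mul_single, finsum_mul_single]
  · refine (Set.finite_singleton x).subset fun z hz => ?_
    by_contra hc
    exact hz (by simp only; rw [Finsupp.single_eq_of_ne hc]; simp)
  · refine (Set.finite_singleton y).subset fun z hz => ?_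
    by_contra hc
    exact hz (by simp only; rw [Finsupp.single_eq_of_ne hc]; simp)

theorem IsDiv.neg {Γ : MetricGraph} {f : Γ.Point → ℝ} {x y : Γ.Point} (h : IsDiv f x y) :
    IsDiv (-f) y x :=
  ⟨neg_mem_rat h.1, fun z => by rw [ord_neg h.1, h.2]; ring⟩

theorem IsDiv.add {Γ : MetricGraph} {f g : Γ.Point → ℝ} {x y z : Γ.Point} (h : IsDiv f x y)
    (h' : IsDiv g y z) : IsDiv (f + g) x z :=
  ⟨add_mem_rat h.1 h'.1, fun w => by rw [ord_add h.1 h'.1, h.2, h'.2]; ring⟩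

/-- The reciprocity law behind all computations on trees: the increment of `f` between `z` and `w`
is the increment of a function with divisor `(z) - (w)` between the points of `div f`. -/
theorem IsDiv.green {Γ : MetricGraph} {f g : Γ.Point → ℝ} {x y z w : Γ.Point} (h : IsDiv f x y)
    (h' : IsDiv g z w) : f z - f w = g x - g y := by
  rw [← h'.pairing f, ← h.pairing g, MetricGraph.green h.1 h'.1]

theorem IsDiv.min_le {Γ : MetricGraph} {f : Γ.Point → ℝ} {x y : Γ.Point} (h : IsDiv f x y)
    (z : Γ.Point) : f y ≤ f z := by
  classical
  refine min_principle h.1 (fun w hw => ?_) z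
  rw [h.2, Finsupp.single_eq_of_ne hw, sub_zero, Finsupp.single_apply]
  split_ifs <;> simp

end MetricGraph
end

noncomputable section
namespace MetricGraph

/-! ## Metric trees -/

theorem dart_eq_or_symm_of_edge {Γ : MetricGraph} {d d' : Γ.Dart} (h : d'.edge = d.edge) :
    d' = d ∨ d' = d.symm := SimpleGraph.dart_edge_eq_iff d' d |>.1 h

theorem IsTree.not_reachable {T : MetricGraph} (hT : T.IsTree) (d : T.Dart) :
    ¬ (T.G.deleteEdges {d.edge}).Reachable d.fst d.snd :=
  SimpleGraph.isBridge_iff.1 (SimpleGraph.isAcyclic_iff_forall_isBridge.1 hT.isAcyclic d.edge_mem)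

/-- Every edge of a tree is a bridge: the value is `0` on the component of the tail of `d` and the
length of `d` on the other one. -/
theorem IsTree.exists_cutFun {T : MetricGraph} (hT : T.IsTree) (d : T.Dart) :
    ∃ F : T.Point → ℝ, (∀ t ∈ Icc 0 (T.edgeLen d), F (T.param d t) = t) ∧
      (∀ d' : T.Dart, d' ≠ d → d' ≠ d.symm → ∀ t ∈ Icc 0 (T.edgeLen d'),
        F (T.param d' t) = F (T.vert d'.fst)) ∧
      ∀ v, F (T.vert v) = 0 ∨ F (T.vert v) = T.edgeLen d := by
  classical
  set fV : T.V → ℝ := fun v =>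
    if (T.G.deleteEdges {d.edge}).Reachable d.snd v then T.edgeLen d else 0 with hfV
  have hfst : fV d.fst = 0 := if_neg fun h => hT.not_reachable d h.symm
  have hsnd : fV d.snd = T.edgeLen d := if_pos (SimpleGraph.Reachable.refl _)
  have hother : ∀ d' : T.Dart, d' ≠ d → d' ≠ d.symm → fV d'.fst = fV d'.snd := by
    intro d' h1 h2
    have hadj : (T.G.deleteEdges {d.edge}).Adj d'.fst d'.snd := by
      rw [SimpleGraph.deleteEdges_adj]
      refine ⟨d'.adj, fun hc => ?_⟩
      rcases dart_eq_or_symm_of_edge (mem_singleton_iff.1 hc) with h | h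
      · exact h1 h
      · exact h2 h
    simp only [hfV]
    exact if_congr ⟨fun h => h.trans hadj.reachable, fun h => h.trans hadj.symm.reachable⟩ rfl rfl
  have hne := dart_symm_ne d
  obtain ⟨F, hF⟩ := T.glue fV (fun d' t => if d' = d then t else if d' = d.symm then
      T.edgeLen d - t else fV d'.fst) (fun d' => by
    by_cases h : d' = d
    · subst h; simp [hfst]
    · by_cases h' : d' = d.symm
      · subst h'
        simp only [if_neg h, if_true]
        rw [sub_zero, ← hsnd]; rfl
      · simp [h, h']) (fun d' t ht => by
    by_cases h : d' = d
    · subst h; simp [hne]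
    · by_cases h' : d' = d.symm
      · subst h'
        simp only [if_neg h, SimpleGraph.Dart.symm_symm, if_true]
        rw [edgeLen_symm]
      · have k1 : d'.symm ≠ d := fun e => h' (by rw [← e, SimpleGraph.Dart.symm_symm])
        have k2 : d'.symm ≠ d.symm := fun e => h (by
          rw [← SimpleGraph.Dart.symm_symm d', e, SimpleGraph.Dart.symm_symm])
        simp only [h, h', k1, k2, if_false]
        exact (hother d' h h').symm)
  refine ⟨F, fun t ht => by rw [hF d t ht, if_pos rfl], fun d' h h' t ht => ?_, fun v => ?_⟩
  · rw [hF d' t ht, ← param_zero, hF d' 0 ⟨le_rfl, (T.edgeLen_pos d').le⟩]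
    simp [h, h']
  · obtain ⟨d', rfl⟩ := T.exists_dart_fst v
    rw [← param_zero, hF d' 0 ⟨le_rfl, (T.edgeLen_pos d').le⟩]
    by_cases h : d' = d
    · exact Or.inl (if_pos h)
    · by_cases h' : d' = d.symm
      · exact Or.inr (by simp [h', hne])
      · simp only [if_neg h, if_neg h', hfV]
        by_cases h'' : (T.G.deleteEdges {d.edge}).Reachable d.snd d'.fst
        · exact Or.inr (if_pos h'')
        · exact Or.inl (if_neg h'')

/-- The function which is the arc length along `d` and which is constant on each of the two
components of the complement of the edge `d`. -/
def IsTree.cutFun {T : MetricGraph} (hT : T.IsTree) (d : T.Dart) : T.Point → ℝ :=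
  (hT.exists_cutFun d).choose

theorem IsTree.cutFun_param {T : MetricGraph} (hT : T.IsTree) (d : T.Dart) {t : ℝ}
    (ht : t ∈ Icc 0 (T.edgeLen d)) : hT.cutFun d (T.param d t) = t :=
  (hT.exists_cutFun d).choose_spec.1 t ht

theorem IsTree.cutFun_other {T : MetricGraph} (hT : T.IsTree) {d d' : T.Dart} (h : d' ≠ d)
    (h' : d' ≠ d.symm) {t : ℝ} (ht : t ∈ Icc 0 (T.edgeLen d')) :
    hT.cutFun d (T.param d' t) = hT.cutFun d (T.vert d'.fst) :=
  (hT.exists_cutFun d).choose_spec.2.1 d' h h' t ht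

theorem IsTree.eq_param_cutFun {T : MetricGraph} (hT : T.IsTree) (d : T.Dart) {x : T.Point}
    (hx : hT.cutFun d x ∈ Ioo 0 (T.edgeLen d)) : x = T.param d (hT.cutFun d x) := by
  have hv := (hT.exists_cutFun d).choose_spec.2.2
  have hv' : ∀ v, hT.cutFun d (T.vert v) ∉ Ioo 0 (T.edgeLen d) := fun v hv' => by
    rcases hv v with h | h
    · exact hv'.1.ne' h
    · exact hv'.2.ne h
  obtain ⟨d', t, ht, rfl⟩ := T.exists_param x
  by_cases h : d' = d
  · subst h; rw [hT.cutFun_param d' ht]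
  · by_cases h' : d'.symm = d
    · subst h'
      have ht' : T.edgeLen d' - t ∈ Icc 0 (T.edgeLen d'.symm) := by
        rw [edgeLen_symm]; exact ⟨by linarith [ht.2], by linarith [ht.1]⟩
      rw [← param_symm T d' ht, hT.cutFun_param _ ht']
    · rw [hT.cutFun_other h (fun e => h' (by rw [e, SimpleGraph.Dart.symm_symm])) ht] at hx
      exact absurd hx (hv' _)

theorem IsTree.cutFun_param_symm {T : MetricGraph} (hT : T.IsTree) (d : T.Dart) {t : ℝ}
    (ht : t ∈ Icc 0 (T.edgeLen d)) : hT.cutFun d (T.param d.symm t) = T.edgeLen d - t := by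
  rw [← hT.cutFun_param d (t := T.edgeLen d - t) ⟨by linarith [ht.2], by linarith [ht.1]⟩,
    ← param_symm T d (t := T.edgeLen d - t) ⟨by linarith [ht.2], by linarith [ht.1]⟩,
    sub_sub_cancel]

theorem IsTree.cutFun_add_symm {T : MetricGraph} (hT : T.IsTree) (d : T.Dart) (x : T.Point) :
    hT.cutFun d x + hT.cutFun d.symm x = T.edgeLen d := by
  have h0 : ∀ d' : T.Dart, ∀ t ∈ Icc 0 (T.edgeLen d'),
      hT.cutFun d (T.param d' t) + hT.cutFun d.symm (T.param d' t) =
        hT.cutFun d (T.vert d'.fst) + hT.cutFun d.symm (T.vert d'.fst) := by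
    intro d' t ht
    have hz : (0 : ℝ) ∈ Icc 0 (T.edgeLen d') := ⟨le_rfl, (T.edgeLen_pos d').le⟩
    by_cases h : d' = d
    · subst h
      have e := hT.cutFun_param_symm d'.symm (t := t) (by rwa [edgeLen_symm])
      have e0 := hT.cutFun_param_symm d'.symm (t := 0) (by rwa [edgeLen_symm])
      rw [SimpleGraph.Dart.symm_symm] at e e0
      rw [← param_zero, hT.cutFun_param d' ht, hT.cutFun_param d' hz, e, e0]
      ring
    · by_cases h' : d' = d.symm
      · subst h'
        have ht' := ht
        have hz' := hz
        rw [edgeLen_symm] at ht' hz'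
        rw [← param_zero, hT.cutFun_param d.symm ht, hT.cutFun_param d.symm hz,
          hT.cutFun_param_symm d ht', hT.cutFun_param_symm d hz']
        ring
      · rw [hT.cutFun_other h h' ht, hT.cutFun_other h' (by rwa [SimpleGraph.Dart.symm_symm]) ht]
  have hE : EdgeAffine fun x => hT.cutFun d x + hT.cutFun d.symm x := fun d' =>
    ⟨0, fun t ht => by rw [Int.cast_zero, zero_mul, add_zero]; exact h0 d' t ht⟩
  have := hE.eq_const (fun d' => by
    rw [← param_len]; exact (h0 d' _ ⟨(T.edgeLen_pos d').le, le_rfl⟩).symm) x (T.param d 0)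
  have hz : (0 : ℝ) ∈ Icc 0 (T.edgeLen d) := ⟨le_rfl, (T.edgeLen_pos d).le⟩
  have e0 := hT.cutFun_param_symm d.symm (t := 0) (by rwa [edgeLen_symm])
  rw [SimpleGraph.Dart.symm_symm, edgeLen_symm] at e0
  simp only [hT.cutFun_param d hz, e0] at this
  rw [this]; ring

open Classical in
theorem finsum_dart_ite {Γ : MetricGraph} (d : Γ.Dart) (v : Γ.V) (a : ℤ) :
    ∑ᶠ d' : {d' : Γ.Dart // d'.fst = v}, (if d'.1 = d then a else 0) =
      if d.fst = v then a else 0 := by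
  by_cases h : d.fst = v
  · rw [finsum_eq_single _ ⟨d, h⟩, if_pos rfl, if_pos h]
    intro d' hne
    exact if_neg fun e => hne (Subtype.ext e)
  · rw [if_neg h]
    refine (finsum_congr fun d' => ?_).trans finsum_zero
    exact if_neg fun e : d'.1 = d => h (by rw [← e, d'.2])

-- The comparison with `t` is strict forwards and weak backwards: at level `t` the truncation is
-- flat ahead and decreases behind.
open Classical in
theorem IsTree.hasSlope_min_cutFun {T : MetricGraph} (hT : T.IsTree) (d : T.Dart) (t : ℝ)
    (ν : T.Dir) :
    HasSlope (fun x => min (hT.cutFun d x) t) ν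
      ((if ν.dart = d then (if ν.pos < t then 1 else 0) else 0) -
        (if ν.dart = d.symm then (if T.edgeLen d - ν.pos ≤ t then 1 else 0) else 0)) := by
  have hr := ν.pos_mem
  have hmove : ∀ h ∈ Ico 0 (T.edgeLen ν.dart - ν.pos), ν.pos + h ∈ Icc 0 (T.edgeLen ν.dart) :=
    fun h hh => ⟨by linarith [hh.1, hr.1], by linarith [hh.2]⟩
  have hε : 0 < T.edgeLen ν.dart - ν.pos := by linarith [hr.2]
  by_cases h : ν.dart = d
  · have h' : ν.dart ≠ d.symm := by rw [h]; exact (dart_symm_ne d).symm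
    rw [if_pos h, if_neg h', sub_zero]
    subst h
    by_cases hp : ν.pos < t
    · rw [if_pos hp]
      refine ⟨min (T.edgeLen ν.dart - ν.pos) (t - ν.pos), lt_min hε (by linarith), fun x hx => ?_⟩
      have hx1 := hx.2.trans_le (min_le_left _ _)
      have hx2 := hx.2.trans_le (min_le_right _ _)
      simp only [Dir.move, Dir.base]
      rw [hT.cutFun_param _ (hmove x ⟨hx.1, hx1⟩), hT.cutFun_param _ ν.pos_mem_Icc,
        min_eq_left (by linarith), min_eq_left (by linarith)]
      push_cast; ring
    · rw [if_neg hp]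
      push Not at hp
      refine ⟨T.edgeLen ν.dart - ν.pos, hε, fun x hx => ?_⟩
      simp only [Dir.move, Dir.base]
      rw [hT.cutFun_param _ (hmove x hx), hT.cutFun_param _ ν.pos_mem_Icc,
        min_eq_right (by linarith [hx.1]), min_eq_right hp]
      push_cast; ring
  · rw [if_neg h]
    by_cases h' : ν.dart = d.symm
    · rw [if_pos h']
      have hl : T.edgeLen ν.dart = T.edgeLen d := by rw [h', edgeLen_symm]
      have key : ∀ x ∈ Ico 0 (T.edgeLen ν.dart - ν.pos),
          hT.cutFun d (ν.move x) = T.edgeLen d - (ν.pos + x) := fun x hx => by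
        rw [Dir.move, h', hT.cutFun_param_symm d (by rw [← hl]; exact hmove x hx)]
      have kb : hT.cutFun d ν.base = T.edgeLen d - ν.pos := by
        rw [Dir.base, h', hT.cutFun_param_symm d (by rw [← hl]; exact ν.pos_mem_Icc)]
      by_cases hp : T.edgeLen d - ν.pos ≤ t
      · rw [if_pos hp]
        refine ⟨T.edgeLen ν.dart - ν.pos, hε, fun x hx => ?_⟩
        simp only
        rw [key x hx, kb, min_eq_left (by linarith [hx.1]), min_eq_left hp]
        push_cast; ring
      · rw [if_neg hp]
        push Not at hp
        refine ⟨min (T.edgeLen ν.dart - ν.pos) (T.edgeLen d - ν.pos - t), lt_min hε (by linarith),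
          fun x hx => ?_⟩
        have hx1 := hx.2.trans_le (min_le_left _ _)
        have hx2 := hx.2.trans_le (min_le_right _ _)
        simp only
        rw [key x ⟨hx.1, hx1⟩, kb, min_eq_right (by linarith), min_eq_right hp.le]
        push_cast; ring
    · rw [if_neg h']
      refine ⟨T.edgeLen ν.dart - ν.pos, hε, fun x hx => ?_⟩
      simp only [Dir.move, Dir.base]
      rw [hT.cutFun_other h h' (hmove x hx), hT.cutFun_other h h' ν.pos_mem_Icc]
      push_cast; ring

-- The truncation rises with slope one from the tail of `d` to `param d t` and is constant on the
-- rest of the tree, so only the two ends of this segment contribute.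
open Classical in
theorem IsTree.isDiv_min_cutFun {T : MetricGraph} (hT : T.IsTree) (d : T.Dart) {t : ℝ}
    (ht : t ∈ Icc 0 (T.edgeLen d)) :
    IsDiv (fun x => min (hT.cutFun d x) t) (T.param d t) (T.param d 0) := by
  refine ⟨mem_rat_iff.2 fun ν => ⟨_, hT.hasSlope_min_cutFun d t ν⟩, fun z => ?_⟩
  have hs := fun ν => (hT.hasSlope_min_cutFun d t ν).slope_eq
  have hl := T.edgeLen_pos d
  have hz0 : (0 : ℝ) ∈ Icc 0 (T.edgeLen d) := ⟨le_rfl, hl.le⟩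
  rcases T.point_cases z with ⟨v, rfl⟩ | ⟨d', t', ht', rfl⟩
  · unfold ord
    have key : ∀ d' : {d' : T.Dart // d'.fst = v},
        slope (fun x => min (hT.cutFun d x) t) (T.dartDir d'.1) =
          (if d'.1 = d then if 0 < t then 1 else 0 else 0) -
            if d'.1 = d.symm then if T.edgeLen d - 0 ≤ t then 1 else 0 else 0 :=
      fun d' => hs (T.dartDir d'.1)
    rw [finsum_tangent_vert v (fun ν => slope _ ν), finsum_congr key, sub_zero]
    rw [finsum_sub_distrib (Set.toFinite _) (Set.toFinite _), finsum_dart_ite, finsum_dart_ite]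
    change -((if d.fst = v then _ else 0) - (if d.snd = v then _ else 0)) = _
    simp only [Finsupp.single_apply, param_zero, T.vert_injective.eq_iff]
    have hne := d.adj.ne
    rcases mem_Icc_cases ht with h | h | h
    · subst h
      rw [if_neg (lt_irrefl _), if_neg (not_le.2 hl)]
      simp [param_zero, T.vert_injective.eq_iff]
    · subst h
      rw [if_pos hl, if_pos le_rfl]
      simp only [param_len, T.vert_injective.eq_iff]
      ring
    · rw [if_pos h.1, if_neg (not_le.2 h.2), if_neg (T.param_ne_vert d h v)]
      simp
  · by_cases hd : d' = d ∨ d' = d.symm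
    · obtain ⟨u, hu, he⟩ : ∃ u ∈ Ioo 0 (T.edgeLen d), T.param d' t' = T.param d u := by
        rcases hd with rfl | rfl
        · exact ⟨t', ht', rfl⟩
        · rw [edgeLen_symm] at ht'
          refine ⟨T.edgeLen d - t', ⟨by linarith [ht'.2], by linarith [ht'.1]⟩, ?_⟩
          rw [← param_symm T d (t := T.edgeLen d - t') ⟨by linarith [ht'.2], by linarith [ht'.1]⟩,
            sub_sub_cancel]
      have hz : T.param d u ≠ T.param d 0 := fun e =>
        T.param_ne_vert d hu _ (e.trans (T.param_zero d))
      have k1 := dart_symm_ne d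
      have k2 := k1.symm
      rw [he, ord_interior hu, hs, hs, Finsupp.single_eq_of_ne hz]
      simp only [backDir, k1, k2, if_false, if_true, sub_sub_cancel]
      by_cases h : t = u
      · subst h; simp
      · have : T.param d u ≠ T.param d t := fun e =>
          h (T.param_injOn d ht (Ioo_subset_Icc_self hu) e.symm)
        rw [Finsupp.single_eq_of_ne this]
        rcases lt_or_gt_of_ne h with h' | h'
        · simp [h'.not_ge, h'.le]
        · simp [h', h'.le]
    · push Not at hd
      have k1 : d'.symm ≠ d := fun e => hd.2 (by rw [← e, SimpleGraph.Dart.symm_symm])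
      have k2 : d'.symm ≠ d.symm := fun e => hd.1 (by
          rw [← SimpleGraph.Dart.symm_symm d', e, SimpleGraph.Dart.symm_symm])
      rw [ord_interior ht', hs, hs]
      simp only [backDir, hd.1, hd.2, k1, k2, if_false]
      have : ∀ u ∈ Icc 0 (T.edgeLen d), T.param d u ≠ T.param d' t' := by
        intro u hu e
        rcases T.param_eq_interior ht' hu e.symm with ⟨e, _⟩ | ⟨e, _⟩
        · exact hd.1 e.symm
        · exact k1 e.symm
      rw [Finsupp.single_eq_of_ne (this t ht).symm, Finsupp.single_eq_of_ne (this 0 hz0).symm]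
      simp

/-- Any two points of a metric tree are linearly equivalent. -/
theorem IsTree.exists_isDiv {T : MetricGraph} (hT : T.IsTree) (x y : T.Point) :
    ∃ f, IsDiv f x y := by
  have h1 : ∀ (d : T.Dart), ∀ t ∈ Icc 0 (T.edgeLen d), ∃ f, IsDiv f (T.param d t) (T.vert d.fst) :=
    fun d t ht => ⟨_, by rw [← param_zero]; exact hT.isDiv_min_cutFun d ht⟩
  obtain ⟨v₀⟩ : Nonempty T.V := inferInstance
  have h2 : ∀ v, ∃ f, IsDiv f (T.vert v) (T.vert v₀) := by
    refine T.vert_reachable_induction (P := fun v => ∃ f, IsDiv f (T.vert v) (T.vert v₀)) (v₀ := v₀)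
      ⟨_, const_mem_rat 0, fun z => by rw [ord_const, sub_self]⟩ fun d ⟨f, hf⟩ => ?_
    obtain ⟨g, hg⟩ := h1 d _ ⟨(T.edgeLen_pos d).le, le_rfl⟩
    rw [param_len] at hg
    exact ⟨_, hg.add hf⟩
  have h3 : ∀ x, ∃ f, IsDiv f x (T.vert v₀) := by
    intro x
    obtain ⟨d, t, ht, rfl⟩ := T.exists_param x
    obtain ⟨f, hf⟩ := h1 d t ht
    obtain ⟨g, hg⟩ := h2 d.fst
    exact ⟨_, hf.add hg⟩
  obtain ⟨f, hf⟩ := h3 x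
  obtain ⟨g, hg⟩ := h3 y
  exact ⟨_, hf.add hg.neg⟩

/-- The direction `ν` points towards the point `x`. -/
def IsTree.Ahead {T : MetricGraph} (hT : T.IsTree) (ν : T.Dir) (x : T.Point) : Prop :=
  ν.pos < hT.cutFun ν.dart x

theorem IsTree.not_ahead_base {T : MetricGraph} (hT : T.IsTree) (ν : T.Dir) :
    ¬ hT.Ahead ν ν.base := by
  unfold IsTree.Ahead Dir.base
  rw [hT.cutFun_param _ ν.pos_mem_Icc]
  exact lt_irrefl _

-- The difference of two truncations of `cutFun ν.dart` has divisor `(ν.move s) - (ν.base)`. By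
-- reciprocity the increment of `f` is the difference of its values at `x` and `y`; for small `s`
-- such a value is `s` if the point is ahead of `ν` and `0` if not.
open Classical in
theorem IsTree.hasSlope_isDiv {T : MetricGraph} (hT : T.IsTree) {f : T.Point → ℝ} {x y : T.Point}
    (h : IsDiv f x y) (ν : T.Dir) :
    HasSlope f ν ((if hT.Ahead ν x then 1 else 0) - (if hT.Ahead ν y then 1 else 0)) := by
  set F := hT.cutFun ν.dart
  set p := ν.pos
  have hp := ν.pos_mem
  have hroom : ∀ z, ∃ ε > 0, ∀ h ∈ Ico 0 ε,
      min (F z) (p + h) - min (F z) p = (if hT.Ahead ν z then (1 : ℝ) else 0) * h := by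
    intro z
    by_cases hz : hT.Ahead ν z
    · have hz' : p < F z := hz
      refine ⟨F z - p, by linarith, fun h hh => ?_⟩
      rw [if_pos hz, min_eq_right (by linarith [hh.2]), min_eq_right hz'.le]; ring
    · have hz' : F z ≤ p := not_lt.1 hz
      refine ⟨1, one_pos, fun h hh => ?_⟩
      rw [if_neg hz, min_eq_left (by linarith [hh.1]), min_eq_left hz']; ring
  obtain ⟨ε, h0, h1⟩ := hroom x
  obtain ⟨ε', h0', h1'⟩ := hroom y
  refine ⟨min (T.edgeLen ν.dart - p) (min ε ε'), lt_min (by linarith [hp.2]) (lt_min h0 h0'),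
    fun s hs => ?_⟩
  have s1 := hs.2.trans_le (min_le_left _ _)
  have s2 := hs.2.trans_le ((min_le_right _ _).trans (min_le_left _ _))
  have s3 := hs.2.trans_le ((min_le_right _ _).trans (min_le_right _ _))
  have hK := (hT.isDiv_min_cutFun ν.dart (t := p + s) ⟨by linarith [hs.1, hp.1], by linarith⟩).add
    (hT.isDiv_min_cutFun ν.dart (t := p) ν.pos_mem_Icc).neg
  have hg := h.green hK
  simp only [Pi.add_apply, Pi.neg_apply] at hg
  have e1 := h1 s ⟨hs.1, s2⟩
  have e2 := h1' s ⟨hs.1, s3⟩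
  change f (ν.move s) - f ν.base = _ at hg
  push_cast
  rw [sub_mul, ← e1, ← e2]
  linarith

-- The order at `x` of a function with divisor `(x) - (y)` counts the directions towards `y`; for `x
-- ≠ y` exactly one direction points there.
open Classical in
theorem IsTree.sum_ahead {T : MetricGraph} (hT : T.IsTree) (x y : T.Point) :
    ∑ᶠ ν : T.Tangent x, (if hT.Ahead ν.1 y then (1 : ℤ) else 0) =
      1 - Finsupp.single y (1 : ℤ) x := by
  obtain ⟨f, hf⟩ := hT.exists_isDiv x y
  have h := hf.2 x
  rw [Finsupp.single_eq_same] at h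
  rw [← h, ord, ← finsum_neg_distrib]
  refine finsum_congr fun ν => ?_
  rw [(hT.hasSlope_isDiv hf ν.1).slope_eq]
  have := hT.not_ahead_base ν.1
  rw [ν.2] at this
  rw [if_neg this, zero_sub, neg_neg]

theorem exists_single_of_sum_eq_one {X : Type*} {g : X → ℤ} (h0 : ∀ x, 0 ≤ g x)
    (hs : ∑ᶠ x, g x = 1) : ∃ x, ∀ z, g z = Finsupp.single x (1 : ℤ) z := by
  classical
  have hfin : (Function.support g).Finite := by
    by_contra hc
    rw [finsum_of_infinite_support hc] at hs
    exact zero_ne_one hs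
  obtain ⟨x, hx⟩ : ∃ x, g x ≠ 0 := by
    by_contra! hc
    rw [finsum_congr hc, finsum_zero] at hs
    exact zero_ne_one hs
  have hx1 : 1 ≤ g x := by
    have := h0 x
    omega
  refine ⟨x, fun z => ?_⟩
  rw [finsum_eq_sum_of_support_subset g (s := insert z (insert x hfin.toFinset))
    (fun w hw => by simp [hw])] at hs
  by_cases hz : z = x
  · subst hz
    rw [Finsupp.single_eq_same]
    refine le_antisymm ?_ hx1
    rw [← hs]
    exact Finset.single_le_sum (fun w _ => h0 w) (by simp)
  · rw [Finsupp.single_eq_of_ne hz]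
    refine le_antisymm ?_ (h0 z)
    have h2 : g z + g x ≤ 1 := by
      rw [← Finset.sum_pair hz, ← hs]
      refine Finset.sum_le_sum_of_subset_of_nonneg ?_ (fun w _ _ => h0 w)
      intro w
      simp only [Finset.mem_insert, Finset.mem_singleton]
      tauto
    linarith

theorem finsum_finsupp {X : Type*} (D : X →₀ ℤ) : ∑ᶠ x, D x = D.sum fun _ n => n := by
  rw [finsum_eq_sum_of_support_subset (s := D.support) _ (by simp), Finsupp.sum]

theorem finsum_add_ord {Γ : MetricGraph} (D : Γ.Divisor) {f : Γ.Point → ℝ} (hf : f ∈ Γ.Rat) :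
    ∑ᶠ x, (D x + ord f x) = degree D := by
  rw [finsum_add_distrib (D.hasFiniteSupport) (ord_support_finite hf), finsum_ord hf, add_zero,
    finsum_finsupp, degree]

theorem exists_single_of_degree_one {Γ : MetricGraph} {D : Γ.Divisor} (hD : degree D = 1)
    {f : Γ.Point → ℝ} (hf : f ∈ ratDiv D) :
    ∃ x, ∀ z, D z + ord f z = Finsupp.single x (1 : ℤ) z :=
  exists_single_of_sum_eq_one hf.2 (by rw [finsum_add_ord D hf.1, hD])

theorem degree_single {Γ : MetricGraph} (x : Γ.Point) : degree (Finsupp.single x (1 : ℤ)) = 1 := by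
  simp [degree]

/-- An effective divisor of degree one is a single point. -/
theorem mem_treeSeries_iff {T : MetricGraph} {t : T.Point} {f : T.Point → ℝ} :
    f ∈ treeSeries t ↔ ∃ x, IsDiv f x t := by
  classical
  constructor
  · intro hf
    obtain ⟨x, hx⟩ := exists_single_of_degree_one (degree_single t) hf
    exact ⟨x, hf.1, fun z => by rw [← hx z]; ring⟩
  · rintro ⟨x, hf⟩
    refine ⟨hf.1, fun z => ?_⟩
    rw [hf.2, add_sub_cancel, Finsupp.single_apply]
    split_ifs <;> simp

theorem IsDiv.add_const {Γ : MetricGraph} {f : Γ.Point → ℝ} {x y : Γ.Point} (h : IsDiv f x y)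
    (c : ℝ) : IsDiv (fun z => f z + c) x y :=
  ⟨add_const_mem_rat h.1 c, fun z => by rw [ord_add_const h.1, h.2]⟩

theorem const_mem_treeSeries {T : MetricGraph} (t : T.Point) (c : ℝ) :
    (fun _ => c) ∈ treeSeries t :=
  mem_treeSeries_iff.2 ⟨t, const_mem_rat c, fun z => by rw [ord_const, sub_self]⟩

/-- The Gromov products on a metric tree satisfy the ultrametric inequality. -/
theorem IsTree.ultrametric {T : MetricGraph} {f g : T.Point → ℝ} {x y z : T.Point}
    (hf : IsDiv f x z) (hg : IsDiv g y z) (hfz : f z = 0) (hgz : g z = 0) (p : T.Point) :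
    min (f y) (g p) ≤ f p := by
  have hsym := hf.green hg
  rw [hfz, hgz, sub_zero, sub_zero] at hsym
  have hc : 0 ≤ f y := by rw [← hfz]; exact hf.min_le y
  -- This truncation `q` of `g` has divisor `(m) - (z)`, so `f - q` is minimal at `m`. Reciprocity
  -- and the symmetry `f y = g x` give `f m = f y`, which is at least `q m`; hence `q ≤ f`
  -- everywhere.
  have hq : (fun w => min (g w) (f y)) ∈ treeSeries z :=
    min_mem_ratDiv (mem_treeSeries_iff.2 ⟨y, hg⟩) (const_mem_treeSeries z (f y))
  obtain ⟨m, hm⟩ := mem_treeSeries_iff.1 hq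
  have h1 := (hf.add hm.neg).min_le p
  have h2 := hf.green hm
  simp only [Pi.add_apply, Pi.neg_apply] at h1 h2
  rw [hfz, hgz, min_eq_left hc, sub_zero, sub_zero, ← hsym, min_self] at h2
  have h3 := min_le_right (g m) (f y)
  rw [min_comm]
  linarith

theorem min_attained_twice {a b c : ℝ} (ha : min b c ≤ a) (hb : min a c ≤ b) (hc : min a b ≤ c) :
    (a = b ∧ a ≤ c) ∨ (a = c ∧ a ≤ b) ∨ (b = c ∧ b ≤ a) := by
  rcases le_total a b with h1 | h1 <;> rcases le_total a c with h2 | h2 <;>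
    rcases le_total b c with h3 | h3 <;>
    simp only [min_eq_left h1, min_eq_right h1, min_eq_left h2, min_eq_right h2, min_eq_left h3,
      min_eq_right h3] at ha hb hc
  · exact Or.inl ⟨by linarith, h2⟩
  · exact Or.inr (Or.inl ⟨by linarith, h1⟩)
  · exact Or.inr (Or.inl ⟨by linarith, h1⟩)
  · exact Or.inr (Or.inl ⟨by linarith, h1⟩)
  · exact Or.inl ⟨by linarith, h2⟩
  · exact Or.inl ⟨by linarith, h2⟩
  · exact Or.inr (Or.inr ⟨by linarith, h1⟩)
  · exact Or.inr (Or.inr ⟨by linarith, h1⟩)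

theorem IsTree.tropicallyDependent {T : MetricGraph} (hT : T.IsTree) (t : T.Point) :
    TropicallyDependent (treeSeries t) 1 := by
  intro f hf
  choose x hx using fun i => mem_treeSeries_iff.1 (hf i)
  set z := x 2
  have hd : ∀ i, IsDiv (fun w => f i w - f 2 w - (f i z - f 2 z)) (x i) z := fun i => by
    have := ((hx i).add (hx 2).neg).add_const (-(f i z - f 2 z))
    convert this using 1
    funext w
    simp only [Pi.add_apply, Pi.neg_apply]; ring
  set F : T.Point → ℝ := fun w => f 0 w - f 2 w - (f 0 z - f 2 z) with hF
  set G : T.Point → ℝ := fun w => f 1 w - f 2 w - (f 1 z - f 2 z) with hG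
  have hF0 : IsDiv F (x 0) z := hd 0
  have hG0 : IsDiv G (x 1) z := hd 1
  have Fz : F z = 0 := by simp [hF]
  have Gz : G z = 0 := by simp [hG]
  have hsym : F (x 1) = G (x 0) := by
    have := hF0.green hG0
    rw [Fz, Gz, sub_zero, sub_zero] at this
    exact this
  -- Relative to `f 2`, the three values at `p` become the Gromov products, based at `z`, of the
  -- pairs among `x 0`, `x 1`, `p`; the constant `F (x 1)` is the product of `x 0` and `x 1`. By the
  -- ultrametric inequality the smallest of the three occurs twice.
  refine ⟨![-(f 0 z - f 2 z), -(f 1 z - f 2 z), F (x 1)], fun p => ?_⟩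
  obtain ⟨h, hh⟩ := hT.exists_isDiv p z
  have hh' : IsDiv (fun w => h w + -h z) p z := hh.add_const _
  have hz' : h z + -h z = 0 := by ring
  have s1 : F p = h (x 0) + -h z := by
    have := hF0.green hh'
    rw [Fz, sub_zero] at this
    linarith
  have s2 : G p = h (x 1) + -h z := by
    have := hG0.green hh'
    rw [Gz, sub_zero] at this
    linarith
  have u1 := IsTree.ultrametric hF0 hG0 Fz Gz p
  have u2 := IsTree.ultrametric hG0 hF0 Gz Fz p
  have u3 := IsTree.ultrametric hF0 hh' Fz hz' (x 1)
  rw [← s2] at u3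
  rw [← hsym] at u2
  have key := min_attained_twice (a := F p) (b := G p) (c := F (x 1)) (by rwa [min_comm])
    (by rwa [min_comm]) u3
  have hall : ∀ (P : Fin 3 → Prop), P 0 → P 1 → P 2 → ∀ k, P k := by
    intro P h0 h1 h2 k
    fin_cases k <;> assumption
  have ev : ∀ k : Fin 3, f k p + (![-(f 0 z - f 2 z), -(f 1 z - f 2 z), F (x 1)] : Fin 3 → ℝ) k =
      f 2 p + (![F p, G p, F (x 1)] : Fin 3 → ℝ) k := by
    refine hall _ ?_ ?_ ?_ <;> simp [hF, hG] <;> ring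
  simp only [ev, add_le_add_iff_left]
  rcases key with ⟨a, b⟩ | ⟨a, b⟩ | ⟨a, b⟩
  · exact ⟨0, 1, by decide, hall _ (by simp [a]) (by simp [a]) (by simpa [a] using by linarith)⟩
  · exact ⟨0, 2, by decide, hall _ (by simp [← a]) (by simpa [← a] using b) (by simp [← a])⟩
  · exact ⟨1, 2, by decide, hall _ (by simpa [← a] using b) (by simp [← a]) (by simp [← a])⟩

/-- The approximating functions have divisors `(x n) - (t)`; an ultrafilter limit `y` of the `x n`
exists by compactness. By reciprocity the value at `p` depends continuously on `x n`, so the limit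
function has divisor `(y) - (t)`. -/
theorem IsTree.treeSeries_closed {T : MetricGraph} (hT : T.IsTree) {t : T.Point}
    {f : T.Point → ℝ} (hf : ∀ ε > (0 : ℝ), ∃ g ∈ treeSeries t, ∀ x, |f x - g x| ≤ ε) :
    f ∈ treeSeries t := by
  have h : ∀ n : ℕ, ∃ g ∈ treeSeries t, ∀ x, |f x - g x| ≤ 1 / ((n : ℝ) + 1) :=
    fun n => hf _ (by positivity)
  choose g hg hgf using h
  choose x hx using fun n => mem_treeSeries_iff.1 (hg n)
  have hlim : ∀ p, Filter.Tendsto (fun n => g n p) Filter.atTop (𝓝 (f p)) := by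
    intro p
    rw [tendsto_iff_dist_tendsto_zero]
    refine squeeze_zero (fun n => dist_nonneg) (fun n => ?_) tendsto_one_div_add_atTop_nhds_zero_nat
    rw [dist_comm, Real.dist_eq]
    exact hgf n p
  let U : Ultrafilter ℕ := Filter.hyperfilter ℕ
  have hU : (U : Filter ℕ) ≤ Filter.atTop := Nat.hyperfilter_le_atTop
  obtain ⟨y, -, hy⟩ := isCompact_univ.ultrafilter_le_nhds (U.map x) (by simp)
  have hy' : Filter.Tendsto x U (𝓝 y) := hy
  obtain ⟨F, hF⟩ := hT.exists_isDiv y t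
  refine mem_treeSeries_iff.2 ⟨y, ?_⟩
  have key : ∀ p, f p - f t = F p - F t := by
    intro p
    obtain ⟨h, hh⟩ := hT.exists_isDiv p t
    have l1 : Filter.Tendsto (fun n => g n p - g n t) U (𝓝 (f p - f t)) :=
      ((hlim p).sub (hlim t)).mono_left hU
    have l2 : Filter.Tendsto (fun n => h (x n) - h t) U (𝓝 (h y - h t)) :=
      (((continuous_of_rat hh.1).tendsto y).comp hy').sub tendsto_const_nhds
    have e : (fun n => g n p - g n t) = fun n => h (x n) - h t :=
      funext fun n => (hx n).green hh
    rw [e] at l1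
    rw [tendsto_nhds_unique l1 l2]
    exact hh.green hF
  have e : f = fun p => F p + (f t - F t) := funext fun p => by linarith [key p]
  rw [e]
  exact hF.add_const _

end MetricGraph
end

noncomputable section
namespace MetricGraph

/-! ## Rank functions attached to partitions -/

open Classical in
/-- The rank function of width one on `{0, 1}^ι` attached to the partition of `ι` into the fibres
of `τ`. -/
def fiberRank {ι κ : Type} (τ : ι → κ) (a : ι → Fin 2) : ℤ :=
  if ∀ i, a i = 0 then 1 else if ∀ i j, a i ≠ 0 → a j ≠ 0 → τ i = τ j then 0 else -1

theorem fiberRank_of_zero {ι κ : Type} (τ : ι → κ) {a : ι → Fin 2} (h : ∀ i, a i = 0) :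
    fiberRank τ a = 1 := if_pos h

theorem fiberRank_of_single {ι κ : Type} (τ : ι → κ) {a : ι → Fin 2} {i : ι} (hi : a i ≠ 0)
    (h : ∀ i j, a i ≠ 0 → a j ≠ 0 → τ i = τ j) : fiberRank τ a = 0 := by
  unfold fiberRank
  rw [if_neg fun h' => hi (h' i), if_pos h]

theorem fiberRank_of_ne (ι κ : Type) (τ : ι → κ) {a : ι → Fin 2} {i j : ι} (hi : a i ≠ 0)
    (hj : a j ≠ 0) (h : τ i ≠ τ j) : fiberRank τ a = -1 := by
  unfold fiberRank
  rw [if_neg fun h' => hi (h' i), if_neg fun h' => h (h' i j hi hj)]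

theorem fiberRank_cases {ι κ : Type} (τ : ι → κ) (a : ι → Fin 2) :
    ((∀ i, a i = 0) ∧ fiberRank τ a = 1) ∨
    ((∃ i, a i ≠ 0) ∧ (∀ i j, a i ≠ 0 → a j ≠ 0 → τ i = τ j) ∧ fiberRank τ a = 0) ∨
    ((∃ i j, a i ≠ 0 ∧ a j ≠ 0 ∧ τ i ≠ τ j) ∧ fiberRank τ a = -1) := by
  by_cases h : ∀ i, a i = 0
  · exact Or.inl ⟨h, fiberRank_of_zero τ h⟩
  · push Not at h
    obtain ⟨i, hi⟩ := h
    by_cases h' : ∀ i j, a i ≠ 0 → a j ≠ 0 → τ i = τ j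
    · exact Or.inr (Or.inl ⟨⟨i, hi⟩, h', fiberRank_of_single τ hi h'⟩)
    · push Not at h'
      obtain ⟨i, j, h1, h2, h3⟩ := h'
      exact Or.inr (Or.inr ⟨⟨i, j, h1, h2, h3⟩, fiberRank_of_ne _ _ τ h1 h2 h3⟩)

theorem fiberRank_antitone {ι κ : Type} (τ : ι → κ) : Antitone (fiberRank τ) := by
  intro a b hab
  have h0 : ∀ i, a i ≠ 0 → b i ≠ 0 := fun i hi hb => hi (le_antisymm (hb ▸ hab i) (Fin.zero_le _))
  rcases fiberRank_cases τ a with ⟨ha, e⟩ | ⟨⟨i, hi⟩, ha, e⟩ | ⟨⟨i, j, hi, hj, hij⟩, e⟩ <;>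
    rcases fiberRank_cases τ b with ⟨hb, e'⟩ | ⟨⟨i', hi'⟩, hb, e'⟩ | ⟨⟨i', j', hi', hj', hij'⟩, e'⟩ <;>
    rw [e, e'] <;> norm_num
  · exact h0 i hi (hb i)
  · exact h0 i hi (hb i)
  · exact hij (hb i j (h0 i hi) (h0 j hj))

/-- The essential case of supermodularity is that of two vectors of rank `0`: if they are supported
in one fibre, so is the join; if in different fibres, their meet is zero and has rank `1`. -/
theorem isRankFunction_fiberRank {ι κ : Type} (τ : ι → κ) :
    IsRankFunction 1 (fiberRank τ) where
  antitone := fiberRank_antitone τ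
  mem_range a := by
    rcases fiberRank_cases τ a with ⟨_, e⟩ | ⟨_, _, e⟩ | ⟨_, e⟩ <;> rw [e] <;> norm_num
  axis i t a hi hj := by
    rcases Fin.exists_fin_two.1 ⟨t, rfl⟩ with ht | ht
    · rw [fiberRank_of_zero]
      · subst ht; simp
      · intro j
        by_cases h : j = i
        · rw [h, hi, ht]
        · exact hj j h
    · have hs : ∀ j, a j ≠ 0 → j = i := fun j h => by_contra fun h' => h (hj j h')
      rw [fiberRank_of_single τ (i := i) (by rw [hi, ht]; decide)
        (fun j j' h h' => by rw [hs j h, hs j' h'])]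
      subst ht; simp
  supermodular a b := by
    have hanti := fiberRank_antitone τ
    have l1 : fiberRank τ a ≤ fiberRank τ (a ⊓ b) := hanti inf_le_left
    have l2 : fiberRank τ b ≤ fiberRank τ (a ⊓ b) := hanti inf_le_right
    have l3 : -1 ≤ fiberRank τ (a ⊔ b) := by
      rcases fiberRank_cases τ (a ⊔ b) with ⟨_, e⟩ | ⟨_, _, e⟩ | ⟨_, e⟩ <;> rw [e] <;> norm_num
    have hsup : ∀ i, (a ⊔ b) i ≠ 0 → a i ≠ 0 ∨ b i ≠ 0 := by
      intro i h
      by_contra! hc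
      exact h (by rw [Pi.sup_apply, hc.1, hc.2]; rfl)
    rcases fiberRank_cases τ a with ⟨ha, e⟩ | ⟨⟨i, hi⟩, ha, e⟩ | ⟨⟨i, j, hi, hj, hij⟩, e⟩
    · have h1 : a ≤ b := fun i => by rw [ha i]; exact Fin.zero_le _
      rw [sup_eq_right.2 h1, inf_eq_left.2 h1, add_comm]
    · rcases fiberRank_cases τ b with ⟨hb, e'⟩ | ⟨⟨i', hi'⟩, hb, e'⟩ | ⟨_, e'⟩
      · have h1 : b ≤ a := fun i => by rw [hb i]; exact Fin.zero_le _
        rw [sup_eq_left.2 h1, inf_eq_right.2 h1]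
      · by_cases h : τ i = τ i'
        · have : fiberRank τ (a ⊔ b) = 0 ∨ fiberRank τ (a ⊔ b) = 1 := by
            by_cases hz : ∀ i, (a ⊔ b) i = 0
            · exact Or.inr (fiberRank_of_zero τ hz)
            · push Not at hz
              obtain ⟨k, hk⟩ := hz
              refine Or.inl (fiberRank_of_single τ hk ?_)
              have : ∀ j, (a ⊔ b) j ≠ 0 → τ j = τ i := fun j hj => by
                rcases hsup j hj with h' | h'
                · exact ha _ _ h' hi
                · rw [h]; exact hb _ _ h' hi'
              exact fun j j' hj hj' => (this j hj).trans (this j' hj').symm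
          omega
        · have : fiberRank τ (a ⊓ b) = 1 := by
            refine fiberRank_of_zero τ fun k => by_contra fun hk => h ?_
            have h1 : a k ≠ 0 := fun h1 => hk (by rw [Pi.inf_apply, h1]; exact min_eq_left (Fin.zero_le _))
            have h2 : b k ≠ 0 := fun h1 => hk (by rw [Pi.inf_apply, h1]; exact min_eq_right (Fin.zero_le _))
            exact (ha i k hi h1).trans (hb k i' h2 hi')
          omega
      · omega
    · omega

theorem fiberRank_eq_stdRank {ι κ : Type} [Finite ι] {τ : ι → κ} (hτ : Function.Injective τ) :
    fiberRank τ = stdRank 1 := by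
  classical
  have := Fintype.ofFinite ι
  have hv : ∀ x : Fin 2, x ≠ 0 → (x : ℕ) = 1 := by decide
  funext a
  unfold stdRank
  rw [finsum_eq_sum_of_fintype]
  rcases fiberRank_cases τ a with ⟨ha, e⟩ | ⟨⟨i, hi⟩, ha, e⟩ | ⟨⟨i, j, hi, hj, hij⟩, e⟩
  · rw [e, Finset.sum_eq_zero fun i _ => by rw [ha i]; rfl]
    simp
  · rw [e, Finset.sum_eq_single i (fun j _ hj => by
      by_contra hc
      have : a j ≠ 0 := fun h => hc (by rw [h]; rfl)
      exact hj (hτ (ha _ _ this hi))) (by simp), hv _ hi]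
    simp
  · rw [e, if_neg]
    have hne : i ≠ j := fun h => hij (by rw [h])
    have : ∑ k ∈ {i, j}, (a k : ℕ) ≤ ∑ k, (a k : ℕ) :=
      Finset.sum_le_sum_of_subset (Finset.subset_univ _)
    rw [Finset.sum_pair hne, hv _ hi, hv _ hj] at this
    omega

/-- Besides zero, the indicator of an entire nonempty fibre is a jump: any further coordinate lies
in another fibre. A proper nonempty part of a fibre would not be one, so whole fibres are required.
-/
theorem isJump_fiberRank {ι κ : Type} {τ : ι → κ} {a : ι → Fin 2}
    (h : (∀ i, a i = 0) ∨ ∃ c, (∃ i, τ i = c) ∧ ∀ i, a i ≠ 0 ↔ τ i = c) :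
    IsJump (r := 1) (fiberRank τ) a := by
  classical
  have hb : ∀ (x b : Fin (1 + 1)), (b : ℕ) = (x : ℕ) + 1 → x = 0 ∧ b = 1 := by decide
  rcases h with h | ⟨c, ⟨i, hi⟩, h⟩
  · refine ⟨by rw [fiberRank_of_zero τ h]; norm_num, fun i b hib => ?_⟩
    obtain ⟨-, rfl⟩ := hb _ _ hib
    rw [fiberRank_of_zero τ h, fiberRank_of_single τ (i := i) (by simp)]
    · norm_num
    · have hs : ∀ j, Function.update a i 1 j ≠ 0 → j = i := fun j hj => by
        by_contra hne
        exact hj (by rw [Function.update_of_ne hne, h j])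
      exact fun j j' hj hj' => by rw [hs j hj, hs j' hj']
  · have h0 : fiberRank τ a = 0 := fiberRank_of_single τ ((h i).2 hi)
      fun j j' hj hj' => ((h j).1 hj).trans ((h j').1 hj').symm
    refine ⟨h0.ge, fun j b hjb => ?_⟩
    obtain ⟨hj, rfl⟩ := hb _ _ hjb
    have hjc : τ j ≠ c := fun hc => (h j).2 hc hj
    have hne : i ≠ j := fun e => hjc (e ▸ hi)
    rw [h0, fiberRank_of_ne _ _ τ (i := j) (j := i) (by simp)
      (by rw [Function.update_of_ne hne]; exact (h i).2 hi) (by rw [hi]; exact hjc)]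
    norm_num

/-! ## Pullbacks of the series on a tree along finite harmonic morphisms -/

variable {Γ T : MetricGraph} {ψ : Γ.Point → T.Point}

theorem exists_dir (Γ : MetricGraph) (x : Γ.Point) : ∃ ν : Γ.Dir, ν.base = x := by
  obtain ⟨ν, h⟩ := (inferInstance : Nonempty (Γ.Tangent x))
  exact ⟨ν, h⟩

theorem exists_ne_point (Γ : MetricGraph) (x : Γ.Point) : ∃ y, y ≠ x := by
  obtain ⟨v, w, h⟩ := exists_pair_ne Γ.V
  by_cases hv : Γ.vert v = x
  · exact ⟨Γ.vert w, fun hw => h (Γ.vert_injective (hv.trans hw.symm))⟩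
  · exact ⟨_, hv⟩

theorem Dirwise.localDegree_pos {K : Set ℕ} (h : Dirwise ψ K) (p : Γ.Point) :
    ∃ ν' : T.Dir, ν'.base = ψ p ∧ 1 ≤ localDegree ψ p ν' := by
  obtain ⟨ν, hν⟩ := Γ.exists_dir p
  obtain ⟨ν', k, -, hm⟩ := h ν
  refine ⟨ν', by rw [← hm.base, hν], ?_⟩
  have h1 : 1 ≤ expansion ψ ν ν' := by rw [expansion_eq hm]; exact hm.1
  exact h1.trans (single_le_finsum (⟨ν, hν⟩ : Γ.Tangent p)
    (f := fun μ : Γ.Tangent p => expansion ψ μ.1 ν') (Set.toFinite _) fun _ => Nat.zero_le _)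

/-- The common local degree at `p`. It is positive because some direction at `p` maps to the tree
with positive factor. -/
theorem IsFiniteHarmonic.exists_mult (h : IsFiniteHarmonic ψ) (p : Γ.Point) :
    ∃ m : ℕ, 1 ≤ m ∧ ∀ ν' : T.Dir, ν'.base = ψ p → localDegree ψ p ν' = m := by
  obtain ⟨ν', hν, h1⟩ := h.finite.dirwise.localDegree_pos p
  exact ⟨_, h1, fun ν'' h'' => h.harmonic p _ _ h'' hν⟩

theorem IsFiniteHarmonic.exists_dir_over (h : IsFiniteHarmonic ψ) (p : Γ.Point) (ν' : T.Dir)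
    (hν : ν'.base = ψ p) : ∃ ν : Γ.Dir, ν.base = p ∧ ∃ k, MapsDir ψ ν ν' k := by
  obtain ⟨m, h1, hm⟩ := h.exists_mult p
  have := hm ν' hν
  by_contra! hc
  unfold localDegree at this
  rw [finsum_congr (g := fun _ => 0) fun ν : Γ.Tangent p => ?_, finsum_zero] at this
  · omega
  · by_contra hne
    exact hc ν.1 ν.2 _ (expansion_pos_iff.1 hne)

/-- The degree of a finite harmonic morphism to a tree is well defined; the pullbacks of the
points of the tree are effective divisors of this degree. -/
theorem IsFiniteHarmonic.exists_degree (hT : T.IsTree) (h : IsFiniteHarmonic ψ) (t : T.Point) :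
    ∃ (d : ℕ) (D : Γ.Divisor), HasDegree ψ d ∧ degree D = d ∧ ∀ (f : T.Point → ℝ) (x : T.Point),
      IsDiv f x t → ∀ p, (ψ p ≠ x → D p + ord (f ∘ ψ) p = 0) ∧
        (ψ p = x → 1 ≤ D p + ord (f ∘ ψ) p) := by
  classical
  choose m hm1 hm using h.exists_mult
  have hdw := h.finite.dirwise
  have hord : ∀ {f : T.Point → ℝ}, f ∈ T.Rat → ∀ p, ord (f ∘ ψ) p = m p * ord f (ψ p) :=
    fun hf p => hdw.ord_comp hf p (hm p)
  -- The fibre over `y` consists of zeros of the pullback of a function with divisor `(y) - (z)`.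
  have hfin : ∀ y, {p | ψ p = y}.Finite := by
    intro y
    obtain ⟨z, hz⟩ := T.exists_ne_point y
    obtain ⟨f, hf⟩ := hT.exists_isDiv y z
    refine (ord_support_finite (hdw.comp_mem_rat hf.1)).subset fun p (hp : ψ p = y) => ?_
    have := hm1 p
    simp only [mem_ofPred_eq]
    rw [hord hf.1, hf.2, hp, Finsupp.single_eq_same, Finsupp.single_eq_of_ne hz.symm]
    simp
    omega
  have hsub : ∀ y, (Function.support fun p => (m p : ℤ) * Finsupp.single y (1 : ℤ) (ψ p)) ⊆
      {p | ψ p = y} := fun y p hp => by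
    by_contra hc
    exact hp (by simp only [Finsupp.single_eq_of_ne hc, mul_zero])
  -- The pullback divisor of the point `y`. It differs from `P t` by the divisor of a pulled back
  -- function, so its degree does not depend on `y`.
  let P : T.Point → Γ.Divisor := fun y =>
    Finsupp.ofSupportFinite (fun p => (m p : ℤ) * Finsupp.single y (1 : ℤ) (ψ p))
      ((hfin y).subset (hsub y))
  have hP : ∀ y p, P y p = (m p : ℤ) * Finsupp.single y (1 : ℤ) (ψ p) := fun y p => rfl
  have hdeg : ∀ y, degree (P y) = degree (P t) := by
    intro y
    obtain ⟨f, hf⟩ := hT.exists_isDiv y t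
    rw [← finsum_add_ord (P t) (hdw.comp_mem_rat hf.1)]
    unfold degree
    rw [← finsum_finsupp]
    refine finsum_congr fun p => ?_
    rw [hord hf.1, hf.2, hP, hP]
    ring
  have hsum : ∀ y, degree (P y) = ((∑ᶠ p : {p : Γ.Point // ψ p = y}, m p.1 : ℕ) : ℤ) := by
    intro y
    have : Finite {p : Γ.Point // ψ p = y} := hfin y
    unfold degree
    rw [← finsum_finsupp, finsum_comp_injective (h := P y) (g := fun p : {p // ψ p = y} => p.1)
      Subtype.val_injective (fun p hp => ⟨⟨p, hsub y hp⟩, rfl⟩)]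
    have := Fintype.ofFinite {p : Γ.Point // ψ p = y}
    rw [finsum_eq_sum_of_fintype, finsum_eq_sum_of_fintype]
    push_cast
    refine Finset.sum_congr rfl fun p _ => ?_
    rw [hP, p.2, Finsupp.single_eq_same, mul_one]
  refine ⟨∑ᶠ p : {p : Γ.Point // ψ p = t}, m p.1, P t, fun ν' => ?_, hsum t, ?_⟩
  · have e := hdeg ν'.base
    rw [hsum, hsum] at e
    rw [← Int.natCast_inj.1 e]
    exact finsum_congr fun p => hm p.1 ν' p.2.symm
  · intro f x hf p
    have e : P t p + ord (f ∘ ψ) p = m p * Finsupp.single x (1 : ℤ) (ψ p) := by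
      rw [hord hf.1, hf.2, hP]; ring
    rw [e]
    refine ⟨fun hp => by rw [Finsupp.single_eq_of_ne hp, mul_zero], fun hp => ?_⟩
    rw [hp, Finsupp.single_eq_same, mul_one]
    exact_mod_cast hm1 p

end MetricGraph
end

/-! ### The slope structure pulled back from a tree, and uniqueness of the pencil on a tree -/

noncomputable section
namespace MetricGraph

variable {Γ T : MetricGraph} {ψ : Γ.Point → T.Point}

/-- The image of a direction. -/
def Dirwise.dir {K : Set ℕ} (h : Dirwise ψ K) (ν : Γ.Dir) : T.Dir := (h ν).choose

/-- The expansion factor along a direction. -/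
def Dirwise.factor {K : Set ℕ} (h : Dirwise ψ K) (ν : Γ.Dir) : ℕ := (h ν).choose_spec.choose

theorem Dirwise.mapsDir {K : Set ℕ} (h : Dirwise ψ K) (ν : Γ.Dir) :
    MapsDir ψ ν (h.dir ν) (h.factor ν) := (h ν).choose_spec.choose_spec.2

theorem Dirwise.dir_base {K : Set ℕ} (h : Dirwise ψ K) (ν : Γ.Dir) :
    (h.dir ν).base = ψ ν.base := (h.mapsDir ν).base.symm

theorem Dirwise.slope_comp {K : Set ℕ} (h : Dirwise ψ K) {f : T.Point → ℝ} (hf : f ∈ T.Rat)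
    (ν : Γ.Dir) : slope (f ∘ ψ) ν = h.factor ν * slope f (h.dir ν) :=
  ((HasSlope.slope hf _).comp (h.mapsDir ν)).slope_eq

/-- A path with values in an edge: the data of a piecewise dilation on one piece. -/
theorem mapsDir_of_dilation {d : Γ.Dart} {d' : T.Dart} {a b c : ℝ} {k : ℕ} (hk : 1 ≤ k)
    (ha : 0 ≤ a) (h : ∀ t ∈ Icc a b,
      c + (k : ℝ) * (t - a) ∈ Icc 0 (T.edgeLen d') ∧
        ψ (Γ.param d t) = T.param d' (c + (k : ℝ) * (t - a))) :
    (∀ ν : Γ.Dir, ν.dart = d → ν.pos ∈ Ico a b → ∃ ν' : T.Dir, ν'.dart = d' ∧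
      ν'.pos = c + k * (ν.pos - a) ∧ MapsDir ψ ν ν' k) ∧
    ∀ ν : Γ.Dir, ν.dart = d.symm → Γ.edgeLen d - ν.pos ∈ Ioc a b → ∃ ν' : T.Dir,
      ν'.dart = d'.symm ∧ ν'.pos = T.edgeLen d' - (c + k * (Γ.edgeLen d - ν.pos - a)) ∧
      MapsDir ψ ν ν' k := by
  have hk0 : (0 : ℝ) < k := by exact_mod_cast hk
  constructor
  · intro ν hd hp
    have hab : a ≤ b := hp.1.trans hp.2.le
    have h1 := (h ν.pos ⟨hp.1, hp.2.le⟩).1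
    have h2 := (h b ⟨hab, le_rfl⟩).1
    have hlt : (k : ℝ) * (ν.pos - a) < k * (b - a) :=
      mul_lt_mul_of_pos_left (by linarith [hp.2]) hk0
    refine ⟨⟨d', c + k * (ν.pos - a), h1.1, by linarith [h2.2]⟩, rfl, rfl, hk, b - ν.pos,
      by linarith [hp.2], fun x hx => ?_⟩
    rw [Dir.move, hd, (h (ν.pos + x) ⟨by linarith [hp.1, hx.1], by linarith [hx.2]⟩).2]
    unfold Dir.move
    congr 1
    simp only
    ring
  · intro ν hd hp
    set u := Γ.edgeLen d - ν.pos with hu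
    have hν := ν.pos_mem
    have h1 := (h u ⟨hp.1.le, hp.2⟩).1
    have h2 := (h a ⟨le_rfl, hp.1.le.trans hp.2⟩).1
    have hpos : 0 < (k : ℝ) * (u - a) := mul_pos hk0 (by linarith [hp.1])
    have hc : 0 ≤ c := by linarith [h2.1]
    have hm : c + k * (u - a) ∈ Ioc 0 (T.edgeLen d') := ⟨by linarith, h1.2⟩
    refine ⟨T.backDir d' (c + k * (u - a)) hm, rfl, rfl, hk, u - a, by linarith [hp.1],
      fun x hx => ?_⟩
    have hkx : (k : ℝ) * x ≤ k * (u - a) := mul_le_mul_of_nonneg_left hx.2.le hk0.le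
    have e : ν.move x = Γ.param d (u - x) := by
      have hm' : Γ.edgeLen d - (ν.pos + x) ∈ Icc 0 (Γ.edgeLen d) :=
        ⟨by linarith [hx.2], by linarith [hx.1, hν.1]⟩
      rw [Dir.move, hd]
      have := Γ.param_symm d hm'
      rw [sub_sub_cancel] at this
      rw [this]
      congr 1
      rw [hu]; ring
    rw [e, (h (u - x) ⟨by linarith [hx.2], by linarith [hx.1, hp.2]⟩).2,
      T.backDir_move d' _ hm ⟨mul_nonneg hk0.le hx.1, by linarith⟩]
    congr 1
    ring

open Classical in
/-- The allowed slopes of the pullbacks of the functions of the series on a tree. -/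
def pullSlope (hT : T.IsTree) {K : Set ℕ} (h : Dirwise ψ K) (t : T.Point) (ν : Γ.Dir)
    (i : Fin 2) : ℤ :=
  h.factor ν * (((i : ℕ) : ℤ) - if hT.Ahead (h.dir ν) t then 1 else 0)

theorem Dirwise.factor_pos {K : Set ℕ} (h : Dirwise ψ K) (ν : Γ.Dir) : 1 ≤ h.factor ν :=
  (h.mapsDir ν).1

theorem exists_free_nhd {A : Set Γ.Point} (hA : A.Finite) (hV : ∀ v, Γ.vert v ∈ A)
    {x : Γ.Point} (hx : x ∉ A) : ∃ (d : Γ.Dart) (a u b : ℝ), 0 ≤ a ∧ a < u ∧ u < b ∧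
      b ≤ Γ.edgeLen d ∧ x = Γ.param d u ∧ ∀ t ∈ Ioo a b, Γ.param d t ∉ A := by
  rcases Γ.point_cases x with ⟨v, rfl⟩ | ⟨d, u, hu, rfl⟩
  · exact absurd (hV v) hx
  · obtain ⟨a, b, h1, h2, h3, -, h5⟩ := Γ.exists_consec hA hV d ⟨hu.1.le, hu.2⟩
    exact ⟨d, a, u, b, h5.nonneg, h1.lt_of_ne fun e => hx (e ▸ h3), h2, h5.le_len, rfl, h5.free⟩

/-- The model is cut at the vertices, at the fibre over `t` and at the breaks of `ψ`. On each
resulting piece `ψ` is a dilation into one edge. The two directions at an interior point then have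
opposite images, so that the rank function is standard; and the piece does not pass over `t`, so
that being ahead does not change along it. -/
theorem exists_pullStructure (hT : T.IsTree) (h : IsFiniteMorphism ψ) {t : T.Point}
    (hfin : {p | ψ p = t}.Finite) :
    ∃ S : SlopeStructure Γ 1, S.s = pullSlope hT h.dirwise t ∧
      ∀ x, S.ρ x = fiberRank fun ν : Γ.Tangent x => h.dirwise.dir ν.1 := by
  classical
  set hd := h.dirwise
  choose B hB using h.2
  set A : Set Γ.Point := (range Γ.vert ∪ {p | ψ p = t}) ∪ ⋃ d, Γ.param d '' (B d : Set ℝ) with hAdef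
  have hA : A.Finite := ((Set.finite_range _).union hfin).union
    (Set.finite_iUnion fun d => (B d).finite_toSet.image _)
  have hV : ∀ v, Γ.vert v ∈ A := fun v => Or.inl (Or.inl ⟨v, rfl⟩)
  have hfree : ∀ (d : Γ.Dart) (a b : ℝ), (∀ u ∈ Ioo a b, Γ.param d u ∉ A) →
      ∀ c ∈ B d, c ∉ Ioo a b := fun d a b hab c hc hc' =>
    hab c hc' (Or.inr (mem_iUnion.2 ⟨d, c, hc, rfl⟩))
  refine ⟨⟨pullSlope hT hd t, fun ν i j hij => ?_, fun x => fiberRank fun ν : Γ.Tangent x =>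
    hd.dir ν.1, fun x => isRankFunction_fiberRank _, A, hA, fun d => by
      rw [param_zero]; exact hV _, fun x hx => fiberRank_eq_stdRank ?_, ?_⟩, rfl, fun x => rfl⟩
  · have := hd.factor_pos ν
    have : (0 : ℤ) < hd.factor ν := by omega
    exact mul_lt_mul_of_pos_left (by simpa using hij) this
  · obtain ⟨d, a, u, b, ha, hau, hub, hb, rfl, hab⟩ := exists_free_nhd hA hV hx
    obtain ⟨k, hk, d', c, hc⟩ := hB d a b ha (hau.trans hub) hb (hfree d a b hab)
    have hu : u ∈ Ioo 0 (Γ.edgeLen d) := ⟨by linarith, by linarith⟩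
    obtain ⟨h1, h2⟩ := mapsDir_of_dilation hk ha hc
    have key : ∀ ν : Γ.Tangent (Γ.param d u), (hd.dir ν.1).dart = d' ∧ ν.1.dart = d ∨
        (hd.dir ν.1).dart = d'.symm ∧ ν.1.dart = d.symm := by
      rintro ⟨ν, hν⟩
      rcases Dir.base_interior hu hν with ⟨e1, e2⟩ | ⟨e1, e2⟩
      · obtain ⟨ν', f1, -, f3⟩ := h1 ν e1 ⟨by linarith, by linarith⟩
        rw [((hd.mapsDir ν).unique f3).1]
        exact Or.inl ⟨f1, e1⟩
      · obtain ⟨ν', f1, -, f3⟩ := h2 ν e1 ⟨by linarith, by linarith⟩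
        rw [((hd.mapsDir ν).unique f3).1]
        exact Or.inr ⟨f1, e1⟩
    have huniq : ∀ ν ν' : Γ.Tangent (Γ.param d u), ν.1.dart = ν'.1.dart → ν = ν' := by
      rintro ⟨ν, hν⟩ ⟨ν', hν'⟩ e
      refine Subtype.ext (Dir.ext' e ?_)
      rcases Dir.base_interior hu hν with ⟨e1, e2⟩ | ⟨e1, e2⟩ <;>
        rcases Dir.base_interior hu hν' with ⟨e1', e2'⟩ | ⟨e1', e2'⟩
      · rw [e2, e2']
      · exact absurd (e1'.symm.trans (e.symm.trans e1)) (dart_symm_ne d)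
      · exact absurd (e1.symm.trans (e.trans e1')) (dart_symm_ne d)
      · rw [e2, e2']
    intro ν ν' e
    simp only at e
    rcases key ν with ⟨e1, e2⟩ | ⟨e1, e2⟩ <;> rcases key ν' with ⟨e1', e2'⟩ | ⟨e1', e2'⟩
    · exact huniq _ _ (e2.trans e2'.symm)
    · rw [e, e1'] at e1; exact absurd e1 (dart_symm_ne d')
    · rw [e, e1'] at e1; exact absurd e1.symm (dart_symm_ne d')
    · exact huniq _ _ (e2.trans e2'.symm)
  · intro d a b ha hb hab ν ν' hνd hν hν'd hν' i
    have hlt : a < b := hν.1.trans_lt hν.2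
    obtain ⟨k, hk, d', c, hc⟩ := hB d a b ha hlt hb (hfree d a b hab)
    have hk0 : (0 : ℝ) < k := by exact_mod_cast hk
    obtain ⟨h1, h2⟩ := mapsDir_of_dilation hk ha hc
    obtain ⟨μ, f1, f2, f3⟩ := h1 ν hνd hν
    obtain ⟨μ', f1', f2', f3'⟩ := h2 ν' hν'd hν'
    obtain ⟨g1, g2⟩ := (hd.mapsDir ν).unique f3
    obtain ⟨g1', g2'⟩ := (hd.mapsDir ν').unique f3'
    -- Otherwise `t` would lie in the image of the open piece, and its preimage there would be a
    -- point of `A`.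
    have hF : ∀ y ∈ Ioo c (c + k * (b - a)), hT.cutFun d' t ≠ y := by
      intro y hy e
      have m1 : (0 : ℝ) ≤ c := by
        have := (hc a ⟨le_rfl, hlt.le⟩).1.1
        linarith
      have m2 := (hc b ⟨hlt.le, le_rfl⟩).1.2
      have ht := hT.eq_param_cutFun d' (x := t) (by rw [e]; exact ⟨by linarith [hy.1], by linarith [hy.2]⟩)
      rw [e] at ht
      have hu1 : a + (y - c) / k < b := by
        have : (y - c) / k < b - a := by rw [div_lt_iff₀ hk0]; linarith [hy.2]
        linarith
      have hu0 : 0 < (y - c) / k := div_pos (by linarith [hy.1]) hk0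
      refine hab (a + (y - c) / k) ⟨by linarith, hu1⟩ (Or.inl (Or.inr ?_))
      change ψ _ = t
      refine (hc _ ⟨by linarith, hu1.le⟩).2.trans (Eq.trans ?_ ht.symm)
      congr 1
      field_simp
      ring
    have hahead : hT.Ahead μ' t ↔ ¬ hT.Ahead μ t := by
      have e := hT.cutFun_add_symm d' t
      have k1 : (k : ℝ) * (ν.pos - a) < k * (b - a) :=
        mul_lt_mul_of_pos_left (by linarith [hν.2]) hk0
      have k2 : 0 ≤ (k : ℝ) * (ν.pos - a) := mul_nonneg hk0.le (by linarith [hν.1])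
      have k3 : 0 < (k : ℝ) * (Γ.edgeLen d - ν'.pos - a) := mul_pos hk0 (by linarith [hν'.1])
      have k4 : (k : ℝ) * (Γ.edgeLen d - ν'.pos - a) ≤ k * (b - a) :=
        mul_le_mul_of_nonneg_left (by linarith [hν'.2]) hk0.le
      unfold IsTree.Ahead
      rw [f1, f1', f2, f2', not_lt]
      have hF' := hF (hT.cutFun d' t)
      constructor
      · intro h
        by_contra! hcon
        exact hF' ⟨by linarith, by linarith⟩ rfl
      · intro h
        by_contra! hcon
        exact hF' ⟨by linarith, by linarith⟩ rfl
    have hi : ((i : ℕ) : ℤ) + ((i.rev : ℕ) : ℤ) = 1 := by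
      have := Fin.val_rev i
      omega
    simp only [pullSlope]
    rw [g1, g1', g2, g2']
    by_cases ha : hT.Ahead μ t
    · rw [if_pos ha, if_neg (fun h => hahead.1 h ha), ← mul_add]
      refine mul_eq_zero_of_right _ ?_
      omega
    · rw [if_neg ha, if_pos (hahead.2 ha), ← mul_add]
      refine mul_eq_zero_of_right _ ?_
      omega

open Classical in
theorem index_comp (hT : T.IsTree) {K : Set ℕ} (hd : Dirwise ψ K) {t x : T.Point}
    {f : T.Point → ℝ} (hf : IsDiv f x t) (ν : Γ.Dir) :
    slope (f ∘ ψ) ν = pullSlope hT hd t ν (if hT.Ahead (hd.dir ν) x then 1 else 0) := by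
  rw [hd.slope_comp hf.1, (hT.hasSlope_isDiv hf _).slope_eq, pullSlope]
  congr 2
  by_cases h : hT.Ahead (hd.dir ν) x
  · simp [h]
  · simp [h]

theorem IsTree.not_ahead_of_base {T : MetricGraph} (hT : T.IsTree) {ν : T.Dir} {x : T.Point}
    (h : ν.base = x) : ¬ hT.Ahead ν x := h ▸ hT.not_ahead_base ν

theorem IsTree.exists_unique_ahead {T : MetricGraph} (hT : T.IsTree) {x y : T.Point} (h : x ≠ y) :
    ∃ ν : T.Dir, ν.base = x ∧ ∀ ν' : T.Dir, ν'.base = x → (hT.Ahead ν' y ↔ ν' = ν) := by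
  classical
  have hs := hT.sum_ahead x y
  rw [Finsupp.single_eq_of_ne h, sub_zero] at hs
  obtain ⟨ν, hν⟩ := exists_single_of_sum_eq_one (fun ν => by split_ifs <;> simp) hs
  refine ⟨ν.1, ν.2, fun ν' h' => ?_⟩
  have := hν ⟨ν', h'⟩
  simp only at this
  constructor
  · intro ha
    rw [if_pos ha] at this
    by_contra hne
    rw [Finsupp.single_eq_of_ne (fun e => hne (congrArg Subtype.val e))] at this
    exact one_ne_zero this
  · intro e
    subst e
    rw [Finsupp.single_eq_same] at this
    by_contra ha
    rw [if_neg ha] at this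
    exact zero_ne_one this

/-- The index of the slope along a direction is `1` exactly when its image points towards `x`. At
points over `x` all indices vanish, giving rank `1`. Elsewhere they form the indicator of the
directions over the single tree direction towards `x`, a whole fibre, nonempty by harmonicity. -/
theorem pullback_index (hT : T.IsTree) (h : IsFiniteHarmonic ψ) {t x : T.Point}
    {S : SlopeStructure Γ 1} (hs : S.s = pullSlope hT h.finite.dirwise t)
    (hρ : ∀ x, S.ρ x = fiberRank fun ν : Γ.Tangent x => h.finite.dirwise.dir ν.1)
    {f : T.Point → ℝ} (hf : IsDiv f x t) (p : Γ.Point) :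
    ∃ a, S.IsIndexAt (f ∘ ψ) p a ∧ IsJump (S.ρ p) a ∧ (ψ p = x → S.ρ p a = 1) := by
  classical
  set hd := h.finite.dirwise
  refine ⟨fun ν => if hT.Ahead (hd.dir ν.1) x then 1 else 0, fun ν => by
    rw [hs]; exact index_comp hT hd hf ν.1, ?_, fun hp => ?_⟩
  · rw [hρ]
    refine isJump_fiberRank ?_
    by_cases hp : ψ p = x
    · exact Or.inl fun ν => if_neg (hT.not_ahead_of_base (by rw [hd.dir_base, ν.2, hp]))
    · obtain ⟨ν', h1, h2⟩ := hT.exists_unique_ahead hp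
      obtain ⟨ν, h3, k, h4⟩ := h.exists_dir_over p ν' h1
      refine Or.inr ⟨ν', ⟨⟨ν, h3⟩, ((hd.mapsDir ν).unique h4).1⟩, fun μ => ?_⟩
      rw [← h2 _ (by rw [hd.dir_base, μ.2])]
      by_cases ha : hT.Ahead (hd.dir μ.1) x <;> simp [ha]
  · rw [hρ]
    exact fiberRank_of_zero _ fun ν => if_neg
      (hT.not_ahead_of_base (by rw [hd.dir_base, ν.2, hp]))

/-- The pullback of the series on a tree along a finite harmonic morphism of degree `d` is a
refined `𝔤^1_d`. -/
theorem IsFiniteHarmonic.isRefined_pullback (hT : T.IsTree) (h : IsFiniteHarmonic ψ)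
    {t : T.Point} {D : Γ.Divisor} (hD : ∀ (f : T.Point → ℝ) (x : T.Point),
      IsDiv f x t → ∀ p, (ψ p ≠ x → D p + ord (f ∘ ψ) p = 0) ∧
        (ψ p = x → 1 ≤ D p + ord (f ∘ ψ) p)) :
    ∃ S : SlopeStructure Γ 1, IsRefinedLinearSeries D S (pullback ψ (treeSeries t)) := by
  classical
  have hfin : {p | ψ p = t}.Finite := by
    refine D.hasFiniteSupport.subset fun p (hp : ψ p = t) => ?_
    have := (hD _ t ⟨const_mem_rat 0, fun z => by rw [ord_const, sub_self]⟩ p).2 hp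
    change 1 ≤ D p + ord (fun _ => (0 : ℝ)) p at this
    rw [ord_const] at this
    simp only [Function.mem_support]
    omega
  obtain ⟨S, hs, hρ⟩ := exists_pullStructure hT h.finite hfin
  have hdw := h.finite.dirwise
  have hnonneg : ∀ {f x}, IsDiv f x t → ∀ p, 0 ≤ D p + ord (f ∘ ψ) p := fun {f x} hf p => by
    by_cases hp : ψ p = x
    · have := (hD f x hf p).2 hp
      omega
    · exact ((hD f x hf p).1 hp).ge
  have hsub : pullback ψ (treeSeries t) ⊆ ratSlope D S := by
    rintro _ ⟨f, hf, rfl⟩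
    obtain ⟨x, hx⟩ := mem_treeSeries_iff.1 hf
    refine ⟨⟨hdw.comp_mem_rat hx.1, hnonneg hx⟩, fun p => ?_⟩
    obtain ⟨a, h1, h2, -⟩ := pullback_index hT h hs hρ hx p
    exact ⟨a, h1, h2⟩
  have hrank : RankCondition D S (pullback ψ (treeSeries t)) := by
    intro E hE hdeg
    obtain ⟨p, hp⟩ := exists_single_of_sum_eq_one hE (by rw [finsum_finsupp]; exact hdeg)
    obtain ⟨f, hf⟩ := hT.exists_isDiv (ψ p) t
    refine ⟨_, ⟨f, mem_treeSeries_iff.2 ⟨_, hf⟩, rfl⟩, fun q => ?_, fun q => ?_⟩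
    · obtain ⟨a, h1, h2, h3⟩ := pullback_index hT h hs hρ hf q
      refine ⟨a, h1, ?_⟩
      rw [hp]
      by_cases hq : q = p
      · subst hq
        rw [h3 rfl, Finsupp.single_eq_same]
      · rw [Finsupp.single_eq_of_ne hq]
        exact h2.1
    · rw [hp]
      by_cases hq : q = p
      · subst hq
        rw [Finsupp.single_eq_same]
        have := (hD f _ hf q).2 rfl
        linarith
      · rw [Finsupp.single_eq_of_ne hq, sub_zero]
        exact hnonneg hf q
  refine ⟨S, ⟨?_, hsub, ?_, ?_, ?_, hrank⟩, ?_, ?_⟩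
  · intro E hE hdeg
    obtain ⟨f, hf, h'⟩ := hrank E hE hdeg
    exact ⟨f, hsub hf, h'⟩
  · rintro _ ⟨f, hf, rfl⟩ _ ⟨g, hg, rfl⟩
    exact ⟨_, min_mem_ratDiv hf hg, rfl⟩
  · rintro _ ⟨f, hf, rfl⟩ c
    exact ⟨_, add_const_mem_ratDiv hf c, rfl⟩
  · intro f _ hf
    -- A uniform limit of pullbacks is constant on the fibres of `ψ`, so it descends along a section
    -- and closedness is inherited from the tree.
    have hsec := Function.surjInv_eq h.surjective
    set σ := Function.surjInv h.surjective
    refine ⟨f ∘ σ, hT.treeSeries_closed fun ε hε => ?_, funext fun p => ?_⟩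
    · obtain ⟨_, ⟨g, hg, rfl⟩, hle⟩ := hf ε hε
      refine ⟨g, hg, fun y => ?_⟩
      have := hle (σ y)
      simp only [Function.comp_apply, hsec] at this
      exact this
    · change f (σ (ψ p)) = f p
      refine eq_of_abs_sub_le_all fun ε hε => ?_
      obtain ⟨_, ⟨g, hg, rfl⟩, hle⟩ := hf (ε / 2) (by positivity)
      have h1 := hle (σ (ψ p))
      have h2 := hle p
      simp only [Function.comp_apply, hsec] at h1 h2
      rw [abs_le] at h1 h2 ⊢
      constructor <;> linarith [h1.1, h1.2, h2.1, h2.2]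
  · intro f hf
    choose g hg hgf using hf
    obtain ⟨c, hc⟩ := hT.tropicallyDependent t g hg
    refine ⟨c, fun p => ?_⟩
    simpa only [← hgf, Function.comp_apply] using hc (ψ p)
  · intro n hn
    by_contra hlt
    have hn0 : n = 0 := by omega
    subst hn0
    -- Tropical rank `0` would make any two functions differ by a constant; `0` and a function with
    -- divisor `(x) - (t)`, for `x ≠ t`, do not.
    obtain ⟨x, hx⟩ := T.exists_ne_point t
    obtain ⟨f, hf⟩ := hT.exists_isDiv x t
    obtain ⟨c, hc⟩ := hn ![(fun _ => 0) ∘ ψ, f ∘ ψ] (by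
      intro i
      fin_cases i
      · exact ⟨_, const_mem_treeSeries t 0, rfl⟩
      · exact ⟨_, mem_treeSeries_iff.2 ⟨x, hf⟩, rfl⟩)
    have hfc : f = fun _ => c 0 - c 1 := by
      funext y
      obtain ⟨p, rfl⟩ := h.surjective y
      obtain ⟨i, j, hij, hk⟩ := hc p
      have h0 := hk 0
      have h1 := hk 1
      have : ∀ i : Fin 2, i = 0 ∨ i = 1 := by decide
      rcases this i with rfl | rfl <;> rcases this j with rfl | rfl
      · exact absurd rfl hij
      · simp at h0 h1
        linarith
      · simp at h0 h1
        linarith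
      · exact absurd rfl hij
    have := hf.2 x
    rw [hfc, ord_const, Finsupp.single_eq_same, Finsupp.single_eq_of_ne hx] at this
    omega

theorem IsIso.isFiniteHarmonic {i : Γ.Point → T.Point} (h : IsIso i) : IsFiniteHarmonic i where
  finite := h.dirwise.isFiniteMorphism
  surjective := h.bij.2
  harmonic p ν₁ ν₂ h₁ h₂ := by rw [h.localDegree p ν₁ h₁, h.localDegree p ν₂ h₂]

theorem mapsDir_id (ν : Γ.Dir) : MapsDir (fun x : Γ.Point => x) ν ν 1 :=
  ⟨le_rfl, 1, one_pos, fun h _ => by simp⟩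

theorem isIso_id (Γ : MetricGraph) : IsIso (fun x : Γ.Point => x) where
  bij := Function.bijective_id
  dirwise ν := ⟨ν, 1, rfl, mapsDir_id ν⟩
  cover ν := ⟨ν, mapsDir_id ν⟩

theorem IsLinearSeries.exists_single {D : Γ.Divisor} {S : SlopeStructure Γ 1}
    {N : Set (Γ.Point → ℝ)} (hN : IsLinearSeries D S N) (hD : degree D = 1) (x : Γ.Point) :
    ∃ f ∈ N, f ∈ Γ.Rat ∧ ∀ z, D z + ord f z = Finsupp.single x (1 : ℤ) z := by
  classical
  obtain ⟨f, hf, -, h⟩ := hN.rank (Finsupp.single x 1)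
    (fun z => by rw [Finsupp.single_apply]; split_ifs <;> simp) (degree_single x)
  have hf' := (hN.subset hf).1
  obtain ⟨y, hy⟩ := exists_single_of_degree_one hD hf'
  have : y = x := by
    by_contra hne
    have := h x
    rw [hy, Finsupp.single_eq_same, Finsupp.single_eq_of_ne (Ne.symm hne)] at this
    omega
  subst this
  exact ⟨f, hf, hf'.1, hy⟩

/-- Existence is the pullback along the identity. For uniqueness, the rank condition and `degree D'
= 1` provide, for each `x`, a function of `N'` moving `D'` to `(x)`; since functions with equal
divisors differ by constants, these and their translates are all of `N'`. -/
theorem IsTree.isUniqueG11 (hT : T.IsTree) (t : T.Point) : IsUniqueG11 t (treeSeries t) := by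
  classical
  constructor
  · obtain ⟨S, hS⟩ := T.isIso_id.isFiniteHarmonic.isRefined_pullback hT (t := t)
      (D := Finsupp.single t 1) (fun f x hf p => by
        have e : Finsupp.single t (1 : ℤ) p + ord (f ∘ fun x => x) p =
            Finsupp.single x (1 : ℤ) p := by
          change _ + ord f p = _
          rw [hf.2, add_sub_cancel]
        rw [e]
        refine ⟨fun h => Finsupp.single_eq_of_ne h, fun h => ?_⟩
        subst h
        rw [Finsupp.single_eq_same])
    refine ⟨S, ?_⟩
    have e : pullback (fun x : T.Point => x) (treeSeries t) = treeSeries t := image_id' _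
    rwa [e] at hS
  · intro D' S' N' hD hN
    obtain ⟨h, -, hr, hh⟩ := hN.exists_single hD t
    refine ⟨h, hr, hh, fun f => ⟨fun hf => ?_, fun hf => ?_⟩⟩
    · have hf' := (hN.subset hf).1
      refine ⟨sub_mem_rat hf'.1 hr, fun x => ?_⟩
      rw [ord_sub hf'.1 hr, ← hh]
      linarith [hf'.2 x]
    · obtain ⟨x, hx⟩ := mem_treeSeries_iff.1 hf
      obtain ⟨g, hg, hgr, hgx⟩ := hN.exists_single hD x
      have hfr : f ∈ T.Rat := by
        have := add_mem_rat hx.1 hr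
        rwa [sub_add_cancel] at this
      have := eq_add_of_ord_eq hfr hgr (fun z => by
        have e1 := hx.2 z
        rw [ord_sub hfr hr] at e1
        linarith [hgx z, hh z]) t
      rw [this]
      exact hN.add_const_mem g hg _

end MetricGraph
end

noncomputable section
namespace MetricGraph

/-! ## Tropical pencils -/

variable {Γ : MetricGraph} {M : Set (Γ.Point → ℝ)} {x₀ : Γ.Point}

/-- The abstract properties of a refined `𝔤^1_d` which govern its reduced functions. -/
structure IsPencil (M : Set (Γ.Point → ℝ)) (x₀ : Γ.Point) : Prop where
  min_mem : ∀ f ∈ M, ∀ g ∈ M, (fun x => min (f x) (g x)) ∈ M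
  add_const_mem : ∀ f ∈ M, ∀ c : ℝ, (fun x => f x + c) ∈ M
  zero_mem : (0 : Γ.Point → ℝ) ∈ M
  dep : TropicallyDependent M 1
  cont : ∀ f ∈ M, Continuous f
  base_le : ∀ f ∈ M, ∀ x, f x₀ ≤ f x
  red_mem : ∀ v, redFun M v ∈ M
  red_le : ∀ v, ∀ f ∈ M, ∀ x, redFun M v x ≤ f x - f v

/-- The height of a point. -/
def height (M : Set (Γ.Point → ℝ)) (x₀ v : Γ.Point) : ℝ := -redFun M v x₀

/-- The reduced function of a point, normalized at the base point. -/
def pot (M : Set (Γ.Point → ℝ)) (x₀ v x : Γ.Point) : ℝ := redFun M v x + height M x₀ v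

/-- The order of the tree attached to a pencil. -/
def Below (M : Set (Γ.Point → ℝ)) (x₀ u w : Γ.Point) : Prop := pot M x₀ w u = height M x₀ u

/-- Two points are equivalent if they are not separated by `M`. -/
def Sim (M : Set (Γ.Point → ℝ)) (u w : Γ.Point) : Prop := ∀ g ∈ M, g u = g w

theorem Sim.symm {u w : Γ.Point} (h : Sim M u w) : Sim M w u := fun g hg => (h g hg).symm

theorem Sim.trans {u w z : Γ.Point} (h : Sim M u w) (h' : Sim M w z) : Sim M u z :=
  fun g hg => (h g hg).trans (h' g hg)

namespace IsPencil

theorem const_mem (h : IsPencil M x₀) (c : ℝ) : (fun _ => c) ∈ M := by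
  have := h.add_const_mem _ h.zero_mem c
  simpa using this

theorem red_self (h : IsPencil M x₀) (v : Γ.Point) : redFun M v v = 0 := by
  have : {y | ∃ g ∈ M, y = g v - g v} = {0} := by
    ext y
    simp only [sub_self, mem_singleton_iff]
    exact ⟨fun ⟨_, _, e⟩ => e, fun e => ⟨_, h.zero_mem, e⟩⟩
  rw [redFun, this, csInf_singleton]

theorem pot_mem (h : IsPencil M x₀) (v : Γ.Point) : pot M x₀ v ∈ M :=
  h.add_const_mem _ (h.red_mem v) _

theorem pot_base (v : Γ.Point) : pot M x₀ v x₀ = 0 := add_neg_cancel _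

theorem pot_self (h : IsPencil M x₀) (v : Γ.Point) : pot M x₀ v v = height M x₀ v := by
  rw [pot, h.red_self, zero_add]

theorem pot_sub_le (h : IsPencil M x₀) {g : Γ.Point → ℝ} (hg : g ∈ M) (v x : Γ.Point) :
    pot M x₀ v x - height M x₀ v ≤ g x - g v := by
  have := h.red_le v g hg x
  rw [pot]; linarith

theorem le_height (h : IsPencil M x₀) {g : Γ.Point → ℝ} (hg : g ∈ M) (v : Γ.Point) :
    g v - g x₀ ≤ height M x₀ v := by
  have := h.red_le v g hg x₀
  rw [height]; linarith

theorem le_height' (h : IsPencil M x₀) {g : Γ.Point → ℝ} (hg : g ∈ M) (h0 : g x₀ = 0)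
    (v : Γ.Point) : g v ≤ height M x₀ v := by
  have := h.le_height hg v
  linarith

theorem pot_le (h : IsPencil M x₀) (v x : Γ.Point) : pot M x₀ v x ≤ height M x₀ v := by
  have := h.pot_sub_le h.zero_mem v x
  simp only [Pi.zero_apply] at this
  linarith

theorem pot_nonneg (h : IsPencil M x₀) (v x : Γ.Point) : 0 ≤ pot M x₀ v x := by
  rw [← pot_base (M := M) (x₀ := x₀) v]
  exact h.base_le _ (h.pot_mem v) x

theorem height_nonneg (h : IsPencil M x₀) (v : Γ.Point) : 0 ≤ height M x₀ v := by
  rw [← h.pot_self]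
  exact h.pot_nonneg v v

theorem height_base (h : IsPencil M x₀) : height M x₀ x₀ = 0 := by
  rw [height, h.red_self, neg_zero]

/-- Normalize by `g` and a dependence to functions `A`, `B` such that the minimum of `0`, `A`, `B`
is attained twice everywhere. If `A` is negative somewhere, then `A = B` wherever one of them is
negative, and the two sets of minima agree. Otherwise both are nonnegative and at each point one of
them is `0`, hence minimal. -/
theorem dichotomy (h : IsPencil M x₀) {g p q : Γ.Point → ℝ} (hg : g ∈ M) (hp : p ∈ M)
    (hq : q ∈ M) :
    (∀ x, (∀ y, p x - g x ≤ p y - g y) ↔ ∀ y, q x - g x ≤ q y - g y) ∨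
      ∀ x, (∀ y, p x - g x ≤ p y - g y) ∨ ∀ y, q x - g x ≤ q y - g y := by
  obtain ⟨c, hc⟩ := h.dep ![g, p, q] (by
    intro i
    fin_cases i
    exacts [hg, hp, hq])
  set A : Γ.Point → ℝ := fun x => (p x + c 1) - (g x + c 0) with hA
  set B : Γ.Point → ℝ := fun x => (q x + c 2) - (g x + c 0) with hB
  have key : ∀ x, (A x = 0 ∧ 0 ≤ B x) ∨ (B x = 0 ∧ 0 ≤ A x) ∨ (A x = B x ∧ A x ≤ 0) := by
    intro x
    obtain ⟨i, j, hij, hk⟩ := hc x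
    have h0 := hk 0
    have h1 := hk 1
    have h2 := hk 2
    simp only [hA, hB]
    fin_cases i <;> fin_cases j <;> simp at hij h0 h1 h2 <;> first
      | exact Or.inl ⟨by linarith, by linarith⟩
      | exact Or.inr (Or.inl ⟨by linarith, by linarith⟩)
      | exact Or.inr (Or.inr ⟨by linarith, by linarith⟩)
  have eA : ∀ x, (∀ y, p x - g x ≤ p y - g y) ↔ ∀ y, A x ≤ A y := fun x =>
    forall_congr' fun y => by
      simp only [hA]
      constructor <;> intro h <;> linarith
  have eB : ∀ x, (∀ y, q x - g x ≤ q y - g y) ↔ ∀ y, B x ≤ B y := fun x =>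
    forall_congr' fun y => by
      simp only [hB]
      constructor <;> intro h <;> linarith
  simp only [eA, eB]
  have hneg : ∀ x, A x < 0 ∨ B x < 0 → A x = B x := fun x hx => by
    rcases key x with h | h | h
    · rcases hx with hx | hx <;> linarith [h.1, h.2]
    · rcases hx with hx | hx <;> linarith [h.1, h.2]
    · exact h.1
  by_cases hex : ∃ z, A z < 0
  · obtain ⟨z, hz⟩ := hex
    have hz' := hneg z (Or.inl hz)
    left
    intro x
    constructor
    · intro hx y
      have e := hneg x (Or.inl ((hx z).trans_lt hz))
      have := hx z
      by_cases hy : B y < 0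
      · rw [← e, ← hneg y (Or.inr hy)]; exact hx y
      · linarith
    · intro hx y
      have h1 := hx z
      have e := hneg x (Or.inr (by linarith))
      by_cases hy : A y < 0
      · rw [e, hneg y (Or.inl hy)]; exact hx y
      · linarith
  · push Not at hex
    have hB0 : ∀ x, 0 ≤ B x := fun x => by
      by_contra! hx
      have := hneg x (Or.inr hx)
      linarith [hex x]
    right
    intro x
    rcases key x with h | h | h
    · exact Or.inl fun y => by rw [h.1]; exact hex y
    · exact Or.inr fun y => by rw [h.1]; exact hB0 y
    · exact Or.inl fun y => h.2.trans (hex y)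

/-- Apply `dichotomy` to `P`, `0`, `Q`: the minima of `-P` are the maxima of `P`. If the two sets
agree, `Q - P` is minimal at `u`; if they cover, it is minimal at `x₀`, where `P` is not maximal
when `0 < c`. Its value is `0` at either point. -/
theorem le_of_max (h : IsPencil M x₀) {P Q : Γ.Point → ℝ} (hP : P ∈ M) (hQ : Q ∈ M)
    (hP0 : P x₀ = 0) (hQ0 : Q x₀ = 0) {c : ℝ} (hPc : ∀ x, P x ≤ c) {u : Γ.Point} (hPu : P u = c)
    (hQu : Q u = c) (x : Γ.Point) : P x ≤ Q x := by
  rcases le_or_gt c 0 with hc | hc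
  · have := h.base_le Q hQ x
    linarith [hPc x]
  · have hx₀ : ¬ ∀ y, (0 : Γ.Point → ℝ) x₀ - P x₀ ≤ (0 : Γ.Point → ℝ) y - P y := fun hy => by
      have := hy u
      simp only [Pi.zero_apply] at this
      linarith
    have hmin : ∀ y, Q x₀ - P x₀ ≤ Q y - P y := by
      rcases h.dichotomy hP h.zero_mem hQ with hd | hd
      · have := (hd u).1 fun y => by
          simp only [Pi.zero_apply]
          linarith [hPc y]
        intro y
        linarith [this y]
      · exact (hd x₀).resolve_left hx₀
    linarith [hmin x]

/-- A function of `M` is determined by its truncation at the value at any point. -/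
theorem eq_of_max (h : IsPencil M x₀) {P Q : Γ.Point → ℝ} (hP : P ∈ M) (hQ : Q ∈ M)
    (hP0 : P x₀ = 0) (hQ0 : Q x₀ = 0) {c : ℝ} (hPc : ∀ x, P x ≤ c) (hQc : ∀ x, Q x ≤ c)
    {u : Γ.Point} (hPu : P u = c) (hQu : Q u = c) : P = Q :=
  funext fun x => le_antisymm (h.le_of_max hP hQ hP0 hQ0 hPc hPu hQu x)
    (h.le_of_max hQ hP hQ0 hP0 hQc hQu hPu x)

/-- Truncations of functions of `M`. -/
theorem min_eq_min (h : IsPencil M x₀) {P Q : Γ.Point → ℝ} (hP : P ∈ M) (hQ : Q ∈ M)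
    (hP0 : P x₀ = 0) (hQ0 : Q x₀ = 0) {c : ℝ} (hc : 0 ≤ c) {u : Γ.Point} (hPu : c ≤ P u)
    (hQu : c ≤ Q u) (x : Γ.Point) : min (P x) c = min (Q x) c :=
  congrFun (h.eq_of_max (P := fun x => min (P x) c) (Q := fun x => min (Q x) c)
    (h.min_mem _ hP _ (h.const_mem c)) (h.min_mem _ hQ _ (h.const_mem c))
    (by simp [hP0, hc]) (by simp [hQ0, hc]) (fun x => min_le_right _ _) (fun x => min_le_right _ _)
    (min_eq_right hPu) (min_eq_right hQu)) x

/-- Let `U v` be the open set where `redFun M v - g` is not minimal. This difference is maximal at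
`v`, so `v ∈ U v` unless it is constant. By `dichotomy` two sets `U v` are equal or disjoint, so if
all contain their point, connectedness forces `U x₀` to be everything; but a continuous function on
a compact space has a minimum. -/
theorem exists_eq_pot (h : IsPencil M x₀) {g : Γ.Point → ℝ} (hg : g ∈ M) :
    ∃ v, ∀ x, g x = pot M x₀ v x + g x₀ := by
  by_contra! hcon
  set U : Γ.Point → Set Γ.Point := fun v =>
    {x | ¬ ∀ y, redFun M v x - g x ≤ redFun M v y - g y} with hU
  have hcont : ∀ v, Continuous fun x => redFun M v x - g x := fun v =>
    (h.cont _ (h.red_mem v)).sub (h.cont _ hg)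
  have hopen : ∀ v, IsOpen (U v) := fun v => by
    have : IsClosed (⋂ y, {x | redFun M v x - g x ≤ redFun M v y - g y}) :=
      isClosed_iInter fun y => isClosed_le (hcont v) continuous_const
    convert this.isOpen_compl using 1
    ext x
    simp [hU]
  have hself : ∀ v, v ∈ U v := fun v hv => by
    obtain ⟨x, hx⟩ := hcon v
    refine hx ?_
    have hall : ∀ y, redFun M v y - g y = - g v := fun y => by
      have h1 := hv y
      have h2 := h.red_le v g hg y
      rw [h.red_self] at h1
      linarith
    have h1 := hall x
    have h2 := hall x₀
    rw [pot, height]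
    linarith
  have hdis : ∀ v w, U v = U w ∨ U v ∩ U w = ∅ := fun v w => by
    rcases h.dichotomy hg (h.red_mem v) (h.red_mem w) with hd | hd
    · left
      ext x
      exact not_congr (hd x)
    · right
      ext x
      simp only [mem_inter_iff, mem_empty_iff_false, iff_false, not_and]
      intro h1 h2
      rcases hd x with h' | h'
      · exact h1 h'
      · exact h2 h'
  have hclosed : IsClosed (U x₀) := by
    rw [← isOpen_compl_iff, isOpen_iff_mem_nhds]
    intro w hw
    refine Filter.mem_of_superset ((hopen w).mem_nhds (hself w)) fun z hz hz' => ?_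
    rcases hdis x₀ w with e | e
    · exact hw (e ▸ hself w)
    · exact (e ▸ (⟨hz', hz⟩ : z ∈ U x₀ ∩ U w) : z ∈ (∅ : Set Γ.Point))
  have huniv := IsClopen.eq_univ ⟨hclosed, hopen x₀⟩ ⟨x₀, hself x₀⟩
  obtain ⟨x, -, hx⟩ := isCompact_univ.exists_isMinOn ⟨x₀, mem_univ _⟩ (hcont x₀).continuousOn
  have : x ∈ U x₀ := huniv ▸ mem_univ x
  exact this fun y => hx (mem_univ y)

/-- Both conditions mean that the potentials of `u` and `w`, truncated at the height of `u`, agree.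
-/
theorem below_iff (h : IsPencil M x₀) {u w : Γ.Point} :
    Below M x₀ u w ↔ pot M x₀ u w = height M x₀ u := by
  have h0 := h.height_nonneg u
  have hm := fun z => h.min_eq_min (h.pot_mem u) (h.pot_mem w) (pot_base u) (pot_base w) h0 (u := z)
  constructor
  · intro hb
    have h1 := h.le_height' (h.pot_mem w) (pot_base w) u
    have e := hm u (h.pot_self u).ge hb.ge w
    have hle : height M x₀ u ≤ height M x₀ w := by
      rw [← hb]; exact h.pot_le w u
    rw [h.pot_self, min_eq_right hle, min_eq_left (h.pot_le u w)] at e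
    exact e
  · intro hb
    have hle : height M x₀ u ≤ height M x₀ w := by
      rw [← hb]; exact h.le_height' (h.pot_mem u) (pot_base u) w
    have e := hm w hb.ge (by rwa [h.pot_self]) u
    rw [h.pot_self, min_self, min_eq_left (h.le_height' (h.pot_mem w) (pot_base w) u)] at e
    exact e.symm

theorem height_le (h : IsPencil M x₀) {u w : Γ.Point} (hb : Below M x₀ u w) :
    height M x₀ u ≤ height M x₀ w := by
  rw [← hb]
  exact h.pot_le w u

theorem pot_below (h : IsPencil M x₀) {u w : Γ.Point} (hb : Below M x₀ u w) (x : Γ.Point) :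
    pot M x₀ u x = min (pot M x₀ w x) (height M x₀ u) := by
  rw [← h.min_eq_min (h.pot_mem u) (h.pot_mem w) (pot_base u) (pot_base w)
    (h.height_nonneg u) (h.pot_self u).ge (ge_of_eq hb), min_eq_left (h.pot_le u x)]

/-- A normalized function of `M` agrees with the potential of `w` after truncation at a common lower
bound of their values at one point. Hence its value at `w`, capped at the height of `u`, is its
value at any `u` below `w`. -/
theorem apply_below (h : IsPencil M x₀) {u w : Γ.Point} (hb : Below M x₀ u w)
    {g : Γ.Point → ℝ} (hg : g ∈ M) (h0 : g x₀ = 0) : g u = min (g w) (height M x₀ u) := by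
  have hgn : ∀ x, 0 ≤ g x := fun x => h0 ▸ h.base_le g hg x
  have hle := h.height_le hb
  have hw := h.pot_self w
  refine le_antisymm (le_min ?_ (h.le_height' hg h0 u)) ?_
  · have := h.min_eq_min hg (h.pot_mem w) h0 (pot_base w) (hgn u) le_rfl
      (by rw [hb]; exact h.le_height' hg h0 u) w
    rw [hw, min_eq_right (a := height M x₀ w)
      ((h.le_height' hg h0 u).trans hle)] at this
    rw [← this]
    exact min_le_left _ _
  · have := h.min_eq_min hg (h.pot_mem w) h0 (pot_base w) (u := w)
      (le_min (hgn w) (h.height_nonneg u)) (min_le_left _ _)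
      (by rw [hw]; exact (min_le_right _ _).trans hle) u
    rw [hb, min_eq_right (min_le_right _ _)] at this
    rw [← this]
    exact min_le_left _ _

theorem below_trans (h : IsPencil M x₀) {u v w : Γ.Point} (h1 : Below M x₀ u v)
    (h2 : Below M x₀ v w) : Below M x₀ u w := by
  unfold Below
  rw [h.apply_below h1 (h.pot_mem w) (pot_base w), show pot M x₀ w v = _ from h2,
    min_eq_right (h.height_le h1)]

theorem below_of_below (h : IsPencil M x₀) {u v w : Γ.Point} (h1 : Below M x₀ u w)
    (h2 : Below M x₀ v w) (hle : height M x₀ u ≤ height M x₀ v) : Below M x₀ u v := by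
  unfold Below
  rw [h.pot_below h2, show pot M x₀ w u = _ from h1, min_eq_left hle]

/-- The potential of `w` truncated at `c` belongs to `M`, so it is the potential of some point; that
point has height `c` and lies below `w`. -/
theorem exists_below (h : IsPencil M x₀) {w : Γ.Point} {c : ℝ} (hc : 0 ≤ c)
    (hcw : c ≤ height M x₀ w) : ∃ u, Below M x₀ u w ∧ height M x₀ u = c := by
  obtain ⟨z, hz⟩ := h.exists_eq_pot (h.min_mem _ (h.pot_mem w) _ (h.const_mem c))
  have hz' : ∀ x, min (pot M x₀ w x) c = pot M x₀ z x := fun x => by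
    rw [hz x, pot_base, min_eq_left hc, add_zero]
  have e1 : height M x₀ z ≤ c := by
    rw [← h.pot_self, ← hz']; exact min_le_right _ _
  have e2 : c ≤ height M x₀ z := by
    have := h.pot_le z w
    rwa [← hz', h.pot_self, min_eq_right hcw] at this
  have e := le_antisymm e1 e2
  refine ⟨z, le_antisymm (h.le_height' (h.pot_mem w) (pot_base w) z) ?_, e⟩
  rw [← h.pot_self z, ← hz']
  exact min_le_left _ _

theorem sim_of_below (h : IsPencil M x₀) {u w : Γ.Point} (hb : Below M x₀ u w)
    (he : height M x₀ u = height M x₀ w) : Sim M u w := by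
  intro g hg
  have := h.apply_below hb (h.add_const_mem g hg (-g x₀)) (add_neg_cancel _)
  rw [min_eq_left] at this
  · linarith
  · rw [he]
    exact h.le_height' (h.add_const_mem g hg (-g x₀)) (add_neg_cancel _) w

theorem height_congr (h : IsPencil M x₀) {u w : Γ.Point} (hs : Sim M u w) :
    height M x₀ u = height M x₀ w := by
  have key : ∀ {u w : Γ.Point}, Sim M u w → height M x₀ u ≤ height M x₀ w := fun {u w} hs => by
    rw [← h.pot_self u, hs _ (h.pot_mem u)]
    exact h.le_height' (h.pot_mem u) (pot_base u) w
  exact le_antisymm (key hs) (key hs.symm)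

theorem below_of_sim (h : IsPencil M x₀) {u w : Γ.Point} (hs : Sim M u w) : Below M x₀ u w := by
  unfold Below
  rw [hs _ (h.pot_mem w), h.pot_self, h.height_congr hs]

theorem sim_of_below_below (h : IsPencil M x₀) {u v w : Γ.Point} (h1 : Below M x₀ u w)
    (h2 : Below M x₀ v w) (he : height M x₀ u = height M x₀ v) : Sim M u v :=
  h.sim_of_below (h.below_of_below h1 h2 he.le) he

theorem sim_iff_pot (h : IsPencil M x₀) {u w : Γ.Point} :
    Sim M u w ↔ pot M x₀ u = pot M x₀ w := by
  constructor
  · intro hs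
    funext x
    rw [h.pot_below (h.below_of_sim hs), h.height_congr hs, min_eq_left (h.pot_le w x)]
  · intro e
    have h1 : Below M x₀ u w := by
      unfold Below; rw [← e, h.pot_self]
    have h2 : Below M x₀ w u := by
      unfold Below; rw [e, h.pot_self]
    exact h.sim_of_below h1 (le_antisymm (h.height_le h1) (h.height_le h2))

theorem isClosed_sim (h : IsPencil M x₀) : IsClosed {p : Γ.Point × Γ.Point | Sim M p.1 p.2} := by
  have : {p : Γ.Point × Γ.Point | Sim M p.1 p.2} = ⋂ g ∈ M, {p | g p.1 = g p.2} := by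
    ext p
    simp [Sim]
  rw [this]
  exact isClosed_biInter fun g hg => isClosed_eq ((h.cont g hg).comp continuous_fst)
    ((h.cont g hg).comp continuous_snd)

end IsPencil

end MetricGraph
end

noncomputable section
namespace MetricGraph

/-! ## Tents -/

/-- `f` is, on `[0, l]`, affine of slope `s₁` up to some point and then affine of slope `s₀`. -/
def IsTent (f : ℝ → ℝ) (l : ℝ) (s₀ s₁ : ℤ) : Prop :=
  ∃ p ∈ Icc 0 l, ∀ t ∈ Icc 0 l, f t = f p + min ((s₁ : ℝ) * (t - p)) (s₀ * (t - p))

/-- Continuous induction: once the slope is `s₀`, the condition `hconc` forbids it to jump back to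
`s₁`, so it stays `s₀` up to `l`. -/
theorem affine_right_of_germs {f : ℝ → ℝ} {l : ℝ} {s₀ s₁ : ℤ} {t : ℝ}
    (hright : ∀ u ∈ Ico t l, ∃ s : ℤ, (s = s₀ ∨ s = s₁) ∧ ∃ ε > 0, ∀ h ∈ Ico 0 ε,
      f (u + h) = f u + s * h)
    (hleft : ∀ u ∈ Ioc t l, ∃ s : ℤ, ∃ ε > 0, ∀ h ∈ Ico 0 ε, f (u - h) = f u + s * h)
    (hconc : ∀ u ∈ Ioo t l, ∀ ε > 0, (∀ h ∈ Ico 0 ε, f (u - h) = f u + (-s₀ : ℤ) * h) →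
      ¬ ∀ h ∈ Ico 0 ε, f (u + h) = f u + s₁ * h)
    (ht : t < l → ∃ ε > 0, ∀ h ∈ Ico 0 ε, f (t + h) = f t + s₀ * h) :
    ∀ u ∈ Icc t l, f u = f t + s₀ * (u - t) := by
  -- The formula is only required strictly before `u`, which makes `S` visibly closed; `key`
  -- recovers the value at `u` from the left germ.
  set S : Set ℝ := {u | ∀ v ∈ Icc t l, v < u → f v = f t + s₀ * (v - t)} with hS
  have key : ∀ u ∈ Ioc t l, u ∈ S → ∃ ε > 0, (∀ h ∈ Ico 0 ε, f (u - h) = f u + (-s₀ : ℤ) * h) ∧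
      f u = f t + s₀ * (u - t) := by
    intro u hu huS
    obtain ⟨s, ε, hε, h⟩ := hleft u hu
    set δ := min ε (u - t) with hδ
    have hδ0 : 0 < δ := lt_min hε (by linarith [hu.1])
    have e : ∀ h' ∈ Ioo 0 δ, f u + s * h' = f t + s₀ * (u - h' - t) := fun h' hh => by
      have h1 := hh.2.trans_le (min_le_left _ _)
      have h2 := hh.2.trans_le (min_le_right _ _)
      rw [← h h' ⟨hh.1.le, h1⟩]
      exact huS _ ⟨by linarith, by linarith [hh.1, hu.2]⟩ (by linarith [hh.1])
    have e1 := e (δ / 2) ⟨by linarith, by linarith⟩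
    have e2 := e (δ / 4) ⟨by linarith, by linarith⟩
    have hs : (s : ℝ) = -s₀ := by
      have : ((s : ℝ) + s₀) * (δ / 4) = 0 := by linarith
      rcases mul_eq_zero.1 this with h' | h'
      · linarith
      · linarith
    refine ⟨ε, hε, fun h' hh => by rw [h h' hh, hs]; push_cast; ring, ?_⟩
    rw [hs] at e1
    linarith
  have hsub : Icc t l ⊆ S := by
    refine IsClosed.Icc_subset_of_forall_exists_gt ?_ (fun v hv hlt => absurd hlt (not_lt.2 hv.1)) ?_
    · have : S = ⋂ v ∈ {v | v ∈ Icc t l ∧ f v ≠ f t + s₀ * (v - t)}, Iic v := by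
        ext u
        simp only [hS, mem_iInter, mem_Iic]
        constructor
        · intro h v hv
          by_contra! hlt
          exact hv.2 (h v hv.1 hlt)
        · intro h v hv hlt
          by_contra hne
          exact absurd (h v ⟨hv, hne⟩) (not_le.2 hlt)
      rw [this]
      exact (isClosed_biInter fun v _ => isClosed_Iic).inter isClosed_Icc
    · intro u hu y hy
      have hgerm : f u = f t + s₀ * (u - t) ∧ ∃ ε > 0, ∀ h ∈ Ico 0 ε, f (u + h) = f u + s₀ * h := by
        rcases eq_or_lt_of_le hu.2.1 with e | hlt
        · subst e
          exact ⟨by ring, ht hu.2.2⟩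
        · obtain ⟨ε, hε, h1, h2⟩ := key u ⟨hlt, hu.2.2.le⟩ hu.1
          refine ⟨h2, ?_⟩
          obtain ⟨s, hs, ε', hε', h3⟩ := hright u hu.2
          rcases hs with rfl | rfl
          · exact ⟨ε', hε', h3⟩
          · exact absurd (fun h (hh : h ∈ Ico 0 (min ε ε')) =>
              h3 h ⟨hh.1, hh.2.trans_le (min_le_right _ _)⟩)
              (hconc u ⟨hlt, hu.2.2⟩ (min ε ε') (lt_min hε hε') fun h hh =>
                h1 h ⟨hh.1, hh.2.trans_le (min_le_left _ _)⟩)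
      obtain ⟨h0, ε, hε, h⟩ := hgerm
      refine ⟨min y (u + ε), fun v hv hlt => ?_, lt_min hy (by linarith), min_le_left _ _⟩
      rcases lt_or_ge v u with hvu | hvu
      · exact hu.1 v hv hvu
      · have := h (v - u) ⟨by linarith, by linarith [hlt.trans_le (min_le_right _ _)]⟩
        rw [add_sub_cancel] at this
        rw [this, h0]; ring
  intro u hu
  rcases eq_or_lt_of_le hu.1 with e | hlt
  · subst e; ring
  · obtain ⟨_, _, _, h⟩ := key u ⟨hlt, hu.2⟩ (hsub hu)
    exact h

theorem isTent_of_germs {f : ℝ → ℝ} {l : ℝ} (hl : 0 ≤ l) {s₀ s₁ : ℤ} (hs : s₀ < s₁)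
    (hf : ContinuousOn f (Icc 0 l))
    (hright : ∀ u ∈ Ico 0 l, ∃ s : ℤ, (s = s₀ ∨ s = s₁) ∧ ∃ ε > 0, ∀ h ∈ Ico 0 ε,
      f (u + h) = f u + s * h)
    (hleft : ∀ u ∈ Ioc 0 l, ∃ s : ℤ, (s = -s₁ ∨ s = -s₀) ∧ ∃ ε > 0, ∀ h ∈ Ico 0 ε,
      f (u - h) = f u + s * h)
    (hconc : ∀ u ∈ Ioo 0 l, ∀ ε > 0, (∀ h ∈ Ico 0 ε, f (u - h) = f u + (-s₀ : ℤ) * h) →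
      ¬ ∀ h ∈ Ico 0 ε, f (u + h) = f u + s₁ * h) : IsTent f l s₀ s₁ := by
  have hs' : (s₀ : ℝ) < s₁ := by exact_mod_cast hs
  -- Subtracting the mean slope makes `s₁` ascending and `s₀` descending, so the peak is a maximum
  -- of the difference: just after it the slope is `s₀`, and just before it `s₁`.
  obtain ⟨p, hp, hmax⟩ := isCompact_Icc.exists_isMaxOn (nonempty_Icc.2 hl)
    (hf.sub (f := f) (g := fun t => ((s₀ : ℝ) + s₁) / 2 * t) (by fun_prop))
  have hmax' : ∀ t ∈ Icc 0 l, f t - ((s₀ : ℝ) + s₁) / 2 * t ≤ f p - ((s₀ : ℝ) + s₁) / 2 * p :=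
    fun t ht => hmax ht
  have hR := affine_right_of_germs (f := f) (s₀ := s₀) (s₁ := s₁)
    (fun u hu => hright u ⟨hp.1.trans hu.1, hu.2⟩)
    (fun u hu => by
      obtain ⟨s, -, h⟩ := hleft u ⟨hp.1.trans_lt hu.1, hu.2⟩
      exact ⟨s, h⟩)
    (fun u hu => hconc u ⟨hp.1.trans_lt hu.1, hu.2⟩) (fun hpl => by
      obtain ⟨s, hs, ε, hε, h⟩ := hright p ⟨hp.1, hpl⟩
      rcases hs with rfl | rfl
      · exact ⟨ε, hε, h⟩
      · have h0 : 0 < min ε (l - p) / 2 := half_pos (lt_min hε (by linarith))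
        have h1 : min ε (l - p) / 2 < min ε (l - p) := half_lt_self (lt_min hε (by linarith))
        have h2 := h1.trans_le (min_le_left _ _)
        have h3 := h1.trans_le (min_le_right _ _)
        have e := hmax' (p + min ε (l - p) / 2) ⟨by linarith [hp.1], by linarith⟩
        rw [h _ ⟨h0.le, h2⟩] at e
        nlinarith)
  -- The left side is the right side of the reflected function; reflection negates and exchanges the
  -- two slopes.
  have hL := affine_right_of_germs (f := fun t => f (l - t)) (l := l) (s₀ := -s₁) (s₁ := -s₀)
    (t := l - p)
    (fun u hu => by
      obtain ⟨s, hs, ε, hε, h⟩ := hleft (l - u) ⟨by linarith [hu.2], by linarith [hu.1, hp.2]⟩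
      exact ⟨s, hs, ε, hε, fun x hx => by rw [← h x hx]; congr 1; ring⟩)
    (fun u hu => by
      obtain ⟨s, -, ε, hε, h⟩ := hright (l - u) ⟨by linarith [hu.2], by linarith [hu.1, hp.2]⟩
      exact ⟨s, ε, hε, fun x hx => by rw [← h x hx]; congr 1; ring⟩)
    (fun u hu ε hε h1 h2 => by
      refine hconc (l - u) ⟨by linarith [hu.2], by linarith [hu.1, hp.2]⟩ ε hε ?_ ?_
      · intro x hx
        rw [← h2 x hx]; congr 1; ring
      · intro x hx
        have := h1 x hx
        rw [neg_neg] at this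
        rw [← this]; congr 1; ring)
    (fun hpl => by
      obtain ⟨s, hs, ε, hε, h⟩ := hleft p ⟨by linarith, hp.2⟩
      rcases hs with rfl | rfl
      · refine ⟨ε, hε, fun x hx => ?_⟩
        rw [sub_sub_cancel, ← h x hx]; congr 1; ring
      · have hp0 : 0 < p := by linarith
        have h0 : 0 < min ε p / 2 := half_pos (lt_min hε hp0)
        have h1 : min ε p / 2 < min ε p := half_lt_self (lt_min hε hp0)
        have h2 := h1.trans_le (min_le_left _ _)
        have h3 := h1.trans_le (min_le_right _ _)
        have e := hmax' (p - min ε p / 2) ⟨by linarith, by linarith [hp.2]⟩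
        rw [h _ ⟨h0.le, h2⟩] at e
        push_cast at e
        nlinarith)
  refine ⟨p, hp, fun t ht => ?_⟩
  rcases le_total p t with h | h
  · rw [hR t ⟨h, ht.2⟩, min_eq_right]
    exact mul_le_mul_of_nonneg_right hs'.le (by linarith)
  · have := hL (l - t) ⟨by linarith, by linarith [ht.1]⟩
    simp only [sub_sub_cancel] at this
    rw [this, min_eq_left]
    · push_cast; ring
    · exact mul_le_mul_of_nonpos_right hs'.le (by linarith)

/-- A tent is determined by its values at the end points. -/
theorem IsTent.eq_min {f : ℝ → ℝ} {l : ℝ} {s₀ s₁ : ℤ} (hs : s₀ < s₁) (h : IsTent f l s₀ s₁)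
    {t : ℝ} (ht : t ∈ Icc 0 l) : f t = min (f 0 + s₁ * t) (f l + s₀ * (t - l)) := by
  have hs' : (s₀ : ℝ) < s₁ := by exact_mod_cast hs
  obtain ⟨p, hp, h⟩ := h
  have hl : 0 ≤ l := ht.1.trans ht.2
  have e1 : ∀ u ∈ Icc 0 l, u ≤ p → f u = f p + s₁ * (u - p) := fun u hu hup => by
    rw [h u hu, min_eq_left (mul_le_mul_of_nonpos_right hs'.le (by linarith))]
  have e2 : ∀ u ∈ Icc 0 l, p ≤ u → f u = f p + s₀ * (u - p) := fun u hu hup => by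
    rw [h u hu, min_eq_right (mul_le_mul_of_nonneg_right hs'.le (by linarith))]
  rw [h t ht, e1 0 ⟨le_rfl, hl⟩ hp.1, e2 l ⟨hl, le_rfl⟩ hp.2, ← min_add_add_left]
  congr 1 <;> ring

theorem IsTent.bounds {f : ℝ → ℝ} {l : ℝ} {s₀ s₁ : ℤ} (hs : s₀ < s₁) (h : IsTent f l s₀ s₁)
    (hl : 0 ≤ l) : f 0 + s₀ * l ≤ f l ∧ f l ≤ f 0 + s₁ * l := by
  have h0 := h.eq_min hs ⟨le_rfl, hl⟩
  have h1 := h.eq_min hs ⟨hl, le_rfl⟩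
  have h2 := min_le_right (f 0 + s₁ * 0) (f l + s₀ * (0 - l))
  have h3 := min_le_left (f 0 + s₁ * l) (f l + s₀ * (l - l))
  constructor <;> linarith

/-- The peak is the intersection of the two lines; the bounds on `B` place it in `[0, l]`. -/
theorem isTent_of_eq_min {f : ℝ → ℝ} {l : ℝ} {s₀ s₁ : ℤ} (hs : s₀ < s₁) {A B : ℝ}
    (h1 : A + s₀ * l ≤ B) (h2 : B ≤ A + s₁ * l)
    (h : ∀ t ∈ Icc 0 l, f t = min (A + s₁ * t) (B + s₀ * (t - l))) : IsTent f l s₀ s₁ := by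
  have hs' : (0 : ℝ) < s₁ - s₀ := by
    have : (s₀ : ℝ) < s₁ := by exact_mod_cast hs
    linarith
  set p := (B - A - s₀ * l) / (s₁ - s₀) with hp
  have e : p * (s₁ - s₀) = B - A - s₀ * l := div_mul_cancel₀ _ hs'.ne'
  have hpm : p ∈ Icc 0 l := by
    constructor
    · exact div_nonneg (by linarith) hs'.le
    · rw [hp, div_le_iff₀ hs']; linarith
  refine ⟨p, hpm, fun t ht => ?_⟩
  have ep : A + s₁ * p = B + s₀ * (p - l) := by linarith
  rw [h t ht, h p hpm, ← ep, min_self, ← min_add_add_left]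
  congr 1
  · ring
  · rw [ep]; ring

/-- Used when an edge is subdivided. If the peak falls outside the subinterval, it is replaced by
the nearer end. -/
theorem IsTent.comp_add {f : ℝ → ℝ} {l : ℝ} {s₀ s₁ : ℤ} (hs : s₀ < s₁) (h : IsTent f l s₀ s₁)
    {a l' : ℝ} (ha : 0 ≤ a) (hl : 0 ≤ l') (hal : a + l' ≤ l) :
    IsTent (fun t => f (a + t)) l' s₀ s₁ := by
  have hs' : (s₀ : ℝ) < s₁ := by exact_mod_cast hs
  obtain ⟨p, hp, h⟩ := h
  have e1 : ∀ u ∈ Icc 0 l, u ≤ p → f u = f p + s₁ * (u - p) := fun u hu hup => by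
    rw [h u hu, min_eq_left (mul_le_mul_of_nonpos_right hs'.le (by linarith))]
  have e2 : ∀ u ∈ Icc 0 l, p ≤ u → f u = f p + s₀ * (u - p) := fun u hu hup => by
    rw [h u hu, min_eq_right (mul_le_mul_of_nonneg_right hs'.le (by linarith))]
  have hm1 : ∀ x : ℝ, 0 ≤ x → min (s₁ * x) (s₀ * x) = s₀ * x := fun x hx =>
    min_eq_right (mul_le_mul_of_nonneg_right hs'.le hx)
  have hm2 : ∀ x : ℝ, x ≤ 0 → min (s₁ * x) (s₀ * x) = s₁ * x := fun x hx =>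
    min_eq_left (mul_le_mul_of_nonpos_right hs'.le hx)
  rcases le_total p a with h1 | h1
  · refine ⟨0, ⟨le_rfl, hl⟩, fun t ht => ?_⟩
    simp only
    rw [hm1 _ (by linarith [ht.1]), e2 (a + t) ⟨by linarith [ht.1], by linarith [ht.2]⟩
      (by linarith [ht.1]), e2 (a + 0) ⟨by linarith, by linarith⟩ (by linarith)]
    ring
  · rcases le_total p (a + l') with h2 | h2
    · refine ⟨p - a, ⟨by linarith, by linarith⟩, fun t ht => ?_⟩
      simp only
      rw [add_sub_cancel, h _ ⟨by linarith [ht.1], by linarith [ht.2]⟩]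
      congr 2 <;> ring
    · refine ⟨l', ⟨hl, le_rfl⟩, fun t ht => ?_⟩
      simp only
      rw [hm2 _ (by linarith [ht.2]), e1 (a + t) ⟨by linarith [ht.1], by linarith [ht.2]⟩
        (by linarith [ht.2]), e1 (a + l') ⟨by linarith, by linarith⟩ (by linarith)]
      ring

end MetricGraph
end

noncomputable section
namespace MetricGraph

/-! ## Series on adapted models -/

variable {Γ Γ₁ : MetricGraph}

/-- The properties of a refined `𝔤^1_d` which do not involve the slope structure. -/
structure IsSeries (D : Γ.Divisor) (M : Set (Γ.Point → ℝ)) : Prop where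
  sub : M ⊆ ratDiv D
  min_mem : ∀ f ∈ M, ∀ g ∈ M, (fun x => min (f x) (g x)) ∈ M
  add_const_mem : ∀ f ∈ M, ∀ c : ℝ, (fun x => f x + c) ∈ M
  zero_mem : (0 : Γ.Point → ℝ) ∈ M
  dep : TropicallyDependent M 1
  closed : ∀ f ∈ ratDiv D, (∀ ε > (0 : ℝ), ∃ g ∈ M, ∀ x, |f x - g x| ≤ ε) → f ∈ M

/-- The model of `Γ` is adapted to the series `M`: the allowed slopes are constant along the
edges. -/
structure IsAdapted (D : Γ.Divisor) (M : Set (Γ.Point → ℝ)) (s₀ s₁ : Γ.Dart → ℤ) : Prop where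
  series : IsSeries D M
  lt : ∀ d, s₀ d < s₁ d
  symm : ∀ d, s₀ d.symm = -s₁ d
  tent : ∀ g ∈ M, ∀ d, IsTent (fun t => g (Γ.param d t)) (Γ.edgeLen d) (s₀ d) (s₁ d)
  rank : ∀ x, ∃ g ∈ M, ∀ ν : Γ.Dir, ν.base = x → slope g ν = s₀ ν.dart
  supp : ∀ x, x ∉ range Γ.vert → D x = 0

/-- The divisor corresponding to `D` under an isometry. -/
def IsIso.div {i : Γ₁.Point → Γ.Point} (hi : IsIso i) (D : Γ.Divisor) : Γ₁.Divisor :=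
  D.comapDomain i hi.bij.1.injOn

theorem IsIso.div_apply {i : Γ₁.Point → Γ.Point} (hi : IsIso i) (D : Γ.Divisor) (x : Γ₁.Point) :
    hi.div D x = D (i x) := rfl

theorem IsIso.comp_mem_ratDiv {i : Γ₁.Point → Γ.Point} (hi : IsIso i) {D : Γ.Divisor}
    {f : Γ.Point → ℝ} : f ∘ i ∈ ratDiv (hi.div D) ↔ f ∈ ratDiv D := by
  constructor
  · rintro ⟨h1, h2⟩
    have hf := hi.comp_mem_rat_iff.1 h1
    refine ⟨hf, fun x => ?_⟩
    obtain ⟨y, rfl⟩ := hi.bij.2 x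
    have := h2 y
    rwa [hi.ord_comp hf, hi.div_apply] at this
  · rintro ⟨h1, h2⟩
    refine ⟨hi.comp_mem_rat_iff.2 h1, fun x => ?_⟩
    rw [hi.ord_comp h1, hi.div_apply]
    exact h2 _

theorem IsIso.isSeries {i : Γ₁.Point → Γ.Point} (hi : IsIso i) {D : Γ.Divisor}
    {M : Set (Γ.Point → ℝ)} (h : IsSeries D M) : IsSeries (hi.div D) (pullback i M) where
  sub := by
    rintro _ ⟨f, hf, rfl⟩
    exact hi.comp_mem_ratDiv.2 (h.sub hf)
  min_mem := by
    rintro _ ⟨f, hf, rfl⟩ _ ⟨g, hg, rfl⟩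
    exact ⟨_, h.min_mem f hf g hg, rfl⟩
  add_const_mem := by
    rintro _ ⟨f, hf, rfl⟩ c
    exact ⟨_, h.add_const_mem f hf c, rfl⟩
  zero_mem := ⟨_, h.zero_mem, rfl⟩
  dep := by
    intro f hf
    choose g hg hgf using hf
    obtain ⟨c, hc⟩ := h.dep g hg
    refine ⟨c, fun p => ?_⟩
    simpa only [← hgf, Function.comp_apply] using hc (i p)
  closed := by
    intro f hf happ
    obtain ⟨j, hj⟩ := hi.bij.2.hasRightInverse
    have hji : ∀ x, j (i x) = x := fun x => hi.bij.1 (hj _)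
    have e : f = (f ∘ j) ∘ i := funext fun x => by simp only [Function.comp_apply, hji]
    rw [e] at hf
    refine ⟨f ∘ j, h.closed _ (hi.comp_mem_ratDiv.1 hf) fun ε hε => ?_, e.symm⟩
    obtain ⟨_, ⟨g, hg, rfl⟩, hle⟩ := happ ε hε
    refine ⟨g, hg, fun x => ?_⟩
    have := hle (j x)
    simp only [Function.comp_apply, hj x] at this
    exact this

theorem IsRefinedLinearSeries.isSeries {D : Γ.Divisor} {S : SlopeStructure Γ 1}
    {M : Set (Γ.Point → ℝ)} (h : IsRefinedLinearSeries D S M) (h0 : (0 : Γ.Point → ℝ) ∈ M) :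
    IsSeries D M where
  sub _ hf := (h.1.subset hf).1
  min_mem := h.1.min_mem
  add_const_mem := h.1.add_const_mem
  zero_mem := h0
  dep := h.2.1
  closed := h.1.closed

theorem slope_comp_of_mapsDir_one {i : Γ₁.Point → Γ.Point} {f : Γ.Point → ℝ}
    (hf : f ∈ Γ.Rat) {μ : Γ₁.Dir} {ν : Γ.Dir} (h : MapsDir i μ ν 1) :
    slope (f ∘ i) μ = slope f ν := by
  have := ((HasSlope.slope hf ν).comp h).slope_eq
  simpa using this

/-- The condition `h'` is what standard rank functions give at interior points of edges: two
outgoing slopes cannot both be the larger one. This is the concavity required by `isTent_of_germs`.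
-/
theorem isTent_of_slopes {g : Γ.Point → ℝ} (hg : g ∈ Γ.Rat) {s₀ s₁ : Γ.Dart → ℤ}
    (hlt : ∀ d, s₀ d < s₁ d) (hsymm : ∀ d, s₀ d.symm = -s₁ d)
    (h : ∀ ν : Γ.Dir, slope g ν = s₀ ν.dart ∨ slope g ν = s₁ ν.dart)
    (h' : ∀ (ν ν' : Γ.Dir), ν.base = ν'.base → ν.base ∉ range Γ.vert → ν ≠ ν' →
      ¬ (slope g ν = s₁ ν.dart ∧ slope g ν' = s₁ ν'.dart)) (d : Γ.Dart) :
    IsTent (fun t => g (Γ.param d t)) (Γ.edgeLen d) (s₀ d) (s₁ d) := by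
  have hsymm' : s₁ d.symm = - s₀ d := by
    have := hsymm d.symm
    rw [SimpleGraph.Dart.symm_symm] at this
    omega
  have hback : ∀ u (hu : u ∈ Ioc 0 (Γ.edgeLen d)), ∃ ε > 0, ∀ h ∈ Ico 0 ε,
      g (Γ.param d (u - h)) = g (Γ.param d u) + slope g (Γ.backDir d u hu) * h := by
    intro u hu
    obtain ⟨ε, hε, he⟩ := HasSlope.slope hg (Γ.backDir d u hu)
    refine ⟨min ε u, lt_min hε hu.1, fun x hx => ?_⟩
    have := he x ⟨hx.1, hx.2.trans_le (min_le_left _ _)⟩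
    rwa [Γ.backDir_move d u hu ⟨hx.1, (hx.2.trans_le (min_le_right _ _)).le⟩,
      Γ.backDir_base] at this
  refine isTent_of_germs (Γ.edgeLen_pos d).le (hlt d)
    ((continuous_of_rat hg).comp (Γ.continuous_param d)).continuousOn ?_ ?_ ?_
  · intro u hu
    obtain ⟨ε, hε, he⟩ := HasSlope.slope hg ⟨d, u, hu⟩
    exact ⟨_, h ⟨d, u, hu⟩, ε, hε, he⟩
  · intro u hu
    obtain ⟨ε, hε, he⟩ := hback u hu
    refine ⟨_, ?_, ε, hε, he⟩
    have := h (Γ.backDir d u hu)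
    rwa [show (Γ.backDir d u hu).dart = d.symm from rfl, hsymm, hsymm'] at this
  · intro u hu ε hε h1 h2
    set ν : Γ.Dir := ⟨d, u, hu.1.le, hu.2⟩
    set ν' := Γ.backDir d u ⟨hu.1, hu.2.le⟩
    refine h' ν ν' (Γ.backDir_base _ _ _).symm ?_ ?_ ⟨?_, ?_⟩
    · rintro ⟨v, hv⟩
      exact Γ.param_ne_vert d hu v hv.symm
    · intro e
      exact dart_symm_ne d (congrArg Dir.dart e).symm
    · exact HasSlope.slope_eq ⟨ε, hε, h2⟩
    · refine HasSlope.slope_eq ⟨min ε u, lt_min hε hu.1, fun x hx => ?_⟩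
      have e1 : ν'.move x = Γ.param d (u - x) :=
        Γ.backDir_move d u _ ⟨hx.1, (hx.2.trans_le (min_le_right _ _)).le⟩
      have e2 : ν'.base = Γ.param d u := Γ.backDir_base _ _ _
      rw [e1, e2, h1 x ⟨hx.1, hx.2.trans_le (min_le_left _ _)⟩]
      change _ = _ + (s₁ d.symm : ℝ) * x
      rw [hsymm']

theorem eq_zero_of_rank_pos {ι : Type} {ρ : (ι → Fin (1 + 1)) → ℤ} (h : IsRankFunction 1 ρ)
    {a : ι → Fin (1 + 1)} (ha : 1 ≤ ρ a) (i : ι) : a i = 0 := by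
  classical
  by_contra hne
  have h1 : a i = 1 := by
    have : ∀ x : Fin (1 + 1), x ≠ 0 → x = 1 := by decide
    exact this _ hne
  have e := h.axis i 1 (Function.update 0 i 1) (by simp) fun j hj => by
    rw [Function.update_of_ne hj]; rfl
  have : ρ a ≤ ρ (Function.update 0 i 1) := by
    refine h.antitone fun j => ?_
    by_cases hj : j = i
    · subst hj; rw [Function.update_self, h1]
    · rw [Function.update_of_ne hj]; exact Fin.zero_le _
  rw [e] at this
  simp at this
  omega

/-- The model of a linear series can be refined to an adapted one. -/
theorem exists_adapted {D : Γ.Divisor} {S : SlopeStructure Γ 1}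
    {M : Set (Γ.Point → ℝ)} (h : IsRefinedLinearSeries D S M) (h0 : (0 : Γ.Point → ℝ) ∈ M) :
    ∃ (Γ₁ : MetricGraph) (i : Γ₁.Point → Γ.Point) (hi : IsIso i) (s₀ s₁ : Γ₁.Dart → ℤ),
      IsAdapted (hi.div D) (pullback i M) s₀ s₁ := by
  classical
  obtain ⟨A, hA, hAV, hstd, hmod⟩ := S.model
  -- Cutting also at the support of `D` leaves no point of `D` in the interior of an edge.
  set B : Set Γ.Point := A ∪ D.support with hB
  have hBV : ∀ v, Γ.vert v ∈ B := fun v => by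
    obtain ⟨d, rfl⟩ := Γ.exists_dart_fst v
    rw [← param_zero]
    exact Or.inl (hAV d)
  obtain ⟨Γ₁, i, hi, hrange, hsub⟩ := Γ.exists_sub B (hA.union D.support.finite_toSet) hBV
  choose e a ha hal hparam hfree using hsub
  have hd := hi.dirwise
  have hvert : ∀ x, i x ∈ B → x ∈ range Γ₁.vert := fun x hx => by
    rw [← hrange] at hx
    obtain ⟨v, hv⟩ := hx
    exact ⟨v, hi.bij.1 hv⟩
  -- the images of the directions
  have hfwd : ∀ μ : Γ₁.Dir, ∃ ν : Γ.Dir, MapsDir i μ ν 1 ∧ ν.dart = e μ.dart ∧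
      ν.pos = a μ.dart + μ.pos := fun μ => by
    have hp := μ.pos_mem
    refine ⟨⟨e μ.dart, a μ.dart + μ.pos, add_nonneg (ha _) hp.1, by linarith [hp.2, hal μ.dart]⟩,
      ⟨le_rfl, Γ₁.edgeLen μ.dart - μ.pos, by linarith [hp.2], fun x hx => ?_⟩, rfl, rfl⟩
    rw [Dir.move, hparam _ _ ⟨by linarith [hp.1, hx.1], by linarith [hx.2]⟩, Dir.move]
    congr 1
    simp only
    push_cast
    ring
  have hbwd : ∀ (d : Γ₁.Dart) (μ : Γ₁.Dir), μ.dart = d.symm → ∃ ν : Γ.Dir, MapsDir i μ ν 1 ∧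
      ν.dart = (e d).symm ∧ Γ.edgeLen (e d) - ν.pos = a d + (Γ₁.edgeLen d - μ.pos) := by
    intro d μ hμ
    have hp := μ.pos_mem
    have hle : Γ₁.edgeLen μ.dart = Γ₁.edgeLen d := by rw [hμ, edgeLen_symm]
    rw [hle] at hp
    have hmem : a d + (Γ₁.edgeLen d - μ.pos) ∈ Ioc 0 (Γ.edgeLen (e d)) :=
      ⟨by linarith [hp.2, ha d], by linarith [hp.1, hal d]⟩
    refine ⟨Γ.backDir (e d) _ hmem, ⟨le_rfl, Γ₁.edgeLen d - μ.pos, by linarith [hp.2],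
      fun x hx => ?_⟩, rfl, sub_sub_cancel _ _⟩
    have hm : Γ₁.edgeLen d - (μ.pos + x) ∈ Icc 0 (Γ₁.edgeLen d) :=
      ⟨by linarith [hx.2], by linarith [hp.1, hx.1]⟩
    rw [Nat.cast_one, one_mul, Γ.backDir_move _ _ _ ⟨hx.1, by linarith [hx.2, ha d]⟩, Dir.move, hμ,
      ← sub_sub_cancel (Γ₁.edgeLen d) (μ.pos + x), param_symm _ _ hm, hparam _ _ hm]
    congr 1
    ring
  -- the slopes are constant along the edges
  have hconst : ∀ (d : Γ₁.Dart) (μ μ' : Γ₁.Dir), μ.dart = d → μ'.dart = d.symm → ∀ j,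
      S.s (hd.dir μ) j + S.s (hd.dir μ') j.rev = 0 := by
    intro d μ μ' hμ hμ' j
    obtain ⟨ν, h1, h2, h3⟩ := hfwd μ
    obtain ⟨ν', h1', h2', h3'⟩ := hbwd d μ' hμ'
    rw [((hd.mapsDir μ).unique h1).1, ((hd.mapsDir μ').unique h1').1]
    have hp := μ.pos_mem
    have hp' := μ'.pos_mem
    rw [hμ] at hp h2 h3
    rw [hμ', edgeLen_symm] at hp'
    refine hmod (e d) (a d) (a d + Γ₁.edgeLen d) (ha d) (hal d) ?_ ν ν' h2
      ⟨by linarith [hp.1], by linarith [hp.2]⟩ h2' ⟨by linarith [hp'.2], by linarith [hp'.1]⟩ j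
    intro t ht hc
    have hm : t - a d ∈ Ioo 0 (Γ₁.edgeLen d) := ⟨by linarith [ht.1], by linarith [ht.2]⟩
    refine hfree d (t - a d) hm (Or.inl ?_)
    rw [hparam d _ (Ioo_subset_Icc_self hm), add_sub_cancel]
    exact hc
  have hconst' : ∀ (μ : Γ₁.Dir) j, S.s (hd.dir μ) j = S.s (hd.dir (Γ₁.dartDir μ.dart)) j := by
    intro μ j
    have h1 := hconst μ.dart μ (Γ₁.dartDir μ.dart.symm) rfl rfl j
    have h2 := hconst μ.dart (Γ₁.dartDir μ.dart) (Γ₁.dartDir μ.dart.symm) rfl rfl j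
    omega
  set σ : Fin (1 + 1) → Γ₁.Dart → ℤ := fun j d => S.s (hd.dir (Γ₁.dartDir d)) j with hσ
  have hlt : ∀ d, σ 0 d < σ 1 d := fun d => S.strictMono _ (by decide)
  have hsymm : ∀ d, σ 0 d.symm = -σ 1 d := fun d => by
    have := hconst d (Γ₁.dartDir d) (Γ₁.dartDir d.symm) rfl rfl 1
    simp only [hσ]
    change _ + S.s _ 0 = 0 at this
    omega
  have hser := h.isSeries h0
  have hf : ∀ f ∈ M, f ∈ Γ.Rat := fun f hf => (hser.sub hf).1
  have hslope : ∀ f ∈ M, ∀ μ : Γ₁.Dir, slope (f ∘ i) μ = slope f (hd.dir μ) := fun f hfM μ =>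
    slope_comp_of_mapsDir_one (hf f hfM) (by
      have := hd.mapsDir μ
      obtain ⟨ν, hν⟩ := hd.maps_one μ
      obtain ⟨e1, e2⟩ := this.unique hν
      rwa [e1])
  have hbase : ∀ μ : Γ₁.Dir, (hd.dir μ).base = i μ.base := hd.dir_base
  refine ⟨Γ₁, i, hi, σ 0, σ 1, hi.isSeries hser, hlt, hsymm, ?_, ?_, ?_⟩
  · rintro _ ⟨f, hfM, rfl⟩ d
    refine isTent_of_slopes (hi.comp_mem_rat_iff.2 (hf f hfM)) hlt hsymm (fun μ => ?_)
      (fun μ μ' hμ hμv hne hc => ?_) d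
    · obtain ⟨α, h1, -⟩ := (h.1.subset hfM).2 (i μ.base)
      have := h1 ⟨hd.dir μ, hbase μ⟩
      rw [hslope f hfM, this, hconst' μ]
      have h2 : ∀ x : Fin (1 + 1), x = 0 ∨ x = 1 := by decide
      rcases h2 (α ⟨hd.dir μ, hbase μ⟩) with e | e <;> rw [e]
      · exact Or.inl rfl
      · exact Or.inr rfl
    · obtain ⟨α, h1, h2, -⟩ := (h.1.subset hfM).2 (i μ.base)
      have hnA : i μ.base ∉ A := fun hA => hμv (hvert _ (Or.inl hA))
      rw [hstd _ hnA] at h2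
      set τ : Γ.Tangent (i μ.base) := ⟨hd.dir μ, hbase μ⟩
      set τ' : Γ.Tangent (i μ.base) := ⟨hd.dir μ', by rw [hbase, hμ]⟩
      have hττ : τ ≠ τ' := fun heq => hne (by
        have e1 : hd.dir μ = hd.dir μ' := congrArg Subtype.val heq
        obtain ⟨ν, hν⟩ := hd.maps_one μ
        obtain ⟨ν', hν'⟩ := hd.maps_one μ'
        have e2 := ((hd.mapsDir μ).unique hν).1
        have e3 := ((hd.mapsDir μ').unique hν').1
        rw [← e2] at hν
        rw [← e3, ← e1] at hν'
        exact MapsDir.injective hi.bij.1 hν hν')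
      have hα : α τ = 1 := by
        have := h1 τ
        rw [← hslope f hfM, hc.1] at this
        exact (S.strictMono _).injective (this.symm.trans (hconst' μ 1).symm)
      have hα' : α τ' = 1 := by
        have := h1 τ'
        rw [← hslope f hfM, hc.2] at this
        exact (S.strictMono _).injective (this.symm.trans (hconst' μ' 1).symm)
      -- Two indices equal to `1` have sum exceeding the rank, so the standard rank is `-1` and the
      -- vector is not a jump.
      unfold stdRank at h2
      rw [if_neg] at h2
      · omega
      · have := Fintype.ofFinite (Γ.Tangent (i μ.base))
        rw [finsum_eq_sum_of_fintype]
        have hle : ∑ k ∈ {τ, τ'}, (α k : ℕ) ≤ ∑ k, (α k : ℕ) :=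
          Finset.sum_le_sum_of_subset (Finset.subset_univ _)
        rw [Finset.sum_pair hττ, hα, hα'] at hle
        simp at hle
        omega
  · intro x
    obtain ⟨f, hfM, h1, -⟩ := h.1.rank (Finsupp.single (i x) 1)
      (fun z => by rw [Finsupp.single_apply]; split_ifs <;> simp) (degree_single _)
    refine ⟨f ∘ i, ⟨f, hfM, rfl⟩, fun μ hμ => ?_⟩
    obtain ⟨α, h2, h3⟩ := h1 (i x)
    rw [Finsupp.single_eq_same] at h3
    have := h2 ⟨hd.dir μ, by rw [hbase, hμ]⟩
    rw [eq_zero_of_rank_pos (S.isRank _) h3] at this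
    rw [hslope f hfM, this, hconst' μ]
  · intro x hx
    rw [hi.div_apply]
    by_contra hne
    exact hx (hvert x (Or.inr (by simpa using hne)))

end MetricGraph
end

/-! ### Reduced functions belong to the series -/

noncomputable section
namespace MetricGraph

theorem IsTent.bounds_at {f : ℝ → ℝ} {l : ℝ} {s₀ s₁ : ℤ} (hs : s₀ < s₁) (h : IsTent f l s₀ s₁)
    {t : ℝ} (ht : t ∈ Icc 0 l) : f 0 + s₀ * t ≤ f t ∧ f t ≤ f 0 + s₁ * t := by
  have hs' : (s₀ : ℝ) < s₁ := by exact_mod_cast hs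
  have e := h.eq_min hs ht
  have hb := (h.bounds hs (ht.1.trans ht.2)).1
  refine ⟨?_, e ▸ min_le_left _ _⟩
  rw [e]
  refine le_min ?_ (by linarith)
  have := mul_le_mul_of_nonneg_right hs'.le ht.1
  linarith

variable {Γ : MetricGraph}

theorem exists_peak {f : Γ.Point → ℝ} {d : Γ.Dart} {s₀ s₁ : ℤ} (hs : s₀ < s₁)
    (h : IsTent (fun t => f (Γ.param d t)) (Γ.edgeLen d) s₀ s₁) : ∃ p ∈ Icc 0 (Γ.edgeLen d),
      (∀ t ∈ Icc 0 (Γ.edgeLen d), ∀ u ∈ Icc 0 (Γ.edgeLen d), p ≤ t → p ≤ u →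
        f (Γ.param d u) - f (Γ.param d t) = s₀ * (u - t)) ∧
      (∀ t ∈ Icc 0 (Γ.edgeLen d), ∀ u ∈ Icc 0 (Γ.edgeLen d), t ≤ p → u ≤ p →
        f (Γ.param d u) - f (Γ.param d t) = s₁ * (u - t)) ∧
      ∀ ν : Γ.Dir, ν.dart = d → (ν.pos < p → HasSlope f ν s₁) ∧ (p ≤ ν.pos → HasSlope f ν s₀) := by
  have hs' : (s₀ : ℝ) < s₁ := by exact_mod_cast hs
  obtain ⟨p, hp, h⟩ := h
  simp only at h
  have e1 : ∀ u ∈ Icc 0 (Γ.edgeLen d), u ≤ p → f (Γ.param d u) = f (Γ.param d p) + s₁ * (u - p) :=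
    fun u hu hup => by
      rw [h u hu, min_eq_left (mul_le_mul_of_nonpos_right hs'.le (by linarith))]
  have e2 : ∀ u ∈ Icc 0 (Γ.edgeLen d), p ≤ u → f (Γ.param d u) = f (Γ.param d p) + s₀ * (u - p) :=
    fun u hu hup => by
      rw [h u hu, min_eq_right (mul_le_mul_of_nonneg_right hs'.le (by linarith))]
  refine ⟨p, hp, fun t ht u hu h1 h2 => by rw [e2 u hu h2, e2 t ht h1]; ring,
    fun t ht u hu h1 h2 => by rw [e1 u hu h2, e1 t ht h1]; ring, ?_⟩
  rintro ν rfl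
  have hν := ν.pos_mem
  constructor
  · intro hlt
    refine ⟨p - ν.pos, by linarith, fun x hx => ?_⟩
    rw [Dir.move, Dir.base, e1 _ ⟨by linarith [hx.1, hν.1], by linarith [hx.2, hp.2]⟩
      (by linarith [hx.2]), e1 _ ν.pos_mem_Icc hlt.le]
    ring
  · intro hle
    refine ⟨Γ.edgeLen ν.dart - ν.pos, by linarith [hν.2], fun x hx => ?_⟩
    rw [Dir.move, Dir.base, e2 _ ⟨by linarith [hx.1, hν.1], by linarith [hx.2]⟩
      (by linarith [hx.1]), e2 _ ν.pos_mem_Icc hle]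
    ring

namespace IsAdapted

variable {D : Γ.Divisor} {M : Set (Γ.Point → ℝ)} {s₀ s₁ : Γ.Dart → ℤ}

theorem mem_rat (h : IsAdapted D M s₀ s₁) {g : Γ.Point → ℝ} (hg : g ∈ M) : g ∈ Γ.Rat :=
  (h.series.sub hg).1

/-- Only two slopes are allowed on each edge, so increments between fixed points are uniformly
bounded; the infimum defining `redFun` is therefore a genuine one. -/
theorem exists_bound (h : IsAdapted D M s₀ s₁) (x y : Γ.Point) :
    ∃ C, ∀ g ∈ M, C ≤ g x - g y := by
  obtain ⟨v₀⟩ : Nonempty Γ.V := inferInstance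
  have hd : ∀ (d : Γ.Dart), ∀ t ∈ Icc 0 (Γ.edgeLen d), ∃ C, ∀ g ∈ M,
      |g (Γ.param d t) - g (Γ.vert d.fst)| ≤ C := fun d t ht => by
    refine ⟨|s₀ d * t| + |s₁ d * t|, fun g hg => ?_⟩
    have := (h.tent g hg d).bounds_at (h.lt d) ht
    simp only [param_zero] at this
    rw [abs_le]
    have h1 := neg_abs_le (s₀ d * t)
    have h2 := abs_nonneg (s₁ d * t)
    have h3 := le_abs_self (s₁ d * t)
    have h4 := abs_nonneg (s₀ d * t)
    constructor <;> linarith [this.1, this.2]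
  have htrans : ∀ {x y z : Γ.Point}, (∃ C, ∀ g ∈ M, |g x - g y| ≤ C) →
      (∃ C, ∀ g ∈ M, |g y - g z| ≤ C) → ∃ C, ∀ g ∈ M, |g x - g z| ≤ C := by
    rintro x y z ⟨C, hC⟩ ⟨C', hC'⟩
    exact ⟨C + C', fun g hg => (abs_sub_le _ (g y) _).trans (add_le_add (hC g hg) (hC' g hg))⟩
  have hv : ∀ v, ∃ C, ∀ g ∈ M, |g (Γ.vert v) - g (Γ.vert v₀)| ≤ C := by
    refine Γ.vert_reachable_induction (v₀ := v₀) ⟨0, fun g _ => by simp⟩ fun d hC => ?_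
    refine htrans ?_ hC
    rw [← param_len]
    exact hd d _ ⟨(Γ.edgeLen_pos d).le, le_rfl⟩
  have hx : ∀ x, ∃ C, ∀ g ∈ M, |g x - g (Γ.vert v₀)| ≤ C := fun x => by
    obtain ⟨d, t, ht, rfl⟩ := Γ.exists_param x
    exact htrans (hd d t ht) (hv _)
  obtain ⟨C, hC⟩ := htrans (hx x) (by
    obtain ⟨C, hC⟩ := hx y
    exact ⟨C, fun g hg => by rw [abs_sub_comm]; exact hC g hg⟩)
  exact ⟨-C, fun g hg => (abs_le.1 (hC g hg)).1⟩

theorem red_le (h : IsAdapted D M s₀ s₁) (v : Γ.Point) {g : Γ.Point → ℝ} (hg : g ∈ M)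
    (x : Γ.Point) : redFun M v x ≤ g x - g v := by
  obtain ⟨C, hC⟩ := h.exists_bound x v
  refine csInf_le ⟨C, ?_⟩ ⟨g, hg, rfl⟩
  rintro _ ⟨g, hg, rfl⟩
  exact hC g hg

theorem le_red (h : IsAdapted D M s₀ s₁) {v x : Γ.Point} {c : ℝ}
    (hc : ∀ g ∈ M, c ≤ g x - g v) : c ≤ redFun M v x := by
  refine le_csInf ⟨_, _, h.series.zero_mem, rfl⟩ ?_
  rintro _ ⟨g, hg, rfl⟩
  exact hc g hg

theorem exists_near (h : IsAdapted D M s₀ s₁) (v x : Γ.Point) {ε : ℝ} (hε : 0 < ε) :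
    ∃ g ∈ M, g v = 0 ∧ g x ≤ redFun M v x + ε := by
  obtain ⟨_, ⟨g, hg, rfl⟩, hlt⟩ := exists_lt_of_csInf_lt (s := {y | ∃ g ∈ M, y = g x - g v})
    ⟨_, _, h.series.zero_mem, rfl⟩ (lt_add_of_pos_right (redFun M v x) hε)
  exact ⟨_, h.series.add_const_mem g hg (-g v), add_neg_cancel _, by linarith⟩

/-- On an edge a tent is the minimum of two lines determined by the values at its ends, and this
formula passes to infima over `M`. -/
theorem red_eq_min (h : IsAdapted D M s₀ s₁) (v : Γ.Point) (d : Γ.Dart) {t : ℝ}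
    (ht : t ∈ Icc 0 (Γ.edgeLen d)) : redFun M v (Γ.param d t) =
      min (redFun M v (Γ.param d 0) + s₁ d * t)
        (redFun M v (Γ.param d (Γ.edgeLen d)) + s₀ d * (t - Γ.edgeLen d)) := by
  have key : ∀ g ∈ M, g (Γ.param d t) = min (g (Γ.param d 0) + s₁ d * t)
      (g (Γ.param d (Γ.edgeLen d)) + s₀ d * (t - Γ.edgeLen d)) := fun g hg =>
    (h.tent g hg d).eq_min (h.lt d) ht
  refine le_antisymm (le_min ?_ ?_) (h.le_red fun g hg => ?_)
  · rw [← sub_le_iff_le_add]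
    refine h.le_red fun g hg => ?_
    have h1 := h.red_le v hg (Γ.param d t)
    rw [key g hg] at h1
    have h2 := min_le_left (g (Γ.param d 0) + s₁ d * t)
      (g (Γ.param d (Γ.edgeLen d)) + s₀ d * (t - Γ.edgeLen d))
    linarith
  · rw [← sub_le_iff_le_add]
    refine h.le_red fun g hg => ?_
    have h1 := h.red_le v hg (Γ.param d t)
    rw [key g hg] at h1
    have h2 := min_le_right (g (Γ.param d 0) + s₁ d * t)
      (g (Γ.param d (Γ.edgeLen d)) + s₀ d * (t - Γ.edgeLen d))
    linarith
  · rw [key g hg, ← min_sub_sub_right]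
    have h1 := h.red_le v hg (Γ.param d 0)
    have h2 := h.red_le v hg (Γ.param d (Γ.edgeLen d))
    exact min_le_min (by linarith) (by linarith)

theorem isTent_red (h : IsAdapted D M s₀ s₁) (v : Γ.Point) (d : Γ.Dart) :
    IsTent (fun t => redFun M v (Γ.param d t)) (Γ.edgeLen d) (s₀ d) (s₁ d) := by
  have hl := (Γ.edgeLen_pos d).le
  refine isTent_of_eq_min (h.lt d) ?_ ?_ fun t ht => h.red_eq_min v d ht
  · refine h.le_red fun g hg => ?_
    have h1 := ((h.tent g hg d).bounds (h.lt d) hl).1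
    have h2 := h.red_le v hg (Γ.param d 0)
    linarith
  · rw [← sub_le_iff_le_add]
    refine h.le_red fun g hg => ?_
    have h1 := ((h.tent g hg d).bounds (h.lt d) hl).2
    have h2 := h.red_le v hg (Γ.param d (Γ.edgeLen d))
    linarith

/-- A limit of functions of the series is in the series. -/
theorem mem_of_limit (h : IsAdapted D M s₀ s₁) {f : Γ.Point → ℝ}
    (hf : ∀ d, IsTent (fun t => f (Γ.param d t)) (Γ.edgeLen d) (s₀ d) (s₁ d))
    (hlim : ∀ ε > (0 : ℝ), ∃ g ∈ M, ∀ x, |f x - g x| ≤ ε) : f ∈ M := by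
  refine h.series.closed f ⟨mem_rat_iff.2 fun ν => ?_, fun x => ?_⟩ hlim
  · obtain ⟨p, -, -, -, hp⟩ := exists_peak (h.lt ν.dart) (hf ν.dart)
    rcases lt_or_ge ν.pos p with h' | h'
    · exact ⟨_, (hp ν rfl).1 h'⟩
    · exact ⟨_, (hp ν rfl).2 h'⟩
  · have key : ∀ ν : Γ.Dir, ∃ η > (0 : ℝ), ∀ g ∈ M, (∀ x, |f x - g x| ≤ η) →
        slope f ν ≤ slope g ν := by
      intro ν
      obtain ⟨p, hp, -, hp1, hp2⟩ := exists_peak (h.lt ν.dart) (hf ν.dart)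
      have hge : ∀ g ∈ M, s₀ ν.dart ≤ slope g ν := fun g hg => by
        obtain ⟨q, -, -, -, hq⟩ := exists_peak (h.lt ν.dart) (h.tent g hg ν.dart)
        rcases lt_or_ge ν.pos q with h' | h'
        · rw [((hq ν rfl).1 h').slope_eq]; exact (h.lt _).le
        · rw [((hq ν rfl).2 h').slope_eq]
      rcases lt_or_ge ν.pos p with h' | h'
      -- If `g` had the lower slope already at `ν`, the increments of `f` and `g` from `ν.pos` to
      -- `p` would differ by at least `p - ν.pos`, whereas closeness allows only two thirds of this.
      · refine ⟨(p - ν.pos) / 3, by linarith, fun g hg hle => ?_⟩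
        rw [((hp2 ν rfl).1 h').slope_eq]
        obtain ⟨q, -, hq1, -, hq⟩ := exists_peak (h.lt ν.dart) (h.tent g hg ν.dart)
        rcases lt_or_ge ν.pos q with h'' | h''
        · rw [((hq ν rfl).1 h'').slope_eq]
        · exfalso
          have e1 := hp1 ν.pos ν.pos_mem_Icc p hp h'.le le_rfl
          have e2 := hq1 ν.pos ν.pos_mem_Icc p hp h'' (h''.trans h'.le)
          have hlt : (s₀ ν.dart : ℝ) + 1 ≤ s₁ ν.dart := by exact_mod_cast h.lt ν.dart
          have e3 := abs_le.1 (hle (Γ.param ν.dart p))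
          have e4 := abs_le.1 (hle (Γ.param ν.dart ν.pos))
          have e5 : ((s₀ ν.dart : ℝ) + 1) * (p - ν.pos) ≤ s₁ ν.dart * (p - ν.pos) :=
            mul_le_mul_of_nonneg_right hlt (by linarith)
          linarith [e3.1, e3.2, e4.1, e4.2]
      · refine ⟨1, one_pos, fun g hg _ => ?_⟩
        rw [((hp2 ν rfl).2 h').slope_eq]
        exact hge g hg
    choose η hη hle using key
    obtain ⟨ν, hν⟩ := Finite.exists_min fun ν : Γ.Tangent x => η ν.1
    obtain ⟨g, hg, hgf⟩ := hlim (η ν.1) (hη _)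
    have h1 := (h.series.sub hg).2 x
    have h2 : ∑ᶠ μ : Γ.Tangent x, slope f μ.1 ≤ ∑ᶠ μ : Γ.Tangent x, slope g μ.1 :=
      finsum_le_finsum' fun μ => hle μ.1 g hg fun y => (hgf y).trans (hν μ)
    unfold ord at h1 ⊢
    linarith

theorem exists_near_all (h : IsAdapted D M s₀ s₁) (v : Γ.Point) {ε : ℝ} (hε : 0 < ε)
    (s : Set Γ.Point) (hs : s.Finite) :
    ∃ g ∈ M, g v = 0 ∧ ∀ x ∈ s, g x ≤ redFun M v x + ε := by
  induction s, hs using Set.Finite.induction_on with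
  | empty => exact ⟨_, h.series.zero_mem, rfl, by simp⟩
  | insert _ _ ih =>
    rename_i y s _ _
    obtain ⟨g, hg, hg0, hle⟩ := ih
    obtain ⟨g', hg', hg0', hle'⟩ := h.exists_near v y hε
    refine ⟨_, h.series.min_mem g hg g' hg', by rw [hg0, hg0', min_self], fun x hx => ?_⟩
    rcases hx with rfl | hx
    · exact (min_le_right _ _).trans hle'
    · exact (min_le_left _ _).trans (hle x hx)

/-- The reduced functions belong to the series. -/
theorem red_mem (h : IsAdapted D M s₀ s₁) (v : Γ.Point) : redFun M v ∈ M := by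
  refine h.mem_of_limit (h.isTent_red v) fun ε hε => ?_
  -- It is enough to approximate at the finitely many vertices: tents on the edges depend
  -- monotonically on their end values.
  obtain ⟨g, hg, hg0, hle⟩ := h.exists_near_all v hε (range Γ.vert) (Set.finite_range _)
  refine ⟨g, hg, fun x => ?_⟩
  have h1 := h.red_le v hg x
  rw [hg0, sub_zero] at h1
  suffices g x ≤ redFun M v x + ε by rw [abs_le]; constructor <;> linarith
  obtain ⟨d, t, ht, rfl⟩ := Γ.exists_param x
  rw [h.red_eq_min v d ht]
  rw [(h.tent g hg d).eq_min (h.lt d) ht, ← min_add_add_right]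
  have ha := hle _ ⟨d.fst, rfl⟩
  have hb := hle _ ⟨d.snd, rfl⟩
  rw [← param_zero] at ha
  rw [← param_len] at hb
  exact min_le_min (by linarith) (by linarith)

/-- If `D` is `x₀`-reduced, the reduced function of `x₀` has zero divisor and is constant; so every
function of `M` has its minimum at `x₀`. -/
theorem isPencil (h : IsAdapted D M s₀ s₁) {x₀ : Γ.Point}
    (hred : ∀ x, ord (redFun M x₀) x = 0) : IsPencil M x₀ where
  min_mem := h.series.min_mem
  add_const_mem := h.series.add_const_mem
  zero_mem := h.series.zero_mem
  dep := h.series.dep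
  cont _ hf := continuous_of_rat (h.mem_rat hf)
  base_le f hf x := by
    have h1 := h.red_le x₀ hf x
    have h2 := eq_of_ord_eq_zero (h.mem_rat (h.red_mem x₀)) hred x x₀
    have h3 : 0 ≤ redFun M x₀ x₀ := h.le_red fun g _ => by rw [sub_self]
    linarith
  red_mem := h.red_mem
  red_le v f hf x := h.red_le v hf x

end IsAdapted

theorem redFun_comp {Γ₁ : MetricGraph} (i : Γ₁.Point → Γ.Point) (M : Set (Γ.Point → ℝ))
    (v : Γ₁.Point) : redFun (pullback i M) v = redFun M (i v) ∘ i := by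
  funext x
  unfold redFun
  simp only [Function.comp_apply]
  congr 1
  ext y
  constructor
  · rintro ⟨_, ⟨g, hg, rfl⟩, rfl⟩
    exact ⟨g, hg, rfl⟩
  · rintro ⟨g, hg, rfl⟩
    exact ⟨_, ⟨g, hg, rfl⟩, rfl⟩

theorem height_comp {Γ₁ : MetricGraph} (i : Γ₁.Point → Γ.Point) (M : Set (Γ.Point → ℝ))
    (x₀ v : Γ₁.Point) : height (pullback i M) x₀ v = height M (i x₀) (i v) := by
  rw [height, redFun_comp]; rfl

theorem sim_comp {Γ₁ : MetricGraph} {i : Γ₁.Point → Γ.Point} {M : Set (Γ.Point → ℝ)}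
    {u w : Γ₁.Point} : Sim (pullback i M) u w ↔ Sim M (i u) (i w) :=
  ⟨fun h g hg => h _ ⟨g, hg, rfl⟩, by rintro h _ ⟨g, hg, rfl⟩; exact h g hg⟩

theorem IsPencil.comp_iso {Γ₁ : MetricGraph} {i : Γ₁.Point → Γ.Point} (hi : IsIso i)
    {M : Set (Γ.Point → ℝ)} {x₀ : Γ₁.Point} (h : IsPencil M (i x₀)) :
    IsPencil (pullback i M) x₀ where
  min_mem := by
    rintro _ ⟨f, hf, rfl⟩ _ ⟨g, hg, rfl⟩
    exact ⟨_, h.min_mem f hf g hg, rfl⟩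
  add_const_mem := by
    rintro _ ⟨f, hf, rfl⟩ c
    exact ⟨_, h.add_const_mem f hf c, rfl⟩
  zero_mem := ⟨_, h.zero_mem, rfl⟩
  dep := by
    intro f hf
    choose g hg hgf using hf
    obtain ⟨c, hc⟩ := h.dep g hg
    refine ⟨c, fun p => ?_⟩
    simpa only [← hgf, Function.comp_apply] using hc (i p)
  cont := by
    rintro _ ⟨f, hf, rfl⟩
    exact (h.cont f hf).comp hi.dirwise.continuous
  base_le := by
    rintro _ ⟨f, hf, rfl⟩ x
    exact h.base_le f hf (i x)
  red_mem v := by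
    rw [redFun_comp]
    exact ⟨_, h.red_mem (i v), rfl⟩
  red_le v := by
    rintro _ ⟨f, hf, rfl⟩ x
    rw [redFun_comp]
    exact h.red_le (i v) f hf (i x)

/-! ## Heights along the edges of an adapted model -/

namespace IsAdapted

variable {D : Γ.Divisor} {M : Set (Γ.Point → ℝ)} {s₀ s₁ : Γ.Dart → ℤ} {x₀ : Γ.Point}

theorem symm' (h : IsAdapted D M s₀ s₁) (d : Γ.Dart) : s₁ d.symm = -s₀ d := by
  have := h.symm d.symm
  rw [SimpleGraph.Dart.symm_symm] at this
  omega

theorem slope_cases (h : IsAdapted D M s₀ s₁) {g : Γ.Point → ℝ} (hg : g ∈ M) (ν : Γ.Dir) :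
    slope g ν = s₀ ν.dart ∨ slope g ν = s₁ ν.dart := by
  obtain ⟨q, -, -, -, hq⟩ := exists_peak (h.lt ν.dart) (h.tent g hg ν.dart)
  rcases lt_or_ge ν.pos q with h' | h'
  · exact Or.inr ((hq ν rfl).1 h').slope_eq
  · exact Or.inl ((hq ν rfl).2 h').slope_eq

/-- The slope `0` of the zero function must be allowed, so one of the two orientations has lower
slope `0`. This is the upward one: along it the height increases. -/
theorem up_or (h : IsAdapted D M s₀ s₁) (d : Γ.Dart) : s₀ d = 0 ∨ s₀ d.symm = 0 := by
  have := h.slope_cases h.series.zero_mem (Γ.dartDir d)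
  rw [show slope (0 : Γ.Point → ℝ) (Γ.dartDir d) = 0 from slope_const 0 _, dartDir_dart] at this
  rw [h.symm]
  omega

/-- The rank condition gives a function with the lower slopes at the base point, and the reduced
function lies below it after normalization there. -/
theorem slope_red (h : IsAdapted D M s₀ s₁) (hp : IsPencil M x₀) (ν : Γ.Dir) :
    slope (redFun M ν.base) ν = s₀ ν.dart := by
  obtain ⟨g, hg, hgs⟩ := h.rank ν.base
  have h1 := HasSlope.slope (h.mem_rat (h.red_mem ν.base)) ν
  have h2 := HasSlope.slope (h.mem_rat hg) ν
  rw [hgs ν rfl] at h2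
  refine (h.slope_cases (h.red_mem ν.base) ν).resolve_right fun hc => ?_
  rw [hc] at h1
  obtain ⟨ε, hε, e1⟩ := h1
  obtain ⟨ε', hε', e2⟩ := h2
  have hm : 0 < min ε ε' / 2 := half_pos (lt_min hε hε')
  have hlt : min ε ε' / 2 < min ε ε' := half_lt_self (lt_min hε hε')
  have e1' := e1 _ ⟨hm.le, hlt.trans_le (min_le_left _ _)⟩
  have e2' := e2 _ ⟨hm.le, hlt.trans_le (min_le_right _ _)⟩
  have h3 := h.red_le ν.base hg (ν.move (min ε ε' / 2))
  rw [hp.red_self] at e1'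
  have hs : (s₀ ν.dart : ℝ) < s₁ ν.dart := by exact_mod_cast h.lt _
  have := mul_lt_mul_of_pos_right hs hm
  linarith

/-- The lower slope at the base point means that the peak of the tent is not beyond it, so the
reduced function is affine from there to the end of the edge. -/
theorem red_right (h : IsAdapted D M s₀ s₁) (hp : IsPencil M x₀) (d : Γ.Dart) {t u : ℝ}
    (ht : 0 ≤ t) (htu : t ≤ u) (hu : u ≤ Γ.edgeLen d) :
    redFun M (Γ.param d t) (Γ.param d u) = s₀ d * (u - t) := by
  rcases eq_or_lt_of_le htu with rfl | hlt
  · rw [hp.red_self]; ring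
  · have h1 := h.slope_red hp ⟨d, t, ht, hlt.trans_le hu⟩
    change slope (redFun M (Γ.param d t)) _ = s₀ d at h1
    obtain ⟨p, -, h2, -, h3⟩ := exists_peak (h.lt d) (h.tent _ (h.red_mem (Γ.param d t)) d)
    have hpt : p ≤ t := by
      by_contra! hc
      rw [((h3 ⟨d, t, ht, hlt.trans_le hu⟩ rfl).1 hc).slope_eq] at h1
      exact (h.lt d).ne' h1
    have := h2 t ⟨ht, htu.trans hu⟩ u ⟨ht.trans htu, hu⟩ hpt (hpt.trans htu)
    rwa [hp.red_self, sub_zero] at this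

theorem red_left (h : IsAdapted D M s₀ s₁) (hp : IsPencil M x₀) (d : Γ.Dart) {t u : ℝ}
    (ht : 0 ≤ t) (htu : t ≤ u) (hu : u ≤ Γ.edgeLen d) :
    redFun M (Γ.param d u) (Γ.param d t) = s₁ d * (t - u) := by
  have := h.red_right hp d.symm (t := Γ.edgeLen d - u) (u := Γ.edgeLen d - t) (by linarith)
    (by linarith) (by rw [edgeLen_symm]; linarith)
  rw [param_symm Γ d ⟨ht.trans htu, hu⟩, param_symm Γ d ⟨ht, htu.trans hu⟩, h.symm] at this
  rw [this]
  push_cast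
  ring

theorem below_of_up (h : IsAdapted D M s₀ s₁) (hp : IsPencil M x₀) {d : Γ.Dart} (hd : s₀ d = 0)
    {t u : ℝ} (ht : 0 ≤ t) (htu : t ≤ u) (hu : u ≤ Γ.edgeLen d) :
    Below M x₀ (Γ.param d t) (Γ.param d u) := by
  rw [hp.below_iff, pot, h.red_right hp d ht htu hu, hd, Int.cast_zero, zero_mul, zero_add]

theorem height_up (h : IsAdapted D M s₀ s₁) (hp : IsPencil M x₀) {d : Γ.Dart} (hd : s₀ d = 0)
    {t u : ℝ} (ht : 0 ≤ t) (htu : t ≤ u) (hu : u ≤ Γ.edgeLen d) :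
    height M x₀ (Γ.param d u) = height M x₀ (Γ.param d t) + s₁ d * (u - t) := by
  have h1 : pot M x₀ (Γ.param d u) (Γ.param d t) = _ := h.below_of_up hp hd ht htu hu
  rw [pot, h.red_left hp d ht htu hu] at h1
  linarith

end IsAdapted

end MetricGraph
end

/-! ### Cutting the model at level sets of the height -/

noncomputable section
namespace MetricGraph

theorem IsTent.congr {f g : ℝ → ℝ} {l : ℝ} {s₀ s₁ : ℤ} (h : IsTent f l s₀ s₁)
    (hfg : ∀ t ∈ Icc 0 l, g t = f t) : IsTent g l s₀ s₁ := by
  obtain ⟨p, hp, h⟩ := h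
  exact ⟨p, hp, fun t ht => by rw [hfg t ht, hfg p hp, h t ht]⟩

variable {Γ : MetricGraph} {D : Γ.Divisor} {M : Set (Γ.Point → ℝ)} {s₀ s₁ : Γ.Dart → ℤ}
  {x₀ : Γ.Point}

namespace IsAdapted

theorem slope_pos (h : IsAdapted D M s₀ s₁) {d : Γ.Dart} (hd : s₀ d = 0) : 0 < s₁ d :=
  hd ▸ h.lt d

theorem slope_pos_real (h : IsAdapted D M s₀ s₁) {d : Γ.Dart} (hd : s₀ d = 0) :
    (0 : ℝ) < s₁ d := by exact_mod_cast h.slope_pos hd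

theorem edgeAffine_height (h : IsAdapted D M s₀ s₁) (hp : IsPencil M x₀) :
    EdgeAffine (height M x₀) := by
  intro d
  have hz : (0 : ℝ) ∈ Icc 0 (Γ.edgeLen d) := ⟨le_rfl, (Γ.edgeLen_pos d).le⟩
  rcases h.up_or d with hd | hd
  · refine ⟨s₁ d, fun t ht => ?_⟩
    rw [h.height_up hp hd le_rfl ht.1 ht.2, param_zero, sub_zero]
  · refine ⟨-s₁ d.symm, fun t ht => ?_⟩
    have := h.height_up hp hd (t := Γ.edgeLen d - t) (u := Γ.edgeLen d - 0) (by linarith [ht.2])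
      (by linarith [ht.1]) (by rw [edgeLen_symm]; linarith)
    rw [param_symm Γ d ht, param_symm Γ d hz, param_zero] at this
    rw [this]
    push_cast
    ring

theorem continuous_height (h : IsAdapted D M s₀ s₁) (hp : IsPencil M x₀) :
    Continuous (height M x₀) := continuous_of_rat (h.edgeAffine_height hp).mem_rat

theorem param_le_iff (h : IsAdapted D M s₀ s₁) (hp : IsPencil M x₀) {d : Γ.Dart} (hd : s₀ d = 0)
    {t u : ℝ} (ht : t ∈ Icc 0 (Γ.edgeLen d)) (hu : u ∈ Icc 0 (Γ.edgeLen d)) :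
    height M x₀ (Γ.param d t) ≤ height M x₀ (Γ.param d u) ↔ t ≤ u := by
  have hs := h.slope_pos_real hd
  rw [h.height_up hp hd le_rfl ht.1 ht.2, h.height_up hp hd le_rfl hu.1 hu.2]
  simp only [sub_zero, add_le_add_iff_left]
  exact mul_le_mul_iff_right₀ hs

theorem height_injOn (h : IsAdapted D M s₀ s₁) (hp : IsPencil M x₀) (d : Γ.Dart) :
    InjOn (fun t => height M x₀ (Γ.param d t)) (Icc 0 (Γ.edgeLen d)) := by
  intro t ht u hu e
  simp only at e
  rcases h.up_or d with hd | hd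
  · exact le_antisymm ((h.param_le_iff hp hd ht hu).1 e.le) ((h.param_le_iff hp hd hu ht).1 e.ge)
  · have ht' : Γ.edgeLen d - t ∈ Icc 0 (Γ.edgeLen d.symm) := by
      rw [edgeLen_symm]; exact ⟨by linarith [ht.2], by linarith [ht.1]⟩
    have hu' : Γ.edgeLen d - u ∈ Icc 0 (Γ.edgeLen d.symm) := by
      rw [edgeLen_symm]; exact ⟨by linarith [hu.2], by linarith [hu.1]⟩
    rw [← param_symm Γ d ht, ← param_symm Γ d hu] at e
    have h1 := (h.param_le_iff hp hd ht' hu').1 e.le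
    have h2 := (h.param_le_iff hp hd hu' ht').1 e.ge
    linarith

theorem below_of_mem_edge (h : IsAdapted D M s₀ s₁) (hp : IsPencil M x₀) {d : Γ.Dart}
    (hd : s₀ d = 0) {t u : ℝ} (ht : t ∈ Icc 0 (Γ.edgeLen d)) (hu : u ∈ Icc 0 (Γ.edgeLen d))
    (hle : height M x₀ (Γ.param d t) ≤ height M x₀ (Γ.param d u)) :
    Below M x₀ (Γ.param d t) (Γ.param d u) :=
  h.below_of_up hp hd ht.1 ((h.param_le_iff hp hd ht hu).1 hle) hu.2

/-- The heights at which the model has to be cut. -/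
theorem exists_levels (h : IsAdapted D M s₀ s₁) (hp : IsPencil M x₀) :
    ∃ L : Set ℝ, L.Finite ∧ 0 ∈ L ∧ (∀ v, height M x₀ (Γ.vert v) ∈ L) ∧
      ∀ (d d' : Γ.Dart), ∀ t ∈ Icc 0 (Γ.edgeLen d), ∀ t' ∈ Icc 0 (Γ.edgeLen d'),
        Sim M (Γ.param d t) (Γ.param d' t') → ∃ u ∈ Icc 0 (Γ.edgeLen d),
          ∃ u' ∈ Icc 0 (Γ.edgeLen d'), Sim M (Γ.param d u) (Γ.param d' u') ∧
            height M x₀ (Γ.param d u) ∈ L ∧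
            height M x₀ (Γ.param d t) ≤ height M x₀ (Γ.param d u) := by
  classical
  -- The equivalent pairs on two given edges form a compact set; its greatest height, a possible
  -- branching height of the two edges, is added to `L`.
  let K : Γ.Dart × Γ.Dart → Set (ℝ × ℝ) := fun e =>
    (Icc 0 (Γ.edgeLen e.1) ×ˢ Icc 0 (Γ.edgeLen e.2)) ∩
      {p | Sim M (Γ.param e.1 p.1) (Γ.param e.2 p.2)}
  have hK : ∀ e, IsCompact (K e) := fun e => (isCompact_Icc.prod isCompact_Icc).inter_right
    (hp.isClosed_sim.preimage (((Γ.continuous_param e.1).comp continuous_fst).prodMk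
      ((Γ.continuous_param e.2).comp continuous_snd)))
  have hmax : ∀ e, ∃ c : ℝ, ∀ p ∈ K e, ∃ q ∈ K e, height M x₀ (Γ.param e.1 q.1) = c ∧
      height M x₀ (Γ.param e.1 p.1) ≤ c := fun e => by
    rcases (K e).eq_empty_or_nonempty with he | he
    · exact ⟨0, fun p hpe => by rw [he] at hpe; exact absurd hpe (notMem_empty p)⟩
    · obtain ⟨q, hq, hqm⟩ := (hK e).exists_isMaxOn he
        (((h.continuous_height hp).comp ((Γ.continuous_param e.1).comp continuous_fst)).continuousOn)
      exact ⟨_, fun p hpe => ⟨q, hq, rfl, hqm hpe⟩⟩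
  choose c hc using hmax
  refine ⟨insert 0 ((range fun v => height M x₀ (Γ.vert v)) ∪ range c),
    ((Set.finite_range _).union (Set.finite_range _)).insert _, mem_insert _ _,
    fun v => mem_insert_of_mem _ (Or.inl ⟨v, rfl⟩), ?_⟩
  intro d d' t ht t' ht' hs
  obtain ⟨q, ⟨⟨hq1, hq2⟩, hqs⟩, e1, e2⟩ := hc (d, d') (t, t') ⟨⟨ht, ht'⟩, hs⟩
  exact ⟨q.1, hq1, q.2, hq2, hqs, mem_insert_of_mem _ (Or.inr ⟨_, e1.symm⟩), e2.trans_eq e1.symm⟩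

end IsAdapted

/-- The model is cut at full level sets of the height, in such a way that equivalent points of
the interiors of edges lie on edges with equivalent end points. -/
structure IsLeveled (M : Set (Γ.Point → ℝ)) (x₀ : Γ.Point) (s₀ : Γ.Dart → ℤ) : Prop where
  base : x₀ ∈ range Γ.vert
  level : ∀ (v : Γ.V) (x : Γ.Point), height M x₀ x = height M x₀ (Γ.vert v) → x ∈ range Γ.vert
  top : ∀ (d d' : Γ.Dart), s₀ d = 0 → s₀ d' = 0 → ∀ t ∈ Ioo 0 (Γ.edgeLen d),
    ∀ t' ∈ Ioo 0 (Γ.edgeLen d'), Sim M (Γ.param d t) (Γ.param d' t') →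
      Sim M (Γ.vert d.snd) (Γ.vert d'.snd)

/-- Full level sets over a finite set of heights are finite, as the height is injective on each
edge. Cutting there keeps the model adapted, and two equivalent interior points then lie below a
branching height, so the upper ends of their edges are equivalent too. -/
theorem exists_leveled (h : IsAdapted D M s₀ s₁) (hp : IsPencil M x₀) :
    ∃ (Γ₂ : MetricGraph) (i : Γ₂.Point → Γ.Point) (hi : IsIso i) (σ₀ σ₁ : Γ₂.Dart → ℤ)
      (x₂ : Γ₂.Point), i x₂ = x₀ ∧ IsAdapted (hi.div D) (pullback i M) σ₀ σ₁ ∧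
        IsLeveled (pullback i M) x₂ σ₀ := by
  classical
  obtain ⟨L, hL, hL0, hLV, hbranch⟩ := h.exists_levels hp
  set A : Set Γ.Point := {x | height M x₀ x ∈ L} with hA
  have hAfin : A.Finite := by
    have hsub : A ⊆ ⋃ d, Γ.param d '' {t ∈ Icc 0 (Γ.edgeLen d) | height M x₀ (Γ.param d t) ∈ L} := by
      intro x hx
      obtain ⟨d, t, ht, rfl⟩ := Γ.exists_param x
      exact mem_iUnion.2 ⟨d, t, ⟨ht, hx⟩, rfl⟩
    refine (Set.finite_iUnion fun d => Set.Finite.image _ ?_).subset hsub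
    refine Set.Finite.of_injOn (f := fun t => height M x₀ (Γ.param d t)) (t := L) ?_ ?_ hL
    · exact fun t ht => ht.2
    · exact (h.height_injOn hp d).mono fun t ht => ht.1
  obtain ⟨Γ₂, i, hi, hrange, hsub⟩ := Γ.exists_sub A hAfin hLV
  choose e a ha hal hparam hfree using hsub
  have hd := hi.dirwise
  have hvert : ∀ x, i x ∈ A ↔ x ∈ range Γ₂.vert := fun x => by
    rw [← hrange]
    constructor
    · rintro ⟨v, hv⟩
      exact ⟨v, hi.bij.1 hv⟩
    · rintro ⟨v, rfl⟩
      exact ⟨v, rfl⟩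
  have hfwd : ∀ μ : Γ₂.Dir, ∃ ν : Γ.Dir, MapsDir i μ ν 1 ∧ ν.dart = e μ.dart := fun μ => by
    have hp := μ.pos_mem
    refine ⟨⟨e μ.dart, a μ.dart + μ.pos, add_nonneg (ha _) hp.1, by linarith [hp.2, hal μ.dart]⟩,
      ⟨le_rfl, Γ₂.edgeLen μ.dart - μ.pos, by linarith [hp.2], fun x hx => ?_⟩, rfl⟩
    rw [Dir.move, hparam _ _ ⟨by linarith [hp.1, hx.1], by linarith [hx.2]⟩, Dir.move]
    congr 1
    simp only
    push_cast
    ring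
  have hsymm : ∀ d, e d.symm = (e d).symm := by
    intro d
    have hl := Γ₂.edgeLen_pos d
    have key : ∀ t ∈ Ioo 0 (Γ₂.edgeLen d), e d.symm = (e d).symm ∨
        a d.symm + t = a d + (Γ₂.edgeLen d - t) := fun t ht => by
      have h1 := hparam d (Γ₂.edgeLen d - t) ⟨by linarith [ht.2], by linarith [ht.1]⟩
      have h2 := hparam d.symm t (by rw [edgeLen_symm]; exact Ioo_subset_Icc_self ht)
      have h3 := param_symm Γ₂ d (t := Γ₂.edgeLen d - t) ⟨by linarith [ht.2], by linarith [ht.1]⟩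
      rw [sub_sub_cancel] at h3
      rw [h3, h1] at h2
      have hls := hal d.symm
      rw [edgeLen_symm] at hls
      rcases Γ.param_eq_interior ⟨by linarith [ha d, ht.2], by linarith [hal d, ht.1]⟩
        ⟨by linarith [ha d.symm, ht.1], by linarith [ht.2]⟩ h2 with ⟨_, e2⟩ | ⟨e1, _⟩
      · exact Or.inr e2
      · exact Or.inl e1
    -- If the reversed new edge ran along the same orientation of the old edge, the positions would
    -- have to agree while moving in opposite directions; two sample points exclude this.
    rcases key (Γ₂.edgeLen d / 2) ⟨by linarith, by linarith⟩ with h1 | h1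
    · exact h1
    · rcases key (Γ₂.edgeLen d / 3) ⟨by linarith, by linarith⟩ with h2 | h2
      · exact h2
      · linarith
  obtain ⟨x₂, hx₂⟩ := hi.bij.2 x₀
  have hinterior : ∀ (d : Γ₂.Dart), ∀ t ∈ Ioo 0 (Γ₂.edgeLen d),
      height M x₀ (Γ.param (e d) (a d + t)) ∉ L := fun d t ht hc => by
    refine hfree d t ht ?_
    rw [hparam d t (Ioo_subset_Icc_self ht)]
    exact hc
  have hslope : ∀ f ∈ M, ∀ μ : Γ₂.Dir, slope (f ∘ i) μ = slope f (hd.dir μ) ∧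
      (hd.dir μ).dart = e μ.dart := fun f hfM μ => by
    obtain ⟨ν, hν, hν'⟩ := hfwd μ
    rw [((hd.mapsDir μ).unique hν).1]
    exact ⟨slope_comp_of_mapsDir_one (h.mem_rat hfM) hν, hν'⟩
  refine ⟨Γ₂, i, hi, fun d => s₀ (e d), fun d => s₁ (e d), x₂, hx₂,
    ⟨hi.isSeries h.series, fun d => h.lt _, fun d => by rw [hsymm, h.symm], ?_, ?_, ?_⟩,
    ⟨?_, ?_, ?_⟩⟩
  · rintro _ ⟨f, hf, rfl⟩ d
    refine ((h.tent f hf (e d)).comp_add (h.lt _) (ha d) (Γ₂.edgeLen_pos d).le (hal d)).congr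
      fun t ht => ?_
    change f (i _) = _
    rw [hparam d t ht]
  · intro x
    obtain ⟨g, hg, hgx⟩ := h.rank (i x)
    refine ⟨g ∘ i, ⟨g, hg, rfl⟩, fun μ hμ => ?_⟩
    obtain ⟨e1, e2⟩ := hslope g hg μ
    rw [e1, hgx _ (by rw [hd.dir_base, hμ]), e2]
  · intro x hx
    rw [hi.div_apply]
    refine h.supp _ fun ⟨v, hv⟩ => hx ((hvert x).1 ?_)
    rw [← hv]
    exact hLV v
  · refine (hvert x₂).1 ?_
    rw [hx₂]
    change height M x₀ x₀ ∈ L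
    rwa [hp.height_base]
  · intro v x hx
    rw [height_comp, height_comp, hx₂] at hx
    refine (hvert x).1 ?_
    have := (hvert (Γ₂.vert v)).2 ⟨v, rfl⟩
    change height M x₀ _ ∈ L at this ⊢
    rwa [hx]
  · intro d d' hd0 hd0' t ht t' ht' hs
    rw [sim_comp, hparam d t (Ioo_subset_Icc_self ht), hparam d' t' (Ioo_subset_Icc_self ht')] at hs
    rw [sim_comp, ← param_len, ← param_len, hparam d _ ⟨(Γ₂.edgeLen_pos d).le, le_rfl⟩,
      hparam d' _ ⟨(Γ₂.edgeLen_pos d').le, le_rfl⟩]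
    have hmem : ∀ (d : Γ₂.Dart), ∀ u ∈ Icc 0 (Γ₂.edgeLen d), a d + u ∈ Icc 0 (Γ.edgeLen (e d)) :=
      fun d u hu => ⟨by linarith [ha d, hu.1], by linarith [hal d, hu.2]⟩
    -- levels above an interior point are above the upper end point
    have hnext : ∀ (d : Γ₂.Dart), s₀ (e d) = 0 → ∀ u ∈ Ioo 0 (Γ₂.edgeLen d), ∀ m ∈ L,
        height M x₀ (Γ.param (e d) (a d + u)) ≤ m →
        height M x₀ (Γ.param (e d) (a d + Γ₂.edgeLen d)) ≤ m := by
      intro d hd u hu m hm hle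
      by_contra! hlt
      have hcont : ContinuousOn (fun w => height M x₀ (Γ.param (e d) (a d + w)))
          (Icc u (Γ₂.edgeLen d)) := by
        refine ((h.continuous_height hp).comp ((Γ.continuous_param _).comp ?_)).continuousOn
        fun_prop
      obtain ⟨w, hw, hwm⟩ := intermediate_value_Icc hu.2.le hcont ⟨hle, hlt.le⟩
      simp only at hwm
      have hwl : w ≠ Γ₂.edgeLen d := by
        rintro rfl
        exact hlt.ne' hwm
      refine hinterior d w ⟨hu.1.trans_le hw.1, lt_of_le_of_ne hw.2 hwl⟩ ?_
      rwa [hwm]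
    have htopL : ∀ d, height M x₀ (Γ.param (e d) (a d + Γ₂.edgeLen d)) ∈ L := fun d => by
      have := (hvert (Γ₂.vert d.snd)).2 ⟨_, rfl⟩
      rw [← param_len, hparam d _ ⟨(Γ₂.edgeLen_pos d).le, le_rfl⟩] at this
      exact this
    have hmono : ∀ (d : Γ₂.Dart), s₀ (e d) = 0 → ∀ u ∈ Ioo 0 (Γ₂.edgeLen d),
        height M x₀ (Γ.param (e d) (a d + u)) ≤
          height M x₀ (Γ.param (e d) (a d + Γ₂.edgeLen d)) := fun d hd u hu =>
      (h.param_le_iff hp hd (hmem d u (Ioo_subset_Icc_self hu))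
        (hmem d _ ⟨(Γ₂.edgeLen_pos d).le, le_rfl⟩)).2 (by linarith [hu.2])
    have hh := hp.height_congr hs
    -- The equivalence of the two edges persists up to the height of `u`, which is in `L`. No height
    -- in `L` occurs inside the new edges, so their upper ends lie below `u` and `u'`, at a common
    -- height.
    obtain ⟨u, hu, u', hu', hsim, huL, hle⟩ := hbranch _ _ _ (hmem d t (Ioo_subset_Icc_self ht)) _
      (hmem d' t' (Ioo_subset_Icc_self ht')) hs
    have b1 := h.below_of_mem_edge hp hd0 (hmem d _ ⟨(Γ₂.edgeLen_pos d).le, le_rfl⟩) hu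
      (hnext d hd0 t ht _ huL hle)
    have b2 := h.below_of_mem_edge hp hd0' (hmem d' _ ⟨(Γ₂.edgeLen_pos d').le, le_rfl⟩) hu'
      (hnext d' hd0' t' ht' _ (by rw [← hp.height_congr hsim]; exact huL)
        (by rw [← hp.height_congr hsim, ← hh]; exact hle))
    refine hp.sim_of_below_below b1 (hp.below_trans b2 (hp.below_of_sim hsim.symm)) ?_
    refine le_antisymm (hnext d hd0 t ht _ (htopL d') ?_) (hnext d' hd0' t' ht' _ (htopL d) ?_)
    · rw [hh]; exact hmono d' hd0' t' ht'
    · rw [← hh]; exact hmono d hd0 t ht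

end MetricGraph
end

noncomputable section
namespace MetricGraph

/-! ## Simplicial maps -/

/-- A map between the models of two metric graphs which maps each edge to an edge, by a dilation
with positive integral factor. -/
structure Simp (Γ T : MetricGraph) where
  f : Γ.V → T.V
  k : Γ.Dart → ℕ
  adj : ∀ d : Γ.Dart, T.G.Adj (f d.fst) (f d.snd)
  k_pos : ∀ d, 1 ≤ k d
  k_symm : ∀ d, k d.symm = k d
  len : ∀ d : Γ.Dart, T.len s(f d.fst, f d.snd) = k d * Γ.edgeLen d

namespace Simp

variable {Γ T : MetricGraph} (σ : Simp Γ T)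

/-- The image of an edge. -/
def dart (d : Γ.Dart) : T.Dart := ⟨(σ.f d.fst, σ.f d.snd), σ.adj d⟩

theorem dart_symm (d : Γ.Dart) : σ.dart d.symm = (σ.dart d).symm := rfl

theorem dart_fst (d : Γ.Dart) : (σ.dart d).fst = σ.f d.fst := rfl

theorem edgeLen_dart (d : Γ.Dart) : T.edgeLen (σ.dart d) = σ.k d * Γ.edgeLen d := σ.len d

theorem k_pos_real (d : Γ.Dart) : (0 : ℝ) < σ.k d := by exact_mod_cast σ.k_pos d

theorem exists_map : ∃ φ : Γ.Point → T.Point, ∀ d, ∀ t ∈ Icc 0 (Γ.edgeLen d),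
    φ (Γ.param d t) = T.param (σ.dart d) (σ.k d * t) := by
  refine Γ.glue (fun v => T.vert (σ.f v)) (fun d t => T.param (σ.dart d) (σ.k d * t)) (fun d => by
    rw [mul_zero, param_zero]; rfl) fun d t ht => ?_
  have hk := (σ.k_pos_real d).le
  rw [dart_symm, k_symm, mul_sub, ← edgeLen_dart, param_symm]
  rw [edgeLen_dart]
  exact ⟨mul_nonneg hk ht.1, mul_le_mul_of_nonneg_left ht.2 hk⟩

/-- The map of metric graphs given by a simplicial map. -/
def map : Γ.Point → T.Point := σ.exists_map.choose

theorem map_param (d : Γ.Dart) {t : ℝ} (ht : t ∈ Icc 0 (Γ.edgeLen d)) :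
    σ.map (Γ.param d t) = T.param (σ.dart d) (σ.k d * t) := σ.exists_map.choose_spec d t ht

theorem map_vert (v : Γ.V) : σ.map (Γ.vert v) = T.vert (σ.f v) := by
  obtain ⟨d, rfl⟩ := Γ.exists_dart_fst v
  rw [← param_zero, σ.map_param d ⟨le_rfl, (Γ.edgeLen_pos d).le⟩, mul_zero, param_zero]
  rfl

theorem mem_Icc (d : Γ.Dart) {t : ℝ} (ht : t ∈ Icc 0 (Γ.edgeLen d)) :
    σ.k d * t ∈ Icc 0 (T.edgeLen (σ.dart d)) := by
  rw [edgeLen_dart]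
  exact ⟨mul_nonneg (σ.k_pos_real d).le ht.1, mul_le_mul_of_nonneg_left ht.2 (σ.k_pos_real d).le⟩

theorem mem_Ioo (d : Γ.Dart) {t : ℝ} (ht : t ∈ Ioo 0 (Γ.edgeLen d)) :
    σ.k d * t ∈ Ioo 0 (T.edgeLen (σ.dart d)) := by
  rw [edgeLen_dart]
  exact ⟨mul_pos (σ.k_pos_real d) ht.1, mul_lt_mul_of_pos_left ht.2 (σ.k_pos_real d)⟩

theorem mapsDir (ν : Γ.Dir) : ∃ ν' : T.Dir, ν'.dart = σ.dart ν.dart ∧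
    ν'.pos = σ.k ν.dart * ν.pos ∧ MapsDir σ.map ν ν' (σ.k ν.dart) := by
  have := (mapsDir_of_dilation (ψ := σ.map) (d := ν.dart) (d' := σ.dart ν.dart) (a := 0)
    (b := Γ.edgeLen ν.dart) (c := 0) (σ.k_pos ν.dart) le_rfl fun t ht => by
      rw [zero_add, sub_zero]
      exact ⟨σ.mem_Icc _ ht, σ.map_param _ ht⟩).1 ν rfl ν.pos_mem
  simpa using this

theorem dirwise : Dirwise σ.map {k | 1 ≤ k} := fun ν => by
  obtain ⟨ν', -, -, h⟩ := σ.mapsDir ν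
  exact ⟨ν', _, σ.k_pos _, h⟩

theorem expansion_dart (d : Γ.Dart) {E : T.Dart} [Decidable (σ.dart d = E)] :
    expansion σ.map (Γ.dartDir d) (T.dartDir E) = if σ.dart d = E then σ.k d else 0 := by
  obtain ⟨ν', h1, h2, h3⟩ := σ.mapsDir (Γ.dartDir d)
  have e : ν' = T.dartDir (σ.dart d) := Dir.ext' h1 (by rw [h2]; simp)
  subst e
  by_cases h : σ.dart d = E
  · subst h
    rw [if_pos rfl, expansion_eq h3]
    rfl
  · rw [if_neg h]
    exact expansion_ne h3 fun h' => h (congrArg Dir.dart h').symm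

open Classical in
/-- The sum of the factors of the edges at `v` over the edge `E`. -/
def mult (v : Γ.V) (E : T.Dart) : ℕ :=
  ∑ᶠ d : {d : Γ.Dart // d.fst = v}, if σ.dart d.1 = E then σ.k d.1 else 0

open Classical in
theorem mult_eq (v : Γ.V) (E : T.Dart) :
    σ.mult v E = ∑ᶠ d : Γ.Dart, if d.fst = v ∧ σ.dart d = E then σ.k d else 0 := by
  unfold mult
  rw [finsum_comp_injective (g := fun d : {d : Γ.Dart // d.fst = v} => d.1) Subtype.val_injective]
  · exact finsum_congr fun d => by simp [d.2]
  · intro d hd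
    by_contra hn
    exact hd (if_neg fun h => hn ⟨⟨d, h.1⟩, rfl⟩)

theorem localDegree_vert (v : Γ.V) (E : T.Dart) :
    localDegree σ.map (Γ.vert v) (T.dartDir E) = σ.mult v E := by
  classical
  unfold localDegree mult
  rw [finsum_tangent_vert v fun ν => expansion σ.map ν (T.dartDir E)]
  exact finsum_congr fun d => σ.expansion_dart d.1

theorem localDegree_interior {d : Γ.Dart} {t : ℝ} (ht : t ∈ Ioo 0 (Γ.edgeLen d)) {ν' : T.Dir}
    (hν : ν'.base = σ.map (Γ.param d t)) :
    localDegree σ.map (Γ.param d t) ν' = σ.k d := by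
  have ht' : Γ.edgeLen d - t ∈ Ico 0 (Γ.edgeLen d.symm) := by
    rw [edgeLen_symm]
    exact ⟨by linarith [ht.2], by linarith [ht.1]⟩
  rw [σ.map_param d (Ioo_subset_Icc_self ht)] at hν
  unfold localDegree
  rw [finsum_tangent_interior ⟨ht.1.le, ht.2⟩ ht' fun ν => expansion σ.map ν ν']
  obtain ⟨ν₁, a1, a2, a3⟩ := σ.mapsDir ⟨d, t, ht.1.le, ht.2⟩
  obtain ⟨ν₂, b1, b2, b3⟩ := σ.mapsDir ⟨d.symm, Γ.edgeLen d - t, ht'⟩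
  simp only [dart_symm, k_symm] at a1 a2 a3 b1 b2 b3
  have hne : ν₁ ≠ ν₂ := fun e => dart_symm_ne (σ.dart d) (by rw [← b1, ← e, a1])
  rcases Dir.base_interior (σ.mem_Ioo d ht) hν with ⟨e1, e2⟩ | ⟨e1, e2⟩
  · have : ν' = ν₁ := Dir.ext' (e1.trans a1.symm) (e2.trans a2.symm)
    rw [this, expansion_eq a3, expansion_ne b3 hne, add_zero]
  · have : ν' = ν₂ := Dir.ext' (e1.trans b1.symm) (by
      rw [e2, b2, edgeLen_dart]; ring)
    rw [this, expansion_eq b3, expansion_ne a3 hne.symm, zero_add]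

theorem isFiniteHarmonic (hs : Function.Surjective σ.map) {δ : Γ.V → ℕ}
    (h : ∀ v (E : T.Dart), E.fst = σ.f v → σ.mult v E = δ v) : IsFiniteHarmonic σ.map where
  finite := σ.dirwise.isFiniteMorphism
  surjective := hs
  harmonic p ν₁ ν₂ h₁ h₂ := by
    rcases Γ.point_cases p with ⟨v, rfl⟩ | ⟨d, t, ht, rfl⟩
    · rw [map_vert] at h₁ h₂
      obtain ⟨e1, f1⟩ := Dir.base_vert h₁
      obtain ⟨e2, f2⟩ := Dir.base_vert h₂
      rw [e1, e2, localDegree_vert, localDegree_vert, h v _ f1, h v _ f2]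
    · rw [σ.localDegree_interior ht h₁, σ.localDegree_interior ht h₂]

theorem map_eq_vert {x : Γ.Point} {a : T.V} (h : σ.map x = T.vert a) :
    ∃ v, x = Γ.vert v ∧ σ.f v = a := by
  rcases Γ.point_cases x with ⟨v, rfl⟩ | ⟨d, t, ht, rfl⟩
  · exact ⟨v, rfl, T.vert_injective (by rw [← map_vert, h])⟩
  · rw [σ.map_param d (Ioo_subset_Icc_self ht)] at h
    exact absurd h (T.param_ne_vert _ (σ.mem_Ioo d ht) a)

theorem finsum_localDegree (E : T.Dart) :
    ∑ᶠ p : {p : Γ.Point // σ.map p = (T.dartDir E).base}, localDegree σ.map p.1 (T.dartDir E) =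
      ∑ᶠ v : {v : Γ.V // σ.f v = E.fst}, σ.mult v.1 E := by
  let g : {v : Γ.V // σ.f v = E.fst} → {p : Γ.Point // σ.map p = (T.dartDir E).base} := fun v =>
    ⟨Γ.vert v.1, by rw [map_vert, v.2, dartDir_base]⟩
  have hg : Function.Injective g := fun v w e =>
    Subtype.ext (Γ.vert_injective (congrArg Subtype.val e))
  rw [finsum_comp_injective hg fun p _ => ?_]
  · exact finsum_congr fun v => σ.localDegree_vert v.1 E
  · obtain ⟨v, hv, hf⟩ := σ.map_eq_vert (p.2.trans (T.dartDir_base E))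
    exact ⟨⟨v, hf⟩, Subtype.ext hv.symm⟩

/-- The degree of a harmonic simplicial map to a tree, by the Euler characteristic. -/
theorem hasDegree (hT : T.IsTree) (hs : Function.Surjective σ.map) {δ : Γ.V → ℕ}
    (h : ∀ v (E : T.Dart), E.fst = σ.f v → σ.mult v E = δ v) {d : ℕ}
    (hd : 2 * (∑ᶠ v, δ v) = (∑ᶠ e, σ.k e) + 2 * d) : HasDegree σ.map d := by
  classical
  have := Fintype.ofFinite Γ.V
  have := Fintype.ofFinite T.V
  have : Fintype Γ.Dart := Fintype.ofFinite _
  have : Fintype T.Dart := Fintype.ofFinite _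
  obtain ⟨v₀⟩ : Nonempty T.V := inferInstance
  -- The map has some degree `c`. Summing local degrees over vertices gives `c` for each vertex of
  -- `T`, and summing factors over darts gives `c` for each dart of `T`. A tree has two fewer darts
  -- than twice its vertices, so `hd` forces `c = d`.
  obtain ⟨c, -, hc, -⟩ := (σ.isFiniteHarmonic hs h).exists_degree hT (T.vert v₀)
  suffices hcd : c = d from hcd ▸ hc
  have hm : ∀ v E, σ.mult v E = ∑ d' : Γ.Dart, if d'.fst = v ∧ σ.dart d' = E then σ.k d' else 0 :=
    fun v E => by rw [mult_eq, finsum_eq_sum_of_fintype]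
  have hfib : ∀ E : T.Dart, ∑ v : Γ.V, (if σ.f v = E.fst then δ v else 0) = c := by
    intro E
    have h1 := hc (T.dartDir E)
    rw [σ.finsum_localDegree, finsum_congr fun v : {v : Γ.V // σ.f v = E.fst} => h v.1 E v.2.symm,
      finsum_eq_sum_of_fintype] at h1
    rw [← h1, ← Finset.sum_filter]
    exact (Finset.sum_subtype _ (by simp) _)
  have hdart : ∀ E : T.Dart, ∑ e : Γ.Dart, (if σ.dart e = E then σ.k e else 0) = c := by
    intro E
    rw [← hfib E]
    have : ∀ v, (if σ.f v = E.fst then δ v else 0) = σ.mult v E := fun v => by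
      by_cases hv : σ.f v = E.fst
      · rw [if_pos hv, h v E hv.symm]
      · rw [if_neg hv, hm]
        symm
        refine Finset.sum_eq_zero fun e _ => if_neg ?_
        rintro ⟨rfl, rfl⟩
        exact hv rfl
    rw [Finset.sum_congr rfl fun v _ => (this v).trans (hm v E), Finset.sum_comm]
    refine Finset.sum_congr rfl fun e _ => ?_
    by_cases he : σ.dart e = E <;> simp [he]
  have hV : ∑ v, δ v = Fintype.card T.V * c := by
    have : ∑ v, δ v = ∑ a : T.V, ∑ v : Γ.V, if σ.f v = a then δ v else 0 := by
      rw [Finset.sum_comm]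
      simp
    rw [this, Finset.sum_congr rfl fun a _ => ?_, Finset.sum_const, smul_eq_mul, Finset.card_univ]
    obtain ⟨E, rfl⟩ := T.exists_dart_fst a
    exact hfib E
  have hE : ∑ e, σ.k e = Fintype.card T.Dart * c := by
    have : ∑ e, σ.k e = ∑ E : T.Dart, ∑ e : Γ.Dart, if σ.dart e = E then σ.k e else 0 := by
      rw [Finset.sum_comm]
      simp
    rw [this, Finset.sum_congr rfl fun E _ => hdart E, Finset.sum_const, smul_eq_mul,
      Finset.card_univ]
  have hcard : Fintype.card T.Dart + 2 = 2 * Fintype.card T.V := by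
    have h1 := T.G.dart_card_eq_twice_card_edges
    have h2 := hT.card_edgeFinset
    rw [Fintype.card_eq_nat_card] at h1 ⊢
    change Nat.card T.G.Dart + 2 = _
    omega
  rw [finsum_eq_sum_of_fintype, finsum_eq_sum_of_fintype, hV, hE] at hd
  have : 2 * (Fintype.card T.V * c) = Fintype.card T.Dart * c + 2 * c := by
    rw [← mul_assoc, ← hcard]; ring
  omega

end Simp

end MetricGraph
end

noncomputable section
namespace MetricGraph

/-! ## The tree of a pencil -/

section Tree

variable {Γ : MetricGraph} {D : Γ.Divisor} {M : Set (Γ.Point → ℝ)} {x₀ : Γ.Point}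
  {s₀ s₁ : Γ.Dart → ℤ}

theorem Sim.redFun_eq {u w : Γ.Point} (h : Sim M u w) : redFun M u = redFun M w := by
  funext x
  unfold redFun
  congr 1
  ext y
  exact exists_congr fun g => and_congr_right fun hg => by rw [h g hg]

theorem Sim.height_eq {u w : Γ.Point} (h : Sim M u w) : height M x₀ u = height M x₀ w := by
  unfold height
  rw [h.redFun_eq]

/-- Vertices which are not separated by `M` are equivalent. -/
def vertSetoid (M : Set (Γ.Point → ℝ)) : Setoid Γ.V where
  r v w := Sim M (Γ.vert v) (Γ.vert w)
  iseqv := ⟨fun _ _ _ => rfl, Sim.symm, Sim.trans⟩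

/-- The height of a class of vertices. -/
def classHeight (M : Set (Γ.Point → ℝ)) (x₀ : Γ.Point) : Quotient (vertSetoid M) → ℝ :=
  Quotient.lift (fun v => height M x₀ (Γ.vert v)) fun _ _ h => Sim.height_eq h

/-- A model of a metric graph which is fine enough for the map from the graph to the quotient by
the pencil `M` to be simplicial. -/
structure IsFine (D : Γ.Divisor) (M : Set (Γ.Point → ℝ)) (x₀ : Γ.Point) (s₀ s₁ : Γ.Dart → ℤ) :
    Prop where
  adapted : IsAdapted D M s₀ s₁
  pencil : IsPencil M x₀
  leveled : IsLeveled M x₀ s₀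

namespace IsFine

variable (h : IsFine D M x₀ s₀ s₁)
include h

theorem height_snd {d : Γ.Dart} (hd : s₀ d = 0) :
    height M x₀ (Γ.vert d.snd) = height M x₀ (Γ.vert d.fst) + s₁ d * Γ.edgeLen d := by
  have := h.adapted.height_up h.pencil hd le_rfl (Γ.edgeLen_pos d).le le_rfl
  rwa [param_len, param_zero, sub_zero] at this

theorem height_param {d : Γ.Dart} (hd : s₀ d = 0) {t : ℝ} (ht : t ∈ Icc 0 (Γ.edgeLen d)) :
    height M x₀ (Γ.param d t) = height M x₀ (Γ.vert d.fst) + s₁ d * t := by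
  have := h.adapted.height_up h.pencil hd le_rfl ht.1 ht.2
  rwa [param_zero, sub_zero] at this

theorem height_lt {d : Γ.Dart} (hd : s₀ d = 0) :
    height M x₀ (Γ.vert d.fst) < height M x₀ (Γ.vert d.snd) := by
  rw [h.height_snd hd]
  have := mul_pos (h.adapted.slope_pos_real hd) (Γ.edgeLen_pos d)
  linarith

theorem height_ne (d : Γ.Dart) :
    height M x₀ (Γ.vert d.fst) ≠ height M x₀ (Γ.vert d.snd) := by
  rcases h.adapted.up_or d with hd | hd
  · exact (h.height_lt hd).ne
  · exact (h.height_lt hd).ne'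

theorem fst_below {d : Γ.Dart} (hd : s₀ d = 0) :
    Below M x₀ (Γ.vert d.fst) (Γ.vert d.snd) := by
  have := h.adapted.below_of_up h.pencil hd le_rfl (Γ.edgeLen_pos d).le le_rfl
  rwa [param_len, param_zero] at this

theorem param_below {d : Γ.Dart} (hd : s₀ d = 0) {t : ℝ} (ht : t ∈ Icc 0 (Γ.edgeLen d)) :
    Below M x₀ (Γ.param d t) (Γ.vert d.snd) := by
  have := h.adapted.below_of_up h.pencil hd ht.1 ht.2 le_rfl
  rwa [param_len] at this

/-- Both lower ends lie below the same class, so they are comparable. If the heights differed, the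
edge `d` would contain in its interior a point at the height of the vertex `d'.fst`, contrary to
cutting at full level sets. -/
theorem sim_fst_aux {d d' : Γ.Dart} (hd : s₀ d = 0) (hd' : s₀ d' = 0)
    (hs : Sim M (Γ.vert d.snd) (Γ.vert d'.snd))
    (hle : height M x₀ (Γ.vert d.fst) ≤ height M x₀ (Γ.vert d'.fst)) :
    Sim M (Γ.vert d.fst) (Γ.vert d'.fst) := by
  have hb := h.pencil.below_of_below (h.fst_below hd)
    (h.pencil.below_trans (h.fst_below hd') (h.pencil.below_of_sim hs.symm)) hle
  refine h.pencil.sim_of_below hb (hle.antisymm (le_of_not_gt fun hlt => ?_))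
  have hk := h.adapted.slope_pos_real hd
  have h1 := h.height_lt hd'
  rw [← hs.height_eq, h.height_snd hd] at h1
  set a := height M x₀ (Γ.vert d.fst)
  set b := height M x₀ (Γ.vert d'.fst)
  have ht : (b - a) / s₁ d ∈ Ioo 0 (Γ.edgeLen d) :=
    ⟨div_pos (by linarith) hk, by rw [div_lt_iff₀ hk]; linarith⟩
  have h2 := h.height_param hd (Ioo_subset_Icc_self ht)
  rw [mul_div_cancel₀ _ hk.ne'] at h2
  obtain ⟨v, hv⟩ := h.leveled.level d'.fst (Γ.param d ((b - a) / s₁ d)) (by rw [h2]; ring)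
  exact Γ.param_ne_vert d ht v hv.symm

theorem sim_fst {d d' : Γ.Dart} (hd : s₀ d = 0) (hd' : s₀ d' = 0)
    (hs : Sim M (Γ.vert d.snd) (Γ.vert d'.snd)) : Sim M (Γ.vert d.fst) (Γ.vert d'.fst) := by
  rcases le_total (height M x₀ (Γ.vert d.fst)) (height M x₀ (Γ.vert d'.fst)) with hle | hle
  · exact h.sim_fst_aux hd hd' hs hle
  · exact (h.sim_fst_aux hd' hd hs.symm hle).symm

theorem exists_up {x : Γ.Point} (hx : x ∉ range Γ.vert) :
    ∃ d : Γ.Dart, s₀ d = 0 ∧ ∃ t ∈ Ioo 0 (Γ.edgeLen d), x = Γ.param d t := by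
  rcases Γ.point_cases x with ⟨v, rfl⟩ | ⟨d, t, ht, rfl⟩
  · exact absurd (mem_range_self v) hx
  · rcases h.adapted.up_or d with hd | hd
    · exact ⟨d, hd, t, ht, rfl⟩
    · refine ⟨d.symm, hd, Γ.edgeLen d - t, ?_, (Γ.param_symm d (Ioo_subset_Icc_self ht)).symm⟩
      rw [edgeLen_symm]
      exact ⟨by linarith [ht.2], by linarith [ht.1]⟩

/-- The quotient of `Γ` by the pencil `M`. -/
def tree : MetricGraph where
  V := Quotient (vertSetoid M)
  finV := Quotient.finite _
  nontrivialV := by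
    obtain ⟨v⟩ : Nonempty Γ.V := inferInstance
    obtain ⟨d, -⟩ := Γ.exists_dart_fst v
    exact ⟨⟦d.fst⟧, ⟦d.snd⟧, fun e => h.height_ne d (congrArg (classHeight M x₀) e)⟩
  G :=
    { Adj a b := ∃ d : Γ.Dart, ⟦d.fst⟧ = a ∧ ⟦d.snd⟧ = b
      symm := ⟨fun _ _ ⟨d, h1, h2⟩ => ⟨d.symm, h2, h1⟩⟩
      loopless := ⟨fun _ ⟨d, h1, h2⟩ =>
        h.height_ne d (congrArg (classHeight M x₀) (h1.trans h2.symm))⟩ }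
  connected := by
    obtain ⟨v₀⟩ : Nonempty Γ.V := inferInstance
    refine SimpleGraph.connected_iff_exists_forall_reachable _ |>.2 ⟨⟦v₀⟧, fun a => ?_⟩
    induction a using Quotient.inductionOn with
    | h v =>
      refine Γ.vert_reachable_induction (P := fun v => SimpleGraph.Reachable _ ⟦v₀⟧ ⟦v⟧)
        (SimpleGraph.Reachable.refl _) (fun d hd => hd.trans ?_) v
      exact SimpleGraph.Adj.reachable ⟨d, rfl, rfl⟩
  -- Edges are measured by height, which makes the quotient map a dilation on each edge.
  len := Sym2.lift ⟨fun a b => |classHeight M x₀ a - classHeight M x₀ b|, fun _ _ => abs_sub_comm _ _⟩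
  len_pos e he := by
    induction e with
    | h a b =>
      obtain ⟨d, rfl, rfl⟩ := he
      exact abs_pos.2 (sub_ne_zero.2 (h.height_ne d))

/-- The simplicial map to the quotient. -/
def simp : Simp Γ h.tree where
  f v := (⟦v⟧ : Quotient (vertSetoid M))
  -- The same for both orientations; on the upward one, where `s₀ d = 0`, it is the slope of the
  -- height.
  k d := (s₁ d - s₀ d).toNat
  adj d := ⟨d, rfl, rfl⟩
  k_pos d := by
    have := h.adapted.lt d
    omega
  k_symm d := by
    rw [h.adapted.symm, h.adapted.symm']
    congr 1
    ring
  len d := by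
    change |height M x₀ (Γ.vert d.fst) - height M x₀ (Γ.vert d.snd)| = _
    have hc : (((s₁ d - s₀ d).toNat : ℕ) : ℝ) = s₁ d - s₀ d := by
      rw [← Int.cast_sub, ← Int.cast_natCast, Int.toNat_of_nonneg (by linarith [h.adapted.lt d])]
    rw [hc]
    rcases h.adapted.up_or d with hd | hd
    · have := h.height_snd hd
      rw [abs_sub_comm, abs_of_pos (by linarith [h.height_lt hd]), this, hd]
      push_cast
      ring
    · have := h.height_snd hd
      have h1 : s₁ d = 0 := by
        have := h.adapted.symm d
        omega
      rw [abs_of_pos (by have := h.height_lt hd; exact sub_pos.2 this), h1]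
      rw [h.adapted.symm', edgeLen_symm] at this
      change height M x₀ (Γ.vert d.fst) = height M x₀ (Γ.vert d.snd) + _ at this
      rw [this]
      push_cast
      ring

theorem simp_f_eq {v w : Γ.V} : h.simp.f v = h.simp.f w ↔ Sim M (Γ.vert v) (Γ.vert w) :=
  Quotient.eq (r := vertSetoid M)

theorem simp_k {d : Γ.Dart} (hd : s₀ d = 0) : (h.simp.k d : ℝ) = s₁ d := by
  change (((s₁ d - s₀ d).toNat : ℕ) : ℝ) = _
  rw [← Int.cast_natCast, Int.toNat_of_nonneg (by linarith [h.adapted.lt d]), hd, sub_zero]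

theorem exists_simp_dart (E : h.tree.Dart) : ∃ d, h.simp.dart d = E := by
  obtain ⟨d, h1, h2⟩ := E.adj
  exact ⟨d, SimpleGraph.Dart.ext _ _ (Prod.ext h1 h2)⟩

theorem exists_simp_dart_up (E : h.tree.Dart) :
    ∃ d, s₀ d = 0 ∧ (h.simp.dart d = E ∨ h.simp.dart d = E.symm) := by
  obtain ⟨d, rfl⟩ := h.exists_simp_dart E
  rcases h.adapted.up_or d with hd | hd
  · exact ⟨d, hd, Or.inl rfl⟩
  · exact ⟨d.symm, hd, Or.inr rfl⟩

theorem simp_surjective : Function.Surjective h.simp.map := by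
  intro y
  obtain ⟨E, t, ht, rfl⟩ := h.tree.exists_param y
  obtain ⟨d, rfl⟩ := h.exists_simp_dart E
  have hk := h.simp.k_pos_real d
  rw [Simp.edgeLen_dart] at ht
  refine ⟨Γ.param d (t / h.simp.k d), ?_⟩
  rw [h.simp.map_param d ⟨div_nonneg ht.1 hk.le, (div_le_iff₀' hk).2 ht.2⟩, mul_div_cancel₀ _ hk.ne']

/-- The root of the quotient. -/
def root : Γ.V := h.leveled.base.choose

theorem vert_root : Γ.vert h.root = x₀ := h.leveled.base.choose_spec

theorem not_sim_root {d : Γ.Dart} (hd : s₀ d = 0) : h.simp.f d.snd ≠ h.simp.f h.root := by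
  intro e
  have h1 := (h.simp_f_eq.1 e).height_eq (x₀ := x₀)
  rw [h.vert_root, h.pencil.height_base] at h1
  have h2 := h.height_lt hd
  have h3 := h.pencil.height_nonneg (Γ.vert d.fst)
  linarith

/-- By `sim_fst` an edge of the quotient is determined by its upper end, which is never the root.
With connectedness this bounds the number of edges both ways and yields a tree. -/
theorem exists_upper_vertex : ∃ U : h.tree.G.edgeSet → {a : h.tree.V // a ≠ h.simp.f h.root},
    Function.Injective U := by
  have hU : ∀ e : h.tree.G.edgeSet, ∃ d, s₀ d = 0 ∧ (h.simp.dart d).edge = e.1 := by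
    rintro ⟨e, he⟩
    induction e with
    | h a b =>
      obtain ⟨d, hd, h1 | h1⟩ := h.exists_simp_dart_up ⟨(a, b), he⟩
      · exact ⟨d, hd, by rw [h1]; rfl⟩
      · exact ⟨d, hd, by rw [h1, SimpleGraph.Dart.edge_symm]; rfl⟩
  choose u hu hue using hU
  refine ⟨fun e => ⟨_, h.not_sim_root (hu e)⟩, fun e e' he => ?_⟩
  have hs : h.simp.f (u e).snd = h.simp.f (u e').snd := congrArg Subtype.val he
  have hf := h.simp_f_eq.2 (h.sim_fst (hu e) (hu e') (h.simp_f_eq.1 hs))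
  refine Subtype.ext ?_
  rw [← hue e, ← hue e']
  congr 1
  exact SimpleGraph.Dart.ext _ _ (Prod.ext hf hs)

theorem card_edges : Nat.card h.tree.G.edgeSet + 1 = Nat.card h.tree.V := by
  classical
  obtain ⟨U, hU⟩ := h.exists_upper_vertex
  have h1 := Nat.card_le_card_of_injective U hU
  have h2 := h.tree.connected.card_vert_le_card_edgeSet_add_one
  have h3 : Nat.card {a : h.tree.V // a ≠ h.simp.f h.root} + 1 = Nat.card h.tree.V := by
    have := Fintype.ofFinite h.tree.V
    rw [Nat.card_eq_fintype_card, Nat.card_eq_fintype_card, Fintype.card_subtype_compl,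
      Fintype.card_subtype_eq]
    exact Nat.sub_add_cancel Fintype.card_pos
  omega

theorem isTree : h.tree.IsTree :=
  SimpleGraph.isTree_iff_connected_and_card.2 ⟨h.tree.connected, h.card_edges⟩

/-- At vertices this is the definition of the quotient, no interior point being at the height of a
vertex. For interior points of upward edges, `IsLeveled.top` and `sim_fst` match the edges, and the
height then matches the positions. -/
theorem map_eq_iff {x y : Γ.Point} : h.simp.map x = h.simp.map y ↔ Sim M x y := by
  by_cases hx : x ∈ range Γ.vert
  · obtain ⟨v, rfl⟩ := hx
    refine ⟨fun e => ?_, fun e => ?_⟩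
    · rw [Simp.map_vert] at e
      obtain ⟨w, rfl, hw⟩ := h.simp.map_eq_vert e.symm
      exact (h.simp_f_eq.1 hw).symm
    · obtain ⟨w, rfl⟩ := h.leveled.level v y (e.height_eq (x₀ := x₀)).symm
      rw [Simp.map_vert, Simp.map_vert, h.simp_f_eq.2 e]
  by_cases hy : y ∈ range Γ.vert
  · obtain ⟨v, rfl⟩ := hy
    refine ⟨fun e => ?_, fun e => ?_⟩
    · rw [Simp.map_vert] at e
      obtain ⟨w, rfl, hw⟩ := h.simp.map_eq_vert e
      exact absurd (mem_range_self w) hx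
    · exact absurd (h.leveled.level v x (e.height_eq (x₀ := x₀))) hx
  obtain ⟨d, hd, t, ht, rfl⟩ := h.exists_up hx
  obtain ⟨d', hd', t', ht', rfl⟩ := h.exists_up hy
  have ht1 := Ioo_subset_Icc_self ht
  have ht1' := Ioo_subset_Icc_self ht'
  have hh := h.height_param hd ht1
  have hh' := h.height_param hd' ht1'
  rw [h.simp.map_param d ht1, h.simp.map_param d' ht1', h.simp_k hd, h.simp_k hd']
  refine ⟨fun e => ?_, fun e => ?_⟩
  · have m1 := h.simp.mem_Ioo d ht
    have m2 := h.simp.mem_Icc d' ht1'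
    rw [h.simp_k hd] at m1
    rw [h.simp_k hd'] at m2
    rcases h.tree.param_eq_interior m1 m2 e with ⟨e1, e2⟩ | ⟨e1, -⟩
    · have f1 : Sim M (Γ.vert d'.fst) (Γ.vert d.fst) :=
        h.simp_f_eq.1 (congrArg (fun E : h.tree.Dart => E.fst) e1)
      have f2 : Sim M (Γ.vert d'.snd) (Γ.vert d.snd) :=
        h.simp_f_eq.1 (congrArg (fun E : h.tree.Dart => E.snd) e1)
      refine h.pencil.sim_of_below_below (h.param_below hd ht1)
        (h.pencil.below_trans (h.param_below hd' ht1') (h.pencil.below_of_sim f2)) ?_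
      rw [hh, hh', f1.height_eq, e2]
    · have f1 : Sim M (Γ.vert d'.fst) (Γ.vert d.snd) :=
        h.simp_f_eq.1 (congrArg (fun E : h.tree.Dart => E.fst) e1)
      have f2 : Sim M (Γ.vert d'.snd) (Γ.vert d.fst) :=
        h.simp_f_eq.1 (congrArg (fun E : h.tree.Dart => E.snd) e1)
      have g1 := h.height_lt hd
      have g2 := h.height_lt hd'
      rw [f1.height_eq, f2.height_eq] at g2
      linarith
  · have f2 := h.leveled.top d d' hd hd' t ht t' ht' e
    have f1 := h.sim_fst hd hd' f2
    have e1 : h.simp.dart d = h.simp.dart d' :=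
      SimpleGraph.Dart.ext _ _ (Prod.ext (h.simp_f_eq.2 f1) (h.simp_f_eq.2 f2))
    have := e.height_eq (x₀ := x₀)
    rw [hh, hh', f1.height_eq] at this
    rw [e1, add_left_cancel this]

end IsFine

end Tree

end MetricGraph
end

noncomputable section
namespace MetricGraph

/-! ## The pencil is the pullback of the series of the tree -/

section PullbackTree

variable {Γ : MetricGraph} {D : Γ.Divisor} {M : Set (Γ.Point → ℝ)} {x₀ : Γ.Point}
  {s₀ s₁ : Γ.Dart → ℤ}

/-- The meet of `v` and `x`: truncating the potential of `v` at its value at `x` yields a point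
below both, of that height. -/
theorem IsPencil.exists_meet (h : IsPencil M x₀) (v x : Γ.Point) :
    ∃ u, Below M x₀ u v ∧ Below M x₀ u x ∧ height M x₀ u = pot M x₀ v x := by
  obtain ⟨u, hu, hc⟩ := h.exists_below (h.pot_nonneg v x) (h.pot_le v x)
  refine ⟨u, hu, h.below_iff.2 ?_, hc⟩
  rw [h.pot_below hu, hc, min_self]

theorem IsPencil.height_le_pot (h : IsPencil M x₀) {u v x : Γ.Point} (hv : Below M x₀ u v)
    (hx : Below M x₀ u x) : height M x₀ u ≤ pot M x₀ v x := by
  rw [h.below_iff, h.pot_below hv] at hx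
  exact min_eq_right_iff.1 hx

/-- Both sides are the greatest height of a point below `v` and `x`, a Gromov product. -/
theorem IsPencil.pot_comm (h : IsPencil M x₀) (v x : Γ.Point) : pot M x₀ v x = pot M x₀ x v := by
  have key : ∀ v x, pot M x₀ v x ≤ pot M x₀ x v := fun v x => by
    obtain ⟨u, h1, h2, h3⟩ := h.exists_meet v x
    exact h3 ▸ h.height_le_pot h2 h1
  exact le_antisymm (key v x) (key x v)

namespace IsFine

variable (h : IsFine D M x₀ s₀ s₁)
include h

theorem dart_eq_of_sim {d d' : Γ.Dart} (hd : s₀ d = 0) (hd' : s₀ d' = 0) {t t' : ℝ}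
    (ht : t ∈ Ioc 0 (Γ.edgeLen d)) (ht' : t' ∈ Ioc 0 (Γ.edgeLen d'))
    (hs : Sim M (Γ.param d t) (Γ.param d' t')) : h.simp.dart d = h.simp.dart d' := by
  have top : ∀ {d d' : Γ.Dart} {t' : ℝ}, t' ∈ Ioc 0 (Γ.edgeLen d') →
      Sim M (Γ.vert d.snd) (Γ.param d' t') → t' = Γ.edgeLen d' := fun {d d' t'} ht' hs => by
    obtain ⟨v, hv⟩ := h.leveled.level d.snd (Γ.param d' t') (hs.height_eq (x₀ := x₀)).symm
    by_contra hne
    exact Γ.param_ne_vert d' ⟨ht'.1, lt_of_le_of_ne ht'.2 hne⟩ v hv.symm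
  have hsnd : Sim M (Γ.vert d.snd) (Γ.vert d'.snd) := by
    rcases eq_or_lt_of_le ht.2 with e | hlt
    · rw [e, param_len] at hs
      rwa [top ht' hs, param_len] at hs
    rcases eq_or_lt_of_le ht'.2 with e | hlt'
    · rw [e, param_len] at hs
      exact absurd (top ht hs.symm) hlt.ne
    exact h.leveled.top d d' hd hd' t ⟨ht.1, hlt⟩ t' ⟨ht'.1, hlt'⟩ hs
  exact SimpleGraph.Dart.ext _ _ (Prod.ext (h.simp_f_eq.2 (h.sim_fst hd hd' hsnd))
    (h.simp_f_eq.2 hsnd))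

theorem exists_param_of_below {d : Γ.Dart} (hd : s₀ d = 0) {t : ℝ} (ht : t ∈ Icc 0 (Γ.edgeLen d))
    {u : Γ.Point} (hu : Below M x₀ u (Γ.param d t))
    (hlt : height M x₀ (Γ.vert d.fst) < height M x₀ u) :
    ∃ r ∈ Ioc 0 (Γ.edgeLen d), Sim M u (Γ.param d r) := by
  have hk := h.adapted.slope_pos_real hd
  have hle := h.pencil.height_le hu
  rw [h.height_param hd ht] at hle
  set a := height M x₀ (Γ.vert d.fst)
  set b := height M x₀ u with hb
  have hr0 : 0 < (b - a) / s₁ d := div_pos (by linarith) hk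
  have hrt : (b - a) / s₁ d ≤ t := by rw [div_le_iff₀ hk]; linarith
  refine ⟨(b - a) / s₁ d, ⟨hr0, hrt.trans ht.2⟩, h.pencil.sim_of_below_below hu
    (h.adapted.below_of_up h.pencil hd hr0.le hrt ht.2) ?_⟩
  rw [h.height_param hd ⟨hr0.le, hrt.trans ht.2⟩, mul_div_cancel₀ _ hk.ne', ← hb]
  ring

theorem pot_fst {d : Γ.Dart} (hd : s₀ d = 0) (x : Γ.Point) :
    pot M x₀ (Γ.vert d.fst) x = min (pot M x₀ (Γ.vert d.snd) x) (height M x₀ (Γ.vert d.fst)) :=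
  h.pencil.pot_below (h.fst_below hd) x

/-- Over the same tree edge, both functions increase by the height along `d'`. Over any other tree
edge, both are constant along `d'`: this is clear for the cut function, and for the potentials it
says that `d` and `d'` have no equivalent points above their lower ends. -/
theorem cut_diff_edge {d d' : Γ.Dart} (hd : s₀ d = 0) (hd' : s₀ d' = 0) {t : ℝ}
    (ht : t ∈ Icc 0 (Γ.edgeLen d')) :
    h.isTree.cutFun (h.simp.dart d) (h.simp.map (Γ.param d' t)) -
        (pot M x₀ (Γ.vert d.snd) (Γ.param d' t) - pot M x₀ (Γ.vert d.fst) (Γ.param d' t)) =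
      h.isTree.cutFun (h.simp.dart d) (h.simp.map (Γ.vert d'.fst)) -
        (pot M x₀ (Γ.vert d.snd) (Γ.vert d'.fst) - pot M x₀ (Γ.vert d.fst) (Γ.vert d'.fst)) := by
  have h0 : (0 : ℝ) ∈ Icc 0 (Γ.edgeLen d') := ⟨le_rfl, (Γ.edgeLen_pos d').le⟩
  by_cases hE : h.simp.dart d' = h.simp.dart d
  · have f1 : Sim M (Γ.vert d.fst) (Γ.vert d'.fst) :=
      h.simp_f_eq.1 (congrArg (fun E : h.tree.Dart => E.fst) hE).symm
    have f2 : Sim M (Γ.vert d.snd) (Γ.vert d'.snd) :=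
      h.simp_f_eq.1 (congrArg (fun E : h.tree.Dart => E.snd) hE).symm
    have key : ∀ r ∈ Icc 0 (Γ.edgeLen d'),
        h.isTree.cutFun (h.simp.dart d) (h.simp.map (Γ.param d' r)) -
          (pot M x₀ (Γ.vert d.snd) (Γ.param d' r) - pot M x₀ (Γ.vert d.fst) (Γ.param d' r)) =
            0 := fun r hr => by
      have b1 : Below M x₀ (Γ.vert d'.fst) (Γ.param d' r) := by
        have := h.adapted.below_of_up h.pencil hd' le_rfl hr.1 hr.2
        rwa [param_zero] at this
      have b2 := h.param_below hd' hr
      rw [← hE, h.simp.map_param d' hr, h.isTree.cutFun_param _ (h.simp.mem_Icc d' hr),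
        h.pencil.sim_iff_pot.1 f1, h.pencil.sim_iff_pot.1 f2, h.pencil.below_iff.1 b1, b2,
        h.height_param hd' hr, h.simp_k hd']
      ring
    rw [key t ht, ← param_zero, key 0 h0]
  · have hE' : h.simp.dart d' ≠ (h.simp.dart d).symm := fun e => by
      have f1 : Sim M (Γ.vert d'.fst) (Γ.vert d.snd) :=
        h.simp_f_eq.1 (congrArg (fun E : h.tree.Dart => E.fst) e)
      have f2 : Sim M (Γ.vert d'.snd) (Γ.vert d.fst) :=
        h.simp_f_eq.1 (congrArg (fun E : h.tree.Dart => E.snd) e)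
      have g1 := h.height_lt hd
      have g2 := h.height_lt hd'
      rw [f1.height_eq, f2.height_eq] at g2
      linarith
    rw [h.simp.map_param d' ht, h.isTree.cutFun_other hE hE' (h.simp.mem_Icc d' ht),
      Simp.dart_fst, ← Simp.map_vert]
    congr 1
    have b1 : Below M x₀ (Γ.vert d'.fst) (Γ.param d' t) := by
      have := h.adapted.below_of_up h.pencil hd' le_rfl ht.1 ht.2
      rwa [param_zero] at this
    rw [h.pot_fst hd, h.pot_fst hd, h.pencil.pot_comm _ (Γ.vert d'.fst), h.pencil.pot_below b1,
      h.pencil.pot_comm (Γ.param d' t)]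
    set c := pot M x₀ (Γ.vert d.snd) (Γ.param d' t) with hc
    rcases le_or_gt c (height M x₀ (Γ.vert d'.fst)) with hle | hlt
    · rw [min_eq_left hle]
    rcases le_or_gt c (height M x₀ (Γ.vert d.fst)) with hle | hlt'
    · rw [min_eq_left hle, min_eq_left ((min_le_left _ _).trans hle), sub_self, sub_self]
    -- In the remaining case the meet is higher than both lower ends, hence equivalent to a point of
    -- `d` and to a point of `d'`; then the two edges have the same image.
    obtain ⟨u, h1, h2, h3⟩ := h.pencil.exists_meet (Γ.vert d.snd) (Γ.param d' t)
    rw [← param_len] at h1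
    obtain ⟨r, hr, e1⟩ := h.exists_param_of_below hd ⟨(Γ.edgeLen_pos d).le, le_rfl⟩ h1
      (by rw [h3]; exact hlt')
    obtain ⟨r', hr', e2⟩ := h.exists_param_of_below hd' ht h2 (by rw [h3]; exact hlt)
    exact absurd (h.dart_eq_of_sim hd' hd hr' hr (e2.symm.trans e1)) hE

/-- The bridge between the combinatorial tree and the pencil: the two sides agree at the lower end
of `d` and their difference is constant along every edge. -/
theorem cutFun_map {d : Γ.Dart} (hd : s₀ d = 0) (x : Γ.Point) :
    h.isTree.cutFun (h.simp.dart d) (h.simp.map x) =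
      pot M x₀ (Γ.vert d.snd) x - pot M x₀ (Γ.vert d.fst) x := by
  have hv : ∀ v, h.isTree.cutFun (h.simp.dart d) (h.simp.map (Γ.vert v)) -
      (pot M x₀ (Γ.vert d.snd) (Γ.vert v) - pot M x₀ (Γ.vert d.fst) (Γ.vert v)) = 0 := by
    refine Γ.vert_reachable_induction (v₀ := d.fst) ?_ fun d' hd' => ?_
    · have := h.fst_below hd
      rw [Simp.map_vert, ← Simp.dart_fst, ← param_zero, h.isTree.cutFun_param _
        ⟨le_rfl, (h.tree.edgeLen_pos _).le⟩, h.pencil.pot_self, this]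
      ring
    · rcases h.adapted.up_or d' with hu | hu
      · have := h.cut_diff_edge hd hu (t := Γ.edgeLen d') ⟨(Γ.edgeLen_pos d').le, le_rfl⟩
        rw [param_len] at this
        exact this.trans hd'
      · have := h.cut_diff_edge hd hu (t := Γ.edgeLen d'.symm) ⟨(Γ.edgeLen_pos _).le, le_rfl⟩
        rw [param_len] at this
        exact this.symm.trans hd'
  refine sub_eq_zero.1 ?_
  by_cases hx : x ∈ range Γ.vert
  · obtain ⟨v, rfl⟩ := hx
    exact hv v
  · obtain ⟨d', hd', t, ht, rfl⟩ := h.exists_up hx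
    exact (h.cut_diff_edge hd hd' (Ioo_subset_Icc_self ht)).trans (hv _)

theorem pot_param_sub {d : Γ.Dart} (hd : s₀ d = 0) {t : ℝ} (ht : t ∈ Icc 0 (Γ.edgeLen d))
    (v : Γ.Point) : pot M x₀ v (Γ.param d t) - pot M x₀ v (Γ.vert d.fst) =
      min (h.isTree.cutFun (h.simp.dart d) (h.simp.map v)) (s₁ d * t) := by
  rw [h.cutFun_map hd, h.pot_fst hd, h.pencil.pot_comm v, h.pencil.pot_comm v, h.pot_fst hd,
    h.pencil.pot_below (h.param_below hd ht), h.height_param hd ht]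
  have hs : 0 ≤ s₁ d * t := mul_nonneg (h.adapted.slope_pos_real hd).le ht.1
  set c := pot M x₀ (Γ.vert d.snd) v
  set a := height M x₀ (Γ.vert d.fst)
  rcases le_total c a with hle | hle
  · rw [min_eq_left hle, min_eq_left (by linarith), sub_self, min_eq_left hs]
  · rw [min_eq_right hle, ← min_sub_sub_right]
    congr 1
    ring

theorem cutFun_base {d : Γ.Dart} (hd : s₀ d = 0) :
    h.isTree.cutFun (h.simp.dart d) (h.simp.map x₀) = 0 := by
  rw [h.cutFun_map hd, IsPencil.pot_base, IsPencil.pot_base, sub_zero]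

theorem isDiv_param_sub {v : Γ.Point} {f : h.tree.Point → ℝ}
    (hf : IsDiv f (h.simp.map v) (h.simp.map x₀)) {d : Γ.Dart} (hd : s₀ d = 0) {t : ℝ}
    (ht : t ∈ Icc 0 (Γ.edgeLen d)) :
    f (h.simp.map (Γ.param d t)) - f (h.simp.map (Γ.vert d.fst)) =
      min (h.isTree.cutFun (h.simp.dart d) (h.simp.map v)) (s₁ d * t) := by
  have ht' := h.simp.mem_Icc d ht
  have := hf.green (h.isTree.isDiv_min_cutFun (h.simp.dart d) ht')
  rw [h.cutFun_base hd, min_eq_left ht'.1, sub_zero, h.simp_k hd] at this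
  rw [h.simp.map_param d ht, h.simp_k hd, Simp.map_vert, ← Simp.dart_fst, ← param_zero, this]

/-- Along each upward edge both functions have the same increments, a truncation of the cut function
evaluated at the image of `v`: for `f` by reciprocity, for the potential by `cutFun_map`. -/
theorem isDiv_comp_map {v : Γ.Point} {f : h.tree.Point → ℝ}
    (hf : IsDiv f (h.simp.map v) (h.simp.map x₀)) (x : Γ.Point) :
    f (h.simp.map x) = pot M x₀ v x + f (h.simp.map x₀) := by
  have he : ∀ d, s₀ d = 0 → ∀ t ∈ Icc 0 (Γ.edgeLen d),
      f (h.simp.map (Γ.param d t)) - pot M x₀ v (Γ.param d t) =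
        f (h.simp.map (Γ.vert d.fst)) - pot M x₀ v (Γ.vert d.fst) := fun d hd t ht => by
    have h1 := h.isDiv_param_sub hf hd ht
    have h2 := h.pot_param_sub hd ht v
    linarith
  have hv : ∀ w, f (h.simp.map (Γ.vert w)) - pot M x₀ v (Γ.vert w) = f (h.simp.map x₀) := by
    refine Γ.vert_reachable_induction (v₀ := h.root) ?_ fun d' hd' => ?_
    · rw [h.vert_root, IsPencil.pot_base, sub_zero]
    · rcases h.adapted.up_or d' with hu | hu
      · have := he d' hu _ ⟨(Γ.edgeLen_pos d').le, le_rfl⟩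
        rw [param_len] at this
        exact this.trans hd'
      · have := he d'.symm hu _ ⟨(Γ.edgeLen_pos _).le, le_rfl⟩
        rw [param_len] at this
        exact this.symm.trans hd'
  suffices f (h.simp.map x) - pot M x₀ v x = f (h.simp.map x₀) by linarith
  by_cases hx : x ∈ range Γ.vert
  · obtain ⟨w, rfl⟩ := hx
    exact hv w
  · obtain ⟨d', hd', t, ht, rfl⟩ := h.exists_up hx
    exact (he d' hd' t (Ioo_subset_Icc_self ht)).trans (hv _)

/-- Up to constants, the functions of `M` are the potentials and those of the tree series are
indexed by their pole-free end `x`; `isDiv_comp_map` matches the two families, and surjectivity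
reaches every point of the tree. -/
theorem eq_pullback : M = pullback h.simp.map (treeSeries (h.simp.map x₀)) := by
  ext g
  constructor
  · intro hg
    obtain ⟨v, hv⟩ := h.pencil.exists_eq_pot hg
    obtain ⟨f, hf⟩ := h.isTree.exists_isDiv (h.simp.map v) (h.simp.map x₀)
    refine ⟨_, mem_treeSeries_iff.2 ⟨_, hf.add_const (g x₀ - f (h.simp.map x₀))⟩, ?_⟩
    funext x
    simp only [Function.comp, h.isDiv_comp_map hf x, hv x]
    ring
  · rintro ⟨f, hf, rfl⟩
    obtain ⟨y, hy⟩ := mem_treeSeries_iff.1 hf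
    obtain ⟨v, rfl⟩ := h.simp_surjective y
    have : f ∘ h.simp.map = fun x => pot M x₀ v x + f (h.simp.map x₀) :=
      funext fun x => h.isDiv_comp_map hy x
    change f ∘ h.simp.map ∈ M
    rw [this]
    exact h.pencil.add_const_mem _ (h.pencil.pot_mem v) _

end IsFine

end PullbackTree

end MetricGraph
end

noncomputable section
namespace MetricGraph

/-! ## Symmetric products and the map to reduced divisors -/

theorem min_germ (p c : ℝ) : ∃ s : ℤ, ∃ ε > 0, ∀ h ∈ Ico 0 ε, min (p + h) c = min p c + s * h := by
  rcases lt_or_ge p c with hlt | hle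
  · refine ⟨1, c - p, by linarith, fun h hh => ?_⟩
    rw [min_eq_left (by linarith [hh.2]), min_eq_left hlt.le, Int.cast_one, one_mul]
  · refine ⟨0, 1, one_pos, fun h hh => ?_⟩
    rw [min_eq_right (by linarith [hh.1]), min_eq_right hle, Int.cast_zero, zero_mul, add_zero]

theorem min_germ_neg (p c : ℝ) :
    ∃ s : ℤ, ∃ ε > 0, ∀ h ∈ Ico 0 ε, min (p - h) c = min p c + s * h := by
  rcases lt_or_ge c p with hlt | hle
  · refine ⟨0, p - c, by linarith, fun h hh => ?_⟩
    rw [min_eq_right (by linarith [hh.2]), min_eq_right hlt.le, Int.cast_zero, zero_mul, add_zero]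
  · refine ⟨-1, 1, one_pos, fun h hh => ?_⟩
    rw [min_eq_left (by linarith [hh.1]), min_eq_left hle]
    push_cast
    ring

theorem exists_edgeLen_bound (Γ : MetricGraph) : ∃ c > 0, ∀ d, c ≤ Γ.edgeLen d := by
  obtain ⟨v⟩ : Nonempty Γ.V := inferInstance
  obtain ⟨d, -⟩ := Γ.exists_dart_fst v
  have : Nonempty Γ.Dart := ⟨d⟩
  obtain ⟨d, hd⟩ := Finite.exists_min Γ.edgeLen
  exact ⟨_, Γ.edgeLen_pos d, hd⟩

-- The function is the distance to `v` on the edges at `v`, truncated at a lower bound for the edge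
-- lengths, and constant on the other edges.
open Classical in
theorem exists_rat_vanishing_vert (Γ : MetricGraph) (v : Γ.V) :
    ∃ f ∈ Γ.Rat, f (Γ.vert v) = 0 ∧ ∀ x, x ≠ Γ.vert v → 0 < f x := by
  obtain ⟨c, hc, hcl⟩ := Γ.exists_edgeLen_bound
  obtain ⟨f, hf⟩ := Γ.glue (fun w => if w = v then 0 else c)
    (fun d t => if d.fst = v then min t c else if d.snd = v then min (Γ.edgeLen d - t) c else c)
    (fun d => by
      by_cases h1 : d.fst = v
      · simp [h1, hc.le]
      · simp [h1, hcl d])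
    (fun d t ht => by
      have hne : d.fst ≠ d.snd := d.fst_ne_snd
      by_cases h1 : d.fst = v
      · have h2 : d.snd ≠ v := fun e => hne (h1.trans e.symm)
        simp [h1, h2, edgeLen_symm]
      · by_cases h2 : d.snd = v <;> simp [h1, h2])
  refine ⟨f, mem_rat_iff.2 fun ν => ?_, ?_, fun x hx => ?_⟩
  · obtain ⟨δ, hδ, hroom⟩ := ν.exists_room 1
    have hmove : ∀ h ∈ Ico 0 δ, ν.pos + h ∈ Icc 0 (Γ.edgeLen ν.dart) := fun h hh => by
      have := hroom h ⟨hh.1, hh.2.le⟩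
      rw [Nat.cast_one, one_mul] at this
      exact ⟨ν.pos_mem.1.trans this.1, this.2.le⟩
    have red : ∀ {g : ℝ → ℝ} {s : ℤ}, (∀ t ∈ Icc 0 (Γ.edgeLen ν.dart), f (Γ.param ν.dart t) = g t) →
        (∃ ε > 0, ∀ h ∈ Ico 0 ε, g (ν.pos + h) = g ν.pos + s * h) → HasSlope f ν s := by
      rintro g s hg ⟨ε, hε, hgs⟩
      refine ⟨min ε δ, lt_min hε hδ, fun h hh => ?_⟩
      rw [Dir.move, Dir.base, hg _ (hmove h ⟨hh.1, hh.2.trans_le (min_le_right _ _)⟩),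
        hg _ ν.pos_mem_Icc]
      exact hgs h ⟨hh.1, hh.2.trans_le (min_le_left _ _)⟩
    by_cases h1 : ν.dart.fst = v
    · obtain ⟨s, hs⟩ := min_germ ν.pos c
      exact ⟨s, red (g := fun t => min t c) (fun t ht => by rw [hf _ t ht, if_pos h1]) hs⟩
    by_cases h2 : ν.dart.snd = v
    · obtain ⟨s, ε, hε, hs⟩ := min_germ_neg (Γ.edgeLen ν.dart - ν.pos) c
      refine ⟨s, red (g := fun t => min (Γ.edgeLen ν.dart - t) c)
        (fun t ht => by rw [hf _ t ht, if_neg h1, if_pos h2]) ⟨ε, hε, fun h hh => ?_⟩⟩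
      rw [← hs h hh, sub_sub]
    · refine ⟨0, red (g := fun _ => c) (fun t ht => by rw [hf _ t ht, if_neg h1, if_neg h2])
        ⟨1, one_pos, fun h _ => ?_⟩⟩
      rw [Int.cast_zero, zero_mul, add_zero]
  · obtain ⟨d, rfl⟩ := Γ.exists_dart_fst v
    rw [← param_zero, hf d 0 ⟨le_rfl, (Γ.edgeLen_pos d).le⟩, if_pos rfl, min_eq_left hc.le]
  · obtain ⟨d, t, ht, rfl⟩ := Γ.exists_param x
    rw [hf d t ht]
    split_ifs with h1 h2
    · refine lt_min (lt_of_le_of_ne ht.1 fun e => hx ?_) hc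
      rw [← e, param_zero, h1]
    · refine lt_min (sub_pos.2 (lt_of_le_of_ne ht.2 fun e => hx ?_)) hc
      rw [e, param_len, h2]
    · exact hc

theorem exists_rat_vanishing (Γ : MetricGraph) (p : Γ.Point) :
    ∃ f ∈ Γ.Rat, f p = 0 ∧ ∀ x, x ≠ p → 0 < f x := by
  obtain ⟨Γ₁, i, hi, hv, -⟩ := exists_model (const_mem_rat (Γ := Γ) 0) (const_mem_rat (Γ := Γ) 0)
    (finite_singleton p)
  obtain ⟨v, rfl⟩ := hv p rfl
  obtain ⟨f, hf, h0, hpos⟩ := Γ₁.exists_rat_vanishing_vert v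
  obtain ⟨j, hj, hj'⟩ := Function.bijective_iff_has_inverse.1 hi.bij
  refine ⟨f ∘ j, (hi.inverse hj hj').dirwise.comp_mem_rat hf, ?_, fun x hx => hpos _ fun e => hx ?_⟩
  · rw [Function.comp, hj, h0]
  · rw [← e, hj']

/-- The sum of the values of `F` at the points of a divisor. -/
def symSum {X : Type} {d : ℕ} (F : X → ℝ) (s : Sym X d) : ℝ := ((s : Multiset X).map F).sum

theorem continuous_symSum {X : Type} [TopologicalSpace X] {d : ℕ} {F : X → ℝ} (hF : Continuous F) :
    Continuous (symSum (d := d) F) := by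
  refine continuous_coinduced_dom.2 ?_
  have : (symSum F ∘ fun p : Fin d → X => (⟨Finset.univ.val.map p, by simp⟩ : Sym X d)) =
      fun p => ∑ i, F (p i) := by
    funext p
    simp only [Function.comp, symSum, Sym.coe_mk, Multiset.map_map]
    rfl
  rw [this]
  fun_prop

theorem symSum_count {X : Type} [DecidableEq X] {d : ℕ} (F : X → ℝ) (s : Sym X d) :
    symSum F s = ∑ᶠ x, F x * (Multiset.count x (s : Multiset X) : ℝ) := by
  rw [symSum, Finset.sum_multiset_map_count, finsum_eq_sum_of_support_subset (s := (s : Multiset X).toFinset)]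
  · exact Finset.sum_congr rfl fun x _ => by rw [nsmul_eq_mul, mul_comm]
  · intro x hx
    rw [Finset.mem_coe, Multiset.mem_toFinset]
    by_contra hn
    exact hx (by simp [Multiset.count_eq_zero_of_notMem hn])

instance compact_sym (X : Type) [TopologicalSpace X] [CompactSpace X] (d : ℕ) :
    CompactSpace (Sym X d) := by
  have hsurj : Function.Surjective fun p : Fin d → X => (⟨Finset.univ.val.map p, by simp⟩ : Sym X d) := by
    rintro ⟨s, hs⟩
    induction s using Quotient.inductionOn with
    | h l =>
      obtain rfl : l.length = d := hs
      refine ⟨l.get, Subtype.ext ?_⟩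
      change Multiset.map l.get Finset.univ.val = _
      rw [Fin.univ_val_map, List.ofFn_get]
      rfl
  exact hsurj.compactSpace continuous_coinduced_rng

/-- Truncate a function vanishing only at `p` at a level below all its other values on both
divisors: its sum then counts the points different from `p`, so the multiplicities of `p` agree. -/
theorem sym_ext_of_symSum {Γ : MetricGraph} {d : ℕ} {s s' : Sym Γ.Point d}
    (h : ∀ F ∈ Γ.Rat, symSum F s = symSum F s') : s = s' := by
  classical
  refine Subtype.ext (Multiset.ext.2 fun p => ?_)
  obtain ⟨f, hf, h0, hpos⟩ := Γ.exists_rat_vanishing p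
  obtain ⟨ε, hε, hle⟩ : ∃ ε > 0, ∀ x ∈ (s : Multiset Γ.Point) + s', x ≠ p → ε ≤ f x := by
    have hfin : {x | x ∈ (s : Multiset Γ.Point) + s' ∧ x ≠ p}.Finite :=
      ((s : Multiset Γ.Point) + s').toFinset.finite_toSet.subset fun x hx => by simpa using hx.1
    rcases {x | x ∈ (s : Multiset Γ.Point) + s' ∧ x ≠ p}.eq_empty_or_nonempty with he | hne
    · exact ⟨1, one_pos, fun x hx hxp => absurd (show x ∈ (∅ : Set Γ.Point) from he ▸ ⟨hx, hxp⟩)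
        (notMem_empty x)⟩
    · obtain ⟨y, hy, hmin⟩ := hfin.exists_minimalFor f _ hne
      exact ⟨f y, hpos y hy.2, fun x hx hxp => (le_total (f y) (f x)).elim id
        fun hl => hmin ⟨hx, hxp⟩ hl⟩
  have key : ∀ m : Multiset Γ.Point, (∀ x ∈ m, x ≠ p → ε ≤ f x) →
      (m.map fun x => min (f x) ε).sum = ε * (Multiset.card m - Multiset.count p m) := by
    intro m hm
    induction m using Multiset.induction_on with
    | empty => simp
    | cons a m ih =>
      rw [Multiset.map_cons, Multiset.sum_cons, ih fun x hx => hm x (Multiset.mem_cons_of_mem hx),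
        Multiset.card_cons]
      by_cases ha : a = p
      · rw [ha, Multiset.count_cons_self, h0, min_eq_left hε.le]
        push_cast
        ring
      · rw [Multiset.count_cons_of_ne (Ne.symm ha), min_eq_right (hm a (Multiset.mem_cons_self a m) ha)]
        push_cast
        ring
  have h1 := h _ (min_mem_rat hf (const_mem_rat ε))
  simp only [symSum] at h1
  rw [key _ fun x hx => hle x (Multiset.mem_add.2 (Or.inl hx)),
    key _ fun x hx => hle x (Multiset.mem_add.2 (Or.inr hx))] at h1
  have h2 : (Multiset.card s.1 - Multiset.count p s.1 : ℝ) =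
      Multiset.card s'.1 - Multiset.count p s'.1 := mul_left_cancel₀ hε.ne' h1
  rw [s.2, s'.2, sub_right_inj] at h2
  exact_mod_cast h2

/-- A continuous injection from a compact space to a Hausdorff one. The topology of the symmetric
product can hence be tested on sums of values of rational functions. -/
theorem isEmbedding_symSum (Γ : MetricGraph) (d : ℕ) :
    IsEmbedding fun (s : Sym Γ.Point d) (F : Γ.Rat) => symSum F.1 s :=
  (Continuous.isClosedEmbedding (continuous_pi fun F => continuous_symSum (continuous_of_rat F.2))
    fun _ _ e => sym_ext_of_symSum fun F hF => congrFun e ⟨F, hF⟩).isEmbedding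

instance t2_sym (Γ : MetricGraph) (d : ℕ) : T2Space (Sym Γ.Point d) :=
  (isEmbedding_symSum Γ d).t2Space

theorem exists_sym_count {X : Type} [DecidableEq X] {d : ℕ} {g : X → ℤ} (h0 : ∀ x, 0 ≤ g x)
    (hfin : (Function.support g).Finite) (hd : ∑ᶠ x, g x = d) :
    ∃ s : Sym X d, ∀ x, (Multiset.count x (s : Multiset X) : ℤ) = g x := by
  let G : X →₀ ℕ := Finsupp.ofSupportFinite (fun x => (g x).toNat)
    (hfin.subset fun x hx => fun e => hx (by simp [e]))
  have hG : ∀ x, (G x : ℤ) = g x := fun x => Int.toNat_of_nonneg (h0 x)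
  refine ⟨⟨Finsupp.toMultiset G, ?_⟩, fun x => ?_⟩
  · rw [Finsupp.card_toMultiset]
    have : ((G.sum fun _ => id : ℕ) : ℤ) = d := by
      rw [← hd, Finsupp.sum, finsum_eq_sum_of_support_subset (s := G.support)]
      · push_cast
        exact Finset.sum_congr rfl fun x _ => hG x
      · intro x hx
        rw [Finset.mem_coe, Finsupp.mem_support_iff]
        intro e
        exact hx (by rw [← hG, e]; rfl)
    exact_mod_cast this
  · rw [Sym.coe_mk, Finsupp.count_toMultiset, hG]

/-! ### The map to reduced divisors and the embedding of the quotient -/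

section Red

variable {Γ : MetricGraph} {D : Γ.Divisor} {M : Set (Γ.Point → ℝ)} {x₀ : Γ.Point}

theorem IsPencil.redFun_eq (h : IsPencil M x₀) (v x : Γ.Point) :
    redFun M v x = pot M x₀ x v - height M x₀ v := by
  rw [h.pot_comm, pot, add_sub_cancel_right]

theorem finite_support_div (D : Γ.Divisor) {f : Γ.Point → ℝ} (hf : f ∈ Γ.Rat) :
    (Function.support fun x => D x + ord f x).Finite := by
  refine (D.support.finite_toSet.union (ord_support_finite hf)).subset fun x hx => ?_
  by_contra hn
  simp only [mem_union, Finset.mem_coe, Finsupp.mem_support_iff, mem_ofPred_eq, not_or,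
    not_not] at hn
  exact hx (by simp [hn.1, hn.2])

/-- By Green's identity the sum of a rational function `F` over the reduced divisor of `v` is a
constant plus the finite sum of the values of `redFun M v` weighted by `div F`. These values depend
continuously on `v`, because `pot` is symmetric and the height is continuous. -/
theorem exists_red (h : IsPencil M x₀) (hsub : M ⊆ ratDiv D) {d : ℕ} (hd : degree D = d)
    (hH : Continuous (height M x₀)) :
    ∃ R : Γ.Point → Sym Γ.Point d, IsRedMap D M R ∧ Continuous R ∧
      ∀ x y, R x = R y ↔ Sim M x y := by
  classical
  have hr : ∀ v, redFun M v ∈ ratDiv D := fun v => hsub (h.red_mem v)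
  choose R hR using fun v => exists_sym_count (d := d) (hr v).2 (finite_support_div D (hr v).1)
    ((finsum_add_ord D (hr v).1).trans hd)
  refine ⟨R, fun v => ⟨h.red_mem v, fun x => ?_⟩, ?_, fun x y => ⟨fun e => ?_, fun e => ?_⟩⟩
  · rw [← hR v x]
  · refine (isEmbedding_symSum Γ d).continuous_iff.2 (continuous_pi fun F => ?_)
    have hfin := ord_support_finite F.2
    have : (fun v => symSum F.1 (R v)) = fun v => (∑ᶠ x, F.1 x * (D x : ℝ)) +
        ∑ x ∈ hfin.toFinset, (pot M x₀ x v - height M x₀ v) * (ord F.1 x : ℝ) := by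
      funext v
      have h1 : symSum F.1 (R v) = ∑ᶠ x, (F.1 x * (D x : ℝ) + F.1 x * (ord (redFun M v) x : ℝ)) := by
        rw [symSum_count]
        refine finsum_congr fun x => ?_
        have := hR v x
        rw [← mul_add, ← Int.cast_add, ← this, Int.cast_natCast]
      rw [h1, finsum_add_distrib, green F.2 (hr v).1,
        finsum_eq_sum_of_support_subset (s := hfin.toFinset) fun x => redFun M v x * (ord F.1 x : ℝ)]
      · simp only [h.redFun_eq]
      · intro x hx
        rw [Finset.mem_coe, Finite.mem_toFinset]
        intro e
        exact hx (by simp only [e]; simp)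
      · exact D.support.finite_toSet.subset fun x hx => by
          rw [Finset.mem_coe, Finsupp.mem_support_iff]
          exact fun e => hx (by simp only [e]; simp)
      · exact (ord_support_finite (hr v).1).subset fun x hx e => hx (by simp only [e]; simp)
    change Continuous fun v => symSum F.1 (R v)
    rw [this]
    refine continuous_const.add (continuous_finsetSum _ fun x _ => ?_)
    exact ((h.cont _ (h.pot_mem x)).sub hH).mul continuous_const
  · rw [h.sim_iff_pot]
    have ho : ∀ z, ord (redFun M x) z = ord (redFun M y) z := fun z => by
      have h1 := hR x z
      rw [e, hR y z] at h1
      linarith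
    have h2 := eq_add_of_ord_eq (hr x).1 (hr y).1 ho x₀
    funext z
    have h3 := congrFun h2 z
    simp only [pot, height]
    linarith
  · refine Subtype.ext (Multiset.ext.2 fun p => ?_)
    have h1 := hR x p
    rw [e.redFun_eq, ← hR y p] at h1
    exact_mod_cast h1

/-- A surjection between these compact Hausdorff spaces is a quotient map, so `R` factors
continuously through `T`; the factor is injective on a compact space, hence an embedding. -/
theorem exists_isEmbedding {Y : Type*} [TopologicalSpace Y] [T2Space Y] {T : MetricGraph}
    {φ : Γ.Point → T.Point} (hφ : Continuous φ) (hs : Function.Surjective φ) {R : Γ.Point → Y}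
    (hR : Continuous R) (h : ∀ x y, R x = R y ↔ φ x = φ y) :
    ∃ ι : T.Point → Y, IsEmbedding ι ∧ range ι = range R ∧ ι ∘ φ = R := by
  have hι : (R ∘ Function.surjInv hs) ∘ φ = R :=
    funext fun x => (h _ _).2 (Function.surjInv_eq hs (φ x))
  refine ⟨R ∘ Function.surjInv hs, ?_, ?_, hι⟩
  · refine (Continuous.isClosedEmbedding ?_ fun a b e => ?_).isEmbedding
    · rw [(hφ.isClosedMap.isQuotientMap hφ hs).continuous_iff, hι]
      exact hR
    · have := (h _ _).1 e
      rwa [Function.surjInv_eq hs, Function.surjInv_eq hs] at this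
  · conv_rhs => rw [← hι]
    exact (hs.range_comp _).symm

end Red

end MetricGraph
end

noncomputable section
namespace MetricGraph

/-! ## Attaching a leaf -/

/-- The metric graph obtained by attaching an edge of length `l` to the vertex `v`. -/
def attach (Γ : MetricGraph) (v : Γ.V) (l : ℝ) (hl : 0 < l) : MetricGraph where
  V := Option Γ.V
  G :=
    { Adj := fun
        | some a, some b => Γ.G.Adj a b
        | some a, none => a = v
        | none, some b => b = v
        | none, none => False
      symm := ⟨fun
        | some _, some _, h => h.symm
        | some _, none, h => h
        | none, some _, h => h
        | none, none, h => h⟩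
      loopless := ⟨fun
        | some _, h => Γ.G.loopless.irrefl _ h
        | none, h => h⟩ }
  connected := by
    refine SimpleGraph.connected_iff_exists_forall_reachable _ |>.2 ⟨some v, fun a => ?_⟩
    cases a with
    | none => exact SimpleGraph.Adj.reachable (show v = v from rfl)
    | some a =>
      refine Γ.vert_reachable_induction (P := fun a => SimpleGraph.Reachable _ (some v) (some a))
        (SimpleGraph.Reachable.refl _) (fun d hd => hd.trans ?_) a
      exact SimpleGraph.Adj.reachable d.adj
  len := Sym2.lift ⟨fun
    | some a, some b => Γ.len s(a, b)
    | some _, none => l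
    | none, some _ => l
    | none, none => l, by
      rintro (_ | a) (_ | b)
      all_goals first | rfl | exact congrArg Γ.len Sym2.eq_swap⟩
  len_pos e he := by
    induction e with
    | h a b =>
      rcases a with _ | a <;> rcases b with _ | b
      · exact hl
      · exact hl
      · exact hl
      · exact Γ.len_pos _ he

section Attach

variable {Γ : MetricGraph} {v : Γ.V} {l : ℝ} {hl : 0 < l}

/-- The vertices of the original graph. -/
def attachVert (v : Γ.V) (hl : 0 < l) (a : Γ.V) : (Γ.attach v l hl).V := some a

/-- The new vertex. -/
def attachLeaf (v : Γ.V) (hl : 0 < l) : (Γ.attach v l hl).V := none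

theorem attachVert_inj {a b : Γ.V} : attachVert v hl a = attachVert v hl b ↔ a = b :=
  (Option.some_injective _).eq_iff

theorem attachVert_ne (a : Γ.V) : attachVert v hl a ≠ attachLeaf v hl := Option.some_ne_none a

theorem attachLeaf_ne (a : Γ.V) : attachLeaf v hl ≠ attachVert v hl a := (attachVert_ne a).symm

/-- The edges of the original graph. -/
def attachOld (v : Γ.V) (hl : 0 < l) (d : Γ.Dart) : (Γ.attach v l hl).Dart :=
  ⟨(attachVert v hl d.fst, attachVert v hl d.snd), d.adj⟩

/-- The new edge, pointing to the leaf. -/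
def attachNew (v : Γ.V) (hl : 0 < l) : (Γ.attach v l hl).Dart := ⟨(attachVert v hl v, attachLeaf v hl), rfl⟩

theorem attachOld_fst (d : Γ.Dart) : (attachOld v hl d).fst = attachVert v hl d.fst := rfl

theorem attachNew_fst : (attachNew v hl).fst = attachVert v hl v := rfl

theorem attachNew_symm_fst : (attachNew v hl).symm.fst = attachLeaf v hl := rfl

theorem attach_dart_cases (d : (Γ.attach v l hl).Dart) :
    (∃ d', d = attachOld v hl d') ∨ d = attachNew v hl ∨ d = (attachNew v hl).symm := by
  obtain ⟨⟨a, b⟩, hab⟩ := d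
  rcases a with _ | a <;> rcases b with _ | b
  · exact hab.elim
  · obtain rfl : b = v := hab
    exact Or.inr (Or.inr rfl)
  · obtain rfl : a = v := hab
    exact Or.inr (Or.inl rfl)
  · exact Or.inl ⟨⟨(a, b), hab⟩, rfl⟩

theorem finsum_attach_dart {N : Type*} [AddCommMonoid N] (F : (Γ.attach v l hl).Dart → N) :
    ∑ᶠ d, F d = F (attachNew v hl) + (F (attachNew v hl).symm + ∑ᶠ d, F (attachOld v hl d)) := by
  have := Fintype.ofFinite Γ.Dart
  let e : Option (Option Γ.Dart) → (Γ.attach v l hl).Dart := fun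
    | none => attachNew v hl
    | some none => (attachNew v hl).symm
    | some (some d) => attachOld v hl d
  have he : Function.Bijective e := by
    refine ⟨?_, fun d => ?_⟩
    · intro a b h
      have h1 : (e a).fst = (e b).fst := by rw [h]
      have h2 : (e a).snd = (e b).snd := by rw [h]
      rcases a with _ | _ | a <;> rcases b with _ | _ | b
      · rfl
      · exact absurd h1 (attachVert_ne _)
      · exact absurd h2 (attachLeaf_ne _)
      · exact absurd h1 (attachLeaf_ne _)
      · rfl
      · exact absurd h1 (attachLeaf_ne _)
      · exact absurd h2 (attachVert_ne _)
      · exact absurd h1 (attachVert_ne _)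
      · congr 2
        exact SimpleGraph.Dart.ext _ _ (Prod.ext (attachVert_inj.1 h1) (attachVert_inj.1 h2))
    · rcases attach_dart_cases d with ⟨d', rfl⟩ | rfl | rfl
      · exact ⟨some (some d'), rfl⟩
      · exact ⟨none, rfl⟩
      · exact ⟨some none, rfl⟩
  rw [← finsum_eq_of_bijective (f := fun a => F (e a)) e he fun _ => rfl,
    finsum_eq_sum_of_fintype, Fintype.sum_option, Fintype.sum_option, finsum_eq_sum_of_fintype]

theorem finsum_option' {α N : Type*} [Finite α] [AddCommMonoid N] (F : Option α → N) :
    ∑ᶠ a, F a = F none + ∑ᶠ a, F (some a) := by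
  have := Fintype.ofFinite α
  rw [finsum_eq_sum_of_fintype, Fintype.sum_option, finsum_eq_sum_of_fintype]

/-- The inclusion of the original graph, as a simplicial map. -/
def attachSimp (v : Γ.V) (hl : 0 < l) : Simp Γ (Γ.attach v l hl) where
  f := attachVert v hl
  k _ := 1
  adj d := d.adj
  k_pos _ := le_rfl
  k_symm _ := rfl
  len d := by
    rw [Nat.cast_one, one_mul]
    rfl

theorem attachSimp_dart (d : Γ.Dart) : (attachSimp v hl).dart d = attachOld v hl d := rfl

theorem edgeLen_attachOld (d : Γ.Dart) :
    (Γ.attach v l hl).edgeLen (attachOld v hl d) = Γ.edgeLen d := rfl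

theorem edgeLen_attachNew : (Γ.attach v l hl).edgeLen (attachNew v hl) = l := rfl

theorem attachSimp_map_param (d : Γ.Dart) {t : ℝ} (ht : t ∈ Icc 0 (Γ.edgeLen d)) :
    (attachSimp v hl).map (Γ.param d t) = (Γ.attach v l hl).param (attachOld v hl d) t := by
  rw [Simp.map_param _ d ht]
  rw [attachSimp_dart]
  simp [attachSimp]

open Classical in
theorem bary_apply (Γ : MetricGraph) (d : Γ.Dart) (t : ℝ) (a : Γ.V) : Γ.bary d t a =
    (if a = d.fst then 1 - t / Γ.edgeLen d else 0) + if a = d.snd then t / Γ.edgeLen d else 0 := by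
  simp [bary, Pi.single_apply]

open Classical in
theorem attachSimp_val_vert (x : Γ.Point) (a : Γ.V) :
    ((attachSimp v hl).map x).1 (attachVert v hl a) = x.1 a := by
  obtain ⟨d, t, ht, rfl⟩ := Γ.exists_param x
  rw [attachSimp_map_param d ht, param_val _ _ (by rwa [edgeLen_attachOld]), param_val _ _ ht]
  rw [bary_apply, bary_apply, edgeLen_attachOld]
  congr 1 <;> exact if_congr attachVert_inj rfl rfl

/-- The barycentric coordinate of the leaf vanishes on the old graph and is positive on the new edge
away from its foot, so it separates the two parts. -/
theorem attachSimp_val_leaf (x : Γ.Point) : ((attachSimp v hl).map x).1 (attachLeaf v hl) = 0 := by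
  obtain ⟨d, t, ht, rfl⟩ := Γ.exists_param x
  rw [attachSimp_map_param d ht, param_val _ _ (by rwa [edgeLen_attachOld])]
  exact bary_ne _ _ _ (attachLeaf_ne _) (attachLeaf_ne _)

theorem attachSimp_injective : Function.Injective (attachSimp v hl).map := fun x y e => by
  refine Subtype.ext (funext fun a => ?_)
  rw [← attachSimp_val_vert (v := v) (hl := hl), e, attachSimp_val_vert]

theorem attachNew_notMem {t : ℝ} (ht : t ∈ Ioc 0 l) :
    (Γ.attach v l hl).param (attachNew v hl) t ∉ range (attachSimp v hl).map := by
  rintro ⟨x, hx⟩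
  have h1 := attachSimp_val_leaf (v := v) (hl := hl) x
  rw [hx, param_val _ _ (Ioc_subset_Icc_self ht)] at h1
  have h2 := bary_snd _ (attachNew v hl) t
  rw [edgeLen_attachNew] at h2
  exact (div_pos ht.1 hl).ne' (h2.symm.trans h1)

theorem attachSimp_dirwise : Dirwise (attachSimp v hl).map {1} := fun ν => by
  obtain ⟨ν', -, -, h⟩ := (attachSimp v hl).mapsDir ν
  exact ⟨ν', 1, rfl, h⟩

open Classical in
/-- The contraction of the new edge. -/
def attachRetract (v : Γ.V) (hl : 0 < l) (y : (Γ.attach v l hl).Point) : Γ.Point :=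
  if h : ∃ x, (attachSimp v hl).map x = y then h.choose else Γ.vert v

theorem attachRetract_map (x : Γ.Point) : attachRetract v hl ((attachSimp v hl).map x) = x := by
  have h : ∃ x', (attachSimp v hl).map x' = (attachSimp v hl).map x := ⟨x, rfl⟩
  rw [attachRetract, dif_pos h]
  exact attachSimp_injective h.choose_spec

theorem isElementaryModification_attach :
    IsElementaryModification (attachSimp v hl).map (attachRetract v hl) := by
  have h0 : (Γ.attach v l hl).param (attachNew v hl) 0 = (attachSimp v hl).map (Γ.vert v) := by
    rw [param_zero, Simp.map_vert]
    rfl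
  refine ⟨⟨attachSimp_injective, attachSimp_dirwise.continuous, attachSimp_dirwise.piecewiseDilation⟩,
    attachRetract_map, Γ.vert v, l, (Γ.attach v l hl).param (attachNew v hl), hl,
    ⟨∅, fun a b ha hab hb _ => ⟨1, rfl, attachNew v hl, a, fun t ht => ?_⟩⟩,
    param_injOn _ _, h0, fun t ht => attachNew_notMem ht, fun y => ?_, fun t ht => ?_⟩
  · rw [Nat.cast_one, one_mul, add_sub_cancel, edgeLen_attachNew]
    exact ⟨⟨ha.trans ht.1, ht.2.trans hb⟩, rfl⟩
  · obtain ⟨D, t, ht, rfl⟩ := exists_param _ y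
    rcases attach_dart_cases D with ⟨d, rfl⟩ | rfl | rfl
    · exact Or.inl ⟨_, attachSimp_map_param d ht⟩
    · exact Or.inr ⟨t, ht, rfl⟩
    · rw [edgeLen_symm] at ht
      refine Or.inr ⟨l - t, ⟨by linarith [ht.2, edgeLen_attachNew (v := v) (hl := hl)],
        by linarith [ht.1]⟩, ?_⟩
      have := param_symm _ (attachNew v hl) (t := l - t)
        ⟨by linarith [ht.2, edgeLen_attachNew (v := v) (hl := hl)],
          by linarith [ht.1, edgeLen_attachNew (v := v) (hl := hl)]⟩
      rw [← this, edgeLen_attachNew, sub_sub_cancel]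
  · rcases eq_or_lt_of_le ht.1 with rfl | hlt
    · rw [h0, attachRetract_map]
    · rw [attachRetract]
      exact dif_neg (attachNew_notMem ⟨hlt, ht.2⟩)

end Attach

/-! ### Extending a simplicial map over a new leaf -/

namespace Simp

variable {Γ T : MetricGraph} (σ : Simp Γ T) {v : Γ.V} {E : T.Dart} (hE : E.fst = σ.f v)
  {m : ℕ} (hm : 0 < m)

/-- The length of the new edge is chosen so that dilation by `m` maps it exactly onto `E`. -/
theorem attachLen_pos (E : T.Dart) {m : ℕ} (hm : 0 < m) : 0 < T.edgeLen E / m :=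
  div_pos (T.edgeLen_pos E) (by exact_mod_cast hm)

/-- The extension of a simplicial map to a new edge. -/
def extend : Simp (Γ.attach v (T.edgeLen E / m) (attachLen_pos E hm)) T where
  f := fun
    | some a => σ.f a
    | none => E.snd
  k := fun
    | ⟨(some a, some b), h⟩ => σ.k ⟨(a, b), h⟩
    | ⟨(some _, none), _⟩ => m
    | ⟨(none, some _), _⟩ => m
    | ⟨(none, none), _⟩ => m
  adj d := by
    rcases attach_dart_cases d with ⟨d', rfl⟩ | rfl | rfl
    · exact σ.adj d'
    · have := E.adj
      rw [hE] at this
      exact this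
    · have := E.symm.adj
      change T.G.Adj E.snd E.fst at this
      rw [hE] at this
      exact this
  k_pos d := by
    rcases attach_dart_cases d with ⟨d', rfl⟩ | rfl | rfl
    · exact σ.k_pos d'
    · exact hm
    · exact hm
  k_symm d := by
    rcases attach_dart_cases d with ⟨d', rfl⟩ | rfl | rfl
    · exact σ.k_symm d'
    · rfl
    · rfl
  len d := by
    have hc : (m : ℝ) * (T.edgeLen E / m) = T.edgeLen E :=
      mul_div_cancel₀ _ (by exact_mod_cast hm.ne')
    rcases attach_dart_cases d with ⟨d', rfl⟩ | rfl | rfl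
    · exact σ.len d'
    · change T.len s(σ.f v, E.snd) = m * (T.edgeLen E / m)
      rw [hc, ← hE]
      rfl
    · change T.len s(E.snd, σ.f v) = m * (T.edgeLen E / m)
      rw [hc, ← hE, Sym2.eq_swap]
      rfl

theorem extend_dart_old (d : Γ.Dart) :
    (σ.extend hE hm).dart (attachOld v (attachLen_pos E hm) d) = σ.dart d := rfl

theorem extend_dart_new : (σ.extend hE hm).dart (attachNew v (attachLen_pos E hm)) = E :=
  SimpleGraph.Dart.ext _ _ (Prod.ext hE.symm rfl)

theorem extend_dart_new_symm :
    (σ.extend hE hm).dart (attachNew v (attachLen_pos E hm)).symm = E.symm := by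
  rw [dart_symm, extend_dart_new]

theorem extend_map (x : Γ.Point) :
    (σ.extend hE hm).map ((attachSimp v (attachLen_pos E hm)).map x) = σ.map x := by
  obtain ⟨d, t, ht, rfl⟩ := Γ.exists_param x
  rw [attachSimp_map_param d ht, σ.map_param d ht]
  exact (σ.extend hE hm).map_param (attachOld v (attachLen_pos E hm) d) ht

open Classical in
theorem extend_mult_vert (w : Γ.V) (E' : T.Dart) :
    (σ.extend hE hm).mult (attachVert v (attachLen_pos E hm) w) E' =
      (if w = v ∧ E' = E then m else 0) + σ.mult w E' := by
  rw [mult_eq, mult_eq, finsum_attach_dart]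
  simp only [extend_dart_old, extend_dart_new, extend_dart_new_symm]
  simp only [attachNew_fst, attachOld_fst, attachNew_symm_fst, attachVert_inj, attachLeaf_ne,
    false_and, if_false, zero_add, eq_comm (a := v), eq_comm (a := E)]
  rfl

open Classical in
theorem extend_mult_leaf (E' : T.Dart) :
    (σ.extend hE hm).mult (attachLeaf v (attachLen_pos E hm)) E' =
      if E' = E.symm then m else 0 := by
  rw [mult_eq, finsum_attach_dart]
  simp only [extend_dart_old, extend_dart_new, extend_dart_new_symm]
  simp only [attachNew_fst, attachOld_fst, attachNew_symm_fst, attachVert_ne,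
    false_and, if_false, zero_add, finsum_zero, add_zero, true_and, eq_comm (a := E.symm)]
  rfl

theorem extend_finsum_k : ∑ᶠ d, (σ.extend hE hm).k d = 2 * m + ∑ᶠ d, σ.k d := by
  rw [finsum_attach_dart, two_mul, add_assoc]
  rfl

end Simp

end MetricGraph
end

noncomputable section
namespace MetricGraph

/-! ## Making a simplicial map to a tree harmonic -/

/-- At the head of `E` only one direction leads to the vertex `a`. It is `E'`, hence not `E.symm`,
so `a` lies beyond `E`. -/
theorem IsTree.cutFun_pos_of_continues {T : MetricGraph} (hT : T.IsTree) {E E' : T.Dart}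
    (h : E'.fst = E.snd) (hne : E' ≠ E.symm) {a : T.V} (ha : 0 < hT.cutFun E' (T.vert a)) :
    0 < hT.cutFun E (T.vert a) := by
  have h0 : T.vert E.snd ≠ T.vert a := fun e => by
    rw [← e, ← h, ← param_zero, hT.cutFun_param _ ⟨le_rfl, (T.edgeLen_pos _).le⟩] at ha
    exact ha.false
  obtain ⟨ν, -, hu⟩ := hT.exists_unique_ahead h0
  have h1 : T.dartDir E' = ν := (hu _ (by rw [dartDir_base, h])).1 ha
  have h2 : ¬ hT.Ahead (T.dartDir E.symm) (T.vert a) := fun h2 =>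
    hne (congrArg Dir.dart (h1.trans ((hu _ (by rw [dartDir_base]; rfl)).1 h2).symm))
  have h3 := hT.cutFun_add_symm E (T.vert a)
  have h4 : hT.cutFun E.symm (T.vert a) ≤ 0 := not_lt.1 h2
  linarith [T.edgeLen_pos E]

-- Fewer vertices lie beyond the continuations of `E` than beyond `E`. Powers of a number exceeding
-- the number of darts, with these counts as exponents, outweigh all continuations together.
open Classical in
theorem IsTree.exists_weight {T : MetricGraph} (hT : T.IsTree) : ∃ W : T.Dart → ℕ,
    ∀ E, ∑ᶠ E' : T.Dart, (if E'.fst = E.snd ∧ E' ≠ E.symm then W E' else 0) < W E := by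
  have := Fintype.ofFinite T.Dart
  let size : T.Dart → ℕ := fun E => {a : T.V | 0 < hT.cutFun E (T.vert a)}.ncard
  have hs : ∀ E E' : T.Dart, E'.fst = E.snd → E' ≠ E.symm → size E' < size E := by
    intro E E' h hne
    refine Set.ncard_lt_ncard ⟨fun a ha => hT.cutFun_pos_of_continues h hne ha, fun hsub => ?_⟩
      (toFinite _)
    have h1 : 0 < hT.cutFun E (T.vert E.snd) := by
      rw [← param_len, hT.cutFun_param _ ⟨(T.edgeLen_pos _).le, le_rfl⟩]
      exact T.edgeLen_pos E
    have h2 : 0 < hT.cutFun E' (T.vert E.snd) := hsub h1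
    rw [← h, ← param_zero, hT.cutFun_param _ ⟨le_rfl, (T.edgeLen_pos _).le⟩] at h2
    exact h2.false
  set K := Fintype.card T.Dart + 1
  refine ⟨fun E => K ^ size E, fun E => ?_⟩
  rw [finsum_eq_sum_of_fintype]
  refine Nat.lt_of_mul_lt_mul_right (a := K) ?_
  have hle : (∑ E' : T.Dart, if E'.fst = E.snd ∧ E' ≠ E.symm then K ^ size E' else 0) * K ≤
      Fintype.card T.Dart * K ^ size E := by
    rw [Finset.sum_mul, ← Finset.card_univ, ← smul_eq_mul (a := Finset.univ.card)]
    refine Finset.sum_le_card_nsmul _ _ _ fun E' _ => ?_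
    split_ifs with hc
    · rw [← pow_succ]
      exact Nat.pow_le_pow_right (Nat.succ_pos _) (hs E E' hc.1 hc.2)
    · rw [zero_mul]
      exact Nat.zero_le _
  refine hle.trans_lt ?_
  rw [mul_comm (K ^ size E)]
  exact Nat.mul_lt_mul_of_pos_right (Nat.lt_succ_self _) (pow_pos (Nat.succ_pos _) _)

namespace Simp

variable {Γ T : MetricGraph}

/-- The numbers `δ v` bound the sums of the factors over an edge, and they are the local degrees
of a harmonic map of degree `d` if they agree with these sums. -/
structure IsFeasible (σ : Simp Γ T) (δ : Γ.V → ℕ) (d : ℕ) : Prop where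
  surjective : Function.Surjective σ.map
  mult_le : ∀ v (E : T.Dart), E.fst = σ.f v → σ.mult v E ≤ δ v
  euler : 2 * (∑ᶠ v, δ v) = (∑ᶠ e, σ.k e) + 2 * d

open Classical in
/-- The weighted number of the places where harmonicity fails. -/
def defect (σ : Simp Γ T) (W : T.Dart → ℕ) (δ : Γ.V → ℕ) : ℕ :=
  ∑ᶠ v, ∑ᶠ E : T.Dart, if E.fst = σ.f v ∧ σ.mult v E < δ v then W E else 0

variable {v : Γ.V} {l : ℝ} {hl : 0 < l}

theorem finsum_attach_vert {N : Type*} [AddCommMonoid N] (F : (Γ.attach v l hl).V → N) :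
    ∑ᶠ a, F a = F (attachLeaf v hl) + ∑ᶠ a, F (attachVert v hl a) := finsum_option' F

/-- The extension of a function on the vertices to a new leaf. -/
def extendDeg (δ : Γ.V → ℕ) (v : Γ.V) (hl : 0 < l) (m : ℕ) : (Γ.attach v l hl).V → ℕ := fun
  | some a => δ a
  | none => m

variable {σ : Simp Γ T} {δ : Γ.V → ℕ} {d : ℕ} {E : T.Dart} (hE : E.fst = σ.f v)
  {m : ℕ} (hm : 0 < m)

theorem IsFeasible.extend (h : IsFeasible σ δ d) (hmd : σ.mult v E + m = δ v) :
    IsFeasible (σ.extend hE hm) (extendDeg δ v (attachLen_pos E hm) m) d where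
  surjective y := by
    obtain ⟨x, rfl⟩ := h.surjective y
    exact ⟨_, σ.extend_map hE hm x⟩
  mult_le w E' he := by
    classical
    cases w with
    | none =>
      change (σ.extend hE hm).mult (attachLeaf v _) E' ≤ m
      rw [extend_mult_leaf]
      split_ifs <;> omega
    | some w =>
      change (σ.extend hE hm).mult (attachVert v _ w) E' ≤ δ w
      rw [extend_mult_vert]
      split_ifs with hc
      · obtain ⟨rfl, rfl⟩ := hc
        omega
      · rw [zero_add]
        exact h.mult_le w E' he
  euler := by
    rw [finsum_attach_vert, extend_finsum_k]
    change 2 * (m + ∑ᶠ a, δ a) = _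
    have := h.euler
    omega

/-- The new edge repairs the defect at `(v, E)`, saving `W E`. New defects only arise at the leaf,
over the directions other than the way back, and their total weight is smaller than `W E`. -/
theorem defect_extend {W : T.Dart → ℕ}
    (hW : ∀ E, ∑ᶠ E' : T.Dart, (open Classical in
      if E'.fst = E.snd ∧ E' ≠ E.symm then W E' else 0) < W E)
    (hmd : σ.mult v E + m = δ v) :
    (σ.extend hE hm).defect W (extendDeg δ v (attachLen_pos E hm) m) < σ.defect W δ := by
  classical
  have := Fintype.ofFinite Γ.V
  have := Fintype.ofFinite T.Dart
  unfold defect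
  rw [finsum_attach_vert]
  have h1 : (∑ᶠ E' : T.Dart, if E'.fst = (σ.extend hE hm).f (attachLeaf v (attachLen_pos E hm)) ∧
      (σ.extend hE hm).mult (attachLeaf v (attachLen_pos E hm)) E' <
        extendDeg δ v (attachLen_pos E hm) m (attachLeaf v (attachLen_pos E hm)) then W E' else 0) =
      ∑ᶠ E' : T.Dart, if E'.fst = E.snd ∧ E' ≠ E.symm then W E' else 0 := by
    refine finsum_congr fun E' => if_congr (and_congr Iff.rfl ?_) rfl rfl
    rw [extend_mult_leaf]
    change _ < m ↔ _
    split_ifs with hc <;> simp [hc, hm]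
  have h2 : ∑ᶠ w, ∑ᶠ E' : T.Dart, (if E'.fst = σ.f w ∧ σ.mult w E' < δ w then W E' else 0) =
      W E + ∑ᶠ w, ∑ᶠ E' : T.Dart,
        if E'.fst = (σ.extend hE hm).f (attachVert v (attachLen_pos E hm) w) ∧
          (σ.extend hE hm).mult (attachVert v (attachLen_pos E hm) w) E' <
            extendDeg δ v (attachLen_pos E hm) m (attachVert v (attachLen_pos E hm) w)
          then W E' else 0 := by
    have hs : W E = ∑ w, ∑ E' : T.Dart, if w = v then (if E' = E then W E else 0) else 0 := by
      simp
    simp only [finsum_eq_sum_of_fintype]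
    rw [hs, ← Finset.sum_add_distrib]
    refine Finset.sum_congr rfl fun w _ => ?_
    rw [← Finset.sum_add_distrib]
    refine Finset.sum_congr rfl fun E' _ => ?_
    rw [extend_mult_vert]
    change _ = _ + if E'.fst = σ.f w ∧ _ < δ w then W E' else 0
    by_cases hw : w = v
    · by_cases he : E' = E
      · subst hw he
        have h3 : σ.mult w E' < δ w := by omega
        have h4 : ¬ m + σ.mult w E' < δ w := by omega
        simp [hE, h3, h4]
      · simp [he]
    · simp [hw]
  rw [h1, h2]
  exact Nat.add_lt_add_right (hW E) _

/-- Strong induction on the defect. When it cannot be lowered further, the map is harmonic and the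
Euler relation, preserved by all extensions, gives its degree. -/
theorem exists_modification_aux (hT : T.IsTree) {W : T.Dart → ℕ}
    (hW : ∀ E, ∑ᶠ E' : T.Dart, (open Classical in
      if E'.fst = E.snd ∧ E' ≠ E.symm then W E' else 0) < W E) {Γ₀ : MetricGraph} {d : ℕ} (n : ℕ) :
    ∀ (Γ : MetricGraph) (σ : Simp Γ T) (δ : Γ.V → ℕ) (i : Γ₀.Point → Γ.Point)
      (α : Γ.Point → Γ₀.Point), IsFeasible σ δ d → σ.defect W δ = n →
      IsTropicalModification Γ₀ Γ i α →
      ∃ (Γ' : MetricGraph) (i' : Γ₀.Point → Γ'.Point) (α' : Γ'.Point → Γ₀.Point)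
        (φ : Γ'.Point → T.Point), IsTropicalModification Γ₀ Γ' i' α' ∧ IsFiniteHarmonic φ ∧
        HasDegree φ d ∧ φ ∘ i' = σ.map ∘ i := by
  induction n using Nat.strong_induction_on with
  | h n ih =>
    intro Γ σ δ i α hσ hn hi
    by_cases hdef : ∀ v (E : T.Dart), E.fst = σ.f v → σ.mult v E = δ v
    · exact ⟨Γ, i, α, σ.map, hi, σ.isFiniteHarmonic hσ.surjective hdef,
        σ.hasDegree hT hσ.surjective hdef hσ.euler, rfl⟩
    · push Not at hdef
      obtain ⟨v, E, hE, hne⟩ := hdef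
      have hle := hσ.mult_le v E hE
      have hm : 0 < δ v - σ.mult v E := by omega
      have hmd : σ.mult v E + (δ v - σ.mult v E) = δ v := by omega
      obtain ⟨Γ', i', α', φ, h1, h2, h3, h4⟩ := ih _ (hn ▸ defect_extend hE hm hW hmd) _
        (σ.extend hE hm) _ _ _ (hσ.extend hE hm hmd) rfl
        (hi.attach _ _ _ _ _ _ isElementaryModification_attach)
      refine ⟨Γ', i', α', φ, h1, h2, h3, h4.trans (funext fun x => ?_)⟩
      exact σ.extend_map hE hm (i x)

/-- A feasible simplicial map to a tree extends to a harmonic morphism of degree `d` on a tropical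
modification. -/
theorem IsFeasible.exists_modification (hT : T.IsTree) (h : IsFeasible σ δ d) {Γ₀ : MetricGraph}
    {i : Γ₀.Point → Γ.Point} {α : Γ.Point → Γ₀.Point} (hi : IsTropicalModification Γ₀ Γ i α) :
    ∃ (Γ' : MetricGraph) (i' : Γ₀.Point → Γ'.Point) (α' : Γ'.Point → Γ₀.Point)
      (φ : Γ'.Point → T.Point), IsTropicalModification Γ₀ Γ' i' α' ∧ IsFiniteHarmonic φ ∧
      HasDegree φ d ∧ φ ∘ i' = σ.map ∘ i := by
  obtain ⟨W, hW⟩ := hT.exists_weight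
  exact exists_modification_aux hT hW _ Γ σ δ i α h rfl hi

end Simp

/-! ### Feasibility of the quotient map of a pencil -/

section Feasible

variable {Γ : MetricGraph} {D : Γ.Divisor} {M : Set (Γ.Point → ℝ)} {x₀ : Γ.Point}
  {s₀ s₁ : Γ.Dart → ℤ}

theorem IsAdapted.slope_red_snd (h : IsAdapted D M s₀ s₁) (hp : IsPencil M x₀) (d : Γ.Dart) :
    slope (redFun M (Γ.vert d.snd)) (Γ.dartDir d) = s₁ d := by
  refine HasSlope.slope_eq ⟨Γ.edgeLen d, Γ.edgeLen_pos d, fun t ht => ?_⟩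
  have hr : ∀ u ∈ Icc 0 (Γ.edgeLen d), redFun M (Γ.vert d.snd) (Γ.param d u) =
      s₁ d * (u - Γ.edgeLen d) := fun u hu => by
    rw [← param_len]
    exact h.red_left hp d hu.1 hu.2 le_rfl
  change redFun M _ (Γ.param d (0 + t)) = redFun M _ (Γ.param d 0) + _
  rw [zero_add, hr t (Ico_subset_Icc_self ht), hr 0 ⟨le_rfl, (Γ.edgeLen_pos d).le⟩]
  ring

namespace IsFine

variable (h : IsFine D M x₀ s₀ s₁)
include h

/-- All edges at `v` over `E` have equivalent far ends, with a common reduced function. It has the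
upper slopes along these edges and at least the lower slopes along the others; effectivity of the
reduced divisor at `v` bounds the sum of its slopes by `D`. -/
theorem mult_le (v : Γ.V) (E : h.tree.Dart) :
    (h.simp.mult v E : ℤ) ≤ D (Γ.vert v) - ∑ᶠ d : {d : Γ.Dart // d.fst = v}, s₀ d.1 := by
  classical
  -- If no edge at `v` lies over `E`, any vertex serves.
  have hex : ∃ u : Γ.V, ∀ d : Γ.Dart, d.fst = v → h.simp.dart d = E →
      redFun M (Γ.vert d.snd) = redFun M (Γ.vert u) := by
    by_cases hd : ∃ d : Γ.Dart, d.fst = v ∧ h.simp.dart d = E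
    · obtain ⟨d₀, -, h0⟩ := hd
      refine ⟨d₀.snd, fun d _ hd => Sim.redFun_eq (h.simp_f_eq.1 ?_)⟩
      exact congrArg (fun E : h.tree.Dart => E.snd) (hd.trans h0.symm)
    · exact ⟨v, fun d h1 h2 => absurd ⟨d, h1, h2⟩ hd⟩
  obtain ⟨u, hu⟩ := hex
  have hM := h.pencil.red_mem (Γ.vert u)
  have h1 := (h.adapted.series.sub hM).2 (Γ.vert v)
  rw [ord, finsum_tangent_vert v fun ν => slope (redFun M (Γ.vert u)) ν] at h1
  have h2 : (h.simp.mult v E : ℤ) + ∑ᶠ d : {d : Γ.Dart // d.fst = v}, s₀ d.1 ≤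
      ∑ᶠ d : {d : Γ.Dart // d.fst = v}, slope (redFun M (Γ.vert u)) (Γ.dartDir d.1) := by
    have := Fintype.ofFinite {d : Γ.Dart // d.fst = v}
    rw [Simp.mult, finsum_eq_sum_of_fintype, finsum_eq_sum_of_fintype, finsum_eq_sum_of_fintype]
    push_cast
    rw [← Finset.sum_add_distrib]
    refine Finset.sum_le_sum fun d _ => ?_
    have hlt := h.adapted.lt d.1
    split_ifs with he
    · rw [← hu d.1 d.2 he, h.adapted.slope_red_snd h.pencil]
      change (((s₁ d.1 - s₀ d.1).toNat : ℕ) : ℤ) + s₀ d.1 ≤ s₁ d.1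
      omega
    · rcases h.adapted.slope_cases hM (Γ.dartDir d.1) with e | e <;> rw [e] <;>
        change 0 + s₀ d.1 ≤ _ <;> rw [zero_add]
      · exact le_rfl
      · exact hlt.le
  linarith

/-- Take for `δ` the bound of `mult_le`. Its sum is `d` minus the sum of all lower slopes, as `D` is
supported on vertices; the factors sum to minus twice the same sum, because the upper slope is minus
the lower slope of the reversed edge. This is the Euler relation. -/
theorem exists_isFeasible {d : ℕ} (hd : degree D = d) : ∃ δ, h.simp.IsFeasible δ d := by
  classical
  have := Fintype.ofFinite Γ.V
  have := Fintype.ofFinite Γ.Dart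
  let g : Γ.V → ℤ := fun v => D (Γ.vert v) - ∑ᶠ d : {d : Γ.Dart // d.fst = v}, s₀ d.1
  have hg : ∀ v, 0 ≤ g v := fun v => by
    obtain ⟨d, rfl⟩ := Γ.exists_dart_fst v
    exact (Int.natCast_nonneg _).trans (h.mult_le _ (h.simp.dart d))
  refine ⟨fun v => (g v).toNat, h.simp_surjective, fun v E _ => ?_, ?_⟩
  · have := h.mult_le v E
    exact (Int.le_toNat (hg v)).2 this
  · have h1 : ∑ v, D (Γ.vert v) = d := by
      rw [← hd, degree, ← finsum_finsupp, finsum_comp_injective Γ.vert_injective,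
        finsum_eq_sum_of_fintype]
      intro x hx
      by_contra hn
      exact hx (h.adapted.supp x hn)
    have h2 : ∑ v, (∑ᶠ e : {d : Γ.Dart // d.fst = v}, s₀ e.1) = ∑ e, s₀ e := by
      have : ∀ v, (∑ᶠ e : {d : Γ.Dart // d.fst = v}, s₀ e.1) =
          ∑ e : Γ.Dart, if e.fst = v then s₀ e else 0 := fun v => by
        rw [finsum_eq_sum_of_fintype, ← Finset.sum_filter]
        exact (Finset.sum_subtype _ (by simp) _).symm
      rw [Finset.sum_congr rfl fun v _ => this v, Finset.sum_comm]
      simp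
    have h3 : ∑ e, (h.simp.k e : ℤ) = -2 * ∑ e, s₀ e := by
      have h4 : ∑ e : Γ.Dart, s₀ e.symm = ∑ e, s₀ e :=
        Equiv.sum_comp (SimpleGraph.Dart.symm_involutive (G := Γ.G)).toPerm s₀
      have h5 : ∀ e : Γ.Dart, (h.simp.k e : ℤ) = -s₀ e.symm - s₀ e := fun e => by
        have := h.adapted.lt e
        rw [h.adapted.symm]
        change (((s₁ e - s₀ e).toNat : ℕ) : ℤ) = _
        omega
      rw [Finset.sum_congr rfl fun e _ => h5 e, Finset.sum_sub_distrib, Finset.sum_neg_distrib, h4]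
      ring
    zify
    rw [finsum_eq_sum_of_fintype, finsum_eq_sum_of_fintype]
    rw [h3]
    have h6 : ∑ v, ((g v).toNat : ℤ) = d - ∑ e, s₀ e := by
      rw [Finset.sum_congr rfl fun v _ => Int.toNat_of_nonneg (hg v), Finset.sum_sub_distrib, h1, h2]
    rw [h6]
    ring

end IsFine

end Feasible

end MetricGraph
end

noncomputable section
namespace MetricGraph

/-! ## The main theorem -/

theorem IsIso.degree_div {Γ Γ₁ : MetricGraph} {i : Γ₁.Point → Γ.Point} (hi : IsIso i)
    (D : Γ.Divisor) : degree (hi.div D) = degree D := by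
  rw [degree, degree, ← finsum_finsupp, ← finsum_finsupp]
  exact finsum_eq_of_bijective i hi.bij fun x => hi.div_apply D x

theorem pullback_pullback {X Y Z : Type} (f : X → Y) (g : Y → Z) (N : Set (Z → ℝ)) :
    pullback f (pullback g N) = pullback (g ∘ f) N :=
  image_image _ _ _

theorem pullback_id {X Y : Type} {f : X → Y} {g : Y → X} (h : ∀ x, g (f x) = x)
    (N : Set (X → ℝ)) : pullback f (pullback g N) = N := by
  rw [pullback_pullback, funext h (f := g ∘ f) (g := id)]
  exact image_id N

/-- Two successive refinements: first the slopes are made constant on edges, which makes the reduced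
functions available; then the model is cut along level sets of the height. -/
theorem exists_fine {Γ : MetricGraph} {x₀ : Γ.Point} {D : Γ.Divisor} {S : SlopeStructure Γ 1}
    {M : Set (Γ.Point → ℝ)} (h : IsRefinedLinearSeries D S M) (h0 : (0 : Γ.Point → ℝ) ∈ M)
    (hr : IsReduced D M x₀) :
    ∃ (Γ₂ : MetricGraph) (i : Γ₂.Point → Γ.Point) (D₂ : Γ₂.Divisor) (σ₀ σ₁ : Γ₂.Dart → ℤ)
      (x₂ : Γ₂.Point), IsIso i ∧ i x₂ = x₀ ∧ degree D₂ = degree D ∧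
        IsFine D₂ (pullback i M) x₂ σ₀ σ₁ := by
  obtain ⟨Γ₁, i, hi, s₀, s₁, hA⟩ := exists_adapted h h0
  obtain ⟨x₁, rfl⟩ := hi.bij.2 x₀
  have hp : IsPencil (pullback i M) x₁ := hA.isPencil fun x => by
    have hm := hA.mem_rat (hA.red_mem x₁)
    rw [redFun_comp] at hm ⊢
    rw [hi.ord_comp (hi.comp_mem_rat_iff.1 hm)]
    have := hr (i x)
    omega
  obtain ⟨Γ₂, j, hj, σ₀, σ₁, x₂, rfl, hA', hL⟩ := exists_leveled hA hp
  refine ⟨Γ₂, i ∘ j, hj.div (hi.div D), σ₀, σ₁, x₂, hj.comp hi, rfl, ?_, ?_⟩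
  · rw [hj.degree_div, hi.degree_div]
  · rw [← pullback_pullback]
    exact ⟨hA', hp.comp_iso hj, hL⟩

end MetricGraph

end

open MetricGraph in
theorem mainTheorem1 (Γ : MetricGraph) (x₀ : Γ.Point) :
    (∀ (d : ℕ) (D : Γ.Divisor) (S : SlopeStructure Γ 1) (M : Set (Γ.Point → ℝ)),
      degree D = d → IsRefinedLinearSeries D S M → (0 : Γ.Point → ℝ) ∈ M → IsReduced D M x₀ →
      ∃ (Red : Γ.Point → Sym Γ.Point d) (T : MetricGraph) (ι : T.Point → Sym Γ.Point d)
        (φ : Γ.Point → T.Point),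
        IsRedMap D M Red ∧
        T.IsTree ∧ Topology.IsEmbedding ι ∧ Set.range ι = Set.range Red ∧ ι ∘ φ = Red ∧
        IsFiniteMorphism φ ∧
        M = pullback φ (treeSeries (φ x₀)) ∧ IsUniqueG11 (φ x₀) (treeSeries (φ x₀)) ∧
        ∃ (Γ' : MetricGraph) (i : Γ.Point → Γ'.Point) (α : Γ'.Point → Γ.Point)
          (φ' : Γ'.Point → T.Point),
          IsTropicalModification Γ Γ' i α ∧ IsFiniteHarmonic φ' ∧ HasDegree φ' d ∧
          φ' ∘ i = φ) ∧
    (∀ (T' : MetricGraph) (ψ : Γ.Point → T'.Point), T'.IsTree → IsFiniteHarmonic ψ →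
      ∃ d : ℕ, HasDegree ψ d ∧
        ∃ (D : Γ.Divisor) (S : SlopeStructure Γ 1), degree D = d ∧
          IsRefinedLinearSeries D S (pullback ψ (treeSeries (ψ x₀))) ∧
          (0 : Γ.Point → ℝ) ∈ pullback ψ (treeSeries (ψ x₀))) := by
  constructor
  · intro d D S M hd hM h0 hr
    obtain ⟨Γ₂, i, D₂, σ₀, σ₁, x₂, hi, rfl, hD₂, hF⟩ := exists_fine hM h0 hr
    obtain ⟨j, hji, hij⟩ := Function.bijective_iff_has_inverse.1 hi.bij
    have hj : IsIso j := hi.inverse hji hij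
    have hMj : pullback j (pullback i M) = M := pullback_id hij M
    have hp : IsPencil M (i x₂) := by
      have := IsPencil.comp_iso hj (M := pullback i M) (x₀ := i x₂) (by rw [hji]; exact hF.pencil)
      rwa [hMj] at this
    have hH : Continuous (height M (i x₂)) := by
      have : height M (i x₂) = height (pullback i M) x₂ ∘ j := funext fun v => by
        rw [Function.comp, height_comp, hij]
      rw [this]
      exact (hF.adapted.continuous_height hF.pencil).comp hj.dirwise.continuous
    obtain ⟨R, hR, hRc, hRs⟩ := exists_red hp (fun f hf => (hM.1.subset hf).1) hd hH
    have hφ : Dirwise (hF.simp.map ∘ j) {k | 1 ≤ k} :=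
      hj.dirwise.comp hF.simp.dirwise fun k hk k' hk' => by
        rw [mem_singleton_iff.1 hk, mul_one]
        exact hk'
    have hs : ∀ x y, R x = R y ↔ (hF.simp.map ∘ j) x = (hF.simp.map ∘ j) y := fun x y => by
      rw [hRs, Function.comp, Function.comp, hF.map_eq_iff, sim_comp, hij, hij]
    obtain ⟨ι, hι, hιr, hιφ⟩ := exists_isEmbedding hφ.continuous
      (hF.simp_surjective.comp hj.bij.2) hRc hs
    obtain ⟨δ, hδ⟩ := hF.exists_isFeasible (hD₂.trans hd)
    -- The quotient was built on the refined model `Γ₂`; it is transported back along the isometry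
    -- `j`, and `Γ₂` itself serves as the trivial modification from which leaves are attached.
    refine ⟨R, hF.tree, ι, hF.simp.map ∘ j, hR, hF.isTree, hι, hιr, hιφ, hφ.isFiniteMorphism, ?_,
      hF.isTree.isUniqueG11 _, hδ.exists_modification hF.isTree
        (IsTropicalModification.isometry Γ₂ j i hj.isSubgraphEmbedding hij hji)⟩
    rw [← pullback_pullback, Function.comp, hji, ← hF.eq_pullback, hMj]
  · intro T' ψ hT hψ
    obtain ⟨d, D, hd, hD, hdiv⟩ := hψ.exists_degree hT (ψ x₀)
    obtain ⟨S, hS⟩ := hψ.isRefined_pullback hT hdiv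
    exact ⟨d, hd, D, S, hD, hS, 0, const_mem_treeSeries _ 0, rfl⟩
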